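/- Let $U:[0,\infty)\to\mathbb R$ be smooth, holomorphic near $z=0$, with $U(0)=0$, $U'(0)>0$, $U(z)>0$ for all $z>0$, such that $U$ converges exponentially fast at $+\infty$ to a constant $U_+>0$ and every derivative of $U$ converges exponentially fast to $0$. For $\nu,\alpha>0$ and $c\in\mathbb C$ put $$\varepsilon=\frac{\nu}{i\alpha},\quad \Delta_\alpha=\partial_z^2-\alpha^2,\quad \mathrm{Orr}_{\alpha,c}(\phi)=-\varepsilon\Delta_\alpha^2\phi+(U-c)\Delta_\alpha\phi-U''\phi,\quad \mathcal A=-\varepsilon\partial_z^2+(U-c),\quad \mu_f=\sqrt{\frac{U-c}{\varepsilon}},$$ the square root being taken with positive real part. Fix $a,b,K>0$, and call $(\nu,\alpha,c)$ admissible if $\nu>0$, $a\nu^{1/4}\le\alpha\le b\nu^{1/4}$, $|c|\le K\nu^{1/4}$ and, for every $z\ge0$, $(U(z)-c)/\varepsilon\notin(-\infty,0]$, so that $\mu_f(z)$ is defined (this holds in particular whenever $\operatorname{Im}c>0$). **Proposition 2.1.** There are $\nu_0>0$ and $C$, depending only on $U,a,b,K$, and, for every admissible $(\nu,\alpha,c)$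 with $\nu<\nu_0$, two smooth functions $\phi^{app}_\pm=\phi^{app}_{\pm,\nu,\alpha,c}:[0,\infty)\to\mathbb C$ without zeros, such that the following holds. 1. For every $N\in\mathbb N$ there is $C_N$ such that, for all admissible $(\nu,\alpha,c)$ with $\nu<\nu_0$ and all $z\ge0$, $$|\mathcal A\,\partial_z^2\phi^{app}_\pm(z)|\le C_N\,\nu^N\,|\phi^{app}_\pm(z)|.$$ 2. For all admissible $(\nu,\alpha,c)$ with $\nu<\nu_0$ and all $z\ge0$, $\;|\mathrm{Orr}_{\alpha,c}(\phi^{app}_\pm)(z)|\le C\,|\phi^{app}_\pm(z)|.$ 3. For $k=1,2,3$, as $\nu\to0$ and for $z\gg\nu^{1/4}$, $$\frac{\partial_z^k\phi^{app}_-(z)}{\phi^{app}_-(z)}\sim(-1)^k\mu_f^k(z),\qquad \frac{\partial_z^k\phi^{app}_+(z)}{\phi^{app}_+(z)}\sim\mu_f^k(z);$$ that is, for every $\delta>0$ there are $M$ and $\nu_1>0$ such that for all admissible $(\nu,\alpha,c)$ with $\nu<\min(\nu_0,\nu_1)$ and all $z\ge0$ with $z\ge M\nu^{1/4}$ the quotient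 of the two sides differs from $1$ by at most $\delta$. 4. For all admissible $(\nu,\alpha,c)$ with $\nu<\nu_0$ and all $0\le x_1<x_2$, $$\Bigl|\frac{\phi^{app}_+(x_2)}{\phi^{app}_+(x_1)}\Bigr|\le C\exp\Bigl(\int_{x_1}^{x_2}\operatorname{Re}\mu_f(y)\,dy\Bigr),\qquad \Bigl|\frac{\phi^{app}_-(x_2)}{\phi^{app}_-(x_1)}\Bigr|\le C\exp\Bigl(-\int_{x_1}^{x_2}\operatorname{Re}\mu_f(y)\,dy\Bigr).$$ -/

import Mathlib

namespace OrrSommerfeld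

noncomputable section

/-- The `k`-th derivative `∂_z^k f (z)` on the closed half line `z ≥ 0` (one-sided at `z = 0`). -/
def dz {E : Type*} [NormedAddCommGroup E] [NormedSpace ℝ E] (k : ℕ) (f : ℝ → E) (z : ℝ) : E :=
  iteratedDerivWithin k f (Set.Ici 0) z

/-- Smoothness on the closed half line `z ≥ 0`. -/
def SmoothOnHalfLine {E : Type*} [NormedAddCommGroup E] [NormedSpace ℝ E] (f : ℝ → E) : Prop :=
  ContDiffOn ℝ (⊤ : ℕ∞) f (Set.Ici 0)

/-- The standing assumptions on the shear profile `U`, with limit `Uplus` at infinity.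
Only the values of `U` on `z ≥ 0` matter. -/
structure IsShearProfile (U : ℝ → ℝ) (Uplus : ℝ) : Prop where
  smooth : SmoothOnHalfLine U
  /-- `U` is the restriction of a function that is holomorphic near `0`. -/
  holomorphic_near_zero : ∃ r : ℝ, 0 < r ∧ ∃ F : ℂ → ℂ,
    DifferentiableOn ℂ F (Metric.ball 0 r) ∧
      ∀ z : ℝ, 0 ≤ z → z < r → F (z : ℂ) = ((U z : ℝ) : ℂ)
  zero : U 0 = 0
  deriv_zero_pos : 0 < dz 1 U 0
  pos : ∀ z : ℝ, 0 < z → 0 < U z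
  Uplus_pos : 0 < Uplus
  /-- `U` converges to `Uplus` exponentially fast. -/
  expConv : ∃ C β : ℝ, 0 < β ∧ ∀ z : ℝ, 0 ≤ z → |U z - Uplus| ≤ C * Real.exp (-(β * z))
  /-- All the derivatives of `U` converge to `0` exponentially fast. -/
  expConv_deriv : ∀ k : ℕ, 1 ≤ k → ∃ C β : ℝ, 0 < β ∧
    ∀ z : ℝ, 0 ≤ z → |dz k U z| ≤ C * Real.exp (-(β * z))

/-- `ε = ν / (i α)`. -/
def eps (ν α : ℝ) : ℂ := (ν : ℂ) / (Complex.I * (α : ℂ))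

/-- `Δ_α φ = ∂_z² φ - α² φ`. -/
def lap (α : ℝ) (φ : ℝ → ℂ) (z : ℝ) : ℂ := dz 2 φ z - (α : ℂ) ^ 2 * φ z

/-- The Orr-Sommerfeld operator `- ε Δ_α² φ + (U - c) Δ_α φ - U'' φ`. -/
def orr (U : ℝ → ℝ) (ν α : ℝ) (c : ℂ) (φ : ℝ → ℂ) (z : ℝ) : ℂ :=
  -(eps ν α) * lap α (lap α φ) z + ((U z : ℂ) - c) * lap α φ z - ((dz 2 U z : ℝ) : ℂ) * φ z

/-- The operator `𝒜 ψ = - ε ∂_z² ψ + (U - c) ψ`. -/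
def opA (U : ℝ → ℝ) (ν α : ℝ) (c : ℂ) (ψ : ℝ → ℂ) (z : ℝ) : ℂ :=
  -(eps ν α) * dz 2 ψ z + ((U z : ℂ) - c) * ψ z

/-- `μ_f = √((U - c) / ε)`, the principal square root: it is the root with positive real part
whenever there is one, that is, whenever `(U - c) / ε` is not in `(-∞, 0]`. -/
def muf (U : ℝ → ℝ) (ν α : ℝ) (c : ℂ) (z : ℝ) : ℂ :=
  (((U z : ℂ) - c) / eps ν α) ^ (1 / 2 : ℂ)

/-- The range of parameters: `α` is of order `ν^{1/4}`, `c = O(ν^{1/4})`, and `(U - c) / ε` has, at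
each point of the half line, a square root with positive real part (this is so if `0 < Im c`). -/
structure Admissible (U : ℝ → ℝ) (a b K ν α : ℝ) (c : ℂ) : Prop where
  nu_pos : 0 < ν
  alpha_lower : a * ν ^ (1 / 4 : ℝ) ≤ α
  alpha_upper : α ≤ b * ν ^ (1 / 4 : ℝ)
  c_bound : ‖c‖ ≤ K * ν ^ (1 / 4 : ℝ)
  re_muf_pos : ∀ z : ℝ, 0 ≤ z → 0 < (muf U ν α c z).re

end

end OrrSommerfeld

/-!
The functions `φ±` are exact solutions of `𝒜 ∂_z² φ = 0`, so that the modified Airy equation holds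
without error. In the variable `ζ = z / ν^{1/4}` this is the equation `φ'''' = q φ''` with
`q = i (α / h) (U (h ζ) / h - c / h)`, `h = ν^{1/4}`, whose coefficient is bounded on compact sets and
large at infinity, uniformly in the parameters; its square root `m` is `h` times `μ_f`. The remaining
part of the Orr-Sommerfeld operator is bounded as soon as `h |φ''| ≤ C |φ|` in the rescaled variable
(`IsJet`, `IsScaled`, `ProfileBounds.exists_wkb`).

For `ζ ≥ M` the solutions are controlled by a WKB expansion. If `φ^{(k+1)} - (± m - γ m' / m) φ^{(k)}`,
with `γ = 5/2, 3/2, 1/2` for `k = 0, 1, 2`, are small compared to `φ^{(k)}` at one point, they remain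
so in the direction of time in which `exp (± ∫ m)` grows, because there they are damped
relative to `φ^{(k)}` (`cone_invariant`, `WKB.propagate`). This yields the equivalents of the
derivatives (`WKB.sub_le`) and the growth of `φ² m⁵` (`WKB.growth`). The growing solution is the one
with WKB data at `M`; the decaying one is the limit, for `T → ∞`, of the normalised solutions with
WKB data at `T` (`WKB.exists_decaying`).

What is left is to keep the functions away from zero on `[0, M]`. For the growing solution a constant,
which solves the equation, may be added, and a curve of finite length cannot approach all the points
of a disc (`exists_translation_away`). For the decaying solution there is no freedom. If its lower
bound degenerated along a sequence of parameters, then `h → 0` (the statement only concerns small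
`ν`), the profile would become linear, and the limit would be a decaying solution of
`φ'''' = i s (κ ζ - c) φ''` with a zero on the half line
(`ProfileBounds.exists_lower_bound`). The condition on `μ_f` forces `Im c ≥ 0` or `Re c ≤ 0`
(`IsScaled.sign`), hence the limit is the second primitive of the Airy function on a part of the sector
`|arg z| ≤ 150°`, where it has no zeros (`decaying_jet_eq_zero`, `IsAiryPrimitive.ne_zero`).

The zero-free sector is the core of the proof; the closest zeros have arguments of about `± 154.6°`, so
it leaves little room. The second primitive, a solution of `f''' = z f' - f`, is given near `0`
by a power series and in the right half plane of `σ = √z` by a saddle point integral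
(`exists_cubicSeries_eq_saddleIntegral`); its initial data are determined up to a factor with
sufficient precision by positivity and monotonicity on the half line (`IsAiryPrimitive.ratio`). The
function `exp (2 σ³ / 3) f (σ²)`, multiplied by a suitable cubic polynomial, has positive real part on
the two rays that bound the sector, by rational interval arithmetic with the series close to the
origin (`rayFun_re_pos_near`) and by the connection formula further out
(`IsAiryPrimitive.weighted_re_pos`). A maximum principle of Phragmén-Lindelöf type extends the
positivity to the interior.
-/


namespace OrrSommerfeld

open Set Filter Topology MeasureTheory intervalIntegral

/-! ### Linear ordinary differential equations -/

section LinearODE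

variable {E : Type*} [NormedAddCommGroup E] [NormedSpace ℝ E]

/-- The Picard iterates of `Y' = A Y`, `Y t₀ = y₀`. -/
noncomputable def picardTerm (A : ℝ → E →L[ℝ] E) (t₀ : ℝ) (y₀ : E) : ℕ → ℝ → E
  | 0 => fun _ => y₀
  | n + 1 => fun t => ∫ s in t₀..t, A s (picardTerm A t₀ y₀ n s)

lemma picardTerm_continuous [CompleteSpace E] {A : ℝ → E →L[ℝ] E} (hA : Continuous A) (t₀ : ℝ)
    (y₀ : E) (n : ℕ) : Continuous (picardTerm A t₀ y₀ n) := by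
  induction n with
  | zero => exact continuous_const
  | succ n ih =>
    exact continuous_primitive (fun a b => (hA.clm_apply ih).intervalIntegrable a b) t₀

lemma picardTerm_hasDerivAt [CompleteSpace E] {A : ℝ → E →L[ℝ] E} (hA : Continuous A) (t₀ : ℝ)
    (y₀ : E) (n : ℕ) (t : ℝ) :
    HasDerivAt (picardTerm A t₀ y₀ (n + 1)) (A t (picardTerm A t₀ y₀ n t)) t :=
  have hc := hA.clm_apply (picardTerm_continuous hA t₀ y₀ n)
  integral_hasDerivAt_right (hc.intervalIntegrable _ _)
    hc.stronglyMeasurable.stronglyMeasurableAtFilter hc.continuousAt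

lemma picardTerm_norm_le {A : ℝ → E →L[ℝ] E} {t₀ T K : ℝ}
    (hK : ∀ t, |t - t₀| ≤ T → ‖A t‖ ≤ K) (hK0 : 0 ≤ K) (y₀ : E) (n : ℕ) :
    ∀ t, |t - t₀| ≤ T →
      ‖picardTerm A t₀ y₀ n t‖ ≤ (K * |t - t₀|) ^ n / n.factorial * ‖y₀‖ := by
  induction n with
  | zero => intro t _; simp [picardTerm]
  | succ n ih =>
    intro t ht
    have hsub : ∀ s ∈ uIoc t₀ t, |s - t₀| ≤ T := by
      intro s hs
      exact (abs_sub_left_of_mem_uIcc (uIoc_subset_uIcc hs)).trans ht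
    have h1 : ‖∫ s in t₀..t, A s (picardTerm A t₀ y₀ n s)‖ ≤
        |∫ s in t₀..t, (K ^ (n + 1) / n.factorial * ‖y₀‖) * |s - t₀| ^ n| := by
      refine norm_integral_le_abs_of_norm_le ?_ (Continuous.intervalIntegrable (by fun_prop) _ _)
      refine (ae_restrict_iff' measurableSet_uIoc).2 (Eventually.of_forall fun s hs => ?_)
      calc ‖A s (picardTerm A t₀ y₀ n s)‖ ≤ ‖A s‖ * ‖picardTerm A t₀ y₀ n s‖ :=
            ContinuousLinearMap.le_opNorm _ _
        _ ≤ K * ((K * |s - t₀|) ^ n / n.factorial * ‖y₀‖) := by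
            gcongr
            · exact hK s (hsub s hs)
            · exact ih s (hsub s hs)
        _ = _ := by rw [mul_pow]; ring
    refine h1.trans (le_of_eq ?_)
    rw [intervalIntegral.integral_const_mul, abs_mul, abs_intervalIntegral_eq,
      integral_pow_abs_sub_uIoc, abs_of_nonneg (by positivity : 0 ≤ K ^ (n + 1) / n.factorial * ‖y₀‖),
      abs_of_nonneg (by positivity), Nat.factorial_succ, mul_pow]
    push_cast
    field_simp

/-- A linear equation `Y' = A Y` with continuous coefficients has global solutions. -/
theorem exists_linearODE [CompleteSpace E] {A : ℝ → E →L[ℝ] E} (hA : Continuous A) (t₀ : ℝ)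
    (y₀ : E) : ∃ Y : ℝ → E, Y t₀ = y₀ ∧ ∀ t, HasDerivAt Y (A t (Y t)) t := by
  have hbd : ∀ T : ℝ, ∃ K, 0 ≤ K ∧ ∀ t, |t - t₀| ≤ T → ‖A t‖ ≤ K := by
    intro T
    obtain ⟨K, hK⟩ := (isCompact_closedBall t₀ T).exists_bound_of_continuousOn hA.continuousOn
    refine ⟨max K 0, le_max_right _ _, fun t ht => (hK t ?_).trans (le_max_left _ _)⟩
    simpa [Real.dist_eq] using ht
  have hsum : ∀ t, Summable fun n => picardTerm A t₀ y₀ n t := by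
    intro t
    obtain ⟨K, hK0, hK⟩ := hbd |t - t₀|
    exact Summable.of_norm_bounded ((Real.summable_pow_div_factorial _).mul_right _)
      (fun n => picardTerm_norm_le hK hK0 y₀ n t le_rfl)
  refine ⟨fun t => ∑' n, picardTerm A t₀ y₀ n t, ?_, fun t => ?_⟩
  · change ∑' n, picardTerm A t₀ y₀ n t₀ = y₀
    rw [tsum_eq_single 0]
    · rfl
    · intro n hn
      obtain ⟨m, rfl⟩ := Nat.exists_eq_succ_of_ne_zero hn
      simp [picardTerm]
  · set T := |t - t₀| + 1
    obtain ⟨K, hK0, hK⟩ := hbd T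
    have hT : 0 ≤ T := by positivity
    have hmem : t ∈ Metric.ball t₀ T := by simp [Real.dist_eq, T]
    have hder : HasDerivAt (fun z => ∑' n, picardTerm A t₀ y₀ (n + 1) z)
        (∑' n, A t (picardTerm A t₀ y₀ n t)) t := by
      refine hasDerivAt_tsum_of_isPreconnected
        (u := fun n => K * ((K * T) ^ n / n.factorial * ‖y₀‖)) (t := Metric.ball t₀ T) ?_
        Metric.isOpen_ball (convex_ball _ _).isPreconnected
        (fun n y _ => picardTerm_hasDerivAt hA t₀ y₀ n y) ?_ hmem ?_ hmem
      · exact ((Real.summable_pow_div_factorial _).mul_right _).mul_left _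
      · intro n y hy
        have hy' : |y - t₀| ≤ T := by simpa [Real.dist_eq] using (Metric.mem_ball.1 hy).le
        refine (ContinuousLinearMap.le_opNorm _ _).trans ?_
        gcongr
        · exact hK y hy'
        · refine (picardTerm_norm_le hK hK0 y₀ n y hy').trans ?_
          gcongr
      · exact (summable_nat_add_iff 1).2 (hsum t)
    have heq : (fun z => ∑' n, picardTerm A t₀ y₀ n z) =
        fun z => y₀ + ∑' n, picardTerm A t₀ y₀ (n + 1) z := by
      funext z
      rw [(hsum z).tsum_eq_zero_add]; rfl
    have h2 := hder.const_add y₀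
    rw [← heq] at h2
    convert h2 using 1
    exact (A t).map_tsum (hsum t)

/-- Gronwall's inequality for a linear equation, in both directions of time. -/
theorem linearODE_norm_le {A : ℝ → E →L[ℝ] E} {Y : ℝ → E} {s : Set ℝ} (hs : s.OrdConnected)
    (hY : ∀ t ∈ s, HasDerivWithinAt Y (A t (Y t)) s t) {K : ℝ} (hK : ∀ t ∈ s, ‖A t‖ ≤ K)
    {t₀ t : ℝ} (ht₀ : t₀ ∈ s) (ht : t ∈ s) :
    ‖Y t‖ ≤ ‖Y t₀‖ * Real.exp (K * |t - t₀|) := by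
  rcases le_total t₀ t with h | h
  · have hsub : Icc t₀ t ⊆ s := hs.out ht₀ ht
    have := norm_le_gronwallBound_of_norm_deriv_right_le (f := Y) (f' := fun u => A u (Y u))
      (δ := ‖Y t₀‖) (K := K) (ε := 0) (a := t₀) (b := t)
      (fun u hu => ((hY u (hsub hu)).mono hsub).continuousWithinAt)
      (fun u hu => (((hY u (hsub (Ico_subset_Icc_self hu))).mono hsub).mono_of_mem_nhdsWithin
        (Icc_mem_nhdsGE_of_mem hu)))
      le_rfl (fun u hu => by
        have := (A u).le_opNorm (Y u)
        have h2 := hK u (hsub (Ico_subset_Icc_self hu))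
        have := mul_le_mul_of_nonneg_right h2 (norm_nonneg (Y u))
        linarith) t ⟨h, le_rfl⟩
    rwa [gronwallBound_ε0, ← abs_of_nonneg (sub_nonneg.2 h)] at this
  · have hsub : Icc t t₀ ⊆ s := hs.out ht ht₀
    have hmaps : MapsTo (fun u : ℝ => -u) (Icc (-t₀) (-t)) (Icc t t₀) :=
      fun u hu => ⟨by linarith [hu.2], by linarith [hu.1]⟩
    have hd : ∀ u ∈ Icc (-t₀) (-t), HasDerivWithinAt (fun v => Y (-v)) (-(A (-u) (Y (-u))))
        (Icc (-t₀) (-t)) u := by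
      intro u hu
      have h1 := ((hY (-u) (hsub (hmaps hu))).mono hsub)
      have := h1.scomp u ((hasDerivAt_neg u).hasDerivWithinAt) hmaps
      simpa [Function.comp_def] using this
    have := norm_le_gronwallBound_of_norm_deriv_right_le (f := fun v => Y (-v))
      (f' := fun u => -(A (-u) (Y (-u))))
      (δ := ‖Y t₀‖) (K := K) (ε := 0) (a := -t₀) (b := -t)
      (fun u hu => (hd u hu).continuousWithinAt)
      (fun u hu => (hd u (Ico_subset_Icc_self hu)).mono_of_mem_nhdsWithin
        (Icc_mem_nhdsGE_of_mem hu))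
      (by simp) (fun u hu => by
        have := (A (-u)).le_opNorm (Y (-u))
        have h2 := hK (-u) (hsub (hmaps (Ico_subset_Icc_self hu)))
        have := mul_le_mul_of_nonneg_right h2 (norm_nonneg (Y (-u)))
        rw [norm_neg]
        linarith) (-t) ⟨by linarith, le_rfl⟩
    rw [gronwallBound_ε0, neg_neg] at this
    rwa [abs_of_nonpos (by linarith), show -(t - t₀) = -t - -t₀ by ring]

end LinearODE

end OrrSommerfeld

namespace OrrSommerfeld

open Set Filter Topology MeasureTheory

open scoped Real

/-! ### Contour integrals for the Airy function and its primitives -/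

section AiryIntegral

/-- The integrand `t ^ k exp (t³/3 - σ² t) exp (2σ³/3)` on the line `t = σ + i τ` through the saddle
point `σ`. -/
noncomputable def saddleIntegrand (k : ℤ) (σ : ℂ) (τ : ℝ) : ℂ :=
  (σ + Complex.I * τ) ^ k * Complex.exp (-((τ : ℂ) ^ 2 * σ) - Complex.I * (τ : ℂ) ^ 3 / 3)

/-- The saddle point integral. For `z = σ²`, `exp (-2σ³/3) * saddleIntegral k σ` is `2π` times
`(-1) ^ k` times the `k`-th derivative of `Ai` (the `(-k)`-fold primitive that vanishes
at `+∞` if `k < 0`). -/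
noncomputable def saddleIntegral (k : ℤ) (σ : ℂ) : ℂ := ∫ τ : ℝ, saddleIntegrand k σ τ

lemma re_add_I_mul (σ : ℂ) (τ : ℝ) : (σ + Complex.I * τ).re = σ.re := by simp

lemma add_I_mul_ne_zero {σ : ℂ} (hσ : 0 < σ.re) (τ : ℝ) : σ + Complex.I * τ ≠ 0 := by
  intro h
  have := congrArg Complex.re h
  simp at this
  linarith

lemma re_le_norm_add_I_mul {σ : ℂ} (τ : ℝ) : σ.re ≤ ‖σ + Complex.I * τ‖ := by
  have := Complex.re_le_norm (σ + Complex.I * τ)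
  rwa [re_add_I_mul] at this

lemma norm_saddle_exp (σ : ℂ) (τ : ℝ) :
    ‖Complex.exp (-((τ : ℂ) ^ 2 * σ) - Complex.I * (τ : ℂ) ^ 3 / 3)‖
      = Real.exp (-(σ.re * τ ^ 2)) := by
  rw [Complex.norm_exp]
  congr 1
  have h1 : Complex.I * (τ : ℂ) ^ 3 / 3 = ((τ ^ 3 / 3 : ℝ) : ℂ) * Complex.I := by push_cast; ring
  have h2 : (τ : ℂ) ^ 2 * σ = ((τ ^ 2 : ℝ) : ℂ) * σ := by push_cast; ring
  rw [h1, h2, Complex.sub_re, Complex.neg_re, Complex.re_ofReal_mul, Complex.re_ofReal_mul]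
  simp [mul_comm]

lemma norm_zpow_le {σ : ℂ} {a M : ℝ} (ha : 0 < a) (hσ : a ≤ σ.re) (hM : a⁻¹ ≤ M)
    (hM1 : 1 ≤ M) (hM2 : ‖σ‖ ≤ M) (k : ℤ) (τ : ℝ) :
    ‖(σ + Complex.I * τ) ^ k‖ ≤ (M * (1 + |τ|)) ^ k.natAbs := by
  have h1 : a ≤ ‖σ + Complex.I * τ‖ := hσ.trans (re_le_norm_add_I_mul τ)
  have h0 : 0 < ‖σ + Complex.I * τ‖ := ha.trans_le h1
  have h2 : ‖σ + Complex.I * τ‖ ≤ M * (1 + |τ|) := by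
    refine (norm_add_le _ _).trans ?_
    have : ‖Complex.I * (τ : ℂ)‖ = |τ| := by simp
    rw [this]
    nlinarith [abs_nonneg τ]
  have h3 : ‖σ + Complex.I * τ‖⁻¹ ≤ M * (1 + |τ|) := by
    have : ‖σ + Complex.I * τ‖⁻¹ ≤ a⁻¹ := inv_anti₀ ha h1
    nlinarith [abs_nonneg τ]
  rw [norm_zpow]
  rcases Int.natAbs_eq k with h | h
  · rw [h, zpow_natCast, Int.natAbs_natCast]
    gcongr
  · rw [h, zpow_neg, zpow_natCast, ← inv_pow, Int.natAbs_neg, Int.natAbs_natCast]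
    gcongr

lemma one_add_abs_pow_mul_exp_le {a : ℝ} (ha : 0 < a) (n : ℕ) (τ : ℝ) :
    (1 + |τ|) ^ n * Real.exp (-(a * τ ^ 2)) ≤
      (n.factorial * Real.exp (1 + 1 / (2 * a))) * Real.exp (-(a / 2) * τ ^ 2) := by
  have h1 : (1 + |τ|) ^ n ≤ n.factorial * Real.exp (1 + |τ|) := by
    have := Real.pow_div_factorial_le_exp (1 + |τ|) (by positivity) n
    rw [div_le_iff₀ (by positivity)] at this
    linarith
  have h2 : Real.exp (1 + |τ|) ≤ Real.exp (1 + 1 / (2 * a)) * Real.exp (a / 2 * τ ^ 2) := by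
    rw [← Real.exp_add]
    apply Real.exp_le_exp.2
    have h3 : 0 ≤ (a * |τ| - 1) ^ 2 := sq_nonneg _
    have h4 : |τ| ≤ 1 / (2 * a) + a / 2 * |τ| ^ 2 := by
      have : 1 / (2 * a) + a / 2 * |τ| ^ 2 - |τ| = (a * |τ| - 1) ^ 2 / (2 * a) := by
        field_simp; ring
      have : 0 ≤ (a * |τ| - 1) ^ 2 / (2 * a) := by positivity
      linarith
    rw [sq_abs] at h4
    linarith
  calc (1 + |τ|) ^ n * Real.exp (-(a * τ ^ 2))
      ≤ (n.factorial * (Real.exp (1 + 1 / (2 * a)) * Real.exp (a / 2 * τ ^ 2)))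
        * Real.exp (-(a * τ ^ 2)) := by gcongr; exact h1.trans (by gcongr)
    _ = (n.factorial * Real.exp (1 + 1 / (2 * a))) *
        (Real.exp (a / 2 * τ ^ 2) * Real.exp (-(a * τ ^ 2))) := by ring
    _ = _ := by rw [← Real.exp_add]; congr 2; ring

lemma integrable_one_add_abs_pow_mul_exp {a : ℝ} (ha : 0 < a) (n : ℕ) :
    Integrable fun τ : ℝ => (1 + |τ|) ^ n * Real.exp (-(a * τ ^ 2)) := by
  refine Integrable.mono' ((integrable_exp_neg_mul_sq (half_pos ha)).const_mul
    (n.factorial * Real.exp (1 + 1 / (2 * a)))) (by fun_prop) (Eventually.of_forall fun τ => ?_)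
  rw [Real.norm_of_nonneg (by positivity)]
  exact one_add_abs_pow_mul_exp_le ha n τ

lemma tendsto_one_add_abs_pow_mul_exp {a : ℝ} (ha : 0 < a) (n : ℕ) {l : Filter ℝ}
    (hl : Tendsto (fun τ : ℝ => τ ^ 2) l atTop) :
    Tendsto (fun τ : ℝ => (1 + |τ|) ^ n * Real.exp (-(a * τ ^ 2))) l (𝓝 0) := by
  have h1 : Tendsto (fun τ : ℝ => Real.exp (-(a / 2) * τ ^ 2)) l (𝓝 0) := by
    refine Real.tendsto_exp_atBot.comp ?_
    exact hl.const_mul_atTop_of_neg (by linarith)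
  have h2 := h1.const_mul (n.factorial * Real.exp (1 + 1 / (2 * a)))
  rw [mul_zero] at h2
  exact squeeze_zero (fun τ => by positivity) (one_add_abs_pow_mul_exp_le ha n) h2

lemma tendsto_sq_atTop' : Tendsto (fun τ : ℝ => τ ^ 2) atTop atTop :=
  tendsto_pow_atTop two_ne_zero

lemma tendsto_sq_atBot' : Tendsto (fun τ : ℝ => τ ^ 2) atBot atTop := by
  have := tendsto_sq_atTop'.comp tendsto_neg_atBot_atTop
  simpa [Function.comp_def] using this

lemma saddleIntegrand_continuous {σ : ℂ} (hσ : 0 < σ.re) (k : ℤ) :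
    Continuous (saddleIntegrand k σ) := by
  unfold saddleIntegrand
  refine Continuous.mul (Continuous.zpow₀ (by fun_prop) k
    (fun τ => Or.inl (add_I_mul_ne_zero hσ τ))) (by fun_prop)

lemma norm_saddleIntegrand_le {σ : ℂ} {a M : ℝ} (ha : 0 < a) (hσ : a ≤ σ.re) (hM : a⁻¹ ≤ M)
    (hM1 : 1 ≤ M) (hM2 : ‖σ‖ ≤ M) (k : ℤ) (τ : ℝ) :
    ‖saddleIntegrand k σ τ‖ ≤
      M ^ k.natAbs * ((1 + |τ|) ^ k.natAbs * Real.exp (-(a * τ ^ 2))) := by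
  rw [saddleIntegrand, norm_mul, norm_saddle_exp, ← mul_assoc, ← mul_pow]
  gcongr
  exact norm_zpow_le ha hσ hM hM1 hM2 k τ

lemma saddleIntegrand_integrable {σ : ℂ} (hσ : 0 < σ.re) (k : ℤ) :
    Integrable (saddleIntegrand k σ) := by
  set M := max (σ.re)⁻¹ (max 1 ‖σ‖)
  refine Integrable.mono' ((integrable_one_add_abs_pow_mul_exp hσ k.natAbs).const_mul
    (M ^ k.natAbs)) (saddleIntegrand_continuous hσ k).aestronglyMeasurable
    (Eventually.of_forall fun τ => ?_)
  exact norm_saddleIntegrand_le hσ le_rfl (le_max_left _ _)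
    ((le_max_left _ _).trans (le_max_right _ _)) ((le_max_right _ _).trans (le_max_right _ _)) k τ

lemma saddleIntegrand_mul {σ : ℂ} (hσ : 0 < σ.re) (k : ℤ) (τ : ℝ) :
    (σ + Complex.I * τ) * saddleIntegrand k σ τ = saddleIntegrand (k + 1) σ τ := by
  rw [saddleIntegrand, saddleIntegrand, zpow_add_one₀ (add_I_mul_ne_zero hσ τ)]
  ring

/-- Integration by parts along the contour. -/
lemma saddleIntegral_by_parts {σ : ℂ} (hσ : 0 < σ.re) (k : ℤ) :
    k * saddleIntegral (k - 1) σ = σ ^ 2 * saddleIntegral k σ - saddleIntegral (k + 2) σ := by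
  have hder : ∀ τ : ℝ, HasDerivAt (saddleIntegrand k σ)
      (Complex.I * (k * saddleIntegrand (k - 1) σ τ - σ ^ 2 * saddleIntegrand k σ τ
        + saddleIntegrand (k + 2) σ τ)) τ := by
    intro τ
    have hne := add_I_mul_ne_zero hσ τ
    have h1 : HasDerivAt (fun τ : ℝ => σ + Complex.I * (τ : ℂ)) Complex.I τ := by
      simpa using ((Complex.ofRealCLM.hasDerivAt (x := τ)).const_mul Complex.I).const_add σ
    have h2 : HasDerivAt (fun τ : ℝ => (τ : ℂ)) 1 τ := Complex.ofRealCLM.hasDerivAt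
    have h3 := (hasDerivAt_zpow k _ (Or.inl hne)).comp τ h1
    have h4 := (((h2.pow 2).mul_const σ).neg.sub (((h2.pow 3).const_mul Complex.I).div_const 3)).cexp
    have h5 := h3.mul h4
    have h6 : saddleIntegrand (k + 2) σ τ =
        (σ + Complex.I * τ) * ((σ + Complex.I * τ) * saddleIntegrand k σ τ) := by
      rw [saddleIntegrand_mul hσ, saddleIntegrand_mul hσ]; congr 1; ring
    rw [h6]
    refine h5.congr_deriv ?_
    simp only [saddleIntegrand, Function.comp, Pi.neg_apply, Pi.sub_apply, Pi.pow_apply]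
    have hI : Complex.I ^ 2 = -1 := Complex.I_sq
    linear_combination ((σ + Complex.I * τ) ^ k * Complex.exp (-((τ : ℂ) ^ 2 * σ) -
      Complex.I * (τ : ℂ) ^ 3 / 3)) * (-(2 * σ * τ) - Complex.I * τ ^ 2) * hI
  have hint : Integrable fun τ => Complex.I * (k * saddleIntegrand (k - 1) σ τ
      - σ ^ 2 * saddleIntegrand k σ τ + saddleIntegrand (k + 2) σ τ) :=
    ((((saddleIntegrand_integrable hσ _).const_mul _).sub
      ((saddleIntegrand_integrable hσ _).const_mul _)).add
      (saddleIntegrand_integrable hσ _)).const_mul _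
  have hlim : ∀ l : Filter ℝ, Tendsto (fun τ : ℝ => τ ^ 2) l atTop →
      Tendsto (saddleIntegrand k σ) l (𝓝 0) := by
    intro l hl
    set M := max (σ.re)⁻¹ (max 1 ‖σ‖)
    refine squeeze_zero_norm (fun τ => norm_saddleIntegrand_le hσ le_rfl (le_max_left _ _)
      ((le_max_left _ _).trans (le_max_right _ _))
      ((le_max_right _ _).trans (le_max_right _ _)) k τ) ?_
    simpa using (tendsto_one_add_abs_pow_mul_exp hσ k.natAbs hl).const_mul (M ^ k.natAbs)
  have h0 := integral_of_hasDerivAt_of_tendsto hder hint (hlim _ tendsto_sq_atBot')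
    (hlim _ tendsto_sq_atTop')
  have i1 : Integrable fun τ => k * saddleIntegrand (k - 1) σ τ :=
    (saddleIntegrand_integrable hσ _).const_mul _
  have i2 : Integrable fun τ => σ ^ 2 * saddleIntegrand k σ τ :=
    (saddleIntegrand_integrable hσ _).const_mul _
  have i12 : Integrable fun τ => k * saddleIntegrand (k - 1) σ τ - σ ^ 2 * saddleIntegrand k σ τ :=
    i1.sub i2
  rw [integral_const_mul, integral_add i12 (saddleIntegrand_integrable hσ _),
    integral_sub i1 i2, integral_const_mul, integral_const_mul, sub_zero] at h0
  have h1 := (mul_eq_zero.1 h0).resolve_left Complex.I_ne_zero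
  simp only [saddleIntegral]
  linear_combination h1

lemma saddleIntegral_hasDerivAt {σ : ℂ} (hσ : 0 < σ.re) (k : ℤ) :
    HasDerivAt (saddleIntegral k)
      (2 * σ ^ 2 * saddleIntegral k σ - 2 * σ * saddleIntegral (k + 1) σ) σ := by
  set a := σ.re / 2
  have ha : 0 < a := half_pos hσ
  set M := max a⁻¹ (max 1 (‖σ‖ + a))
  have hball : ∀ s ∈ Metric.ball σ a, a ≤ s.re ∧ ‖s‖ ≤ M := by
    intro s hs
    rw [Metric.mem_ball, dist_eq_norm] at hs
    constructor
    · have h1 := Complex.abs_re_le_norm (s - σ)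
      have h2 := neg_abs_le (s - σ).re
      simp only [Complex.sub_re] at h1 h2
      have : a = σ.re / 2 := rfl
      linarith
    · have h1 : ‖s‖ ≤ ‖s - σ‖ + ‖σ‖ := by simpa using norm_add_le (s - σ) σ
      refine le_trans ?_ ((le_max_right _ _).trans (le_max_right _ _))
      linarith
  have hM : a⁻¹ ≤ M := le_max_left _ _
  have hM1 : 1 ≤ M := (le_max_left _ _).trans (le_max_right _ _)
  have hder : ∀ s ∈ Metric.ball σ a, ∀ τ : ℝ, HasDerivAt (fun s => saddleIntegrand k s τ)
      (k * saddleIntegrand (k - 1) s τ - (τ : ℂ) ^ 2 * saddleIntegrand k s τ) s := by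
    intro s hs τ
    have hne := add_I_mul_ne_zero (ha.trans_le (hball s hs).1) τ
    have h1 : HasDerivAt (fun s : ℂ => s + Complex.I * (τ : ℂ)) 1 s :=
      (hasDerivAt_id s).add_const _
    have h3 := (hasDerivAt_zpow k _ (Or.inl hne)).comp s h1
    have h4 := (((hasDerivAt_id s).const_mul ((τ : ℂ) ^ 2)).neg.sub_const
      (Complex.I * (τ : ℂ) ^ 3 / 3)).cexp
    have h5 := h3.mul h4
    refine h5.congr_deriv ?_
    simp only [saddleIntegrand, Function.comp, Pi.neg_apply, id]
    ring
  set bound : ℝ → ℝ := fun τ => |(k : ℝ)| * (M ^ (k - 1).natAbs * ((1 + |τ|) ^ (k - 1).natAbs *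
    Real.exp (-(a * τ ^ 2)))) + M ^ k.natAbs * ((1 + |τ|) ^ (k.natAbs + 2) *
    Real.exp (-(a * τ ^ 2)))
  have hb : Integrable bound :=
    (((integrable_one_add_abs_pow_mul_exp ha _).const_mul _).const_mul _).add
      ((integrable_one_add_abs_pow_mul_exp ha _).const_mul _)
  have hmain := hasDerivAt_integral_of_dominated_loc_of_deriv_le (μ := volume)
    (F := fun s τ => saddleIntegrand k s τ)
    (F' := fun s τ => k * saddleIntegrand (k - 1) s τ - (τ : ℂ) ^ 2 * saddleIntegrand k s τ)
    (x₀ := σ) (s := Metric.ball σ a) (bound := bound) (Metric.ball_mem_nhds σ ha)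
    (by
      filter_upwards [Metric.ball_mem_nhds σ ha] with s hs
      exact (saddleIntegrand_continuous (ha.trans_le (hball s hs).1) k).aestronglyMeasurable)
    (saddleIntegrand_integrable hσ k)
    (by
      refine Continuous.aestronglyMeasurable ?_
      have h1 := saddleIntegrand_continuous hσ (k - 1)
      have h2 := saddleIntegrand_continuous hσ k
      fun_prop)
    (Eventually.of_forall fun τ s hs => by
      obtain ⟨h1, h2⟩ := hball s hs
      have e1 := norm_saddleIntegrand_le ha h1 hM hM1 h2 (k - 1) τ
      have e2 := norm_saddleIntegrand_le ha h1 hM hM1 h2 k τ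
      refine (norm_sub_le _ _).trans (add_le_add ?_ ?_)
      · rw [norm_mul, Complex.norm_intCast]
        gcongr
      · rw [norm_mul, norm_pow, Complex.norm_real, Real.norm_eq_abs]
        calc |τ| ^ 2 * ‖saddleIntegrand k s τ‖
            ≤ (1 + |τ|) ^ 2 * (M ^ k.natAbs * ((1 + |τ|) ^ k.natAbs * Real.exp (-(a * τ ^ 2)))) := by
              gcongr; linarith
          _ = _ := by rw [pow_add]; ring)
    hb (Eventually.of_forall fun τ s hs => hder s hs τ)
  refine hmain.2.congr_deriv ?_
  -- `τ² = (t² - σ²) - 2 σ (t - σ) · …` is rewritten through powers of `t = σ + i τ`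
  have hpt : ∀ τ : ℝ, k * saddleIntegrand (k - 1) σ τ - (τ : ℂ) ^ 2 * saddleIntegrand k σ τ =
      k * saddleIntegrand (k - 1) σ τ + (σ ^ 2 * saddleIntegrand k σ τ -
        2 * σ * saddleIntegrand (k + 1) σ τ) + saddleIntegrand (k + 2) σ τ := by
    intro τ
    have h6 : saddleIntegrand (k + 2) σ τ =
        (σ + Complex.I * τ) * ((σ + Complex.I * τ) * saddleIntegrand k σ τ) := by
      rw [saddleIntegrand_mul hσ, saddleIntegrand_mul hσ]; congr 1; ring
    rw [h6, ← saddleIntegrand_mul hσ k]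
    linear_combination (-(τ : ℂ) ^ 2 * saddleIntegrand k σ τ) * Complex.I_sq
  simp_rw [hpt]
  have i1 : Integrable fun τ => k * saddleIntegrand (k - 1) σ τ :=
    (saddleIntegrand_integrable hσ _).const_mul _
  have i2 : Integrable fun τ => σ ^ 2 * saddleIntegrand k σ τ :=
    (saddleIntegrand_integrable hσ _).const_mul _
  have i3 : Integrable fun τ => 2 * σ * saddleIntegrand (k + 1) σ τ :=
    (saddleIntegrand_integrable hσ _).const_mul _
  have i23 : Integrable fun τ => σ ^ 2 * saddleIntegrand k σ τ -
    2 * σ * saddleIntegrand (k + 1) σ τ := i2.sub i3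
  have i123 : Integrable fun τ => k * saddleIntegrand (k - 1) σ τ +
    (σ ^ 2 * saddleIntegrand k σ τ - 2 * σ * saddleIntegrand (k + 1) σ τ) := i1.add i23
  rw [integral_add i123 (saddleIntegrand_integrable hσ (k + 2)), integral_add i1 i23,
    integral_sub i2 i3, integral_const_mul, integral_const_mul, integral_const_mul]
  have := saddleIntegral_by_parts hσ k
  simp only [saddleIntegral] at this ⊢
  linear_combination this

end AiryIntegral

end OrrSommerfeld

namespace OrrSommerfeld

open Set Filter Topology MeasureTheory

open scoped Real

/-! ### Everywhere convergent power series -/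

section PowerSeries

/-- The coefficients `a n` decay faster than every geometric sequence. -/
def RapidDecay (a : ℕ → ℂ) : Prop := ∀ R : ℝ, 0 < R → ∃ K, ∀ n, ‖a n‖ * R ^ n ≤ K

/-- The sum of the power series with coefficients `a`. -/
noncomputable def powSum (a : ℕ → ℂ) (z : ℂ) : ℂ := ∑' n, a n * z ^ n

/-- The coefficients of the derivative of a power series. -/
def derivCoeff (a : ℕ → ℂ) (n : ℕ) : ℂ := (n + 1) * a (n + 1)

lemma RapidDecay.summable {a : ℕ → ℂ} (ha : RapidDecay a) (r : ℝ) (hr : 0 ≤ r) :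
    Summable fun n => ‖a n‖ * r ^ n := by
  obtain ⟨K, hK⟩ := ha (2 * (r + 1)) (by linarith)
  have hg : Summable fun n : ℕ => K * (1 / 2 : ℝ) ^ n :=
    (summable_geometric_of_lt_one (by norm_num) (by norm_num)).mul_left K
  refine Summable.of_nonneg_of_le (fun n => by positivity) (fun n => ?_) hg
  have h1 : r ^ n ≤ (2 * (r + 1)) ^ n * (1 / 2) ^ n := by
    rw [← mul_pow]
    gcongr
    linarith
  calc ‖a n‖ * r ^ n ≤ ‖a n‖ * ((2 * (r + 1)) ^ n * (1 / 2) ^ n) := by gcongr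
    _ = (‖a n‖ * (2 * (r + 1)) ^ n) * (1 / 2) ^ n := by ring
    _ ≤ K * (1 / 2) ^ n := by gcongr; exact hK n

lemma RapidDecay.summable' {a : ℕ → ℂ} (ha : RapidDecay a) (z : ℂ) :
    Summable fun n => a n * z ^ n := by
  refine Summable.of_norm ?_
  simpa [norm_mul, norm_pow] using ha.summable ‖z‖ (norm_nonneg z)

lemma RapidDecay.derivCoeff {a : ℕ → ℂ} (ha : RapidDecay a) : RapidDecay (derivCoeff a) := by
  intro R hR
  obtain ⟨K, hK⟩ := ha (2 * R) (by linarith)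
  refine ⟨K / R, fun n => ?_⟩
  have h := hK (n + 1)
  have h1 : ((n : ℝ) + 1) ≤ 2 ^ (n + 1) := by
    have := Nat.lt_two_pow_self (n := n + 1)
    exact_mod_cast this.le
  rw [le_div_iff₀ hR]
  have h2 : ‖OrrSommerfeld.derivCoeff a n‖ = (n + 1) * ‖a (n + 1)‖ := by
    rw [OrrSommerfeld.derivCoeff, norm_mul]
    congr 1
    exact_mod_cast Complex.norm_natCast (n + 1)
  rw [h2]
  calc ((n : ℝ) + 1) * ‖a (n + 1)‖ * R ^ n * R = ((n : ℝ) + 1) * (‖a (n + 1)‖ * R ^ (n + 1)) := by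
        ring
    _ ≤ 2 ^ (n + 1) * (‖a (n + 1)‖ * R ^ (n + 1)) := by gcongr
    _ = ‖a (n + 1)‖ * (2 * R) ^ (n + 1) := by rw [mul_pow]; ring
    _ ≤ K := h

lemma powSum_hasDerivAt {a : ℕ → ℂ} (ha : RapidDecay a) (z : ℂ) :
    HasDerivAt (powSum a) (powSum (derivCoeff a) z) z := by
  set R := ‖z‖ + 1
  have hR : 0 < R := by positivity
  have hu : Summable fun n : ℕ => ‖(n : ℂ) * a n‖ * R ^ (n - 1) := by
    rw [← summable_nat_add_iff 1]
    refine (ha.derivCoeff.summable R hR.le).congr fun n => ?_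
    simp [derivCoeff]
  have h := hasDerivAt_tsum_of_isPreconnected (g := fun n z => a n * z ^ n)
    (g' := fun n z => n * a n * z ^ (n - 1)) (t := Metric.ball 0 R) (y₀ := z) (y := z) hu
    Metric.isOpen_ball (convex_ball _ _).isPreconnected
    (fun n y _ => by
      refine ((hasDerivAt_pow n y).const_mul (a n)).congr_deriv ?_
      ring)
    (fun n y hy => by
      rw [mem_ball_zero_iff] at hy
      rw [norm_mul, norm_pow]
      gcongr)
    (by simp [R]) (ha.summable' z) (by simp [R])
  refine h.congr_deriv ?_
  have hs : Summable fun n : ℕ => (n : ℂ) * a n * z ^ (n - 1) := by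
    rw [← summable_nat_add_iff 1]
    refine (ha.derivCoeff.summable' z).congr fun n => ?_
    simp [derivCoeff]
  rw [hs.tsum_eq_zero_add, powSum]
  simp [derivCoeff]

lemma powSum_zero (a : ℕ → ℂ) : powSum a 0 = a 0 := by
  rw [powSum, tsum_eq_single 0]
  · simp
  · intro n hn
    simp [hn]

end PowerSeries

/-! ### The power series solutions of `f''' = z f' - f` -/

section CubicSeries

/-- The Taylor coefficients at `0` of the solution of `f''' = z f' - f` with `f 0 = a`, `f' 0 = b`,
`f'' 0 = c`. Solutions are the second primitives `f` of the solutions of the Airy equation. -/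
noncomputable def cubicCoeff (a b c : ℂ) : ℕ → ℂ
  | 0 => a
  | 1 => b
  | 2 => c / 2
  | n + 3 => ((n : ℂ) - 1) / ((n + 3) * (n + 2) * (n + 1)) * cubicCoeff a b c n

lemma norm_cubicCoeff_le (a b c : ℂ) (n : ℕ) :
    ‖cubicCoeff a b c (n + 3)‖ ≤ ‖cubicCoeff a b c n‖ / ((n + 1) * (n + 1)) := by
  rw [cubicCoeff, norm_mul, div_eq_inv_mul ‖cubicCoeff a b c n‖]
  refine mul_le_mul_of_nonneg_right ?_ (norm_nonneg _)
  rw [norm_div, inv_eq_one_div]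
  have h1 : ‖((n : ℂ) + 3) * (n + 2) * (n + 1)‖ = (n + 3) * (n + 2) * (n + 1) := by
    have := Complex.norm_natCast ((n + 3) * (n + 2) * (n + 1))
    push_cast at this
    exact this
  have h2 : ‖(n : ℂ) - 1‖ ≤ n + 3 := by
    refine (norm_sub_le _ _).trans ?_
    simp only [Complex.norm_natCast, norm_one]
    linarith
  rw [h1]
  have hn : (0 : ℝ) ≤ n := n.cast_nonneg
  rw [div_le_div_iff₀ (by positivity) (by positivity)]
  have : ((n : ℝ) + 3) * (n + 1) * (n + 1) ≤ (n + 3) * (n + 1) * (n + 2) := by gcongr; norm_num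
  nlinarith

lemma cubicCoeff_rapidDecay (a b c : ℂ) : RapidDecay (cubicCoeff a b c) := by
  intro R hR
  obtain ⟨N, hN⟩ := exists_nat_ge (R ^ 3)
  set K := ∑ i ∈ Finset.range (N + 3), ‖cubicCoeff a b c i‖ * R ^ i
  refine ⟨K, fun n => ?_⟩
  induction n using Nat.strong_induction_on with
  | _ n ih =>
    by_cases hn : n < N + 3
    · exact Finset.single_le_sum (f := fun i => ‖cubicCoeff a b c i‖ * R ^ i)
        (fun i _ => by positivity) (Finset.mem_range.2 hn)
    · obtain ⟨k, rfl⟩ : ∃ k, n = k + 3 := ⟨n - 3, by omega⟩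
      have hk : (N : ℝ) ≤ k := by exact_mod_cast (by omega : N ≤ k)
      refine le_trans ?_ (ih k (by omega))
      have h1 := norm_cubicCoeff_le a b c k
      calc ‖cubicCoeff a b c (k + 3)‖ * R ^ (k + 3)
          ≤ ‖cubicCoeff a b c k‖ / ((k + 1) * (k + 1)) * R ^ (k + 3) := by gcongr
        _ = ‖cubicCoeff a b c k‖ * R ^ k * (R ^ 3 / ((k + 1) * (k + 1))) := by rw [pow_add]; ring
        _ ≤ ‖cubicCoeff a b c k‖ * R ^ k * 1 := by
            gcongr
            rw [div_le_one (by positivity)]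
            nlinarith
        _ = _ := mul_one _

/-- The solution of `f''' = z f' - f` with `f 0 = a`, `f' 0 = b`, `f'' 0 = c`. -/
noncomputable def cubicSeries (a b c z : ℂ) : ℂ := powSum (cubicCoeff a b c) z

/-- The derivative of `cubicSeries`. -/
noncomputable def cubicSeries1 (a b c z : ℂ) : ℂ := powSum (derivCoeff (cubicCoeff a b c)) z

/-- The second derivative of `cubicSeries`, a solution of the Airy equation. -/
noncomputable def cubicSeries2 (a b c z : ℂ) : ℂ :=
  powSum (derivCoeff (derivCoeff (cubicCoeff a b c))) z

variable (a b c z : ℂ)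

lemma cubicSeries_hasDerivAt : HasDerivAt (cubicSeries a b c) (cubicSeries1 a b c z) z :=
  powSum_hasDerivAt (cubicCoeff_rapidDecay a b c) z

lemma cubicSeries1_hasDerivAt : HasDerivAt (cubicSeries1 a b c) (cubicSeries2 a b c z) z :=
  powSum_hasDerivAt (cubicCoeff_rapidDecay a b c).derivCoeff z

lemma cubicSeries2_hasDerivAt : HasDerivAt (cubicSeries2 a b c)
    (z * cubicSeries1 a b c z - cubicSeries a b c z) z := by
  have hd := cubicCoeff_rapidDecay a b c
  refine (powSum_hasDerivAt hd.derivCoeff.derivCoeff z).congr_deriv ?_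
  have h1 : z * cubicSeries1 a b c z = ∑' n : ℕ, (n : ℂ) * cubicCoeff a b c n * z ^ n := by
    have hs : Summable fun n : ℕ => (n : ℂ) * cubicCoeff a b c n * z ^ n := by
      rw [← summable_nat_add_iff 1]
      refine ((hd.derivCoeff.summable' z).mul_left z).congr fun n => ?_
      simp only [derivCoeff, Nat.cast_add, Nat.cast_one]
      ring
    rw [hs.tsum_eq_zero_add, cubicSeries1, powSum, ← tsum_mul_left]
    simp only [derivCoeff, Nat.cast_zero, zero_mul, zero_add, Nat.cast_add, Nat.cast_one]
    exact tsum_congr fun n => by ring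
  have hs : Summable fun n : ℕ => (n : ℂ) * cubicCoeff a b c n * z ^ n := by
    rw [← summable_nat_add_iff 1]
    refine ((hd.derivCoeff.summable' z).mul_left z).congr fun n => ?_
    simp only [derivCoeff, Nat.cast_add, Nat.cast_one]
    ring
  rw [h1, cubicSeries, powSum, powSum, ← hs.tsum_sub (hd.summable' z)]
  refine tsum_congr fun n => ?_
  have e1 : (n : ℂ) + 1 ≠ 0 := by exact_mod_cast Nat.succ_ne_zero n
  have e2 : (n : ℂ) + 2 ≠ 0 := by exact_mod_cast Nat.succ_ne_zero (n + 1)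
  have e3 : (n : ℂ) + 3 ≠ 0 := by exact_mod_cast Nat.succ_ne_zero (n + 2)
  simp only [derivCoeff, Nat.cast_add, Nat.cast_one]
  rw [cubicCoeff]
  field_simp
  ring

lemma cubicSeries_zero : cubicSeries a b c 0 = a := by
  rw [cubicSeries, powSum_zero, cubicCoeff]

lemma cubicSeries1_zero : cubicSeries1 a b c 0 = b := by
  rw [cubicSeries1, powSum_zero, derivCoeff]
  simp [cubicCoeff]

lemma cubicSeries2_zero : cubicSeries2 a b c 0 = c := by
  rw [cubicSeries2, powSum_zero, derivCoeff, derivCoeff]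
  simp only [cubicCoeff]
  push_cast
  ring

end CubicSeries

/-- Uniqueness for the equation `f''' = w f' - f`, where the prime is differentiation with respect
to a variable whose differential is `k`. -/
lemma cubic_unique {S : Set ℂ} (hS : Convex ℝ S) {k w : ℂ → ℂ} (hk : ContinuousOn k S)
    (hw : ContinuousOn w S) {f0 f1 f2 : ℂ → ℂ}
    (h0 : ∀ z ∈ S, HasDerivAt f0 (k z * f1 z) z) (h1 : ∀ z ∈ S, HasDerivAt f1 (k z * f2 z) z)
    (h2 : ∀ z ∈ S, HasDerivAt f2 (k z * (w z * f1 z - f0 z)) z) {z₀ z : ℂ} (hz₀ : z₀ ∈ S)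
    (hz : z ∈ S) (e0 : f0 z₀ = 0) (e1 : f1 z₀ = 0) (e2 : f2 z₀ = 0) :
    f0 z = 0 ∧ f1 z = 0 ∧ f2 z = 0 := by
  set g : ℝ → ℂ := fun s => z₀ + s * (z - z₀)
  have hg : ∀ s ∈ Icc (0 : ℝ) 1, g s ∈ S := by
    intro s hs
    have := hS.add_smul_sub_mem hz₀ hz hs
    simpa [g] using this
  have hgc : ContinuousOn g (Icc 0 1) := by fun_prop
  have hgd : ∀ s : ℝ, HasDerivAt g (z - z₀) s := by
    intro s
    have : HasDerivAt (fun s : ℝ => (s : ℂ)) 1 s := Complex.ofRealCLM.hasDerivAt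
    simpa only [one_mul] using (this.mul_const (z - z₀)).const_add z₀
  obtain ⟨Kk, hKk⟩ := isCompact_Icc.exists_bound_of_continuousOn (hk.comp hgc hg)
  obtain ⟨Kw, hKw⟩ := isCompact_Icc.exists_bound_of_continuousOn (hw.comp hgc hg)
  set y : ℝ → ℂ × ℂ × ℂ := fun s => (f0 (g s), f1 (g s), f2 (g s))
  set y' : ℝ → ℂ × ℂ × ℂ := fun s => (k (g s) * f1 (g s) * (z - z₀), k (g s) * f2 (g s) * (z - z₀),
    k (g s) * (w (g s) * f1 (g s) - f0 (g s)) * (z - z₀))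
  have hy : ∀ s ∈ Icc (0 : ℝ) 1, HasDerivAt y (y' s) s := by
    intro s hs
    have a0 := (h0 _ (hg s hs)).comp s (hgd s)
    have a1 := (h1 _ (hg s hs)).comp s (hgd s)
    have a2 := (h2 _ (hg s hs)).comp s (hgd s)
    exact a0.prodMk (a1.prodMk a2)
  have hbound := norm_le_gronwallBound_of_norm_deriv_right_le (f := y) (f' := y') (δ := 0)
    (K := Kk * (Kw + 1) * ‖z - z₀‖) (ε := 0) (a := 0) (b := 1)
    (fun s hs => (hy s hs).continuousAt.continuousWithinAt)
    (fun s hs => (hy s (Ico_subset_Icc_self hs)).hasDerivWithinAt)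
    (by simp [y, g, e0, e1, e2])
    (by
      intro s hs
      have hs' := Ico_subset_Icc_self hs
      have b1 : ‖k (g s)‖ ≤ Kk := hKk s hs'
      have b2 : ‖w (g s)‖ ≤ Kw := hKw s hs'
      have b1' := (norm_nonneg _).trans b1
      have b2' := (norm_nonneg _).trans b2
      have c0 : ‖f0 (g s)‖ ≤ ‖y s‖ := norm_fst_le (y s)
      have c12 : ‖(y s).2‖ ≤ ‖y s‖ := norm_snd_le (y s)
      have c1 : ‖f1 (g s)‖ ≤ ‖y s‖ := (norm_fst_le (y s).2).trans c12
      have c2 : ‖f2 (g s)‖ ≤ ‖y s‖ := (norm_snd_le (y s).2).trans c12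
      have hyn := norm_nonneg (y s)
      have hmain : ∀ v : ℂ, ‖v‖ ≤ (Kw + 1) * ‖y s‖ →
          ‖k (g s) * v * (z - z₀)‖ ≤ Kk * (Kw + 1) * ‖z - z₀‖ * ‖y s‖ := by
        intro v hv
        rw [norm_mul, norm_mul]
        calc ‖k (g s)‖ * ‖v‖ * ‖z - z₀‖ ≤ Kk * ((Kw + 1) * ‖y s‖) * ‖z - z₀‖ := by gcongr
          _ = _ := by ring
      rw [add_zero]
      refine norm_prod_le_iff.2 ⟨hmain _ ?_, norm_prod_le_iff.2 ⟨hmain _ ?_, hmain _ ?_⟩⟩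
      · nlinarith
      · nlinarith
      · refine (norm_sub_le _ _).trans ?_
        rw [norm_mul]
        have : ‖w (g s)‖ * ‖f1 (g s)‖ ≤ Kw * ‖y s‖ := by gcongr
        linarith)
    1 (by simp)
  rw [gronwallBound_ε0_δ0] at hbound
  have hy1 : y 1 = 0 := norm_le_zero_iff.1 hbound
  have hg1 : g 1 = z := by simp [g]
  simp only [y, hg1, Prod.mk_eq_zero] at hy1
  exact hy1

end OrrSommerfeld

namespace OrrSommerfeld

open Set Filter Topology MeasureTheory

open scoped Real

/-! ### Estimates of the saddle point integrals -/

section Estimates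

lemma integrable_pow_mul_exp {a : ℝ} (ha : 0 < a) (n : ℕ) :
    Integrable fun τ : ℝ => τ ^ n * Real.exp (-(a * τ ^ 2)) := by
  refine (integrable_one_add_abs_pow_mul_exp ha n).mono' (by fun_prop)
    (Eventually.of_forall fun τ => ?_)
  rw [norm_mul, Real.norm_of_nonneg (Real.exp_nonneg _), norm_pow, Real.norm_eq_abs]
  gcongr
  linarith [abs_nonneg τ]

lemma integral_pow_mul_exp_step {a : ℝ} (ha : 0 < a) (n : ℕ) :
    ∫ τ : ℝ, τ ^ (n + 2) * Real.exp (-(a * τ ^ 2)) =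
      (n + 1) / (2 * a) * ∫ τ : ℝ, τ ^ n * Real.exp (-(a * τ ^ 2)) := by
  have hder : ∀ τ : ℝ, HasDerivAt (fun τ => τ ^ (n + 1) * Real.exp (-(a * τ ^ 2)))
      ((n + 1) * (τ ^ n * Real.exp (-(a * τ ^ 2))) -
        2 * a * (τ ^ (n + 2) * Real.exp (-(a * τ ^ 2)))) τ := by
    intro τ
    have h1 := (hasDerivAt_pow (n + 1) τ).mul
      (((hasDerivAt_pow 2 τ).const_mul a).neg.exp)
    refine h1.congr_deriv ?_
    simp only [Nat.add_sub_cancel, Pi.neg_apply]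
    push_cast
    ring
  have i1 : Integrable fun τ : ℝ => ((n : ℝ) + 1) * (τ ^ n * Real.exp (-(a * τ ^ 2))) :=
    (integrable_pow_mul_exp ha n).const_mul _
  have i2 : Integrable fun τ : ℝ => 2 * a * (τ ^ (n + 2) * Real.exp (-(a * τ ^ 2))) :=
    (integrable_pow_mul_exp ha (n + 2)).const_mul _
  have hlim : ∀ l : Filter ℝ, Tendsto (fun τ : ℝ => τ ^ 2) l atTop →
      Tendsto (fun τ : ℝ => τ ^ (n + 1) * Real.exp (-(a * τ ^ 2))) l (𝓝 0) := by
    intro l hl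
    refine squeeze_zero_norm (fun τ => ?_) (tendsto_one_add_abs_pow_mul_exp ha (n + 1) hl)
    rw [norm_mul, Real.norm_of_nonneg (Real.exp_nonneg _), norm_pow, Real.norm_eq_abs]
    gcongr
    linarith [abs_nonneg τ]
  have h0 := integral_of_hasDerivAt_of_tendsto hder (i1.sub i2) (hlim _ tendsto_sq_atBot')
    (hlim _ tendsto_sq_atTop')
  rw [integral_sub i1 i2, integral_const_mul, integral_const_mul, sub_zero] at h0
  field_simp
  linarith

lemma integral_exp_neg_mul_sq (a : ℝ) :
    ∫ τ : ℝ, Real.exp (-(a * τ ^ 2)) = √(π / a) := by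
  rw [← integral_gaussian a]
  simp only [neg_mul]

lemma integral_sq_mul_exp {a : ℝ} (ha : 0 < a) :
    ∫ τ : ℝ, τ ^ 2 * Real.exp (-(a * τ ^ 2)) = √(π / a) / (2 * a) := by
  rw [integral_pow_mul_exp_step ha 0]
  simp only [pow_zero, one_mul, integral_exp_neg_mul_sq]
  push_cast
  ring

lemma integral_pow_six_mul_exp {a : ℝ} (ha : 0 < a) :
    ∫ τ : ℝ, τ ^ 6 * Real.exp (-(a * τ ^ 2)) = 15 / (8 * a ^ 3) * √(π / a) := by
  rw [integral_pow_mul_exp_step ha 4, integral_pow_mul_exp_step ha 2, integral_sq_mul_exp ha]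
  push_cast
  field_simp
  norm_num

lemma exp_saddle_split (σ : ℂ) (τ : ℝ) :
    Complex.exp (-((τ : ℂ) ^ 2 * σ) - Complex.I * (τ : ℂ) ^ 3 / 3) =
      Complex.exp (-σ * (τ : ℂ) ^ 2) * Complex.exp (((-(τ ^ 3 / 3) : ℝ) : ℂ) * Complex.I) := by
  rw [← Complex.exp_add]
  congr 1
  push_cast
  ring

lemma norm_exp_neg_mul_sq (σ : ℂ) (τ : ℝ) :
    ‖Complex.exp (-σ * (τ : ℂ) ^ 2)‖ = Real.exp (-(σ.re * τ ^ 2)) := by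
  rw [Complex.norm_exp]
  congr 1
  rw [← Complex.ofReal_pow, Complex.re_mul_ofReal]
  simp

/-- Only the even part of the integrand contributes to the difference with the Gauss integral. -/
lemma norm_saddleIntegral_zero_sub_le {σ : ℂ} (hσ : 0 < σ.re) :
    ‖saddleIntegral 0 σ - (π / σ) ^ (1 / 2 : ℂ)‖ ≤ 5 / (48 * σ.re ^ 3) * √(π / σ.re) := by
  have hI := saddleIntegrand_integrable hσ 0
  have hG : Integrable fun τ : ℝ => Complex.exp (-σ * (τ : ℂ) ^ 2) :=
    integrable_cexp_neg_mul_sq hσ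
  set g : ℝ → ℂ := fun τ => saddleIntegrand 0 σ τ - Complex.exp (-σ * (τ : ℂ) ^ 2)
  have hg : Integrable g := hI.sub hG
  have h1 : saddleIntegral 0 σ - (π / σ) ^ (1 / 2 : ℂ) = ∫ τ, g τ := by
    rw [integral_sub hI hG, integral_gaussian_complex hσ, saddleIntegral]
  have h2 : ∫ τ, g τ = ∫ τ, (1 / 2 : ℂ) * (g τ + g (-τ)) := by
    rw [integral_const_mul, integral_add hg hg.comp_neg, integral_neg_eq_self g]
    ring
  rw [h1, h2]
  calc ‖∫ τ, (1 / 2 : ℂ) * (g τ + g (-τ))‖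
      ≤ ∫ τ : ℝ, 1 / 18 * (τ ^ 6 * Real.exp (-(σ.re * τ ^ 2))) := by
        refine norm_integral_le_of_norm_le ((integrable_pow_mul_exp hσ 6).const_mul _)
          (Eventually.of_forall fun τ => ?_)
        have e1 : (1 / 2 : ℂ) * (g τ + g (-τ)) =
            Complex.exp (-σ * (τ : ℂ) ^ 2) * ((Real.cos (τ ^ 3 / 3) - 1 : ℝ) : ℂ) := by
          simp only [g, saddleIntegrand, zpow_zero, one_mul, exp_saddle_split]
          rw [Complex.exp_mul_I, Complex.exp_mul_I]
          push_cast
          have e2 : (-((-(τ : ℂ)) ^ 3 / 3)) = (τ : ℂ) ^ 3 / 3 := by ring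
          have e3 : (-(τ : ℂ)) ^ 2 = (τ : ℂ) ^ 2 := by ring
          rw [e2, e3, Complex.cos_neg, Complex.sin_neg]
          ring
        rw [e1, norm_mul, norm_exp_neg_mul_sq, Complex.norm_real, Real.norm_eq_abs]
        have e4 : |Real.cos (τ ^ 3 / 3) - 1| ≤ τ ^ 6 / 18 := by
          rw [abs_sub_comm, abs_of_nonneg (by linarith [Real.cos_le_one (τ ^ 3 / 3)])]
          have := Real.one_sub_sq_div_two_le_cos (x := τ ^ 3 / 3)
          have e5 : (τ ^ 3 / 3) ^ 2 / 2 = τ ^ 6 / 18 := by ring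
          linarith
        nlinarith [Real.exp_pos (-(σ.re * τ ^ 2))]
    _ = _ := by
        rw [integral_const_mul, integral_pow_six_mul_exp hσ]
        field_simp
        norm_num

lemma norm_saddleIntegral_one_sub_le {σ : ℂ} (hσ : 0 < σ.re) :
    ‖saddleIntegral 1 σ - σ * saddleIntegral 0 σ‖ ≤ 1 / (4 * ‖σ‖ * σ.re) * √(π / σ.re) := by
  have hn : 0 < ‖σ‖ := hσ.trans_le (Complex.re_le_norm σ)
  have hne : σ ≠ 0 := norm_pos_iff.1 hn
  have hI0 := saddleIntegrand_integrable hσ 0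
  have hI1 := saddleIntegrand_integrable hσ 1
  have hI2 := saddleIntegrand_integrable hσ 2
  have h0 := saddleIntegral_by_parts hσ 0
  simp only [Int.cast_zero, zero_mul, zero_add] at h0
  -- the integral of `(t - σ)² = -τ²` against the weight
  have h1 : ∫ τ : ℝ, (-((τ : ℂ) ^ 2) * saddleIntegrand 0 σ τ) =
      saddleIntegral 2 σ - 2 * σ * saddleIntegral 1 σ + σ ^ 2 * saddleIntegral 0 σ := by
    have i1 : Integrable fun τ => 2 * σ * saddleIntegrand 1 σ τ := hI1.const_mul _
    have i2 : Integrable fun τ => saddleIntegrand 2 σ τ - 2 * σ * saddleIntegrand 1 σ τ :=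
      hI2.sub i1
    have i3 : Integrable fun τ => σ ^ 2 * saddleIntegrand 0 σ τ := hI0.const_mul _
    have e : ∀ τ : ℝ, -((τ : ℂ) ^ 2) * saddleIntegrand 0 σ τ =
        saddleIntegrand 2 σ τ - 2 * σ * saddleIntegrand 1 σ τ
          + σ ^ 2 * saddleIntegrand 0 σ τ := by
      intro τ
      have e1 : saddleIntegrand 1 σ τ = (σ + Complex.I * τ) * saddleIntegrand 0 σ τ :=
        (saddleIntegrand_mul hσ 0 τ).symm
      have e2 : saddleIntegrand 2 σ τ = (σ + Complex.I * τ) * saddleIntegrand 1 σ τ :=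
        (saddleIntegrand_mul hσ 1 τ).symm
      rw [e2, e1]
      linear_combination (-(τ : ℂ) ^ 2 * saddleIntegrand 0 σ τ) * Complex.I_sq
    simp_rw [e]
    rw [integral_add i2 i3, integral_sub hI2 i1, integral_const_mul, integral_const_mul]
    rfl
  have h2 : saddleIntegral 1 σ - σ * saddleIntegral 0 σ =
      -(1 / (2 * σ)) * ∫ τ : ℝ, (-((τ : ℂ) ^ 2) * saddleIntegrand 0 σ τ) := by
    rw [h1]
    field_simp
    linear_combination h0
  have h3 : ‖∫ τ : ℝ, (-((τ : ℂ) ^ 2) * saddleIntegrand 0 σ τ)‖ ≤ √(π / σ.re) / (2 * σ.re) := by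
    rw [← integral_sq_mul_exp hσ]
    refine norm_integral_le_of_norm_le (integrable_pow_mul_exp hσ 2)
      (Eventually.of_forall fun τ => le_of_eq ?_)
    rw [saddleIntegrand, zpow_zero, one_mul, norm_mul, norm_saddle_exp]
    simp
  rw [h2, norm_mul]
  have h4 : ‖-(1 / (2 * σ))‖ = 1 / (2 * ‖σ‖) := by simp
  rw [h4]
  calc 1 / (2 * ‖σ‖) * _ ≤ 1 / (2 * ‖σ‖) * (√(π / σ.re) / (2 * σ.re)) := by gcongr
    _ = _ := by field_simp; norm_num

lemma norm_saddleIntegral_neg_le {σ : ℂ} (hσ : 0 < σ.re) (k : ℕ) :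
    ‖saddleIntegral (-k) σ‖ ≤ (1 / σ.re ^ k) * √(π / σ.re) := by
  rw [← integral_exp_neg_mul_sq, ← integral_const_mul]
  have h := (integrable_pow_mul_exp hσ 0).const_mul (1 / σ.re ^ k)
  simp only [pow_zero, one_mul] at h
  refine norm_integral_le_of_norm_le h (Eventually.of_forall fun τ => ?_)
  rw [saddleIntegrand, norm_mul, norm_saddle_exp, zpow_neg, zpow_natCast, norm_inv, norm_pow,
    inv_eq_one_div]
  have := re_le_norm_add_I_mul (σ := σ) τ
  gcongr

lemma saddleIntegral_conj (k : ℤ) (σ : ℂ) :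
    saddleIntegral k (starRingEnd ℂ σ) = starRingEnd ℂ (saddleIntegral k σ) := by
  rw [saddleIntegral, saddleIntegral, ← integral_conj, ← integral_neg_eq_self]
  refine integral_congr_ae (Eventually.of_forall fun τ => ?_)
  simp only [saddleIntegrand, map_mul, map_zpow₀, map_add, Complex.conj_I, Complex.conj_ofReal,
    ← Complex.exp_conj, map_sub, map_neg, map_pow, map_div₀]
  have : (starRingEnd ℂ) (3 : ℂ) = 3 := Complex.conj_ofNat 3
  rw [this]
  push_cast
  congr 2
  · ring
  · ring

end Estimates

/-! ### The decaying solution as a power series -/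

section Link

variable (a b c z : ℂ)

lemma cubicSeries_linear :
    cubicSeries a b c z = a * cubicSeries 1 0 0 z + b * cubicSeries 0 1 0 z +
      c * cubicSeries 0 0 1 z ∧
    cubicSeries1 a b c z = a * cubicSeries1 1 0 0 z + b * cubicSeries1 0 1 0 z +
      c * cubicSeries1 0 0 1 z ∧
    cubicSeries2 a b c z = a * cubicSeries2 1 0 0 z + b * cubicSeries2 0 1 0 z +
      c * cubicSeries2 0 0 1 z := by
  have h := cubic_unique convex_univ (k := fun _ => 1) (w := fun z => z) (by fun_prop)
    (by fun_prop)
    (f0 := fun z => cubicSeries a b c z - (a * cubicSeries 1 0 0 z + b * cubicSeries 0 1 0 z +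
      c * cubicSeries 0 0 1 z))
    (f1 := fun z => cubicSeries1 a b c z - (a * cubicSeries1 1 0 0 z + b * cubicSeries1 0 1 0 z +
      c * cubicSeries1 0 0 1 z))
    (f2 := fun z => cubicSeries2 a b c z - (a * cubicSeries2 1 0 0 z + b * cubicSeries2 0 1 0 z +
      c * cubicSeries2 0 0 1 z))
    (fun z _ => by
      refine ((cubicSeries_hasDerivAt a b c z).sub
        ((((cubicSeries_hasDerivAt 1 0 0 z).const_mul a).add
        ((cubicSeries_hasDerivAt 0 1 0 z).const_mul b)).add
        ((cubicSeries_hasDerivAt 0 0 1 z).const_mul c))).congr_deriv ?_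
      ring)
    (fun z _ => by
      refine ((cubicSeries1_hasDerivAt a b c z).sub
        ((((cubicSeries1_hasDerivAt 1 0 0 z).const_mul a).add
        ((cubicSeries1_hasDerivAt 0 1 0 z).const_mul b)).add
        ((cubicSeries1_hasDerivAt 0 0 1 z).const_mul c))).congr_deriv ?_
      ring)
    (fun z _ => by
      refine ((cubicSeries2_hasDerivAt a b c z).sub
        ((((cubicSeries2_hasDerivAt 1 0 0 z).const_mul a).add
        ((cubicSeries2_hasDerivAt 0 1 0 z).const_mul b)).add
        ((cubicSeries2_hasDerivAt 0 0 1 z).const_mul c))).congr_deriv ?_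
      ring)
    (z₀ := 0) (z := z) (mem_univ _) (mem_univ _) (by simp [cubicSeries_zero])
    (by simp [cubicSeries1_zero]) (by simp [cubicSeries2_zero])
  simpa only [sub_eq_zero] using h

lemma cubicCoeff_conj (n : ℕ) : starRingEnd ℂ (cubicCoeff a b c n) =
    cubicCoeff (starRingEnd ℂ a) (starRingEnd ℂ b) (starRingEnd ℂ c) n := by
  induction n using Nat.strong_induction_on with
  | _ n ih =>
    match n with
    | 0 => simp [cubicCoeff]
    | 1 => simp [cubicCoeff]
    | 2 => simp [cubicCoeff, Complex.conj_ofNat]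
    | n + 3 =>
      rw [cubicCoeff, cubicCoeff, map_mul, ih n (by omega)]
      simp [Complex.conj_ofNat]

lemma powSum_conj (u : ℕ → ℂ) :
    starRingEnd ℂ (powSum u z) = powSum (fun n => starRingEnd ℂ (u n)) (starRingEnd ℂ z) := by
  rw [powSum, Complex.conj_tsum, powSum]
  simp

lemma cubicSeries_conj : starRingEnd ℂ (cubicSeries a b c z) =
    cubicSeries (starRingEnd ℂ a) (starRingEnd ℂ b) (starRingEnd ℂ c) (starRingEnd ℂ z) := by
  simp only [cubicSeries, powSum_conj, cubicCoeff_conj]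

lemma cubicSeries1_conj : starRingEnd ℂ (cubicSeries1 a b c z) =
    cubicSeries1 (starRingEnd ℂ a) (starRingEnd ℂ b) (starRingEnd ℂ c) (starRingEnd ℂ z) := by
  simp only [cubicSeries1, powSum_conj, derivCoeff, map_mul, cubicCoeff_conj, map_add,
    map_natCast, map_one]
  rfl

lemma cubicSeries2_conj : starRingEnd ℂ (cubicSeries2 a b c z) =
    cubicSeries2 (starRingEnd ℂ a) (starRingEnd ℂ b) (starRingEnd ℂ c) (starRingEnd ℂ z) := by
  simp only [cubicSeries2, powSum_conj, derivCoeff, map_mul, cubicCoeff_conj, map_add,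
    map_natCast, map_one]
  rfl

end Link

/-- Real initial data at `0` realize all real data at `1`. -/
lemma exists_cubicSeries_eq (v0 v1 v2 : ℝ) : ∃ a b c : ℝ, cubicSeries a b c 1 = v0 ∧
    cubicSeries1 a b c 1 = v1 ∧ cubicSeries2 a b c 1 = v2 := by
  have him : ∀ w : ℂ, starRingEnd ℂ w = w → ((w.re : ℝ) : ℂ) = w := fun w hw =>
    Complex.conj_eq_iff_re.1 hw
  have r0 : ∀ a b c : ℝ, (((cubicSeries a b c 1).re : ℝ) : ℂ) = cubicSeries a b c 1 := by
    intro a b c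
    apply him
    rw [cubicSeries_conj]
    simp
  have r1 : ∀ a b c : ℝ, (((cubicSeries1 a b c 1).re : ℝ) : ℂ) = cubicSeries1 a b c 1 := by
    intro a b c
    apply him
    rw [cubicSeries1_conj]
    simp
  have r2 : ∀ a b c : ℝ, (((cubicSeries2 a b c 1).re : ℝ) : ℂ) = cubicSeries2 a b c 1 := by
    intro a b c
    apply him
    rw [cubicSeries2_conj]
    simp
  let L : ℝ × ℝ × ℝ →ₗ[ℝ] ℝ × ℝ × ℝ :=
    { toFun := fun p => ((cubicSeries p.1 p.2.1 p.2.2 1).re, (cubicSeries1 p.1 p.2.1 p.2.2 1).re,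
        (cubicSeries2 p.1 p.2.1 p.2.2 1).re)
      map_add' := by
        rintro ⟨a, b, c⟩ ⟨a', b', c'⟩
        obtain ⟨h0, h1, h2⟩ := cubicSeries_linear a b c 1
        obtain ⟨h0', h1', h2'⟩ := cubicSeries_linear a' b' c' 1
        obtain ⟨k0, k1, k2⟩ := cubicSeries_linear ((a + a' : ℝ)) ((b + b' : ℝ)) ((c + c' : ℝ)) 1
        simp only [Prod.mk_add_mk]
        rw [h0, h1, h2, h0', h1', h2', k0, k1, k2]
        simp only [Complex.add_re, Complex.re_ofReal_mul]
        ext <;> simp <;> ring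
      map_smul' := by
        rintro s ⟨a, b, c⟩
        obtain ⟨h0, h1, h2⟩ := cubicSeries_linear a b c 1
        obtain ⟨k0, k1, k2⟩ := cubicSeries_linear ((s * a : ℝ)) ((s * b : ℝ)) ((s * c : ℝ)) 1
        simp only [Prod.smul_mk, smul_eq_mul]
        rw [h0, h1, h2, k0, k1, k2]
        simp only [Complex.add_re, Complex.re_ofReal_mul]
        ext <;> simp <;> ring }
  have hinj : Function.Injective L := by
    rw [← LinearMap.ker_eq_bot, LinearMap.ker_eq_bot']
    rintro ⟨a, b, c⟩ h
    have h0 : (cubicSeries a b c 1).re = 0 := congrArg Prod.fst h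
    have h1 : (cubicSeries1 a b c 1).re = 0 := congrArg (fun p => p.2.1) h
    have h2 : (cubicSeries2 a b c 1).re = 0 := congrArg (fun p => p.2.2) h
    have := cubic_unique convex_univ (k := fun _ => 1) (w := fun z => z) (by fun_prop)
      (by fun_prop) (f0 := cubicSeries a b c) (f1 := cubicSeries1 a b c) (f2 := cubicSeries2 a b c)
      (fun z _ => by simpa using cubicSeries_hasDerivAt a b c z)
      (fun z _ => by simpa using cubicSeries1_hasDerivAt a b c z)
      (fun z _ => by simpa using cubicSeries2_hasDerivAt a b c z) (z₀ := 1) (z := 0)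
      (mem_univ _) (mem_univ _) (by rw [← r0, h0, Complex.ofReal_zero])
      (by rw [← r1, h1, Complex.ofReal_zero]) (by rw [← r2, h2, Complex.ofReal_zero])
    rw [cubicSeries_zero, cubicSeries1_zero, cubicSeries2_zero] at this
    simpa using this
  obtain ⟨⟨a, b, c⟩, h⟩ := (LinearMap.injective_iff_surjective.1 hinj) (v0, v1, v2)
  refine ⟨a, b, c, ?_, ?_, ?_⟩
  · rw [← r0]; exact congrArg (fun p : ℝ × ℝ × ℝ => ((p.1 : ℝ) : ℂ)) h
  · rw [← r1]; exact congrArg (fun p : ℝ × ℝ × ℝ => ((p.2.1 : ℝ) : ℂ)) h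
  · rw [← r2]; exact congrArg (fun p : ℝ × ℝ × ℝ => ((p.2.2 : ℝ) : ℂ)) h

lemma saddleIntegral_mul_exp_hasDerivAt {σ : ℂ} (hσ : 0 < σ.re) (k : ℤ) :
    HasDerivAt (fun σ => Complex.exp (-(2 / 3 * σ ^ 3)) * saddleIntegral k σ)
      (-(2 * σ) * (Complex.exp (-(2 / 3 * σ ^ 3)) * saddleIntegral (k + 1) σ)) σ := by
  refine ((((hasDerivAt_pow 3 σ).const_mul (2 / 3 : ℂ)).neg.cexp).mul
    (saddleIntegral_hasDerivAt hσ k)).congr_deriv ?_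
  simp only [Pi.neg_apply]
  push_cast
  ring

/-- The power series of `2π` times the second primitive of the Airy function. -/
theorem exists_cubicSeries_eq_saddleIntegral : ∃ A B C : ℝ, ∀ σ : ℂ, 0 < σ.re →
    cubicSeries A B C (σ ^ 2) = Complex.exp (-(2 / 3 * σ ^ 3)) * saddleIntegral (-2) σ ∧
    cubicSeries1 A B C (σ ^ 2) = -(Complex.exp (-(2 / 3 * σ ^ 3)) * saddleIntegral (-1) σ) ∧
    cubicSeries2 A B C (σ ^ 2) = Complex.exp (-(2 / 3 * σ ^ 3)) * saddleIntegral 0 σ := by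
  have hreal : ∀ k, ∃ v : ℝ, (v : ℂ) = Complex.exp (-(2 / 3 * 1 ^ 3)) * saddleIntegral k 1 := by
    intro k
    refine ⟨(Complex.exp (-(2 / 3 * 1 ^ 3)) * saddleIntegral k 1).re, Complex.conj_eq_iff_re.1 ?_⟩
    rw [map_mul, ← saddleIntegral_conj, ← Complex.exp_conj]
    simp only [map_one, map_neg, map_mul, map_div₀, map_pow, Complex.conj_ofNat]
  obtain ⟨v0, h0⟩ := hreal (-2)
  obtain ⟨v1, h1⟩ := hreal (-1)
  obtain ⟨v2, h2⟩ := hreal 0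
  obtain ⟨A, B, C, e0, e1, e2⟩ := exists_cubicSeries_eq v0 (-v1) v2
  refine ⟨A, B, C, fun σ hσ => ?_⟩
  have hS : Convex ℝ {σ : ℂ | 0 < σ.re} := convex_halfSpace_re_gt 0
  have hsq : ∀ σ : ℂ, HasDerivAt (fun σ : ℂ => σ ^ 2) (2 * σ) σ := fun σ => by
    simpa using hasDerivAt_pow 2 σ
  have := cubic_unique hS (k := fun σ => 2 * σ) (w := fun σ => σ ^ 2) (by fun_prop) (by fun_prop)
    (f0 := fun σ => cubicSeries A B C (σ ^ 2) -
      Complex.exp (-(2 / 3 * σ ^ 3)) * saddleIntegral (-2) σ)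
    (f1 := fun σ => cubicSeries1 A B C (σ ^ 2) +
      Complex.exp (-(2 / 3 * σ ^ 3)) * saddleIntegral (-1) σ)
    (f2 := fun σ => cubicSeries2 A B C (σ ^ 2) -
      Complex.exp (-(2 / 3 * σ ^ 3)) * saddleIntegral 0 σ)
    (fun s hs => by
      refine (((cubicSeries_hasDerivAt A B C (s ^ 2)).comp s (hsq s)).sub
        (saddleIntegral_mul_exp_hasDerivAt hs (-2))).congr_deriv ?_
      norm_num
      ring)
    (fun s hs => by
      refine (((cubicSeries1_hasDerivAt A B C (s ^ 2)).comp s (hsq s)).add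
        (saddleIntegral_mul_exp_hasDerivAt hs (-1))).congr_deriv ?_
      norm_num
      ring)
    (fun s hs => by
      refine (((cubicSeries2_hasDerivAt A B C (s ^ 2)).comp s (hsq s)).sub
        (saddleIntegral_mul_exp_hasDerivAt hs 0)).congr_deriv ?_
      have hp := saddleIntegral_by_parts hs (-1)
      norm_num at hp
      norm_num
      linear_combination (2 * s * Complex.exp (-(2 / 3 * s ^ 3))) * hp)
    (z₀ := 1) (z := σ) (by simp) hσ
    (by simp only [one_pow] at h0 ⊢; rw [e0, h0, sub_self])
    (by simp only [one_pow] at h1 ⊢; rw [e1, Complex.ofReal_neg, h1, neg_add_cancel])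
    (by simp only [one_pow] at h2 ⊢; rw [e2, h2, sub_self])
  exact ⟨sub_eq_zero.1 this.1, eq_neg_of_add_eq_zero_left this.2.1, sub_eq_zero.1 this.2.2⟩

end OrrSommerfeld

namespace OrrSommerfeld

open Set Filter Topology MeasureTheory

open scoped Real

/-! ### The second primitive of the Airy function on the half line -/

section DecayingSolution

/-- The power series with initial data `A, B, C` is `2π` times the second primitive of the Airy
function that decays at `+∞`. -/
def IsAiryPrimitive (A B C : ℝ) : Prop := ∀ σ : ℂ, 0 < σ.re →
    cubicSeries A B C (σ ^ 2) = Complex.exp (-(2 / 3 * σ ^ 3)) * saddleIntegral (-2) σ ∧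
    cubicSeries1 A B C (σ ^ 2) = -(Complex.exp (-(2 / 3 * σ ^ 3)) * saddleIntegral (-1) σ) ∧
    cubicSeries2 A B C (σ ^ 2) = Complex.exp (-(2 / 3 * σ ^ 3)) * saddleIntegral 0 σ

variable {A B C : ℝ}

lemma norm_exp_cube_mul_le {x : ℝ} (hx : 1 ≤ x) (k : ℕ) :
    ‖Complex.exp (-(2 / 3 * (√x : ℂ) ^ 3)) * saddleIntegral (-k) (√x : ℂ)‖
      ≤ √π * Real.exp (-(2 / 3 * x)) := by
  have h1 : 1 ≤ √x := Real.one_le_sqrt.2 hx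
  have h0 : 0 < ((√x : ℝ) : ℂ).re := by simpa using zero_lt_one.trans_le h1
  have hb := norm_saddleIntegral_neg_le h0 k
  rw [Complex.ofReal_re] at hb
  rw [norm_mul, mul_comm]
  gcongr
  · refine hb.trans ?_
    have h2 : 1 / √x ^ k ≤ 1 := by
      rw [div_le_one (by positivity)]
      exact one_le_pow₀ h1
    have h3 : √(π / √x) ≤ √π := Real.sqrt_le_sqrt (div_le_self Real.pi_pos.le h1)
    calc 1 / √x ^ k * √(π / √x) ≤ 1 * √π := by gcongr
      _ = _ := one_mul _
  · have h2 : -(2 / 3 * (√x : ℂ) ^ 3) = ((-(2 / 3 * √x ^ 3) : ℝ) : ℂ) := by push_cast; ring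
    rw [h2, Complex.norm_exp_ofReal]
    apply Real.exp_le_exp.2
    have h3 : √x ^ 2 = x := Real.sq_sqrt (by linarith)
    have : √x ^ 3 = x * √x := by rw [pow_succ, h3]
    nlinarith

lemma tendsto_poly_mul_exp_neg : Tendsto (fun x : ℝ => (x + 1) * (√π * Real.exp (-(2 / 3 * x))))
    atTop (𝓝 0) := by
  have h1 : Tendsto (fun x : ℝ => 2 / 3 * x) atTop atTop :=
    tendsto_id.const_mul_atTop (by norm_num)
  have h2 := ((Real.tendsto_pow_mul_exp_neg_atTop_nhds_zero 1).comp h1).const_mul (3 / 2 * √π)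
  have h3 := ((Real.tendsto_pow_mul_exp_neg_atTop_nhds_zero 0).comp h1).const_mul √π
  have h4 := h2.add h3
  simp only [mul_zero, add_zero] at h4
  refine h4.congr fun x => ?_
  simp only [Function.comp]
  ring

lemma neg_of_strictMonoOn_of_tendsto {f : ℝ → ℝ} (hf : StrictMonoOn f (Ici 0))
    (hl : Tendsto f atTop (𝓝 0)) {x : ℝ} (hx : 0 ≤ x) : f x < 0 := by
  have h1 : f x < f (x + 1) := hf hx (by simp only [mem_Ici]; linarith) (by linarith)
  refine h1.trans_le (ge_of_tendsto hl ?_)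
  filter_upwards [eventually_ge_atTop (x + 1)] with y hy
  exact hf.monotoneOn (by simp only [mem_Ici]; linarith) (by simp only [mem_Ici]; linarith) hy

lemma real_hasDerivAt {a b c : ℝ} (x : ℝ) :
    HasDerivAt (fun x : ℝ => (cubicSeries a b c x).re) (cubicSeries1 a b c x).re x ∧
    HasDerivAt (fun x : ℝ => (cubicSeries1 a b c x).re) (cubicSeries2 a b c x).re x ∧
    HasDerivAt (fun x : ℝ => (cubicSeries2 a b c x).re)
      (x * (cubicSeries1 a b c x).re - (cubicSeries a b c x).re) x := by
  refine ⟨(cubicSeries_hasDerivAt a b c x).real_of_complex,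
    (cubicSeries1_hasDerivAt a b c x).real_of_complex, ?_⟩
  refine (cubicSeries2_hasDerivAt a b c x).real_of_complex.congr_deriv ?_
  rw [Complex.sub_re, Complex.re_ofReal_mul]

/-- The second primitive of `Ai` is positive, decreasing and convex on the half line: the product
of `Ai` and its derivative is increasing with limit `0`, so neither has a zero. -/
lemma IsAiryPrimitive.sign (h : IsAiryPrimitive A B C) {x : ℝ} (hx : 0 ≤ x) :
    0 < (cubicSeries A B C x).re ∧ (cubicSeries1 A B C x).re < 0 ∧
      0 < (cubicSeries2 A B C x).re := by
  set u0 : ℝ → ℝ := fun x => (cubicSeries A B C x).re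
  set u1 : ℝ → ℝ := fun x => (cubicSeries1 A B C x).re
  set u2 : ℝ → ℝ := fun x => (cubicSeries2 A B C x).re
  set u3 : ℝ → ℝ := fun x => x * u1 x - u0 x
  have d0 : ∀ x, HasDerivAt u0 (u1 x) x := fun x => (real_hasDerivAt x).1
  have d1 : ∀ x, HasDerivAt u1 (u2 x) x := fun x => (real_hasDerivAt x).2.1
  have d2 : ∀ x, HasDerivAt u2 (u3 x) x := fun x => (real_hasDerivAt x).2.2
  have d3 : ∀ x, HasDerivAt u3 (x * u2 x) x := fun x => by
    refine (((hasDerivAt_id x).mul (d1 x)).sub (d0 x)).congr_deriv ?_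
    simp
  have key : ∀ x : ℝ, 1 ≤ x → |u0 x| ≤ √π * Real.exp (-(2 / 3 * x)) ∧
      |u1 x| ≤ √π * Real.exp (-(2 / 3 * x)) ∧ |u2 x| ≤ √π * Real.exp (-(2 / 3 * x)) := by
    intro x hx
    have hs : ((√x : ℝ) : ℂ) ^ 2 = (x : ℂ) := by
      rw [← Complex.ofReal_pow, Real.sq_sqrt (by linarith)]
    have h0 : 0 < ((√x : ℝ) : ℂ).re := by
      simpa using (by linarith : 0 < x)
    obtain ⟨e0, e1, e2⟩ := h _ h0
    rw [hs] at e0 e1 e2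
    refine ⟨?_, ?_, ?_⟩
    · refine (Complex.abs_re_le_norm _).trans ?_
      rw [e0]; exact_mod_cast norm_exp_cube_mul_le hx 2
    · refine (Complex.abs_re_le_norm _).trans ?_
      rw [e1, norm_neg]; exact_mod_cast norm_exp_cube_mul_le hx 1
    · refine (Complex.abs_re_le_norm _).trans ?_
      rw [e2]; exact_mod_cast norm_exp_cube_mul_le hx 0
  have hlim : ∀ v : ℝ → ℝ, (∀ x : ℝ, 1 ≤ x → |v x| ≤ (x + 1) * (√π * Real.exp (-(2 / 3 * x)))) →
      Tendsto v atTop (𝓝 0) := by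
    intro v hv
    refine squeeze_zero_norm' ?_ tendsto_poly_mul_exp_neg
    filter_upwards [eventually_ge_atTop 1] with x hx
    exact hv x hx
  have hle : ∀ x t : ℝ, 1 ≤ x → t ≤ √π * Real.exp (-(2 / 3 * x)) →
      t ≤ (x + 1) * (√π * Real.exp (-(2 / 3 * x))) := by
    intro x t hx ht
    have : 0 ≤ √π * Real.exp (-(2 / 3 * x)) := by positivity
    nlinarith
  have l0 : Tendsto u0 atTop (𝓝 0) := hlim _ fun x hx => hle x _ hx (key x hx).1
  have l1 : Tendsto u1 atTop (𝓝 0) := hlim _ fun x hx => hle x _ hx (key x hx).2.1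
  have l2 : Tendsto u2 atTop (𝓝 0) := hlim _ fun x hx => hle x _ hx (key x hx).2.2
  have l3 : Tendsto u3 atTop (𝓝 0) := hlim _ fun x hx => by
    obtain ⟨k0, k1, -⟩ := key x hx
    refine (abs_sub _ _).trans ?_
    rw [abs_mul, abs_of_nonneg (by linarith : 0 ≤ x)]
    nlinarith [abs_nonneg (u1 x)]
  -- positivity far out, from the Gauss integral
  have hpos : ∃ X : ℝ, 1 ≤ X ∧ ∀ x, X ≤ x → 0 < u2 x := by
    refine ⟨1, le_rfl, fun x hx => ?_⟩
    have h1 : 1 ≤ √x := Real.one_le_sqrt.2 hx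
    have hs : ((√x : ℝ) : ℂ) ^ 2 = (x : ℂ) := by
      rw [← Complex.ofReal_pow, Real.sq_sqrt (by linarith)]
    have h0 : 0 < ((√x : ℝ) : ℂ).re := by
      simpa using (by linarith : 0 < x)
    have e2 := (h _ h0).2.2
    have e3 : Complex.exp (-(2 / 3 * (√x : ℂ) ^ 3)) = ((Real.exp (-(2 / 3 * √x ^ 3)) : ℝ) : ℂ) := by
      push_cast
      rfl
    rw [hs, e3] at e2
    have e4 : u2 x = Real.exp (-(2 / 3 * √x ^ 3)) * (saddleIntegral 0 (√x : ℂ)).re := by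
      simp only [u2]
      rw [e2, Complex.re_ofReal_mul]
    rw [e4]
    refine mul_pos (Real.exp_pos _) ?_
    have hb := norm_saddleIntegral_zero_sub_le h0
    rw [Complex.ofReal_re] at hb
    have e5 : ((π : ℂ) / (√x : ℂ)) ^ (1 / 2 : ℂ) = ((√(π / √x) : ℝ) : ℂ) := by
      have e8 : 0 ≤ π / √x := by positivity
      rw [Real.sqrt_eq_rpow (π / √x), Complex.ofReal_cpow e8]
      push_cast
      rfl
    rw [e5] at hb
    have hb2 := (abs_le.1 ((Complex.abs_re_le_norm _).trans hb)).1
    rw [Complex.sub_re, Complex.ofReal_re] at hb2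
    have e6 : 0 < √(π / √x) := by
      have := Real.pi_pos
      positivity
    have e7 : 5 / (48 * √x ^ 3) ≤ 1 / 2 := by
      rw [div_le_div_iff₀ (by positivity) (by norm_num)]
      have := one_le_pow₀ h1 (n := 3)
      linarith
    nlinarith
  obtain ⟨X, hX1, hX⟩ := hpos
  set P : ℝ → ℝ := fun x => u2 x * u3 x
  have dP : ∀ x, HasDerivAt P (u3 x ^ 2 + x * u2 x ^ 2) x := fun x => by
    refine ((d2 x).mul (d3 x)).congr_deriv ?_
    ring
  have cP : Continuous P := continuous_iff_continuousAt.2 fun x => (dP x).continuousAt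
  have c2 : Continuous u2 := continuous_iff_continuousAt.2 fun x => (d2 x).continuousAt
  have mP : MonotoneOn P (Ici 0) := by
    refine monotoneOn_of_deriv_nonneg (convex_Ici 0) cP.continuousOn
      (fun x _ => (dP x).differentiableAt.differentiableWithinAt) fun x hx => ?_
    rw [interior_Ici] at hx
    rw [(dP x).deriv]
    have := mem_Ioi.1 hx
    positivity
  have lP : Tendsto P atTop (𝓝 0) := by simpa using l2.mul l3
  have hPle : ∀ x, 0 ≤ x → P x ≤ 0 := fun x hx => by
    refine ge_of_tendsto lP ?_
    filter_upwards [eventually_ge_atTop x] with y hy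
    exact mP hx (hx.trans hy) hy
  have hPlt : ∀ x, 0 ≤ x → P x < 0 := by
    intro x hx
    refine lt_of_le_of_ne (hPle x hx) fun h0 => ?_
    -- `P` vanishes beyond `x`, hence so does its derivative
    set y := max x X + 1
    have hyx : x < y := by have := le_max_left x X; simp only [y]; linarith
    have hyX : X ≤ y := by have := le_max_right x X; simp only [y]; linarith
    have hev : P =ᶠ[𝓝 y] fun _ => 0 := by
      filter_upwards [lt_mem_nhds hyx] with t ht
      exact le_antisymm (hPle t (hx.trans ht.le)) (h0 ▸ mP hx (hx.trans ht.le) ht.le)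
    have h1 := (dP y).unique ((hasDerivAt_const y (0 : ℝ)).congr_of_eventuallyEq hev)
    have h2 := hX y hyX
    have h3 : 0 < y := hx.trans_lt hyx
    have : 0 < y * u2 y ^ 2 := by positivity
    nlinarith [sq_nonneg (u3 y)]
  have p2 : ∀ x, 0 ≤ x → 0 < u2 x := by
    intro x hx
    by_contra hneg
    push Not at hneg
    set y := max x X
    have hy : 0 < u2 y := hX y (le_max_right _ _)
    obtain ⟨t, ht, ht0⟩ := intermediate_value_Icc (le_max_left x X) c2.continuousOn
      ⟨hneg, hy.le⟩
    have := hPlt t (hx.trans ht.1)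
    simp [P, ht0] at this
  have m1 : StrictMonoOn u1 (Ici 0) := by
    refine strictMonoOn_of_deriv_pos (convex_Ici 0)
      (fun x _ => (d1 x).continuousAt.continuousWithinAt) fun x hx => ?_
    rw [interior_Ici] at hx
    rw [(d1 x).deriv]
    exact p2 x (mem_Ioi.1 hx).le
  have p1 : ∀ x, 0 ≤ x → u1 x < 0 := fun x hx => neg_of_strictMonoOn_of_tendsto m1 l1 hx
  have m0 : StrictMonoOn (fun x => -u0 x) (Ici 0) := by
    refine strictMonoOn_of_deriv_pos (convex_Ici 0)
      (fun x _ => (d0 x).continuousAt.neg.continuousWithinAt) fun x hx => ?_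
    rw [interior_Ici] at hx
    have hd : HasDerivAt (fun x => -u0 x) (-u1 x) x := (d0 x).neg
    rw [hd.deriv]
    have := p1 x (mem_Ioi.1 hx).le
    linarith
  have p0 := neg_of_strictMonoOn_of_tendsto m0 (by simpa using l0.neg) hx
  exact ⟨by simpa using p0, p1 x hx, p2 x hx⟩

/-- The primitive cube root of unity `exp (2 π i / 3)`. -/
noncomputable def cubeRoot : ℂ := -1 / 2 + √3 / 2 * Complex.I

lemma sqrt_three_sq : ((√3 : ℝ) : ℂ) ^ 2 = 3 := by
  rw [← Complex.ofReal_pow, Real.sq_sqrt (by norm_num)]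
  norm_num

lemma cubeRoot_sq : cubeRoot ^ 2 = -1 / 2 - √3 / 2 * Complex.I := by
  rw [cubeRoot]
  linear_combination (Complex.I ^ 2 / 4) * sqrt_three_sq + (3 / 4) * Complex.I_sq

lemma cubeRoot_pow_three : cubeRoot ^ 3 = 1 := by
  have : cubeRoot ^ 3 = cubeRoot * cubeRoot ^ 2 := by ring
  rw [this, cubeRoot_sq, cubeRoot]
  linear_combination (-Complex.I ^ 2 / 4) * sqrt_three_sq - (3 / 4) * Complex.I_sq

lemma one_add_cubeRoot : 1 + cubeRoot + cubeRoot ^ 2 = 0 := by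
  rw [cubeRoot_sq, cubeRoot]; ring

/-- Comparison of the saddle point integrals with the Gauss integral, close to the real axis. -/
lemma saddleIntegral_gauss_bounds {σ : ℂ} {ρ : ℝ} (hρ : 1 ≤ ρ) (hσn : ‖σ‖ = ρ)
    (hρ1 : 0.85 * ρ ≤ σ.re) : |‖saddleIntegral 0 σ‖ ^ 2 - π / ρ| ≤ 5 / ρ ^ 2 ∧
      ‖saddleIntegral 1 σ - σ * saddleIntegral 0 σ‖ * ‖saddleIntegral 0 σ‖ ≤ 3 / ρ ^ 2 := by
  have hρ0 : 0 < ρ := by linarith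
  have hσpos : 0 < σ.re := by nlinarith
  have hπ := Real.pi_pos
  have hπ4 := Real.pi_lt_d2
  set X := saddleIntegral 0 σ
  set Z := saddleIntegral 1 σ
  set s := √ρ with hs
  have hs1 : 1 ≤ s := Real.one_le_sqrt.2 hρ
  have hs2 : s ^ 2 = ρ := Real.sq_sqrt hρ0.le
  have hq : √(π / σ.re) ≤ 2 / s := by
    apply Real.sqrt_le_iff.2
    refine ⟨by positivity, ?_⟩
    rw [div_pow, div_le_div_iff₀ (by positivity) (by positivity), hs2]
    nlinarith
  have hG : ‖(π / σ) ^ (1 / 2 : ℂ)‖ ^ 2 = π / ρ := by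
    rw [← norm_pow, ← Complex.cpow_nat_mul]
    norm_num
    rw [hσn, abs_of_pos hπ]
  have hr := norm_saddleIntegral_zero_sub_le hσpos
  have hz := norm_saddleIntegral_one_sub_le hσpos
  have hr' : ‖X - (π / σ) ^ (1 / 2 : ℂ)‖ ≤ 1 / (ρ * s) := by
    refine hr.trans ?_
    have h1 : 5 / (48 * σ.re ^ 3) ≤ 1 / (2 * ρ) := by
      rw [div_le_div_iff₀ (by positivity) (by positivity)]
      have h2 : (0.85 * ρ) ^ 3 ≤ σ.re ^ 3 := by gcongr
      have h3 : ρ ≤ ρ ^ 3 := le_self_pow₀ hρ (by norm_num)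
      nlinarith
    calc 5 / (48 * σ.re ^ 3) * √(π / σ.re) ≤ 1 / (2 * ρ) * (2 / s) := by gcongr
      _ = _ := by field_simp
  have hz' : ‖Z - σ * X‖ ≤ 1 / (ρ * s) := by
    refine hz.trans ?_
    have h1 : 1 / (4 * ‖σ‖ * σ.re) ≤ 1 / (2 * ρ) := by
      rw [hσn]
      refine one_div_le_one_div_of_le (by positivity) ?_
      nlinarith
    calc 1 / (4 * ‖σ‖ * σ.re) * √(π / σ.re) ≤ 1 / (2 * ρ) * (2 / s) := by gcongr
      _ = _ := by field_simp
  set G := (π / σ) ^ (1 / 2 : ℂ)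
  have hGn : ‖G‖ ≤ 2 / s := by
    refine (sq_le_sq₀ (norm_nonneg _) (by positivity)).1 ?_
    rw [hG, div_pow, hs2]
    gcongr
    linarith
  have hρs : 1 / (ρ * s) ≤ 1 / s := by
    refine one_div_le_one_div_of_le (by positivity) ?_
    nlinarith
  have hXn : ‖X‖ ≤ 3 / s := by
    have := norm_add_le (X - G) G
    rw [sub_add_cancel] at this
    calc ‖X‖ ≤ 1 / s + 2 / s := by linarith
      _ = 3 / s := by ring
  have hdiff : |‖X‖ ^ 2 - π / ρ| ≤ 1 / (ρ * s) * (5 / s) := by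
    rw [← hG]
    have h1 := abs_norm_sub_norm_le X G
    have h2 : ‖X‖ ^ 2 - ‖G‖ ^ 2 = (‖X‖ - ‖G‖) * (‖X‖ + ‖G‖) := by ring
    rw [h2, abs_mul, abs_of_nonneg (by positivity : 0 ≤ ‖X‖ + ‖G‖)]
    have h3 : ‖X‖ + ‖G‖ ≤ 5 / s := by
      calc ‖X‖ + ‖G‖ ≤ 3 / s + 2 / s := by linarith
        _ = _ := by ring
    gcongr
    exact h1.trans hr'
  refine ⟨hdiff.trans (le_of_eq ?_), ?_⟩
  · rw [← hs2]; field_simp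
  · calc ‖Z - σ * X‖ * ‖X‖ ≤ 1 / (ρ * s) * (3 / s) := by gcongr
      _ = 3 / ρ ^ 2 := by rw [← hs2]; field_simp

/-- The Wronskian of `Ai z` and `Ai (ω z)`, computed at `0` and at infinity. -/
lemma IsAiryPrimitive.mul_eq (h : IsAiryPrimitive A B C) : A * C = 2 * π / √3 := by
  set ψ : ℂ → ℂ := cubicSeries2 A B C
  set ψ' : ℂ → ℂ := fun z => z * cubicSeries1 A B C z - cubicSeries A B C z
  have dψ : ∀ z, HasDerivAt ψ (ψ' z) z := fun z => cubicSeries2_hasDerivAt A B C z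
  have dψ' : ∀ z, HasDerivAt ψ' (z * ψ z) z := fun z => by
    refine (((hasDerivAt_id z).mul (cubicSeries1_hasDerivAt A B C z)).sub
      (cubicSeries_hasDerivAt A B C z)).congr_deriv ?_
    simp [ψ]
  set W : ℂ → ℂ := fun z => ψ z * (cubeRoot * ψ' (cubeRoot * z)) - ψ' z * ψ (cubeRoot * z)
  have dW : ∀ z, HasDerivAt W 0 z := fun z => by
    have hm : HasDerivAt (fun z => cubeRoot * z) cubeRoot z := by
      simpa using (hasDerivAt_id z).const_mul cubeRoot
    refine (((dψ z).mul (((dψ' (cubeRoot * z)).comp z hm).const_mul cubeRoot)).sub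
      ((dψ' z).mul ((dψ (cubeRoot * z)).comp z hm))).congr_deriv ?_
    simp only [Function.comp]
    linear_combination (ψ z * z * ψ (cubeRoot * z)) * cubeRoot_pow_three
  have hW : ∀ z, W z = W 0 := fun z => is_const_of_deriv_eq_zero
    (fun z => (dW z).differentiableAt) (fun z => (dW z).deriv) z 0
  have hW0 : W 0 = A * C * (1 - cubeRoot) := by
    simp only [W, ψ, ψ', mul_zero, zero_mul, cubicSeries2_zero, cubicSeries_zero]
    ring
  set e : ℂ := √3 / 2 - Complex.I / 2 with he
  have hconj : starRingEnd ℂ e = √3 / 2 + Complex.I / 2 := by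
    simp only [e, map_sub, map_div₀, Complex.conj_ofReal, Complex.conj_I, map_ofNat]
    ring
  have he1 : 1 - cubeRoot = √3 * e := by
    rw [cubeRoot, he]
    linear_combination (-1 / 2 : ℂ) * sqrt_three_sq
  have he3 : e ^ 3 = -Complex.I := by
    rw [he]
    linear_combination (√3 / 8 - 3 * Complex.I / 8) * sqrt_three_sq
      + (3 * √3 / 8 - Complex.I / 8) * Complex.I_sq
  have hce : starRingEnd ℂ e ^ 2 = cubeRoot * e ^ 2 := by
    rw [hconj, cubeRoot, he]
    linear_combination (3 / 8 + Complex.I * (-√3 / 8 + Complex.I / 4)) * sqrt_three_sq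
      + (9 / 8 - √3 * Complex.I / 8) * Complex.I_sq
  have hce2 : cubeRoot * starRingEnd ℂ e = -e := by
    rw [hconj, cubeRoot, he]
    linear_combination (Complex.I / 4) * sqrt_three_sq + (√3 / 4) * Complex.I_sq
  have hne : ‖e‖ = 1 := by
    have : ‖e‖ ^ 3 = 1 := by rw [← norm_pow, he3]; simp
    exact (pow_eq_one_iff_of_nonneg (norm_nonneg e) (by norm_num)).1 this
  have hre : e.re = √3 / 2 := by
    have : e = ((√3 / 2 : ℝ) : ℂ) + ((-1 / 2 : ℝ) : ℂ) * Complex.I := by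
      rw [he]; push_cast; ring
    rw [this]
    simp
  have hs3 : (√3 : ℝ) ^ 2 = 3 := Real.sq_sqrt (by norm_num)
  have hs3lo : 1.7 ≤ √3 := Real.le_sqrt_of_sq_le (by norm_num)
  have hπ := Real.pi_pos
  have hπ4 := Real.pi_lt_d2
  -- comparison with the Gauss integral at distance `ρ`
  have hmain : ∀ ρ : ℝ, 1 ≤ ρ → |√3 * (A * C) - 2 * π| ≤ 40 / ρ := by
    intro ρ hρ
    have hρ0 : 0 < ρ := by linarith
    set σ : ℂ := ρ * e with hσ
    have hσre : σ.re = ρ * (√3 / 2) := by rw [hσ, Complex.re_ofReal_mul, hre]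
    have hσpos : 0 < σ.re := by rw [hσre]; positivity
    have hσn : ‖σ‖ = ρ := by rw [hσ, norm_mul, hne, Complex.norm_of_nonneg hρ0.le, mul_one]
    have hσc : starRingEnd ℂ σ = ρ * starRingEnd ℂ e := by rw [hσ, map_mul, Complex.conj_ofReal]
    have hσcpos : 0 < (starRingEnd ℂ σ).re := by rwa [Complex.conj_re]
    have hsq : cubeRoot * σ ^ 2 = starRingEnd ℂ σ ^ 2 := by
      rw [hσc, mul_pow _ (starRingEnd ℂ e), hce, hσ]; ring
    set X := saddleIntegral 0 σ
    set Z := saddleIntegral 1 σ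
    have hX' : saddleIntegral 0 (starRingEnd ℂ σ) = starRingEnd ℂ X := saddleIntegral_conj 0 σ
    have hZ' : saddleIntegral 1 (starRingEnd ℂ σ) = starRingEnd ℂ Z := saddleIntegral_conj 1 σ
    have hψ' : ∀ s : ℂ, 0 < s.re → ψ' (s ^ 2) =
        -(Complex.exp (-(2 / 3 * s ^ 3)) * saddleIntegral 1 s) := by
      intro s hs
      obtain ⟨e0, e1, -⟩ := h s hs
      have hp := saddleIntegral_by_parts hs (-1)
      norm_num at hp
      simp only [ψ']
      rw [e0, e1]
      linear_combination (Complex.exp (-(2 / 3 * s ^ 3))) * hp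
    have hE : Complex.exp (-(2 / 3 * σ ^ 3)) * Complex.exp (-(2 / 3 * starRingEnd ℂ σ ^ 3)) = 1 := by
      rw [← Complex.exp_add, ← Complex.exp_zero]
      congr 1
      have h1 : σ ^ 3 = -(ρ ^ 3 * Complex.I) := by rw [hσ, mul_pow, he3]; ring
      have h2 : starRingEnd ℂ σ ^ 3 = ρ ^ 3 * Complex.I := by
        rw [← map_pow, h1]
        simp
      rw [h1, h2]; ring
    have hWσ : W (σ ^ 2) = Z * starRingEnd ℂ X - cubeRoot * (X * starRingEnd ℂ Z) := by
      simp only [W]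
      rw [hsq, hψ' σ hσpos, hψ' _ hσcpos]
      simp only [ψ]
      rw [(h σ hσpos).2.2, (h _ hσcpos).2.2, hX', hZ']
      linear_combination (Z * starRingEnd ℂ X - cubeRoot * (X * starRingEnd ℂ Z)) * hE
    have hXX : X * starRingEnd ℂ X = ((‖X‖ ^ 2 : ℝ) : ℂ) := by
      rw [Complex.mul_conj, Complex.normSq_eq_norm_sq]
    have hid : (√3 * (A * C) - 2 * ρ * ‖X‖ ^ 2 : ℝ) * e =
        (Z - σ * X) * starRingEnd ℂ X - cubeRoot * (X * starRingEnd ℂ (Z - σ * X)) := by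
      have h1 := hW (σ ^ 2)
      rw [hWσ, hW0, he1] at h1
      rw [map_sub, map_mul, hσc]
      push_cast at hXX ⊢
      rw [hσ]
      linear_combination -h1 + (2 * ρ * e) * hXX
        - (ρ * X * starRingEnd ℂ X) * hce2
    have hcr : ‖cubeRoot‖ = 1 := by
      have : ‖cubeRoot‖ ^ 3 = 1 := by rw [← norm_pow, cubeRoot_pow_three, norm_one]
      exact (pow_eq_one_iff_of_nonneg (norm_nonneg _) (by norm_num)).1 this
    have hb1 : |√3 * (A * C) - 2 * ρ * ‖X‖ ^ 2| ≤ 2 * (‖Z - σ * X‖ * ‖X‖) := by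
      have := congrArg norm hid
      rw [norm_mul, hne, mul_one, Complex.norm_real, Real.norm_eq_abs] at this
      rw [this]
      refine (norm_sub_le _ _).trans (le_of_eq ?_)
      rw [norm_mul, norm_mul, norm_mul, hcr, Complex.norm_conj, Complex.norm_conj]
      ring
    obtain ⟨hdiff, hz'⟩ := saddleIntegral_gauss_bounds hρ hσn (by rw [hσre]; nlinarith)
    have hsplit : √3 * (A * C) - 2 * π = (√3 * (A * C) - 2 * ρ * ‖X‖ ^ 2) +
        2 * ρ * (‖X‖ ^ 2 - π / ρ) := by field_simp; ring
    rw [hsplit]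
    refine (abs_add_le _ _).trans ?_
    rw [abs_mul, abs_of_nonneg (by positivity : 0 ≤ 2 * ρ)]
    calc |√3 * (A * C) - 2 * ρ * ‖X‖ ^ 2| + 2 * ρ * |‖X‖ ^ 2 - π / ρ|
        ≤ 2 * (3 / ρ ^ 2) + 2 * ρ * (5 / ρ ^ 2) :=
          add_le_add (hb1.trans (by linarith)) (mul_le_mul_of_nonneg_left hdiff (by positivity))
      _ = 6 / ρ ^ 2 + 10 / ρ := by field_simp; ring
      _ ≤ 6 / ρ + 10 / ρ := by
          gcongr
          exact le_self_pow₀ hρ (by norm_num)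
      _ ≤ 40 / ρ := by rw [← add_div]; gcongr; norm_num
  have hlim : Tendsto (fun ρ : ℝ => 40 / ρ) atTop (𝓝 0) := tendsto_const_nhds.div_atTop tendsto_id
  have h0 : |√3 * (A * C) - 2 * π| ≤ 0 := by
    refine ge_of_tendsto hlim ?_
    filter_upwards [eventually_ge_atTop 1] with ρ hρ
    exact hmain ρ hρ
  have h1 := abs_nonpos_iff.1 h0
  field_simp
  linarith

/-- The sum of the three rotated solutions is a linear function. -/
lemma cubicSeries_connection (a b c z : ℂ) :
    cubicSeries a b c z + cubeRoot * cubicSeries a b c (cubeRoot ^ 2 * z) +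
      cubeRoot ^ 2 * cubicSeries a b c (cubeRoot * z) = 3 * b * z := by
  have hw := cubeRoot_pow_three
  have hm : ∀ w z : ℂ, HasDerivAt (fun z => w * z) w z := fun w z => by
    simpa using (hasDerivAt_id z).const_mul w
  have h := cubic_unique convex_univ (k := fun _ => 1) (w := fun z => z) (by fun_prop)
    (by fun_prop)
    (f0 := fun z => cubicSeries a b c z + cubeRoot * cubicSeries a b c (cubeRoot ^ 2 * z) +
      cubeRoot ^ 2 * cubicSeries a b c (cubeRoot * z) - 3 * b * z)
    (f1 := fun z => cubicSeries1 a b c z + cubicSeries1 a b c (cubeRoot ^ 2 * z) +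
      cubicSeries1 a b c (cubeRoot * z) - 3 * b)
    (f2 := fun z => cubicSeries2 a b c z + cubeRoot ^ 2 * cubicSeries2 a b c (cubeRoot ^ 2 * z) +
      cubeRoot * cubicSeries2 a b c (cubeRoot * z))
    (fun z _ => by
      refine ((((cubicSeries_hasDerivAt a b c z).add
        (((cubicSeries_hasDerivAt a b c (cubeRoot ^ 2 * z)).comp z (hm _ z)).const_mul
          cubeRoot)).add
        (((cubicSeries_hasDerivAt a b c (cubeRoot * z)).comp z (hm _ z)).const_mul
          (cubeRoot ^ 2))).sub (hm (3 * b) z)).congr_deriv ?_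
      linear_combination (cubicSeries1 a b c (cubeRoot ^ 2 * z) +
        cubicSeries1 a b c (cubeRoot * z)) * hw)
    (fun z _ => by
      refine ((((cubicSeries1_hasDerivAt a b c z).add
        (((cubicSeries1_hasDerivAt a b c (cubeRoot ^ 2 * z)).comp z (hm _ z)))).add
        (((cubicSeries1_hasDerivAt a b c (cubeRoot * z)).comp z (hm _ z)))).sub_const
          (3 * b)).congr_deriv ?_
      ring)
    (fun z _ => by
      refine (((cubicSeries2_hasDerivAt a b c z).add
        (((cubicSeries2_hasDerivAt a b c (cubeRoot ^ 2 * z)).comp z (hm _ z)).const_mul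
          (cubeRoot ^ 2))).add
        (((cubicSeries2_hasDerivAt a b c (cubeRoot * z)).comp z (hm _ z)).const_mul
          cubeRoot)).congr_deriv ?_
      linear_combination (z * cubicSeries1 a b c (cubeRoot ^ 2 * z) * cubeRoot ^ 3
        + z * cubicSeries1 a b c (cubeRoot ^ 2 * z)
        - cubeRoot * cubicSeries a b c (cubeRoot ^ 2 * z)
        + z * cubicSeries1 a b c (cubeRoot * z)) * hw)
    (z₀ := 0) (z := z) (mem_univ _) (mem_univ _)
    (by
      simp only [mul_zero, cubicSeries_zero]
      linear_combination a * one_add_cubeRoot)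
    (by
      simp only [mul_zero, cubicSeries1_zero]
      ring)
    (by
      simp only [mul_zero, cubicSeries2_zero]
      linear_combination c * one_add_cubeRoot)
  exact sub_eq_zero.1 h.1

end DecayingSolution

end OrrSommerfeld

namespace OrrSommerfeld

open Set Filter Topology MeasureTheory

open scoped Real

/-! ### Rational evaluation of the power series -/

section Numerics

/-- The `k` coefficients from the `n`-th on of a series `cubicSeries`, given the first three of
them. -/
def coeffList : ℕ → ℕ → ℚ → ℚ → ℚ → List ℚ
  | 0, _, _, _, _ => []
  | k + 1, n, a, b, c =>
    a :: coeffList k (n + 1) b c (((n : ℚ) - 1) / ((n + 3) * (n + 2) * (n + 1)) * a)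

/-- The value of a polynomial, by Horner's scheme. -/
noncomputable def listEval (z : ℂ) : List ℚ → ℂ
  | [] => 0
  | c :: cs => c + z * listEval z cs

/-- The derivative of a polynomial, by Horner's scheme. -/
noncomputable def listDeriv (z : ℂ) : List ℚ → ℂ
  | [] => 0
  | _ :: cs => listEval z cs + z * listDeriv z cs

/-- The value at `r` of the polynomial with the absolute values of the given coefficients. -/
def listMaj (r : ℚ) : List ℚ → ℚ
  | [] => 0
  | c :: cs => |c| + r * listMaj r cs

/-- The value at `r` of a majorant and of its first two derivatives. -/
def listMaj2 (r : ℚ) : List ℚ → ℚ × ℚ × ℚ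
  | [] => (0, 0, 0)
  | c :: cs =>
    let m := listMaj2 r cs
    (|c| + r * m.1, m.1 + r * m.2.1, 2 * m.2.1 + r * m.2.2)

/-- Value and derivative of a polynomial at `x + i y`, as pairs of rational numbers. -/
def listPair (x y : ℚ) : List ℚ → (ℚ × ℚ) × (ℚ × ℚ)
  | [] => ((0, 0), (0, 0))
  | c :: cs =>
    let p := listPair x y cs
    ((c + (x * p.1.1 - y * p.1.2), x * p.1.2 + y * p.1.1),
      (p.1.1 + (x * p.2.1 - y * p.2.2), p.1.2 + (x * p.2.2 + y * p.2.1)))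

lemma listEval_listPair (x y : ℚ) (L : List ℚ) :
    listEval (x + y * Complex.I) L = (listPair x y L).1.1 + (listPair x y L).1.2 * Complex.I := by
  induction L with
  | nil => simp [listEval, listPair]
  | cons c cs ih =>
    rw [listEval, ih, listPair]
    push_cast
    linear_combination (y * (listPair x y cs).1.2 : ℂ) * Complex.I_sq

lemma listDeriv_listPair (x y : ℚ) (L : List ℚ) :
    listDeriv (x + y * Complex.I) L = (listPair x y L).2.1 + (listPair x y L).2.2 * Complex.I := by
  induction L with
  | nil => simp [listDeriv, listPair]
  | cons c cs ih =>
    rw [listDeriv, ih, listEval_listPair, listPair]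
    push_cast
    linear_combination (y * (listPair x y cs).2.2 : ℂ) * Complex.I_sq

/-- The first and second order Taylor estimates of a polynomial. -/
lemma listEval_taylor {r : ℚ} {z w : ℂ} (hz : ‖z‖ ≤ r) (hw : ‖w‖ ≤ r) (L : List ℚ) :
    ‖listEval z L‖ ≤ (listMaj2 r L).1 ∧
    ‖listEval z L - listEval w L‖ ≤ ‖z - w‖ * (listMaj2 r L).2.1 ∧
    ‖listEval z L - listEval w L - (z - w) * listDeriv w L‖ ≤
      ‖z - w‖ ^ 2 / 2 * (listMaj2 r L).2.2 := by
  have hr : (0 : ℝ) ≤ r := (norm_nonneg z).trans hz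
  induction L with
  | nil => simp [listEval, listDeriv, listMaj2]
  | cons c cs ih =>
    obtain ⟨h0, h1, h2⟩ := ih
    have h0' : (0 : ℝ) ≤ (listMaj2 r cs).1 := (norm_nonneg _).trans h0
    simp only [listEval, listDeriv, listMaj2]
    push_cast
    refine ⟨?_, ?_, ?_⟩
    · refine (norm_add_le _ _).trans ?_
      rw [norm_mul]
      have : ‖(c : ℂ)‖ = |(c : ℝ)| := by
        have := Complex.norm_real (c : ℝ)
        rwa [Complex.ofReal_ratCast, Real.norm_eq_abs] at this
      rw [this]
      gcongr
    · have e : (c + z * listEval z cs) - (c + w * listEval w cs) =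
          (z - w) * listEval z cs + w * (listEval z cs - listEval w cs) := by ring
      rw [e]
      refine (norm_add_le _ _).trans ?_
      rw [norm_mul, norm_mul]
      calc ‖z - w‖ * ‖listEval z cs‖ + ‖w‖ * ‖listEval z cs - listEval w cs‖
          ≤ ‖z - w‖ * (listMaj2 r cs).1 + r * (‖z - w‖ * (listMaj2 r cs).2.1) := by gcongr
        _ = _ := by ring
    · have e : (c + z * listEval z cs) - (c + w * listEval w cs) -
          (z - w) * (listEval w cs + w * listDeriv w cs) =
          w * (listEval z cs - listEval w cs - (z - w) * listDeriv w cs) +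
          (z - w) * (listEval z cs - listEval w cs) := by ring
      rw [e]
      refine (norm_add_le _ _).trans ?_
      rw [norm_mul, norm_mul]
      calc ‖w‖ * ‖listEval z cs - listEval w cs - (z - w) * listDeriv w cs‖ +
            ‖z - w‖ * ‖listEval z cs - listEval w cs‖
          ≤ r * (‖z - w‖ ^ 2 / 2 * (listMaj2 r cs).2.2) +
            ‖z - w‖ * (‖z - w‖ * (listMaj2 r cs).2.1) := by gcongr
        _ = _ := by ring

lemma listMaj2_nonneg {r : ℚ} (hr : 0 ≤ r) (L : List ℚ) :
    0 ≤ (listMaj2 r L).1 ∧ 0 ≤ (listMaj2 r L).2.1 ∧ 0 ≤ (listMaj2 r L).2.2 := by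
  induction L with
  | nil => simp [listMaj2]
  | cons c cs ih =>
    obtain ⟨h0, h1, h2⟩ := ih
    simp only [listMaj2]
    refine ⟨?_, ?_, ?_⟩ <;> positivity

lemma listEval_coeffList {a b c : ℂ} (z : ℂ) (k n : ℕ) (p q s : ℚ) (hp : cubicCoeff a b c n = p)
    (hq : cubicCoeff a b c (n + 1) = q) (hs : cubicCoeff a b c (n + 2) = s) :
    listEval z (coeffList k n p q s) = ∑ i ∈ Finset.range k, cubicCoeff a b c (n + i) * z ^ i := by
  induction k generalizing n p q s with
  | zero => simp [coeffList, listEval]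
  | succ k ih =>
    rw [coeffList, listEval, ih (n + 1) _ _ _ hq hs (by
      rw [show n + 1 + 2 = n + 3 by ring, cubicCoeff, hp]; push_cast; ring),
      Finset.sum_range_succ', Finset.mul_sum, add_comm]
    simp only [add_zero, pow_zero, mul_one, hp]
    congr 1
    refine Finset.sum_congr rfl fun i _ => ?_
    rw [show n + 1 + i = n + (i + 1) by ring]
    ring

lemma listMaj_coeffList {a b c : ℂ} (r : ℚ) (k n : ℕ) (p q s : ℚ) (hp : cubicCoeff a b c n = p)
    (hq : cubicCoeff a b c (n + 1) = q) (hs : cubicCoeff a b c (n + 2) = s) :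
    (listMaj r (coeffList k n p q s) : ℝ) =
      ∑ i ∈ Finset.range k, ‖cubicCoeff a b c (n + i)‖ * (r : ℝ) ^ i := by
  induction k generalizing n p q s with
  | zero => simp [coeffList, listMaj]
  | succ k ih =>
    have hn : ‖(p : ℂ)‖ = |(p : ℝ)| := by
      have := Complex.norm_real (p : ℝ)
      rwa [Complex.ofReal_ratCast, Real.norm_eq_abs] at this
    rw [coeffList, listMaj, Finset.sum_range_succ']
    push_cast
    rw [ih (n + 1) _ _ _ hq hs (by
      rw [show n + 1 + 2 = n + 3 by ring, cubicCoeff, hp]; push_cast; ring), Finset.mul_sum,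
      add_comm]
    simp only [add_zero, pow_zero, mul_one, hp, hn]
    congr 1
    refine Finset.sum_congr rfl fun i _ => ?_
    rw [show n + 1 + i = n + (i + 1) by ring]
    ring

lemma norm_tsum_le_of_halving {u : ℕ → ℝ} (hs : Summable u) (h : ∀ n, u (n + 3) ≤ u n / 2) :
    ∑' n, u n ≤ 2 * (u 0 + u 1 + u 2) := by
  have h1 := hs.sum_add_tsum_nat_add 3
  have h2 : ∑' n, u (n + 3) ≤ (∑' n, u n) / 2 := by
    rw [← tsum_div_const]
    exact ((summable_nat_add_iff 3).2 hs).tsum_le_tsum h (hs.div_const 2)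
  simp only [Finset.sum_range_succ, Finset.sum_range_zero, zero_add] at h1
  linarith

/-- Truncation of the power series. -/
lemma norm_cubicSeries_sub_listEval_le (a b c r : ℚ) (N : ℕ) (hr : 2 * r ^ 3 ≤ (N + 1) * (N + 1))
    {z : ℂ} (hz : ‖z‖ ≤ r) :
    ‖cubicSeries a b c z - listEval z (coeffList N 0 a b (c / 2))‖ ≤
      ((2 * (listMaj r (coeffList (N + 3) 0 a b (c / 2)) -
        listMaj r (coeffList N 0 a b (c / 2))) : ℚ) : ℝ) := by
  have hr0 : (0 : ℝ) ≤ r := (norm_nonneg z).trans hz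
  have e0 : cubicCoeff a b c 0 = a := by rw [cubicCoeff]
  have e1 : cubicCoeff a b c (0 + 1) = b := by rw [zero_add, cubicCoeff]
  have e2 : cubicCoeff a b c (0 + 2) = ((c / 2 : ℚ) : ℂ) := by
    rw [zero_add, cubicCoeff]; push_cast; rfl
  rw [listEval_coeffList z N 0 a b (c / 2) e0 e1 e2]
  push_cast
  rw [listMaj_coeffList r (N + 3) 0 a b (c / 2) e0 e1 e2,
    listMaj_coeffList r N 0 a b (c / 2) e0 e1 e2]
  simp only [zero_add, Finset.sum_range_succ]
  have hd := cubicCoeff_rapidDecay a b c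
  rw [cubicSeries, powSum, ← (hd.summable' z).sum_add_tsum_nat_add N, add_sub_cancel_left]
  set u : ℕ → ℝ := fun n => ‖cubicCoeff a b c (n + N)‖ * (r : ℝ) ^ (n + N)
  have hu : Summable u := (summable_nat_add_iff N).2 (hd.summable r hr0)
  have h1 : ‖∑' n, cubicCoeff a b c (n + N) * z ^ (n + N)‖ ≤ ∑' n, u n := by
    refine tsum_of_norm_bounded hu.hasSum fun n => ?_
    rw [norm_mul, norm_pow]
    simp only [u]
    gcongr
  have h2 := norm_tsum_le_of_halving hu (fun n => by
    have h3 := norm_cubicCoeff_le a b c (n + N)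
    simp only [u]
    rw [show n + 3 + N = n + N + 3 by ring, pow_add]
    have hr' : 2 * (r : ℝ) ^ 3 ≤ (N + 1) * (N + 1) := by exact_mod_cast hr
    have hn : (0 : ℝ) ≤ n := n.cast_nonneg
    have hN : (0 : ℝ) ≤ N := N.cast_nonneg
    push_cast at h3
    calc ‖cubicCoeff a b c (n + N + 3)‖ * ((r : ℝ) ^ (n + N) * r ^ 3)
        ≤ ‖cubicCoeff a b c (n + N)‖ / ((n + N + 1) * (n + N + 1)) *
          ((r : ℝ) ^ (n + N) * r ^ 3) := by gcongr
      _ = ‖cubicCoeff a b c (n + N)‖ * (r : ℝ) ^ (n + N) *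
          (r ^ 3 / ((n + N + 1) * (n + N + 1))) := by ring
      _ ≤ ‖cubicCoeff a b c (n + N)‖ * (r : ℝ) ^ (n + N) * (1 / 2) := by
          refine mul_le_mul_of_nonneg_left ?_ (by positivity)
          rw [div_le_div_iff₀ (by positivity) (by norm_num)]
          nlinarith [mul_nonneg hn hN, mul_nonneg hn hn]
      _ = _ := by ring)
  simp only [u, zero_add, Nat.add_comm 1 N, Nat.add_comm 2 N] at h2
  linarith

lemma cubicSeries_real_approx (a b c x v η : ℚ) (N : ℕ) (hr : 2 * |x| ^ 3 ≤ (N + 1) * (N + 1))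
    (hv : |(listPair x 0 (coeffList N 0 a b (c / 2))).1.1 - v| +
      2 * (listMaj |x| (coeffList (N + 3) 0 a b (c / 2)) -
        listMaj |x| (coeffList N 0 a b (c / 2))) ≤ η) :
    |(cubicSeries a b c (x : ℝ)).re - v| ≤ η := by
  have hx : ‖((x : ℝ) : ℂ)‖ ≤ (|x| : ℚ) := by
    rw [Complex.norm_real, Real.norm_eq_abs]; push_cast; rfl
  have h1 := norm_cubicSeries_sub_listEval_le a b c |x| N hr hx
  have h2 := listEval_listPair x 0 (coeffList N 0 a b (c / 2))
  have e : (x : ℂ) + ((0 : ℚ) : ℂ) * Complex.I = ((x : ℝ) : ℂ) := by push_cast; ring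
  rw [e] at h2
  set P := listPair x 0 (coeffList N 0 a b (c / 2))
  have h3 : (listEval ((x : ℝ) : ℂ) (coeffList N 0 a b (c / 2))).re = P.1.1 := by
    rw [h2]
    have : ((P.1.1 : ℚ) : ℂ) + ((P.1.2 : ℚ) : ℂ) * Complex.I =
      ((P.1.1 : ℝ) : ℂ) + ((P.1.2 : ℝ) : ℂ) * Complex.I := by push_cast; rfl
    rw [this]
    simp
  have h4 := (Complex.abs_re_le_norm _).trans h1
  rw [Complex.sub_re, h3] at h4
  have hv' : |(P.1.1 : ℝ) - v| + ((2 * (listMaj |x| (coeffList (N + 3) 0 a b (c / 2)) -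
        listMaj |x| (coeffList N 0 a b (c / 2))) : ℚ) : ℝ) ≤ η := by exact_mod_cast hv
  have h5 := abs_add_le ((cubicSeries a b c (x : ℝ)).re - P.1.1) ((P.1.1 : ℝ) - v)
  rw [sub_add_sub_cancel] at h5
  linarith

end Numerics

lemma cubicSeries_linear_solution (z : ℂ) : cubicSeries 0 1 0 z = z := by
  have := cubic_unique convex_univ (k := fun _ => 1) (w := fun z => z) (by fun_prop)
    (by fun_prop)
    (f0 := fun z => cubicSeries 0 1 0 z - z) (f1 := fun z => cubicSeries1 0 1 0 z - 1)
    (f2 := cubicSeries2 0 1 0)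
    (fun z _ => ((cubicSeries_hasDerivAt 0 1 0 z).sub (hasDerivAt_id z)).congr_deriv (by simp))
    (fun z _ => ((cubicSeries1_hasDerivAt 0 1 0 z).sub_const 1).congr_deriv (by simp))
    (fun z _ => (cubicSeries2_hasDerivAt 0 1 0 z).congr_deriv (by ring))
    (z₀ := 0) (z := z) (mem_univ _) (mem_univ _) (by simp [cubicSeries_zero])
    (by simp [cubicSeries1_zero]) (by simp [cubicSeries2_zero])
  exact sub_eq_zero.1 this.1

/-- Positivity, monotonicity and convexity at the points `3, 4, 5` determine the ratios of the
initial data. -/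
lemma IsAiryPrimitive.ratio {A B C : ℝ} (h : IsAiryPrimitive A B C) : 0 < A ∧
    |B / A + 1.2846| ≤ 0.0036 ∧ |C / A - 1.3717| ≤ 0.0001 := by
  have hA : 0 < A := by
    have := (h.sign le_rfl).1
    rwa [Complex.ofReal_zero, cubicSeries_zero, Complex.ofReal_re] at this
  have hlin : ∀ x : ℝ, (cubicSeries A B C x).re = A * (cubicSeries (1 : ℚ) (0 : ℚ) (0 : ℚ) x).re +
      B * x + C * (cubicSeries (0 : ℚ) (0 : ℚ) (1 : ℚ) x).re := by
    intro x
    rw [(cubicSeries_linear A B C x).1, cubicSeries_linear_solution]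
    simp only [Complex.add_re, Complex.re_ofReal_mul, Complex.ofReal_re, Rat.cast_one,
      Rat.cast_zero]
  set u : ℝ → ℝ := fun x => (cubicSeries A B C x).re
  have d0 : ∀ x : ℝ, HasDerivAt u (cubicSeries1 A B C x).re x := fun x => (real_hasDerivAt x).1
  have d1 : ∀ x : ℝ, HasDerivAt (fun x : ℝ => (cubicSeries1 A B C x).re)
    (cubicSeries2 A B C x).re x := fun x => (real_hasDerivAt x).2.1
  have hder : deriv u = fun x : ℝ => (cubicSeries1 A B C x).re := funext fun x => (d0 x).deriv
  have hcont : Continuous u := continuous_iff_continuousAt.2 fun x => (d0 x).continuousAt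
  have hanti : StrictAntiOn u (Ici 0) := by
    refine strictAntiOn_of_deriv_neg (convex_Ici 0) hcont.continuousOn fun x hx => ?_
    rw [interior_Ici] at hx
    rw [hder]
    exact (h.sign (mem_Ioi.1 hx).le).2.1
  have hconv : ConvexOn ℝ (Ici 0) u := by
    refine convexOn_of_deriv2_nonneg (convex_Ici 0) hcont.continuousOn
      (fun x _ => (d0 x).differentiableAt.differentiableWithinAt) ?_ fun x hx => ?_
    · rw [hder]
      exact fun x _ => (d1 x).differentiableAt.differentiableWithinAt
    · rw [interior_Ici] at hx
      simp only [Function.iterate_succ, Function.iterate_zero, Function.comp, id]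
      rw [hder, (d1 x).deriv]
      exact (h.sign (mem_Ioi.1 hx).le).2.2.le
  have m1 : u 4 < u 3 := hanti (by norm_num) (by norm_num) (by norm_num)
  have m2 : u 5 < u 4 := hanti (by norm_num) (by norm_num) (by norm_num)
  have p5 : 0 < u 5 := (h.sign (by norm_num)).1
  have hc : u 4 ≤ 1 / 2 * u 3 + 1 / 2 * u 5 := by
    have := hconv.2 (show (3 : ℝ) ∈ Ici 0 by norm_num) (show (5 : ℝ) ∈ Ici 0 by norm_num)
      (show (0 : ℝ) ≤ 1 / 2 by norm_num) (show (0 : ℝ) ≤ 1 / 2 by norm_num) (by norm_num)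
    simp only [smul_eq_mul] at this
    norm_num at this ⊢
    exact this
  have a3 := cubicSeries_real_approx 1 0 0 3 (-6.1666153) 0.000001 30 (by norm_num)
    (by decide +kernel)
  have a4 := cubicSeries_real_approx 1 0 0 4 (-31.9453726) 0.000001 40 (by norm_num)
    (by decide +kernel)
  have a5 := cubicSeries_real_approx 1 0 0 5 (-188.1442225) 0.000001 45 (by norm_num)
    (by decide +kernel)
  have c3 := cubicSeries_real_approx 0 0 1 3 7.3169254 0.000001 30 (by norm_num)
    (by decide +kernel)
  have c4 := cubicSeries_real_approx 0 0 1 4 27.0446558 0.000001 40 (by norm_num)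
    (by decide +kernel)
  have c5 := cubicSeries_real_approx 0 0 1 5 141.8537502 0.000001 45 (by norm_num)
    (by decide +kernel)
  have hC : 0 < C := by
    have := (h.sign le_rfl).2.2
    rwa [Complex.ofReal_zero, cubicSeries2_zero, Complex.ofReal_re] at this
  set β := B / A
  set γ := C / A
  have hγ : 0 < γ := div_pos hC hA
  have hB' : B = β * A := by simp only [β]; field_simp
  have hC' : C = γ * A := by simp only [γ]; field_simp
  set g : ℝ → ℝ := fun x => (cubicSeries (1 : ℚ) (0 : ℚ) (0 : ℚ) x).re + β * x +
    γ * (cubicSeries (0 : ℚ) (0 : ℚ) (1 : ℚ) x).re with hg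
  have hug : ∀ x, u x = A * g x := fun x => by
    simp only [u, g]
    rw [hlin x, hB', hC']
    ring
  rw [hug, hug] at m1 m2
  rw [hug] at p5
  rw [hug, hug, hug] at hc
  have m1' : g 4 < g 3 := lt_of_mul_lt_mul_left m1 hA.le
  have m2' : g 5 < g 4 := lt_of_mul_lt_mul_left m2 hA.le
  have p5' : 0 < g 5 := pos_of_mul_pos_right p5 hA.le
  have hc' : g 4 ≤ 1 / 2 * g 3 + 1 / 2 * g 5 := by
    refine le_of_mul_le_mul_left ?_ hA
    linarith
  have hmul : ∀ t v η : ℝ, |t - v| ≤ η → γ * (v - η) ≤ γ * t ∧ γ * t ≤ γ * (v + η) := by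
    intro t v η ht
    have := abs_le.1 ht
    exact ⟨by gcongr; linarith, by gcongr; linarith⟩
  have q3 := hmul _ _ _ c3
  have q4 := hmul _ _ _ c4
  have q5 := hmul _ _ _ c5
  rw [abs_le] at a3 a4 a5
  simp only [hg] at m1' m2' p5' hc'
  push_cast at a3 a4 a5 q3 q4 q5 m1' m2' p5' hc'
  refine ⟨hA, abs_le.2 ⟨by linarith, by linarith⟩, abs_le.2 ⟨by linarith, by linarith⟩⟩

end OrrSommerfeld

namespace OrrSommerfeld

open Set Filter Topology MeasureTheory

open scoped Real

/-! ### Rational bounds on the ray, close to the origin -/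

/-- An upper bound for the modulus of a pair of rational numbers: the arithmetic mean of `t` and
`(x² + y²) / t`, where `t` is close to the modulus. -/
def pairBound (p : ℚ × ℚ) : ℚ :=
  let t := max |p.1| |p.2| + 2 / 5 * min |p.1| |p.2|
  ((p.1 ^ 2 + p.2 ^ 2) / t + t) / 2

/-- The product of two complex numbers. -/
def pairMul (p q : ℚ × ℚ) : ℚ × ℚ := (p.1 * q.1 - p.2 * q.2, p.1 * q.2 + p.2 * q.1)

/-- The Taylor coefficients of the exponential function. -/
def expList : ℕ → ℕ → ℚ → List ℚ
  | 0, _, _ => []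
  | k + 1, n, a => a :: expList k (n + 1) (a / (n + 1))

/-- The coefficients of the polynomial `(σ² - 2σ/5 + 2) (σ + 3/10)`. On the ray through
`(16 + 63 i) / 65` the argument of the decaying solution, without its exponential factor, leaves the
interval between plus and minus a right angle; multiplication by this polynomial brings it back. -/
def weightList : List ℚ := [3 / 5, 47 / 25, -1 / 10, 1]

/-- The coefficients of the approximate decaying solution, normalized at `0`. -/
def seriesList : List ℚ := coeffList 46 0 1 (-1.2846) (1.3717 / 2)

/-- The coefficients of the solution with data `0, 0, 1`, which measures the effect of an error in
the second derivative at `0`. -/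
def seriesList' : List ℚ := coeffList 46 0 0 0 (1 / 2)

/-- A lower bound for the real part of `rayFun` on the part of the ray between the radii `ρ - δ` and
`ρ + δ`: the value at `ρ`, minus Taylor estimates for the series (`Δf`, which includes the
uncertainty of the initial data and the truncation) and for the other factors (`Δw`). The square of
`(16 + 63 i) / 65` is `(-3713 + 2016 i) / 4225`, and `2 / 3` of the imaginary part of its cube is
`-134442 / 274625`. -/
def rayBound (ρ δ : ℚ) : ℚ :=
  let R := ρ + δ
  let P := listPair (-3713 / 4225 * ρ ^ 2) (2016 / 4225 * ρ ^ 2) seriesList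
  let d := δ * (2 * ρ + δ)
  let Δf := d * pairBound P.2 + d ^ 2 / 2 * (listMaj2 (R ^ 2) seriesList).2.2
    + 0.0036 * R ^ 2 + 0.0001 * ((listMaj2 (R ^ 2) seriesList').1 + 0.01) + 0.01
  let κ : ℚ := 134442 / 274625
  let p := (listPair (16 / 65 * ρ) (63 / 65 * ρ) weightList).1
  let w := pairMul (listPair 0 (-(κ * ρ ^ 3)) (expList 30 0 1)).1 p
  let Δw := δ * (listMaj2 R weightList).2.1 + pairBound p * (κ * (R ^ 3 - ρ ^ 3) + 0.0001)
  P.1.1 * w.1 - P.1.2 * w.2 - (pairBound P.1 + Δf) * Δw - Δf * pairBound w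

lemma rayBound_pos_near : ∀ i : ℕ, i < 32 → 0 < rayBound ((2 * i + 1) / 40) (1 / 40) := by
  decide +kernel

lemma rayBound_pos_far : ∀ i : ℕ, i < 36 → 0 < rayBound (8 / 5 + (2 * i + 1) / 80) (1 / 80) := by
  decide +kernel

lemma norm_pair_le (p : ℚ × ℚ) : ‖(p.1 : ℂ) + p.2 * Complex.I‖ ≤ pairBound p := by
  obtain ⟨x, y⟩ := p
  set t : ℚ := max |x| |y| + 2 / 5 * min |x| |y|
  have ht0 : 0 ≤ t := by positivity
  have hpb : pairBound (x, y) = ((x ^ 2 + y ^ 2) / t + t) / 2 := rfl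
  have hsq : ‖(x : ℂ) + y * Complex.I‖ ^ 2 = (x : ℝ) ^ 2 + (y : ℝ) ^ 2 := by
    have : (x : ℂ) + y * Complex.I = ((x : ℝ) : ℂ) + ((y : ℝ) : ℂ) * Complex.I := by
      push_cast; rfl
    rw [this, ← Complex.normSq_eq_norm_sq, Complex.normSq_add_mul_I]
  set v := ‖(x : ℂ) + y * Complex.I‖
  rw [hpb]
  push_cast
  rw [← hsq]
  rcases ht0.eq_or_lt with h | h
  · have hx : |x| ≤ 0 := by
      have h1 := le_max_left |x| |y|
      have h2 : 0 ≤ min |x| |y| := le_min (abs_nonneg _) (abs_nonneg _)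
      simp only [t] at h
      linarith
    have hy : |y| ≤ 0 := by
      have h1 := le_max_right |x| |y|
      have h2 : 0 ≤ min |x| |y| := le_min (abs_nonneg _) (abs_nonneg _)
      simp only [t] at h
      linarith
    have hx0 := abs_nonpos_iff.1 hx
    have hy0 := abs_nonpos_iff.1 hy
    have hv : v = 0 := by simp [v, hx0, hy0]
    rw [hv, ← h]
    simp
  · have h' : (0 : ℝ) < t := by exact_mod_cast h
    have h1 : v ^ 2 / t + t - 2 * v = (v - t) ^ 2 / t := by field_simp; ring
    have h2 : 0 ≤ (v - t) ^ 2 / (t : ℝ) := by positivity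
    linarith

lemma listEval_expList (z : ℂ) (k n : ℕ) (a : ℚ) (ha : (a : ℂ) = 1 / n.factorial) :
    listEval z (expList k n a) = ∑ i ∈ Finset.range k, z ^ i / (n + i).factorial := by
  induction k generalizing n a with
  | zero => simp [expList, listEval]
  | succ k ih =>
    rw [expList, listEval, ih (n + 1) _ (by
      rw [Nat.factorial_succ]; push_cast; rw [ha]; field_simp),
      Finset.sum_range_succ', Finset.mul_sum, add_comm, ha]
    simp only [add_zero, pow_zero]
    congr 1
    refine Finset.sum_congr rfl fun i _ => ?_
    rw [show n + 1 + i = n + (i + 1) by ring]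
    ring

/-- The function of modulus comparable to `f (σ²)` whose real part is shown to be positive on the
ray through `(16 + 63 i) / 65`; the real exponential factor is dropped. -/
noncomputable def rayFun (β γ ρ : ℝ) : ℂ :=
  cubicSeries 1 β γ ((ρ * ((16 + 63 * Complex.I) / 65)) ^ 2) *
    (Complex.exp ((-(134442 / 274625 * ρ ^ 3) : ℝ) * Complex.I) *
      listEval (ρ * ((16 + 63 * Complex.I) / 65)) weightList)

lemma norm_unit_sub_le (x y : ℝ) : ‖Complex.exp (x * Complex.I) - Complex.exp (y * Complex.I)‖ ≤
    |x - y| := by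
  have h1 : Complex.exp (x * Complex.I) - Complex.exp (y * Complex.I) =
      Complex.exp (y * Complex.I) * (Complex.exp (Complex.I * (x - y : ℝ)) - 1) := by
    rw [mul_sub, ← Complex.exp_add, mul_one]
    congr 2
    push_cast
    ring
  rw [h1, norm_mul, Complex.norm_exp_ofReal_mul_I, one_mul]
  exact Real.norm_exp_I_mul_ofReal_sub_one_le

lemma norm_sub_seriesList_le {z : ℂ} (hz : ‖z‖ ≤ ((25 / 4 : ℚ) : ℝ)) :
    ‖cubicSeries (1 : ℚ) (-1.2846 : ℚ) (1.3717 : ℚ) z - listEval z seriesList‖ ≤ 0.01 := by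
  refine (norm_cubicSeries_sub_listEval_le 1 (-1.2846) 1.3717 (25 / 4) 46 (by norm_num)
    hz).trans ?_
  have : 2 * (listMaj (25 / 4) (coeffList (46 + 3) 0 1 (-1.2846) (1.3717 / 2)) -
    listMaj (25 / 4) (coeffList 46 0 1 (-1.2846) (1.3717 / 2))) ≤ (0.01 : ℚ) := by
    decide +kernel
  have h2 : (((0.01 : ℚ) : ℚ) : ℝ) = 0.01 := by norm_num
  rw [← h2]
  exact_mod_cast this

lemma norm_sub_seriesList'_le {z : ℂ} (hz : ‖z‖ ≤ ((25 / 4 : ℚ) : ℝ)) :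
    ‖cubicSeries (0 : ℚ) (0 : ℚ) (1 : ℚ) z - listEval z seriesList'‖ ≤ 0.01 := by
  refine (norm_cubicSeries_sub_listEval_le 0 0 1 (25 / 4) 46 (by norm_num) hz).trans ?_
  have : 2 * (listMaj (25 / 4) (coeffList (46 + 3) 0 0 0 (1 / 2)) -
    listMaj (25 / 4) (coeffList 46 0 0 0 (1 / 2))) ≤ (0.01 : ℚ) := by
    decide +kernel
  have h2 : (((0.01 : ℚ) : ℚ) : ℝ) = 0.01 := by norm_num
  rw [← h2]
  exact_mod_cast this

attribute [irreducible] seriesList seriesList'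

lemma rayFun_re_pos {β γ : ℝ} (hβ : |β + 1.2846| ≤ 0.0036) (hγ : |γ - 1.3717| ≤ 0.0001)
    {ρ₀ δ : ℚ} (hb : 0 < rayBound ρ₀ δ) (h0 : 0 ≤ ρ₀) (hδ : 0 ≤ δ) (hR : ρ₀ + δ ≤ 5 / 2) {ρ : ℝ}
    (hρ0 : 0 ≤ ρ) (hρ : |ρ - ρ₀| ≤ δ) : 0 < (rayFun β γ ρ).re := by
  set s : ℂ := (16 + 63 * Complex.I) / 65 with hs
  have hsn : ‖s‖ = 1 := by
    have h1 : s = ((16 / 65 : ℝ) : ℂ) + ((63 / 65 : ℝ) : ℂ) * Complex.I := by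
      rw [hs]; push_cast; ring
    have h2 : ‖s‖ ^ 2 = 1 := by
      rw [h1, ← Complex.normSq_eq_norm_sq, Complex.normSq_add_mul_I]; norm_num
    exact (pow_eq_one_iff_of_nonneg (norm_nonneg _) two_ne_zero).1 h2
  have hs2 : s ^ 2 = (-3713 + 2016 * Complex.I) / 4225 := by
    rw [hs]
    linear_combination (3969 / 4225 : ℂ) * Complex.I_sq
  set R : ℚ := ρ₀ + δ with hRdef
  have hR0 : 0 ≤ R := by positivity
  have h0' : (0 : ℝ) ≤ ρ₀ := by exact_mod_cast h0
  have hδ' : (0 : ℝ) ≤ δ := by exact_mod_cast hδ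
  have hRr : (R : ℝ) = ρ₀ + δ := by rw [hRdef]; push_cast; rfl
  have hR' : (R : ℝ) ≤ 5 / 2 := by
    have : (R : ℝ) ≤ ((5 / 2 : ℚ) : ℝ) := by exact_mod_cast hR
    simpa using this
  have hρR : ρ ≤ R := by rw [hRr]; linarith [(abs_le.1 hρ).2]
  have hρ₀R : (ρ₀ : ℝ) ≤ R := by rw [hRr]; linarith
  -- the arguments of the two factors
  set z : ℂ := (ρ * s) ^ 2 with hz
  set z₀ : ℂ := (ρ₀ * s) ^ 2 with hz₀
  have hzn : ‖z‖ = ρ ^ 2 := by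
    rw [hz, norm_pow, norm_mul, hsn, Complex.norm_of_nonneg hρ0, mul_one]
  have hρ₀n : ‖(ρ₀ : ℂ)‖ = ρ₀ := by
    have := Complex.norm_of_nonneg h0'
    rwa [Complex.ofReal_ratCast] at this
  have hz₀n : ‖z₀‖ = (ρ₀ : ℝ) ^ 2 := by
    rw [hz₀, norm_pow, norm_mul, hsn, hρ₀n, mul_one]
  have hzR : ‖z‖ ≤ ((R ^ 2 : ℚ) : ℝ) := by rw [hzn]; push_cast; gcongr
  have hz₀R : ‖z₀‖ ≤ ((R ^ 2 : ℚ) : ℝ) := by rw [hz₀n]; push_cast; gcongr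
  have hzmax : ‖z‖ ≤ ((25 / 4 : ℚ) : ℝ) := by
    refine hzR.trans ?_
    push_cast
    have : (0 : ℝ) ≤ R := by exact_mod_cast hR0
    nlinarith
  have hdz : ‖z - z₀‖ ≤ ((δ * (2 * ρ₀ + δ) : ℚ) : ℝ) := by
    have e : z - z₀ = ((ρ - ρ₀ : ℝ) : ℂ) * ((ρ + ρ₀ : ℝ) : ℂ) * s ^ 2 := by
      rw [hz, hz₀]; push_cast; ring
    rw [e, norm_mul, norm_mul, norm_pow, hsn, Complex.norm_real, Complex.norm_real,
      Real.norm_eq_abs, Real.norm_eq_abs, one_pow, mul_one, abs_of_nonneg (by linarith : 0 ≤ ρ + ρ₀)]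
    push_cast
    have : ρ + ρ₀ ≤ 2 * ρ₀ + δ := by linarith [(abs_le.1 hρ).2]
    gcongr
  set P := listPair (-3713 / 4225 * ρ₀ ^ 2) (2016 / 4225 * ρ₀ ^ 2) seriesList
  have hz₀' : z₀ = ((-3713 / 4225 * ρ₀ ^ 2 : ℚ) : ℂ) + ((2016 / 4225 * ρ₀ ^ 2 : ℚ) : ℂ) *
      Complex.I := by
    rw [hz₀, mul_pow, hs2]; push_cast; ring
  have hP1 : listEval z₀ seriesList = P.1.1 + P.1.2 * Complex.I := by
    rw [hz₀']; exact listEval_listPair _ _ _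
  have hP2 : listDeriv z₀ seriesList = P.2.1 + P.2.2 * Complex.I := by
    rw [hz₀']; exact listDeriv_listPair _ _ _
  set d : ℚ := δ * (2 * ρ₀ + δ) with hd
  have hd0 : (0 : ℝ) ≤ d := (norm_nonneg _).trans hdz
  set M := (listMaj2 (R ^ 2) seriesList).2.2
  set M' := (listMaj2 (R ^ 2) seriesList').1
  set Δf : ℚ := d * pairBound P.2 + d ^ 2 / 2 * M + 0.0036 * R ^ 2 + 0.0001 * (M' + 0.01) + 0.01
    with hΔf
  have hf : ‖cubicSeries 1 β γ z - (P.1.1 + P.1.2 * Complex.I)‖ ≤ Δf := by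
    have t1 := norm_sub_seriesList_le hzmax
    have t2 := norm_sub_seriesList'_le hzmax
    obtain ⟨-, -, t3⟩ := listEval_taylor hzR hz₀R seriesList
    obtain ⟨t4, -, -⟩ := listEval_taylor hzR hz₀R seriesList'
    have t5 := norm_pair_le P.2
    have t6 : cubicSeries 1 β γ z = cubicSeries (1 : ℚ) (-1.2846 : ℚ) (1.3717 : ℚ) z +
        ((β + 1.2846 : ℝ) : ℂ) * z +
        ((γ - 1.3717 : ℝ) : ℂ) * cubicSeries (0 : ℚ) (0 : ℚ) (1 : ℚ) z := by
      rw [(cubicSeries_linear 1 β γ z).1, (cubicSeries_linear (1 : ℚ) _ _ z).1, cubicSeries_linear_solution]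
      push_cast
      ring
    have t7 : cubicSeries 1 β γ z - (P.1.1 + P.1.2 * Complex.I) =
        (cubicSeries (1 : ℚ) (-1.2846 : ℚ) (1.3717 : ℚ) z - listEval z seriesList) +
        (listEval z seriesList - listEval z₀ seriesList - (z - z₀) * listDeriv z₀ seriesList) +
        (z - z₀) * (P.2.1 + P.2.2 * Complex.I) + ((β + 1.2846 : ℝ) : ℂ) * z +
        ((γ - 1.3717 : ℝ) : ℂ) * (listEval z seriesList' +
          (cubicSeries (0 : ℚ) (0 : ℚ) (1 : ℚ) z - listEval z seriesList')) := by
      rw [t6, hP2, hP1]; ring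
    rw [t7]
    have hM0 : (0 : ℝ) ≤ M := by exact_mod_cast (listMaj2_nonneg (sq_nonneg R) seriesList).2.2
    have hM0' : (0 : ℝ) ≤ M' := by exact_mod_cast (listMaj2_nonneg (sq_nonneg R) seriesList').1
    rw [hP2] at t3
    have b2 : ‖listEval z seriesList - listEval z₀ seriesList -
        (z - z₀) * listDeriv z₀ seriesList‖ ≤ (d : ℝ) ^ 2 / 2 * M := by
      rw [hP2]
      exact t3.trans (by gcongr)
    have b3 : ‖(z - z₀) * (P.2.1 + P.2.2 * Complex.I)‖ ≤ d * pairBound P.2 := by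
      rw [norm_mul]
      gcongr
    have b4 : ‖((β + 1.2846 : ℝ) : ℂ) * z‖ ≤ 0.0036 * (R : ℝ) ^ 2 := by
      rw [norm_mul, Complex.norm_real, Real.norm_eq_abs]
      push_cast at hzR
      gcongr
    have b5 : ‖((γ - 1.3717 : ℝ) : ℂ) * (listEval z seriesList' +
          (cubicSeries (0 : ℚ) (0 : ℚ) (1 : ℚ) z - listEval z seriesList'))‖ ≤
        0.0001 * (M' + 0.01) := by
      rw [norm_mul, Complex.norm_real, Real.norm_eq_abs]
      gcongr
      exact (norm_add_le _ _).trans (add_le_add t4 t2)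
    refine (norm_add_le _ _).trans ((add_le_add ((norm_add_le _ _).trans (add_le_add
      ((norm_add_le _ _).trans (add_le_add ((norm_add_le _ _).trans (add_le_add t1 b2)) b3)) b4))
      b5).trans (le_of_eq ?_))
    rw [hΔf]
    push_cast
    ring
  set κ : ℚ := 134442 / 274625 with hκ
  set p := (listPair (16 / 65 * ρ₀) (63 / 65 * ρ₀) weightList).1
  set q := (listPair 0 (-(κ * ρ₀ ^ 3)) (expList 30 0 1)).1
  set w := pairMul q p with hw
  set Δw : ℚ := δ * (listMaj2 R weightList).2.1 + pairBound p * (κ * (R ^ 3 - ρ₀ ^ 3) + 0.0001)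
    with hΔw
  have hp : listEval (ρ₀ * s) weightList = p.1 + p.2 * Complex.I := by
    rw [← listEval_listPair]
    congr 1
    rw [hs]; push_cast; ring
  have hq : ‖Complex.exp ((-(134442 / 274625 * (ρ₀ : ℝ) ^ 3) : ℝ) * Complex.I) -
      (q.1 + q.2 * Complex.I)‖ ≤ 0.0001 := by
    rw [← listEval_listPair, listEval_expList _ _ _ _ (by simp)]
    have e : ((-(134442 / 274625 * (ρ₀ : ℝ) ^ 3) : ℝ) : ℂ) * Complex.I =
        ((0 : ℚ) : ℂ) + ((-(κ * ρ₀ ^ 3) : ℚ) : ℂ) * Complex.I := by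
      rw [hκ]; push_cast; ring
    rw [← e]
    simp only [zero_add]
    set x : ℝ := -(134442 / 274625 * (ρ₀ : ℝ) ^ 3)
    have hx : ‖(x : ℂ) * Complex.I‖ ≤ 7.65 := by
      rw [norm_mul, Complex.norm_I, mul_one, Complex.norm_real, Real.norm_eq_abs, abs_neg,
        abs_of_nonneg (by positivity)]
      have : (ρ₀ : ℝ) ^ 3 ≤ (5 / 2) ^ 3 := by gcongr; linarith
      norm_num at this ⊢
      linarith
    refine (Complex.exp_bound' (n := 30) ?_).trans ?_
    · rw [div_le_iff₀ (by positivity)]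
      refine hx.trans ?_
      norm_num
    · have : ‖(x : ℂ) * Complex.I‖ ^ 30 ≤ 7.65 ^ 30 := by gcongr
      calc ‖(x : ℂ) * Complex.I‖ ^ 30 / (Nat.factorial 30) * 2
          ≤ 7.65 ^ 30 / (Nat.factorial 30) * 2 := by gcongr
        _ ≤ 0.0001 := by norm_num [Nat.factorial]
  have hwn : (w.1 : ℂ) + w.2 * Complex.I = (q.1 + q.2 * Complex.I) * (p.1 + p.2 * Complex.I) := by
    rw [hw, pairMul]
    push_cast
    linear_combination (-(q.2 : ℂ) * p.2) * Complex.I_sq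
  set E := Complex.exp ((-(134442 / 274625 * ρ ^ 3) : ℝ) * Complex.I)
  set E₀ := Complex.exp ((-(134442 / 274625 * (ρ₀ : ℝ) ^ 3) : ℝ) * Complex.I)
  have hE : ‖E - E₀‖ ≤ κ * ((R : ℝ) ^ 3 - ρ₀ ^ 3) := by
    refine (norm_unit_sub_le _ _).trans ?_
    have h1 : |ρ ^ 3 - (ρ₀ : ℝ) ^ 3| ≤ (R : ℝ) ^ 3 - ρ₀ ^ 3 := by
      have hup : ρ ^ 3 ≤ (R : ℝ) ^ 3 := by gcongr
      refine abs_le.2 ⟨?_, by linarith⟩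
      rcases le_total ρ (ρ₀ : ℝ) with h | h
      · -- by convexity of the cube
        have h2 : (ρ₀ : ℝ) - ρ ≤ δ := by linarith [(abs_le.1 hρ).1]
        have h3 : (R : ℝ) ^ 3 - ρ₀ ^ 3 = δ * (R ^ 2 + R * ρ₀ + ρ₀ ^ 2) := by rw [hRr]; ring
        have h4 : (ρ₀ : ℝ) ^ 3 - ρ ^ 3 = (ρ₀ - ρ) * (ρ₀ ^ 2 + ρ₀ * ρ + ρ ^ 2) := by ring
        have h5 : (ρ₀ : ℝ) ^ 2 + ρ₀ * ρ + ρ ^ 2 ≤ R ^ 2 + R * ρ₀ + ρ₀ ^ 2 := by nlinarith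
        have h6 : ((ρ₀ : ℝ) - ρ) * (ρ₀ ^ 2 + ρ₀ * ρ + ρ ^ 2) ≤
            δ * (R ^ 2 + R * ρ₀ + ρ₀ ^ 2) := by gcongr
        linarith
      · have h2 : (ρ₀ : ℝ) ^ 3 ≤ ρ ^ 3 := by gcongr
        linarith
    have h2 : -(134442 / 274625 * ρ ^ 3) - -(134442 / 274625 * (ρ₀ : ℝ) ^ 3) =
        -(134442 / 274625 * (ρ ^ 3 - ρ₀ ^ 3)) := by ring
    rw [h2, abs_neg, abs_mul, hκ]
    push_cast
    rw [abs_of_nonneg (by norm_num)]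
    gcongr
  have hσn : ‖(ρ : ℂ) * s‖ ≤ R := by
    rw [norm_mul, hsn, Complex.norm_of_nonneg hρ0, mul_one]; exact hρR
  have hσ₀n : ‖(ρ₀ : ℂ) * s‖ ≤ R := by
    rw [norm_mul, hsn, hρ₀n, mul_one]; exact hρ₀R
  have hpp : ‖listEval (ρ * s) weightList - listEval (ρ₀ * s) weightList‖ ≤
      δ * (listMaj2 R weightList).2.1 := by
    refine (listEval_taylor hσn hσ₀n weightList).2.1.trans ?_
    have : (0 : ℝ) ≤ (listMaj2 R weightList).2.1 := by
      exact_mod_cast (listMaj2_nonneg hR0 weightList).2.1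
    gcongr
    have e : (ρ : ℂ) * s - ρ₀ * s = ((ρ - ρ₀ : ℝ) : ℂ) * s := by push_cast; ring
    rw [e, norm_mul, hsn, mul_one, Complex.norm_real, Real.norm_eq_abs]
    exact hρ
  have hWd : ‖E * listEval (ρ * s) weightList - (w.1 + w.2 * Complex.I)‖ ≤ Δw := by
    have e : E * listEval (ρ * s) weightList - (w.1 + w.2 * Complex.I) =
        E * (listEval (ρ * s) weightList - listEval (ρ₀ * s) weightList) +
        (p.1 + p.2 * Complex.I) * ((E - E₀) + (E₀ - (q.1 + q.2 * Complex.I))) := by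
      rw [hwn, hp]; ring
    rw [e]
    refine (norm_add_le _ _).trans ?_
    rw [norm_mul, norm_mul, Complex.norm_exp_ofReal_mul_I, one_mul, hΔw]
    push_cast
    have h1 := norm_pair_le p
    have h2 : ‖(E - E₀) + (E₀ - (q.1 + q.2 * Complex.I))‖ ≤
        κ * ((R : ℝ) ^ 3 - ρ₀ ^ 3) + 0.0001 := (norm_add_le _ _).trans (add_le_add hE hq)
    have h3 : (0 : ℝ) ≤ pairBound p := (norm_nonneg _).trans h1
    refine add_le_add hpp ?_
    refine (mul_le_mul h1 h2 (norm_nonneg _) h3).trans (le_of_eq ?_)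
    norm_num
  have hPn := norm_pair_le P.1
  have hwn' := norm_pair_le w
  set F : ℂ := P.1.1 + P.1.2 * Complex.I
  set W : ℂ := w.1 + w.2 * Complex.I
  have hre : (F * W).re = P.1.1 * w.1 - P.1.2 * w.2 := by
    have h1 : F = ((P.1.1 : ℝ) : ℂ) + ((P.1.2 : ℝ) : ℂ) * Complex.I := by
      simp only [F]; push_cast; rfl
    have h2 : W = ((w.1 : ℝ) : ℂ) + ((w.2 : ℝ) : ℂ) * Complex.I := by
      simp only [W]; push_cast; rfl
    rw [h1, h2]
    simp
  have hbr : (0 : ℝ) < P.1.1 * w.1 - P.1.2 * w.2 - (pairBound P.1 + Δf) * Δw -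
      Δf * pairBound w := by
    have : 0 < P.1.1 * w.1 - P.1.2 * w.2 - (pairBound P.1 + Δf) * Δw - Δf * pairBound w := hb
    exact_mod_cast this
  have hsplit : rayFun β γ ρ = F * W + (cubicSeries 1 β γ z *
      (E * listEval (ρ * s) weightList - W) + (cubicSeries 1 β γ z - F) * W) := by
    simp only [rayFun, E, hz, hs]
    ring
  have hfn : ‖cubicSeries 1 β γ z‖ ≤ pairBound P.1 + Δf := by
    have := norm_add_le F (cubicSeries 1 β γ z - F)
    rw [add_sub_cancel] at this
    linarith
  have hrest : ‖cubicSeries 1 β γ z * (E * listEval (ρ * s) weightList - W) +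
      (cubicSeries 1 β γ z - F) * W‖ ≤ (pairBound P.1 + Δf) * Δw + Δf * pairBound w := by
    refine (norm_add_le _ _).trans ?_
    rw [norm_mul, norm_mul]
    have h1 : (0 : ℝ) ≤ Δf := (norm_nonneg _).trans hf
    have h2 : (0 : ℝ) ≤ pairBound P.1 + Δf := (norm_nonneg _).trans hfn
    gcongr
  have h1 := (abs_le.1 ((Complex.abs_re_le_norm _).trans hrest)).1
  rw [hsplit, Complex.add_re, hre]
  linarith

/-- Positivity of the real part on the part of the ray within `5 / 2` of the origin. -/
lemma rayFun_re_pos_near {β γ : ℝ} (hβ : |β + 1.2846| ≤ 0.0036) (hγ : |γ - 1.3717| ≤ 0.0001)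
    {ρ : ℝ} (h0 : 0 ≤ ρ) (h1 : ρ ≤ 5 / 2) : 0 < (rayFun β γ ρ).re := by
  -- the index of the interval of length `l` that contains `x`
  have hidx : ∀ (x l : ℝ) (n : ℕ), 0 ≤ x → 0 < l → x < l * n →
      ∃ i < n, |x - l * (i + 1 / 2)| ≤ l / 2 := by
    intro x l n hx hl hxn
    have hx' : 0 ≤ x / l := by positivity
    refine ⟨⌊x / l⌋₊, (Nat.floor_lt hx').2 ?_, ?_⟩
    · rw [div_lt_iff₀ hl]; linarith
    · have e1 := Nat.floor_le hx'
      have e2 := Nat.lt_floor_add_one (x / l)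
      rw [le_div_iff₀ hl] at e1
      rw [div_lt_iff₀ hl] at e2
      rw [abs_le]
      constructor <;> linarith
  rcases lt_or_ge ρ (8 / 5) with h | h
  · obtain ⟨i, hi, hd⟩ := hidx ρ (1 / 20) 32 h0 (by norm_num) (by norm_num; linarith)
    have hi' : (i : ℚ) ≤ 31 := by exact_mod_cast Nat.le_of_lt_succ hi
    refine rayFun_re_pos hβ hγ (rayBound_pos_near i hi) (by positivity) (by norm_num)
      (by linarith) h0 ?_
    push_cast
    rw [abs_le] at hd ⊢
    constructor <;> linarith [hd.1, hd.2]
  · rcases h1.eq_or_lt with h1 | h1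
    · refine rayFun_re_pos hβ hγ (rayBound_pos_far 35 (by norm_num)) (by norm_num) (by norm_num)
        (by norm_num) h0 ?_
      rw [h1]
      norm_num [abs_le]
    · obtain ⟨i, hi, hd⟩ := hidx (ρ - 8 / 5) (1 / 40) 36 (by linarith) (by norm_num)
        (by norm_num; linarith)
      have hi' : (i : ℚ) ≤ 35 := by exact_mod_cast Nat.le_of_lt_succ hi
      refine rayFun_re_pos hβ hγ (rayBound_pos_far i hi) (by positivity) (by norm_num)
        (by linarith) h0 ?_
      push_cast
      rw [abs_le] at hd ⊢
      constructor <;> linarith [hd.1, hd.2]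

end OrrSommerfeld

namespace OrrSommerfeld

open Set Filter Topology MeasureTheory

open scoped Real

/-! ### Zero-free sector of the second primitive of the Airy function -/

section ZeroFree

lemma re_cpow_half_nonneg (w : ℂ) : 0 ≤ (w ^ (1 / 2 : ℂ)).re := by
  rcases eq_or_ne w 0 with rfl | hw
  · simp
  rw [Complex.cpow_def_of_ne_zero hw, Complex.exp_re]
  refine mul_nonneg (Real.exp_pos _).le (Real.cos_nonneg_of_mem_Icc ?_)
  have h1 : (Complex.log w * (1 / 2)).im = w.arg / 2 := by
    have : Complex.log w * (1 / 2) = ((1 / 2 : ℝ) : ℂ) * Complex.log w := by push_cast; ring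
    rw [this, Complex.im_ofReal_mul, Complex.log_im]
    ring
  rw [h1]
  have h2 := Complex.neg_pi_lt_arg w
  have h3 := Complex.arg_le_pi w
  constructor <;> linarith

lemma cpow_half_sq (w : ℂ) : (w ^ (1 / 2 : ℂ)) ^ 2 = w := by
  simp

/-- A refined estimate, by repeated integration by parts. -/
lemma norm_sq_mul_saddleIntegral_sub_le {σ : ℂ} {ρ : ℝ} (hρ : 0 < ρ) (hσn : ‖σ‖ = ρ)
    (hσ : 0.716 * ρ ≤ σ.re) : ‖σ ^ 2 * saddleIntegral (-2) σ - (π / σ) ^ (1 / 2 : ℂ)‖ ≤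
      √(π / ρ) * (2.4 / ρ ^ 3 + 33.2 / ρ ^ 6) := by
  have hπ := Real.pi_pos
  have hpos : 0 < σ.re := by nlinarith
  have hne : σ ≠ 0 := norm_pos_iff.1 (by rw [hσn]; exact hρ)
  set S := √(π / ρ)
  have hS : 0 ≤ S := Real.sqrt_nonneg _
  have hq : √(π / σ.re) ≤ 1.182 * S := by
    apply Real.sqrt_le_iff.2
    refine ⟨by positivity, ?_⟩
    rw [mul_pow, Real.sq_sqrt (by positivity), div_le_iff₀ hpos]
    have : π / ρ * (0.716 * ρ) ≤ π / ρ * σ.re := by gcongr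
    have e : π / ρ * (0.716 * ρ) = 0.716 * π := by field_simp
    nlinarith
  have hG : ‖(π / σ) ^ (1 / 2 : ℂ)‖ = S := by
    refine (sq_eq_sq₀ (norm_nonneg _) hS).1 ?_
    rw [← norm_pow, cpow_half_sq, norm_div, hσn, Complex.norm_of_nonneg hπ.le,
      Real.sq_sqrt (by positivity)]
  set G := (π / σ) ^ (1 / 2 : ℂ)
  have b1 := saddleIntegral_by_parts hpos (-2)
  have b2 := saddleIntegral_by_parts hpos (-3)
  have b3 := saddleIntegral_by_parts hpos (-1)
  norm_num at b1 b2 b3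
  have hkey : σ ^ 2 * saddleIntegral (-2) σ - G = (saddleIntegral 0 σ - G) -
      2 / σ ^ 4 * (σ * saddleIntegral 0 σ + (saddleIntegral 1 σ - σ * saddleIntegral 0 σ)
        - saddleIntegral (-2) σ) + 6 / σ ^ 2 * saddleIntegral (-4) σ := by
    field_simp
    linear_combination (-σ ^ 4) * b1 + 2 * σ ^ 2 * b2 + 2 * b3
  have hpw : ∀ n : ℕ, (0.716 * ρ) ^ n ≤ σ.re ^ n := fun n => by gcongr
  have n0 : ‖saddleIntegral 0 σ - G‖ ≤ S * (0.336 / ρ ^ 3) := by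
    refine (norm_saddleIntegral_zero_sub_le hpos).trans ?_
    have h1 : 5 / (48 * σ.re ^ 3) ≤ 0.284 / ρ ^ 3 := by
      rw [div_le_div_iff₀ (by positivity) (by positivity)]
      have := hpw 3
      rw [mul_pow] at this
      nlinarith [pow_pos hρ 3]
    calc 5 / (48 * σ.re ^ 3) * √(π / σ.re) ≤ 0.284 / ρ ^ 3 * (1.182 * S) := by gcongr
      _ = S * (0.335688 / ρ ^ 3) := by ring
      _ ≤ _ := by gcongr; norm_num
  have n1 : ‖saddleIntegral 1 σ - σ * saddleIntegral 0 σ‖ ≤ S * (0.414 / ρ ^ 2) := by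
    refine (norm_saddleIntegral_one_sub_le hpos).trans ?_
    have h1 : 1 / (4 * ‖σ‖ * σ.re) ≤ 0.35 / ρ ^ 2 := by
      rw [hσn, div_le_div_iff₀ (by positivity) (by positivity)]
      nlinarith
    calc 1 / (4 * ‖σ‖ * σ.re) * √(π / σ.re) ≤ 0.35 / ρ ^ 2 * (1.182 * S) := by gcongr
      _ = S * (0.4137 / ρ ^ 2) := by ring
      _ ≤ _ := by gcongr; norm_num
  have n2 : ‖saddleIntegral (-2) σ‖ ≤ S * (2.31 / ρ ^ 2) := by
    have h := norm_saddleIntegral_neg_le hpos 2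
    have h1 : 1 / σ.re ^ 2 ≤ 1.951 / ρ ^ 2 := by
      rw [div_le_div_iff₀ (by positivity) (by positivity)]
      have := hpw 2
      rw [mul_pow] at this
      nlinarith [pow_pos hρ 2]
    calc ‖saddleIntegral (-2) σ‖ ≤ 1 / σ.re ^ 2 * √(π / σ.re) := by exact_mod_cast h
      _ ≤ 1.951 / ρ ^ 2 * (1.182 * S) := by gcongr
      _ = S * (2.306082 / ρ ^ 2) := by ring
      _ ≤ _ := by gcongr; norm_num
  have n4 : ‖saddleIntegral (-4) σ‖ ≤ S * (4.5 / ρ ^ 4) := by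
    have h := norm_saddleIntegral_neg_le hpos 4
    have h1 : 1 / σ.re ^ 4 ≤ 3.806 / ρ ^ 4 := by
      rw [div_le_div_iff₀ (by positivity) (by positivity)]
      have := hpw 4
      rw [mul_pow] at this
      nlinarith [pow_pos hρ 4]
    calc ‖saddleIntegral (-4) σ‖ ≤ 1 / σ.re ^ 4 * √(π / σ.re) := by exact_mod_cast h
      _ ≤ 3.806 / ρ ^ 4 * (1.182 * S) := by gcongr
      _ = S * (4.498692 / ρ ^ 4) := by ring
      _ ≤ _ := by gcongr; norm_num
  have n0' : ‖saddleIntegral 0 σ‖ ≤ S * (1 + 0.336 / ρ ^ 3) := by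
    have := norm_add_le (saddleIntegral 0 σ - G) G
    rw [sub_add_cancel, hG] at this
    linarith
  rw [hkey]
  calc _ ≤ ‖saddleIntegral 0 σ - G‖ + ‖2 / σ ^ 4‖ * (‖σ‖ * ‖saddleIntegral 0 σ‖ +
        ‖saddleIntegral 1 σ - σ * saddleIntegral 0 σ‖ + ‖saddleIntegral (-2) σ‖) +
        ‖6 / σ ^ 2‖ * ‖saddleIntegral (-4) σ‖ := by
        refine (norm_add_le _ _).trans ?_
        rw [norm_mul (6 / σ ^ 2)]
        gcongr
        refine (norm_sub_le _ _).trans ?_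
        rw [norm_mul (2 / σ ^ 4)]
        gcongr
        refine (norm_sub_le _ _).trans ?_
        gcongr
        refine (norm_add_le _ _).trans ?_
        rw [norm_mul]
    _ ≤ S * (0.336 / ρ ^ 3) + 2 / ρ ^ 4 * (ρ * (S * (1 + 0.336 / ρ ^ 3)) +
        S * (0.414 / ρ ^ 2) + S * (2.31 / ρ ^ 2)) + 6 / ρ ^ 2 * (S * (4.5 / ρ ^ 4)) := by
        rw [norm_div, norm_div, norm_pow, norm_pow, hσn, Complex.norm_ofNat, Complex.norm_ofNat]
        gcongr
    _ = S * (2.336 / ρ ^ 3 + 33.12 / ρ ^ 6) := by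
        field_simp
        ring
    _ ≤ _ := by gcongr <;> norm_num

lemma cube_mul_exp_le {t : ℝ} (ht : 125 / 8 ≤ t) :
    t ^ 3 * Real.exp (-(0.905 * t)) ≤ 0.003 := by
  set y := t / (125 / 8) - 1 with hy
  have ht' : t = 125 / 8 * (y + 1) := by rw [hy]; field_simp; ring
  have hy0 : 0 ≤ y := by rw [hy, sub_nonneg, le_div_iff₀ (by norm_num)]; linarith
  have h1 : t ^ 3 ≤ (125 / 8 * Real.exp y) ^ 3 := by
    have := Real.add_one_le_exp y
    rw [ht']
    gcongr
  have h2 : Real.exp (-(0.905 * t)) ≤ Real.exp (-14.14) * Real.exp (-(3 * y)) := by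
    rw [← Real.exp_add]
    apply Real.exp_le_exp.2
    rw [ht']
    linarith
  have h3 : Real.exp (-14.14) ≤ 1 / 1360000 := by
    rw [Real.exp_neg, inv_eq_one_div]
    refine one_div_le_one_div_of_le (by norm_num) ?_
    have e1 : Real.exp 14.14 = Real.exp 1 ^ 14 * Real.exp 0.14 := by
      rw [← Real.exp_nat_mul, ← Real.exp_add]; norm_num
    have e2 := Real.exp_one_gt_d9
    have e3 := Real.add_one_le_exp (0.14 : ℝ)
    rw [e1]
    calc (1360000 : ℝ) ≤ 2.718 ^ 14 * (0.14 + 1) := by norm_num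
      _ ≤ Real.exp 1 ^ 14 * Real.exp 0.14 := by gcongr; linarith
  calc t ^ 3 * Real.exp (-(0.905 * t))
      ≤ (125 / 8 * Real.exp y) ^ 3 * (1 / 1360000 * Real.exp (-(3 * y))) := by
        gcongr
        exact h2.trans (by gcongr)
    _ = (125 / 8) ^ 3 / 1360000 * (Real.exp y ^ 3 * Real.exp (-(3 * y))) := by ring
    _ = (125 / 8) ^ 3 / 1360000 := by
        rw [← Real.exp_nat_mul, ← Real.exp_add]
        norm_num
    _ ≤ 0.003 := by norm_num

variable {A B C : ℝ}

/-- The decaying solution times a polynomial, as an entire function of `σ = √z`. -/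
noncomputable def weightedAiry (A B C : ℝ) (σ : ℂ) : ℂ :=
  Complex.exp (2 / 3 * σ ^ 3) * cubicSeries A B C (σ ^ 2) * listEval σ weightList

lemma listEval_weightList (σ : ℂ) : listEval σ weightList =
    3 / 5 + 47 / 25 * σ - 1 / 10 * σ ^ 2 + σ ^ 3 := by
  simp only [weightList, listEval]
  push_cast
  ring

/-- The direction of the ray on which the real part of `weightedAiry` is shown to be positive; its
argument is slightly more than `75` degrees. -/
noncomputable def rayDir : ℂ := (16 + 63 * Complex.I) / 65

lemma rayDir_cube : rayDir ^ 3 = (-186416 - 201663 * Complex.I) / 274625 := by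
  rw [rayDir]
  linear_combination ((190512 + 250047 * Complex.I) / 274625 : ℂ) * Complex.I_sq

lemma IsAiryPrimitive.abs_slope_le (h : IsAiryPrimitive A B C) : |B| ≤ 2.1 := by
  obtain ⟨hA, hβ, hγ⟩ := h.ratio
  have hAC := h.mul_eq
  have hC : 1.3716 * A ≤ C := by
    have := (abs_le.1 hγ).1
    have h1 : 1.3716 ≤ C / A := by linarith
    rwa [le_div_iff₀ hA] at h1
  have h3 : 1.732 ≤ √3 := Real.le_sqrt_of_sq_le (by norm_num)
  have h4 : 2 * π / √3 ≤ 3.6375 := by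
    rw [div_le_iff₀ (by positivity)]
    have := Real.pi_lt_d2
    nlinarith
  have hA2 : A ≤ 1.63 := by nlinarith
  have h5 : |B| = |B / A| * A := by rw [abs_div, abs_of_pos hA]; field_simp
  have h6 : |B / A| ≤ 1.2882 := by
    have h7 := abs_sub_abs_le_abs_sub (B / A) (-1.2846)
    rw [sub_neg_eq_add, abs_neg, abs_of_pos (by norm_num : (0 : ℝ) < 1.2846)] at h7
    linarith
  rw [h5]
  calc |B / A| * A ≤ 1.2882 * 1.63 := by gcongr
    _ ≤ 2.1 := by norm_num

lemma IsAiryPrimitive.weighted_re_pos_near (h : IsAiryPrimitive A B C) {ρ : ℝ} (h0 : 0 ≤ ρ)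
    (h1 : ρ ≤ 5 / 2) : 0 < (weightedAiry A B C (ρ * rayDir)).re := by
  obtain ⟨hA, hβ, hγ⟩ := h.ratio
  have hpos := rayFun_re_pos_near hβ hγ h0 h1
  have e1 : cubicSeries A B C ((ρ * rayDir) ^ 2) =
      A * cubicSeries 1 (B / A : ℝ) (C / A : ℝ) ((ρ * rayDir) ^ 2) := by
    rw [(cubicSeries_linear A B C _).1,
      (cubicSeries_linear 1 (B / A : ℝ) (C / A : ℝ) _).1]
    have : (A : ℂ) ≠ 0 := by exact_mod_cast hA.ne'
    push_cast
    field_simp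
  have e2 : Complex.exp (2 / 3 * (ρ * rayDir) ^ 3) =
      (Real.exp (-(2 / 3 * (186416 / 274625 * ρ ^ 3))) : ℝ) *
        Complex.exp ((-(134442 / 274625 * ρ ^ 3) : ℝ) * Complex.I) := by
    rw [mul_pow, rayDir_cube, Complex.ofReal_exp, ← Complex.exp_add]
    congr 1
    push_cast
    ring
  have e3 : weightedAiry A B C (ρ * rayDir) =
      ((Real.exp (-(2 / 3 * (186416 / 274625 * ρ ^ 3))) * A : ℝ) : ℂ) *
        rayFun (B / A) (C / A) ρ := by
    rw [weightedAiry, e1, e2, rayFun, rayDir]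
    push_cast
    ring
  rw [e3, Complex.re_ofReal_mul]
  positivity

lemma norm_rayDir : ‖rayDir‖ = 1 := by
  have h1 : rayDir = ((16 / 65 : ℝ) : ℂ) + ((63 / 65 : ℝ) : ℂ) * Complex.I := by
    rw [rayDir]; push_cast; ring
  have h2 : ‖rayDir‖ ^ 2 = 1 := by
    rw [h1, ← Complex.normSq_eq_norm_sq, Complex.normSq_add_mul_I]; norm_num
  exact (pow_eq_one_iff_of_nonneg (norm_nonneg _) two_ne_zero).1 h2

/-- Far out on the ray, the connection formula expresses the function by the other two
solutions, of which one dominates. -/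
lemma IsAiryPrimitive.exists_remainder (h : IsAiryPrimitive A B C) {ρ : ℝ} (hρ : 5 / 2 ≤ ρ) :
    ∃ r : ℂ, ‖r‖ ≤ √(π / ρ) * 0.493 ∧ (ρ * rayDir) ^ 2 * (Complex.exp (2 / 3 * (ρ * rayDir) ^ 3) *
      cubicSeries A B C ((ρ * rayDir) ^ 2)) = √(π / ρ) * ((9 - 7 * Complex.I) / √130) + r := by
  have hπ := Real.pi_pos
  have hρ0 : 0 < ρ := by linarith
  set s := rayDir with hs
  set ω := cubeRoot with hω
  have hw3 : ω ^ 3 = 1 := cubeRoot_pow_three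
  have hωn : ‖ω‖ = 1 := by
    have : ‖ω‖ ^ 3 = 1 := by rw [← norm_pow, hw3, norm_one]
    exact (pow_eq_one_iff_of_nonneg (norm_nonneg _) (by norm_num)).1 this
  have hω0 : ω ≠ 0 := by rw [← norm_pos_iff, hωn]; norm_num
  have hs0 : s ≠ 0 := by rw [← norm_pos_iff, hs, norm_rayDir]; norm_num
  set σ : ℂ := ρ * s with hσ
  have hσn : ‖σ‖ = ρ := by rw [hσ, norm_mul, hs, norm_rayDir, Complex.norm_of_nonneg hρ0.le, mul_one]
  set σ₁ : ℂ := ω ^ 2 * σ with hσ₁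
  set σ₂ : ℂ := -ω * σ with hσ₂
  have h3lo : 1.732 ≤ √3 := Real.le_sqrt_of_sq_le (by norm_num)
  have hre1 : σ₁.re = ρ * ((-8 + 63 / 2 * √3) / 65) := by
    have : σ₁ = ((ρ * ((-8 + 63 / 2 * √3) / 65) : ℝ) : ℂ) +
        ((ρ * ((-63 / 2 - 8 * √3) / 65) : ℝ) : ℂ) * Complex.I := by
      rw [hσ₁, hω, cubeRoot_sq, hσ, hs, rayDir]
      push_cast
      linear_combination (-(63 / 130 * ρ * √3) : ℂ) * Complex.I_sq
    rw [this]
    simp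
  have hre2 : σ₂.re = ρ * ((8 + 63 / 2 * √3) / 65) := by
    have : σ₂ = ((ρ * ((8 + 63 / 2 * √3) / 65) : ℝ) : ℂ) +
        ((ρ * ((63 / 2 - 8 * √3) / 65) : ℝ) : ℂ) * Complex.I := by
      rw [hσ₂, hω, cubeRoot, hσ, hs, rayDir]
      push_cast
      linear_combination (-(63 / 130 * ρ * √3) : ℂ) * Complex.I_sq
    rw [this]
    simp
  have hlo1 : 0.716 * ρ ≤ σ₁.re := by rw [hre1]; nlinarith
  have hlo2 : 0.9 * ρ ≤ σ₂.re := by rw [hre2]; nlinarith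
  have hpos1 : 0 < σ₁.re := by nlinarith
  have hpos2 : 0 < σ₂.re := by nlinarith
  have hσ₁n : ‖σ₁‖ = ρ := by rw [hσ₁, norm_mul, norm_pow, hωn, hσn]; ring
  set S := √(π / ρ) with hSdef
  have hS : 0 < S := Real.sqrt_pos.2 (by positivity)
  have hS2 : S ^ 2 = π / ρ := Real.sq_sqrt (by positivity)
  set v : ℂ := (9 - 7 * Complex.I) / √130 with hv
  have h130 : ((√130 : ℝ) : ℂ) ^ 2 = 130 := by
    rw [← Complex.ofReal_pow, Real.sq_sqrt (by norm_num)]; norm_num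
  have h130' : ((√130 : ℝ) : ℂ) ≠ 0 := by
    have : (0 : ℝ) < √130 := Real.sqrt_pos.2 (by norm_num)
    exact_mod_cast this.ne'
  have hv2 : v ^ 2 = (16 - 63 * Complex.I) / 65 := by
    rw [hv, div_pow, h130]
    linear_combination (49 / 130 : ℂ) * Complex.I_sq
  have hvs : v ^ 2 * s = 1 := by
    rw [hv2, hs, rayDir]
    linear_combination (-3969 / 4225 : ℂ) * Complex.I_sq
  set G := (π / σ₁) ^ (1 / 2 : ℂ)
  have hGeq : G = -ω ^ 2 * (S * v) := by
    have hsq : G ^ 2 = (-ω ^ 2 * (S * v)) ^ 2 := by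
      rw [cpow_half_sq]
      have e1 : ((S : ℝ) : ℂ) ^ 2 = π / ρ := by rw [← Complex.ofReal_pow, hS2]; push_cast; rfl
      have e2 : (-ω ^ 2 * (S * v)) ^ 2 = ω * ω ^ 3 * (S : ℂ) ^ 2 * v ^ 2 := by ring
      have hρc : (ρ : ℂ) ≠ 0 := by exact_mod_cast hρ0.ne'
      rw [e2, e1, hw3, hσ₁, hσ]
      field_simp
      linear_combination (-ω ^ 3) * hvs - hw3
    rcases sq_eq_sq_iff_eq_or_eq_neg.1 hsq with h1 | h1
    · exact h1
    · exfalso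
      have h2 : 0 ≤ G.re := re_cpow_half_nonneg _
      have h3 : -ω ^ 2 * (S * v) = ((S / √130 * (9 / 2 + 7 / 2 * √3) : ℝ) : ℂ) +
          ((S / √130 * (9 / 2 * √3 - 7 / 2) : ℝ) : ℂ) * Complex.I := by
        rw [hω, cubeRoot_sq, hv]
        push_cast
        field_simp
        linear_combination (-7 * √3 * S : ℂ) * Complex.I_sq
      rw [h1, h3] at h2
      simp at h2
      have : 0 < S / √130 * (9 / 2 + 7 / 2 * √3) := by positivity
      linarith
  set E := Complex.exp (2 / 3 * σ ^ 3) with hE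
  have hc1 : σ₁ ^ 2 = ω * σ ^ 2 := by
    rw [hσ₁]; linear_combination (ω * σ ^ 2) * hw3
  have hc2 : σ₂ ^ 2 = ω ^ 2 * σ ^ 2 := by rw [hσ₂]; ring
  have hc3 : σ₁ ^ 3 = σ ^ 3 := by
    rw [hσ₁]; linear_combination (σ ^ 3 * (ω ^ 3 + 1)) * hw3
  have hc4 : σ₂ ^ 3 = -σ ^ 3 := by
    rw [hσ₂]; linear_combination (-σ ^ 3) * hw3
  have f1 := (h σ₁ hpos1).1
  have f2 := (h σ₂ hpos2).1
  rw [hc1, hc3] at f1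
  rw [hc2, hc4] at f2
  have hE1 : E * Complex.exp (-(2 / 3 * σ ^ 3)) = 1 := by
    rw [hE, ← Complex.exp_add, add_neg_cancel, Complex.exp_zero]
  have hE2 : Complex.exp (-(2 / 3 * -σ ^ 3)) = E := by rw [hE]; congr 1; ring
  rw [hE2] at f2
  have hconn := cubicSeries_connection A B C (σ ^ 2)
  rw [← hω, f1, f2] at hconn
  set r : ℂ := -ω * (σ₁ ^ 2 * saddleIntegral (-2) σ₁ - G) -
    ω * σ ^ 2 * E ^ 2 * saddleIntegral (-2) σ₂ + 3 * B * σ ^ 4 * E with hr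
  have hmain : σ ^ 2 * (E * cubicSeries A B C (σ ^ 2)) = S * v + r := by
    rw [hr, hGeq, hc1]
    linear_combination (σ ^ 2 * E) * hconn - (σ ^ 2 * ω ^ 2 * saddleIntegral (-2) σ₁) * hE1
      + (S * v) * hw3
  -- the size of the remainder
  have hEn : ‖E‖ = Real.exp (-(2 / 3 * (186416 / 274625 * ρ ^ 3))) := by
    rw [hE, Complex.norm_exp]
    congr 1
    have : 2 / 3 * σ ^ 3 = ((-(2 / 3 * (186416 / 274625 * ρ ^ 3)) : ℝ) : ℂ) +
        ((-(2 / 3 * (201663 / 274625 * ρ ^ 3)) : ℝ) : ℂ) * Complex.I := by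
      rw [hσ, mul_pow, hs, rayDir_cube]
      push_cast
      ring
    rw [this, Complex.add_re, Complex.ofReal_re, Complex.re_ofReal_mul, Complex.I_re, mul_zero,
      add_zero]
  set t := ρ ^ 3 with ht
  have ht15 : 125 / 8 ≤ t := by
    have : (5 / 2 : ℝ) ^ 3 ≤ ρ ^ 3 := by gcongr
    norm_num at this ⊢
    linarith
  have hE2n : ‖E‖ ^ 2 ≤ Real.exp (-(0.905 * t)) := by
    rw [hEn, ← Real.exp_nat_mul]
    apply Real.exp_le_exp.2
    push_cast
    linarith
  have hexp := cube_mul_exp_le ht15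
  have r1 : ‖-ω * (σ₁ ^ 2 * saddleIntegral (-2) σ₁ - G)‖ ≤ S * 0.29 := by
    rw [norm_mul, norm_neg, hωn, one_mul]
    refine (norm_sq_mul_saddleIntegral_sub_le hρ0 hσ₁n hlo1).trans ?_
    gcongr
    have h6 : ρ ^ 6 = t ^ 2 := by rw [ht]; ring
    rw [h6, ← ht]
    have a1 : 2.4 / t ≤ 2.4 / (125 / 8) := by gcongr
    have a2 : 33.2 / t ^ 2 ≤ 33.2 / (125 / 8) ^ 2 := by gcongr
    norm_num at a1 a2 ⊢
    linarith
  have r2 : ‖ω * σ ^ 2 * E ^ 2 * saddleIntegral (-2) σ₂‖ ≤ S * 0.003 := by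
    rw [norm_mul, norm_mul, norm_mul, norm_pow, norm_pow, hωn, hσn, one_mul]
    have b1 := norm_saddleIntegral_neg_le hpos2 2
    have b2 : 1 / σ₂.re ^ 2 ≤ 2 / ρ ^ 2 := by
      rw [div_le_div_iff₀ (by positivity) (by positivity)]
      have : (0.9 * ρ) ^ 2 ≤ σ₂.re ^ 2 := by gcongr
      nlinarith [pow_pos hρ0 2]
    have b3 : √(π / σ₂.re) ≤ 2 * S := by
      apply Real.sqrt_le_iff.2
      refine ⟨by positivity, ?_⟩
      rw [mul_pow, hS2, div_le_iff₀ hpos2]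
      have : π / ρ * (0.9 * ρ) ≤ π / ρ * σ₂.re := by gcongr
      have e : π / ρ * (0.9 * ρ) = 0.9 * π := by field_simp
      nlinarith
    have b4 : ‖saddleIntegral (-2) σ₂‖ ≤ 2 / ρ ^ 2 * (2 * S) := by
      refine le_trans (by exact_mod_cast b1) ?_
      gcongr
    have b5 : ‖E‖ ^ 2 ≤ 0.00005 := by
      refine hE2n.trans ?_
      have : (125 / 8 : ℝ) ^ 3 ≤ t ^ 3 := by gcongr
      norm_num at this
      nlinarith [Real.exp_pos (-(0.905 * t))]
    calc ρ ^ 2 * ‖E‖ ^ 2 * ‖saddleIntegral (-2) σ₂‖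
        ≤ ρ ^ 2 * 0.00005 * (2 / ρ ^ 2 * (2 * S)) := by gcongr
      _ = S * 0.0002 := by field_simp; ring
      _ ≤ _ := by gcongr; norm_num
  have r3 : ‖3 * B * σ ^ 4 * E‖ ≤ S * 0.2 := by
    refine (sq_le_sq₀ (norm_nonneg _) (by positivity)).1 ?_
    rw [norm_mul, norm_mul, norm_mul, norm_pow, hσn, Complex.norm_ofNat, Complex.norm_real,
      Real.norm_eq_abs, mul_pow, mul_pow S, hS2]
    have hB := h.abs_slope_le
    calc (3 * |B| * ρ ^ 4) ^ 2 * ‖E‖ ^ 2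
        ≤ (3 * 2.1 * ρ ^ 4) ^ 2 * Real.exp (-(0.905 * t)) := by gcongr
      _ = 39.69 / ρ * (t ^ 3 * Real.exp (-(0.905 * t))) := by
          rw [ht]; field_simp; ring
      _ ≤ 39.69 / ρ * 0.003 := by gcongr
      _ ≤ 3.14 / ρ * 0.2 ^ 2 := by
          have : 0 < 1 / ρ := by positivity
          have e1 : 39.69 / ρ * 0.003 = 0.11907 * (1 / ρ) := by ring
          have e2 : 3.14 / ρ * 0.2 ^ 2 = 0.1256 * (1 / ρ) := by ring
          rw [e1, e2]
          gcongr
          norm_num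
      _ ≤ π / ρ * 0.2 ^ 2 := by
          gcongr
          exact Real.pi_gt_d2.le
  have hrn : ‖r‖ ≤ S * 0.493 := by
    rw [hr]
    refine (norm_add_le _ _).trans ((add_le_add ((norm_sub_le _ _).trans (add_le_add r1 r2))
      r3).trans (le_of_eq ?_))
    ring
  exact ⟨r, hrn, hmain⟩

/-- The leading term lies in a cone around the positive axis, far enough from the boundary to absorb
the remainder of `IsAiryPrimitive.exists_remainder`. -/
lemma norm_lt_re_leading {ρ : ℝ} (hρ : 5 / 2 ≤ ρ) :
    ‖((16 - 63 * Complex.I) / 65) ^ 2 * listEval (ρ * rayDir) weightList‖ * 0.493 <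
      (((16 - 63 * Complex.I) / 65) ^ 2 * listEval (ρ * rayDir) weightList *
        ((9 - 7 * Complex.I) / √130)).re := by
  have hρ0 : 0 < ρ := by linarith
  set s := rayDir with hs
  set v : ℂ := (9 - 7 * Complex.I) / √130 with hv
  have h130 : ((√130 : ℝ) : ℂ) ^ 2 = 130 := by
    rw [← Complex.ofReal_pow, Real.sq_sqrt (by norm_num)]; norm_num
  have h130p : (0 : ℝ) < √130 := Real.sqrt_pos.2 (by norm_num)
  set sb : ℂ := (16 - 63 * Complex.I) / 65 with hsb
  have hv2 : v ^ 2 = sb := by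
    rw [hv, div_pow, h130]
    linear_combination (49 / 130 : ℂ) * Complex.I_sq
  have hsbs : sb * s = 1 := by
    rw [hsb, hs, rayDir]
    linear_combination (-3969 / 4225 : ℂ) * Complex.I_sq
  have hsbn : ‖sb‖ = 1 := by
    have := congrArg norm hsbs
    rwa [norm_mul, hs, norm_rayDir, mul_one, norm_one] at this
  have hvn : ‖v‖ = 1 := by
    have := congrArg norm hv2
    rw [norm_pow, hsbn] at this
    exact (pow_eq_one_iff_of_nonneg (norm_nonneg _) two_ne_zero).1 this
  set Q : ℂ := sb ^ 2 * listEval (ρ * s) weightList with hQ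
  set X : ℝ := 9 * ρ ^ 3 - 9 / 10 * ρ ^ 2 - 297 * 47 / (65 * 25) * ρ - 3 / 5 * (47529 / 4225)
    with hX
  set Y : ℝ := 7 * ρ ^ 3 + 7 / 10 * ρ ^ 2 - 679 * 47 / (65 * 25) * ρ + 3 / 5 * (7847 / 4225)
    with hY
  have hQv : Q * v = ((X / √130 : ℝ) : ℂ) + ((Y / √130 : ℝ) : ℂ) * Complex.I := by
    have hp : Q = ρ ^ 3 * s - 1 / 10 * ρ ^ 2 + 47 / 25 * ρ * sb + 3 / 5 * sb ^ 2 := by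
      rw [hQ, listEval_weightList]
      linear_combination (47 / 25 * ρ * sb - 1 / 10 * ρ ^ 2 * (sb * s + 1)
        + ρ ^ 3 * s * (sb * s + 1)) * hsbs
    have m1 : s * (9 - 7 * Complex.I) = 9 + 7 * Complex.I := by
      rw [hs, rayDir]; linear_combination (-441 / 65 : ℂ) * Complex.I_sq
    have m2 : sb * (9 - 7 * Complex.I) = (-297 - 679 * Complex.I) / 65 := by
      rw [hsb]; linear_combination (441 / 65 : ℂ) * Complex.I_sq
    have m3 : sb ^ 2 * (9 - 7 * Complex.I) = (-47529 + 7847 * Complex.I) / 4225 := by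
      rw [sq, mul_assoc, m2, hsb]; linear_combination (42777 / 4225 : ℂ) * Complex.I_sq
    have e : Q * v = (ρ ^ 3 * (s * (9 - 7 * Complex.I)) - 1 / 10 * ρ ^ 2 * (9 - 7 * Complex.I) +
        47 / 25 * ρ * (sb * (9 - 7 * Complex.I)) + 3 / 5 * (sb ^ 2 * (9 - 7 * Complex.I))) /
          √130 := by
      rw [hp, hv]; ring
    rw [e, m1, m2, m3, hX, hY]
    push_cast
    ring
  have hXlo : 2 * ρ ^ 3 ≤ X := by
    rw [hX]
    have e1 : 25 / 4 * ρ ≤ ρ ^ 3 := by nlinarith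
    have e2 : 5 / 2 * ρ ^ 2 ≤ ρ ^ 3 := by nlinarith
    linarith
  have hXpos : 0 < X := lt_of_lt_of_le (by positivity) hXlo
  have hY1 : Y ≤ 1.7 * X := by
    rw [hX, hY]
    have e1 : 25 / 4 * ρ ≤ ρ ^ 3 := by nlinarith
    have e2 : 5 / 2 * ρ ^ 2 ≤ ρ ^ 3 := by nlinarith
    linarith
  have hY2 : -(1.7 * X) ≤ Y := by
    rw [hX, hY]
    have e1 : 25 / 4 * ρ ≤ ρ ^ 3 := by nlinarith
    have e2 : 5 / 2 * ρ ^ 2 ≤ ρ ^ 3 := by nlinarith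
    linarith
  have hQn : ‖Q‖ = √(X ^ 2 + Y ^ 2) / √130 := by
    have e1 : ‖Q‖ = ‖Q * v‖ := by rw [norm_mul Q, hvn, mul_one]
    rw [e1, hQv, Complex.norm_add_mul_I, div_pow, div_pow, ← add_div, Real.sqrt_div (by positivity),
      Real.sqrt_sq h130p.le]
  have hre : (Q * v).re = X / √130 := by
    rw [hQv, Complex.add_re, Complex.ofReal_re, Complex.re_ofReal_mul, Complex.I_re, mul_zero,
      add_zero]
  rw [hQn, hre]
  have hs1 : √(X ^ 2 + Y ^ 2) ≤ 2 * X := by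
    apply Real.sqrt_le_iff.2
    refine ⟨by positivity, ?_⟩
    nlinarith [abs_le.2 ⟨hY2, hY1⟩, sq_le_sq' hY2 hY1]
  rw [div_mul_eq_mul_div]
  gcongr
  linarith

lemma IsAiryPrimitive.weighted_re_pos (h : IsAiryPrimitive A B C) {ρ : ℝ} (h0 : 0 ≤ ρ) :
    0 < (weightedAiry A B C (ρ * rayDir)).re := by
  rcases le_total ρ (5 / 2) with h1 | h1
  · exact h.weighted_re_pos_near h0 h1
  have hρ0 : 0 < ρ := by linarith
  obtain ⟨r, hr, he⟩ := h.exists_remainder h1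
  have hlead := norm_lt_re_leading h1
  set v : ℂ := (9 - 7 * Complex.I) / √130
  set sb : ℂ := (16 - 63 * Complex.I) / 65 with hsb
  have hsbs : sb * rayDir = 1 := by
    rw [hsb, rayDir]
    linear_combination (-3969 / 4225 : ℂ) * Complex.I_sq
  set L := listEval (ρ * rayDir) weightList
  set S := √(π / ρ)
  have hS : 0 < S := Real.sqrt_pos.2 (by have := Real.pi_pos; positivity)
  have hρc : (ρ : ℂ) ≠ 0 := by exact_mod_cast hρ0.ne'
  have e1 : weightedAiry A B C (ρ * rayDir) =
      ((1 / ρ ^ 2 : ℝ) : ℂ) * ((S : ℂ) * (sb ^ 2 * L * v) + sb ^ 2 * L * r) := by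
    have e2 : (S : ℂ) * (sb ^ 2 * L * v) + sb ^ 2 * L * r = sb ^ 2 * L * (S * v + r) := by ring
    rw [e2, ← he, weightedAiry]
    have e3 : ((1 / ρ ^ 2 : ℝ) : ℂ) * ρ ^ 2 = 1 := by
      push_cast
      field_simp
    have e4 : ((1 / ρ ^ 2 : ℝ) : ℂ) * sb ^ 2 * (ρ * rayDir) ^ 2 = 1 := by
      calc _ = ((1 / ρ ^ 2 : ℝ) : ℂ) * ρ ^ 2 * (sb * rayDir) ^ 2 := by ring
        _ = 1 := by rw [e3, hsbs]; norm_num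
    calc _ = 1 * (Complex.exp (2 / 3 * (ρ * rayDir) ^ 3) *
          cubicSeries A B C ((ρ * rayDir) ^ 2) * L) := (one_mul _).symm
      _ = _ := by rw [← e4]; ring
  rw [e1, Complex.re_ofReal_mul, Complex.add_re, Complex.re_ofReal_mul]
  refine mul_pos (by positivity) ?_
  have h2 := (abs_le.1 (Complex.abs_re_le_norm (sb ^ 2 * L * r))).1
  have h3 : ‖sb ^ 2 * L * r‖ ≤ ‖sb ^ 2 * L‖ * (S * 0.493) := by
    rw [norm_mul (sb ^ 2 * L)]
    gcongr
  nlinarith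

end ZeroFree

end OrrSommerfeld

namespace OrrSommerfeld

open Set Filter Topology MeasureTheory

open scoped Real

section Sector

variable {A B C : ℝ}

/-- The open sector around the positive half line whose boundary is made of the ray through
`rayDir` and its mirror image. -/
def sector : Set ℂ := {σ | 16 * |σ.im| < 63 * σ.re}

lemma mem_closure_sector {σ : ℂ} (h : σ ∈ closure sector) : 16 * |σ.im| ≤ 63 * σ.re := by
  have hc : IsClosed {σ : ℂ | 16 * |σ.im| ≤ 63 * σ.re} :=
    isClosed_le (by fun_prop) (by fun_prop)
  have hs : sector ⊆ {σ : ℂ | 16 * |σ.im| ≤ 63 * σ.re} :=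
    fun σ (hσ : 16 * |σ.im| < 63 * σ.re) => le_of_lt hσ
  exact closure_minimal hs hc h

lemma isOpen_sector : IsOpen sector := isOpen_lt (by fun_prop) (by fun_prop)

lemma convex_sector : Convex ℝ sector := by
  intro x hx y hy a b ha hb hab
  simp only [sector, mem_ofPred_eq] at hx hy ⊢
  simp only [Complex.add_im, Complex.add_re, Complex.real_smul, Complex.im_ofReal_mul,
    Complex.re_ofReal_mul]
  have h1 := abs_add_le (a * x.im) (b * y.im)
  rw [abs_mul, abs_mul, abs_of_nonneg ha, abs_of_nonneg hb] at h1
  rcases ha.eq_or_lt with h | h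
  · have : b = 1 := by linarith
    subst this
    rw [← h] at h1 ⊢
    linarith
  · nlinarith

lemma norm_le_re_of_mem_closure_sector {σ : ℂ} (h : 16 * |σ.im| ≤ 63 * σ.re) :
    16 * ‖σ‖ ≤ 65 * σ.re := by
  have h0 : 0 ≤ σ.re := by
    have := abs_nonneg σ.im
    linarith
  have h1 : ‖σ‖ ^ 2 = σ.re ^ 2 + σ.im ^ 2 := by
    rw [← Complex.normSq_eq_norm_sq, Complex.normSq_apply]; ring
  have h2 : (16 * |σ.im|) ^ 2 ≤ (63 * σ.re) ^ 2 := by gcongr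
  have h3 : (16 * ‖σ‖) ^ 2 ≤ (65 * σ.re) ^ 2 := by
    rw [mul_pow, h1]
    rw [mul_pow, sq_abs] at h2
    nlinarith
  exact (sq_le_sq₀ (by positivity) (by positivity)).1 h3

lemma weightedAiry_differentiable (A B C : ℝ) : Differentiable ℂ (weightedAiry A B C) := by
  intro σ
  have h1 : DifferentiableAt ℂ (fun σ => cubicSeries A B C (σ ^ 2)) σ :=
    (cubicSeries_hasDerivAt A B C (σ ^ 2)).differentiableAt.comp σ (by fun_prop)
  have h2 : DifferentiableAt ℂ (fun σ : ℂ => Complex.exp (2 / 3 * σ ^ 3)) σ := by fun_prop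
  have h3 : DifferentiableAt ℂ (fun σ => listEval σ weightList) σ := by
    simp only [listEval_weightList]
    fun_prop
  exact (h2.mul h1).mul h3

lemma weightedAiry_conj (σ : ℂ) :
    weightedAiry A B C (starRingEnd ℂ σ) = starRingEnd ℂ (weightedAiry A B C σ) := by
  rw [weightedAiry, weightedAiry, map_mul, map_mul, cubicSeries_conj, ← Complex.exp_conj,
    listEval_weightList, listEval_weightList]
  simp [map_ofNat, Complex.conj_ofReal]

lemma IsAiryPrimitive.weighted_eq (h : IsAiryPrimitive A B C) {σ : ℂ} (hσ : 0 < σ.re) :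
    weightedAiry A B C σ = saddleIntegral (-2) σ * listEval σ weightList := by
  rw [weightedAiry, (h σ hσ).1, ← mul_assoc (Complex.exp _) (Complex.exp _), ← Complex.exp_add,
    add_neg_cancel, Complex.exp_zero, one_mul]

/-- The function grows at most like the square root in the sector. -/
lemma IsAiryPrimitive.norm_weighted_le (h : IsAiryPrimitive A B C) {σ : ℂ}
    (hσ : 16 * ‖σ‖ ≤ 65 * σ.re) (h1 : 1 ≤ ‖σ‖) :
    ‖weightedAiry A B C σ‖ ≤ 300 * √‖σ‖ := by
  have hpos : 0 < σ.re := by linarith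
  rw [h.weighted_eq hpos, norm_mul]
  set ρ := ‖σ‖
  have hρ0 : 0 < ρ := by linarith
  have hs : 0 < √ρ := Real.sqrt_pos.2 hρ0
  have hss : √ρ ^ 2 = ρ := Real.sq_sqrt hρ0.le
  have b1 : ‖saddleIntegral (-2) σ‖ ≤ 1 / σ.re ^ 2 * √(π / σ.re) := by
    exact_mod_cast norm_saddleIntegral_neg_le hpos 2
  have b2 : 1 / σ.re ^ 2 ≤ 17 / ρ ^ 2 := by
    rw [div_le_div_iff₀ (by positivity) (by positivity)]
    have : (16 * ρ) ^ 2 ≤ (65 * σ.re) ^ 2 := by gcongr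
    nlinarith
  have b3 : √(π / σ.re) ≤ 4 / √ρ := by
    apply Real.sqrt_le_iff.2
    refine ⟨by positivity, ?_⟩
    rw [div_pow, hss, div_le_div_iff₀ hpos hρ0]
    have := Real.pi_lt_d2
    nlinarith
  have b4 : ‖listEval σ weightList‖ ≤ 4 * ρ ^ 3 := by
    rw [listEval_weightList]
    have e : ‖(3 / 5 : ℂ) + 47 / 25 * σ - 1 / 10 * σ ^ 2 + σ ^ 3‖ ≤
        3 / 5 + 47 / 25 * ρ + 1 / 10 * ρ ^ 2 + ρ ^ 3 := by
      refine (norm_add_le _ _).trans (add_le_add ((norm_sub_le _ _).trans (add_le_add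
        ((norm_add_le _ _).trans (add_le_add ?_ ?_)) ?_)) ?_) <;> simp [ρ]
    refine e.trans ?_
    have e1 : 1 ≤ ρ ^ 3 := one_le_pow₀ h1
    have e2 : ρ ≤ ρ ^ 3 := le_self_pow₀ h1 (by norm_num)
    have e3 : ρ ^ 2 ≤ ρ ^ 3 := pow_le_pow_right₀ h1 (by norm_num)
    linarith
  calc ‖saddleIntegral (-2) σ‖ * ‖listEval σ weightList‖
      ≤ (1 / σ.re ^ 2 * √(π / σ.re)) * (4 * ρ ^ 3) := by gcongr
    _ ≤ (17 / ρ ^ 2 * (4 / √ρ)) * (4 * ρ ^ 3) := by gcongr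
    _ = 272 * √ρ := by
        have e : ρ ^ 3 = ρ ^ 2 * √ρ ^ 2 := by rw [hss]; ring
        rw [e]
        field_simp
        norm_num
    _ ≤ 300 * √ρ := by gcongr; norm_num

/-- On the boundary of the sector the real part is nonnegative. -/
lemma IsAiryPrimitive.weighted_re_nonneg_boundary (h : IsAiryPrimitive A B C) {σ : ℂ}
    (hσ : 16 * |σ.im| = 63 * σ.re) : 0 ≤ (weightedAiry A B C σ).re := by
  have h0 : 0 ≤ σ.re := by
    have := abs_nonneg σ.im
    linarith
  have hρ : 0 ≤ 65 / 16 * σ.re := by positivity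
  have hpos := (h.weighted_re_pos hρ).le
  have hray : ((65 / 16 * σ.re : ℝ) : ℂ) * rayDir =
      (σ.re : ℂ) + ((63 / 16 * σ.re : ℝ) : ℂ) * Complex.I := by
    rw [rayDir]; push_cast; ring
  rcases abs_cases σ.im with ⟨h1, -⟩ | ⟨h1, -⟩
  · have e : σ = ((65 / 16 * σ.re : ℝ) : ℂ) * rayDir := by
      rw [hray]
      have : σ.im = 63 / 16 * σ.re := by linarith
      rw [← this]
      exact (Complex.re_add_im σ).symm
    rw [e]; exact hpos
  · have e : σ = starRingEnd ℂ (((65 / 16 * σ.re : ℝ) : ℂ) * rayDir) := by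
      rw [hray]
      have : -σ.im = 63 / 16 * σ.re := by linarith
      rw [← this]
      apply Complex.ext <;> simp
    rw [e, weightedAiry_conj, Complex.conj_re]; exact hpos

/-- The maximum principle for `exp (-H - ε σ)` in the truncated sector. -/
lemma IsAiryPrimitive.weighted_re_add_nonneg (h : IsAiryPrimitive A B C) {σ : ℂ}
    (hσ : σ ∈ sector) {ε : ℝ} (hε : 0 < ε) : 0 ≤ (weightedAiry A B C σ).re + ε * σ.re := by
  set F : ℂ → ℂ := fun σ => Complex.exp (-(weightedAiry A B C σ + ε * σ))
  have hF : ∀ σ, ‖F σ‖ ≤ 1 ↔ 0 ≤ (weightedAiry A B C σ).re + ε * σ.re := by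
    intro σ
    simp only [F]
    rw [Complex.norm_exp, Real.exp_le_one_iff, Complex.neg_re, Complex.add_re,
      Complex.re_ofReal_mul]
    constructor <;> intro h <;> linarith
  have hFd : Differentiable ℂ F :=
    (((weightedAiry_differentiable A B C).add (by fun_prop)).neg).cexp
  set R : ℝ := max (‖σ‖ + 1) (max 1 ((300 * 65 / (16 * ε)) ^ 2))
  have hR1 : 1 ≤ R := (le_max_left _ _).trans (le_max_right _ _)
  have hRε : 300 * 65 / (16 * ε) ≤ √R := by
    apply Real.le_sqrt_of_sq_le
    exact (le_max_right _ _).trans (le_max_right _ _)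
  set U : Set ℂ := sector ∩ Metric.ball 0 R
  have hU : IsOpen U := isOpen_sector.inter Metric.isOpen_ball
  have hσU : σ ∈ U := ⟨hσ, by
    rw [mem_ball_zero_iff]
    have := le_max_left (‖σ‖ + 1) (max 1 ((300 * 65 / (16 * ε)) ^ 2))
    simp only [R]
    linarith⟩
  refine (hF σ).1 (Complex.norm_le_of_forall_mem_frontier_norm_le
    (Metric.isBounded_ball.subset inter_subset_right) hFd.diffContOnCl (fun τ hτ => ?_)
    (subset_closure hσU))
  rw [hF]
  rw [hU.frontier_eq] at hτ
  have h1 : 16 * |τ.im| ≤ 63 * τ.re :=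
    mem_closure_sector (closure_mono inter_subset_left hτ.1)
  have h2 : ‖τ‖ ≤ R := by
    have := Metric.closure_ball_subset_closedBall (closure_mono inter_subset_right hτ.1)
    rwa [mem_closedBall_zero_iff] at this
  have hre : 0 ≤ τ.re := by
    have := abs_nonneg τ.im
    linarith
  by_cases h3 : τ ∈ sector
  · have h4 : ‖τ‖ = R := by
      refine le_antisymm h2 (not_lt.1 fun h5 => hτ.2 ⟨h3, ?_⟩)
      rwa [mem_ball_zero_iff]
    have h5 := norm_le_re_of_mem_closure_sector h1
    have h6 := h.norm_weighted_le h5 (by rw [h4]; exact hR1)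
    have h7 := (abs_le.1 ((Complex.abs_re_le_norm _).trans h6)).1
    rw [h4] at h5 h7
    have h8 : R = √R * √R := (Real.mul_self_sqrt (by linarith)).symm
    have h9 : 300 * 65 ≤ √R * (16 * ε) := by rwa [div_le_iff₀ (by positivity)] at hRε
    have h10 : 300 * √R * 65 ≤ 16 * ε * R := by
      rw [h8, Real.sqrt_mul_self (Real.sqrt_nonneg R)]
      nlinarith [Real.sqrt_nonneg R]
    nlinarith
  · have h4 : 16 * |τ.im| = 63 * τ.re := le_antisymm h1 (not_lt.1 h3)
    have := h.weighted_re_nonneg_boundary h4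
    positivity

/-- The second primitive of the Airy function has no zeros `z` in a sector around the positive half
line with an opening angle of slightly more than `300` degrees. -/
theorem IsAiryPrimitive.ne_zero (h : IsAiryPrimitive A B C) {z : ℂ}
    (hz : -(0.87 * ‖z‖) ≤ z.re) : cubicSeries A B C z ≠ 0 := by
  have hA := h.ratio.1
  rcases eq_or_ne z 0 with rfl | hz0
  · rw [cubicSeries_zero]
    exact_mod_cast hA.ne'
  intro hzero
  -- the square root of `z` lies in the sector
  set σ : ℂ := z ^ (1 / 2 : ℂ)
  have hσ2 : σ ^ 2 = z := cpow_half_sq z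
  have hσre : 0 ≤ σ.re := re_cpow_half_nonneg z
  have hzn : ‖z‖ = σ.re ^ 2 + σ.im ^ 2 := by
    rw [← hσ2, norm_pow, ← Complex.normSq_eq_norm_sq, Complex.normSq_apply]; ring
  have hzre : z.re = σ.re ^ 2 - σ.im ^ 2 := by
    rw [← hσ2, sq, Complex.mul_re]; ring
  have hzpos : 0 < ‖z‖ := norm_pos_iff.2 hz0
  have hσ : σ ∈ sector := by
    have h1 : (16 * |σ.im|) ^ 2 < (63 * σ.re) ^ 2 := by
      rw [mul_pow, sq_abs]
      rw [hzre, hzn] at hz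
      rw [hzn] at hzpos
      nlinarith
    exact (sq_lt_sq₀ (by positivity) (by positivity)).1 h1
  have hHσ : weightedAiry A B C σ = 0 := by rw [weightedAiry, hσ2, hzero]; ring
  -- the real part is nonnegative in the sector
  have hre : ∀ τ ∈ sector, 0 ≤ (weightedAiry A B C τ).re := by
    intro τ hτ
    refine ge_of_tendsto' (f := fun n : ℕ => (weightedAiry A B C τ).re + (1 / ((n : ℝ) + 1)) * τ.re)
      (x := atTop) ?_ fun n => h.weighted_re_add_nonneg hτ (by positivity)
    have := (tendsto_one_div_add_atTop_nhds_zero_nat (𝕜 := ℝ)).mul_const τ.re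
    simpa using this.const_add (weightedAiry A B C τ).re
  set F : ℂ → ℂ := fun τ => Complex.exp (-weightedAiry A B C τ)
  have hFd : Differentiable ℂ F := (weightedAiry_differentiable A B C).neg.cexp
  have hmax : IsMaxOn (norm ∘ F) sector σ := by
    intro τ hτ
    simp only [mem_ofPred_eq, Function.comp, F]
    rw [hHσ, Complex.norm_exp, neg_zero, Complex.exp_zero, norm_one, Real.exp_le_one_iff,
      Complex.neg_re]
    linarith [hre τ hτ]
  have hconst := Complex.eqOn_of_isPreconnected_of_isMaxOn_norm convex_sector.isPreconnected
    isOpen_sector hFd.differentiableOn hσ hmax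
  -- comparison at the vertex of the sector
  have h0 : (0 : ℂ) ∈ closure sector := by
    refine mem_closure_of_tendsto (f := fun n : ℕ => (((1 / ((n : ℝ) + 1)) : ℝ) : ℂ))
      (b := atTop) ?_ (Eventually.of_forall fun n => ?_)
    · have := (Complex.continuous_ofReal.tendsto 0).comp
        (tendsto_one_div_add_atTop_nhds_zero_nat (𝕜 := ℝ))
      rwa [Complex.ofReal_zero] at this
    · simp only [sector, mem_ofPred_eq, Complex.ofReal_im, Complex.ofReal_re, abs_zero, mul_zero]
      positivity
  have hcl := hconst.closure hFd.continuous continuous_const h0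
  simp only [F, Function.const_apply, hHσ, neg_zero, Complex.exp_zero] at hcl
  have h1 : weightedAiry A B C 0 = ((A * (3 / 5) : ℝ) : ℂ) := by
    rw [weightedAiry, listEval_weightList]
    simp [cubicSeries_zero]
  have h2 := congrArg norm hcl
  rw [h1, Complex.norm_exp, norm_one, Real.exp_eq_one_iff, Complex.neg_re, Complex.ofReal_re] at h2
  linarith

end Sector

end OrrSommerfeld

namespace OrrSommerfeld

open Set Filter Topology MeasureTheory

open scoped Real

/-! ### The equation `φ'''' = q φ''` as a first order system -/

/-- The linear map `(y₀, y₁, y₂, y₃) ↦ (y₁, y₂, y₃, q y₂)`. -/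
noncomputable def jetMap (q : ℂ) : (Fin 4 → ℂ) →L[ℝ] (Fin 4 → ℂ) :=
  ContinuousLinearMap.pi
    ![ContinuousLinearMap.proj 1, ContinuousLinearMap.proj 2, ContinuousLinearMap.proj 3,
      (ContinuousLinearMap.mul ℝ ℂ q).comp (ContinuousLinearMap.proj 2)]

lemma jetMap_apply (q : ℂ) (y : Fin 4 → ℂ) : jetMap q y = ![y 1, y 2, y 3, q * y 2] := by
  ext i
  fin_cases i <;> simp [jetMap]

lemma norm_jetMap_le (q : ℂ) : ‖jetMap q‖ ≤ 1 + ‖q‖ := by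
  refine ContinuousLinearMap.opNorm_le_bound _ (by positivity) fun y => ?_
  rw [jetMap_apply, pi_norm_le_iff_of_nonneg (by positivity)]
  have h : ∀ i, ‖y i‖ ≤ (1 + ‖q‖) * ‖y‖ := fun i => by
    nlinarith [norm_le_pi_norm y i, norm_nonneg y, norm_nonneg q,
      mul_nonneg (norm_nonneg q) (norm_nonneg y)]
  intro i
  fin_cases i
  · exact h 1
  · exact h 2
  · exact h 3
  · change ‖q * y 2‖ ≤ _
    rw [norm_mul]
    nlinarith [norm_le_pi_norm y 2, norm_nonneg y, norm_nonneg q,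
      mul_le_mul_of_nonneg_left (norm_le_pi_norm y 2) (norm_nonneg q)]

lemma norm_jetMap_sub_le (q q' : ℂ) (y : Fin 4 → ℂ) :
    ‖jetMap q y - jetMap q' y‖ ≤ ‖q - q'‖ * ‖y‖ := by
  rw [jetMap_apply, jetMap_apply, pi_norm_le_iff_of_nonneg (by positivity)]
  intro i
  have h0 : (0 : ℝ) ≤ ‖q - q'‖ * ‖y‖ := by positivity
  fin_cases i
  · simpa using h0
  · simpa using h0
  · simpa using h0
  · change ‖q * y 2 - q' * y 2‖ ≤ _
    rw [← sub_mul, norm_mul]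
    gcongr
    exact norm_le_pi_norm y 2

lemma jetMap_continuous : Continuous jetMap := by
  refine LipschitzWith.continuous (K := 1) (LipschitzWith.of_dist_le_mul fun q q' => ?_)
  rw [dist_eq_norm, dist_eq_norm, NNReal.coe_one, one_mul]
  exact ContinuousLinearMap.opNorm_le_bound _ (norm_nonneg _) fun y => norm_jetMap_sub_le q q' y

/-- `Y = (φ, φ', φ'', φ''')` with `φ'''' = q φ''`. -/
def IsJet (q : ℝ → ℂ) (Y : ℝ → Fin 4 → ℂ) : Prop := ∀ t, HasDerivAt Y (jetMap (q t) (Y t)) t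

section Jet

variable {q : ℝ → ℂ} {Y Z : ℝ → Fin 4 → ℂ}

lemma isJet_iff : IsJet q Y ↔ ∀ t, HasDerivAt (fun s => Y s 0) (Y t 1) t ∧
    HasDerivAt (fun s => Y s 1) (Y t 2) t ∧ HasDerivAt (fun s => Y s 2) (Y t 3) t ∧
    HasDerivAt (fun s => Y s 3) (q t * Y t 2) t := by
  refine forall_congr' fun t => ?_
  rw [hasDerivAt_pi, Fin.forall_fin_succ, Fin.forall_fin_succ, Fin.forall_fin_succ,
    Fin.forall_fin_one, jetMap_apply]
  rfl

lemma IsJet.hasDerivAt_zero (h : IsJet q Y) (t : ℝ) : HasDerivAt (fun s => Y s 0) (Y t 1) t :=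
  (isJet_iff.1 h t).1

lemma IsJet.hasDerivAt_one (h : IsJet q Y) (t : ℝ) : HasDerivAt (fun s => Y s 1) (Y t 2) t :=
  (isJet_iff.1 h t).2.1

lemma IsJet.hasDerivAt_two (h : IsJet q Y) (t : ℝ) : HasDerivAt (fun s => Y s 2) (Y t 3) t :=
  (isJet_iff.1 h t).2.2.1

lemma IsJet.hasDerivAt_three (h : IsJet q Y) (t : ℝ) :
    HasDerivAt (fun s => Y s 3) (q t * Y t 2) t :=
  (isJet_iff.1 h t).2.2.2

lemma IsJet.continuous (h : IsJet q Y) : Continuous Y :=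
  continuous_iff_continuousAt.2 fun t => (h t).continuousAt

lemma exists_isJet (hq : Continuous q) (t₀ : ℝ) (y₀ : Fin 4 → ℂ) : ∃ Y, Y t₀ = y₀ ∧ IsJet q Y :=
  exists_linearODE (jetMap_continuous.comp hq) t₀ y₀

lemma IsJet.norm_le (h : IsJet q Y) {s : Set ℝ} (hs : s.OrdConnected) {K : ℝ}
    (hK : ∀ t ∈ s, ‖q t‖ ≤ K) {t₀ t : ℝ} (ht₀ : t₀ ∈ s) (ht : t ∈ s) :
    ‖Y t‖ ≤ ‖Y t₀‖ * Real.exp ((1 + K) * |t - t₀|) :=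
  linearODE_norm_le (A := fun t => jetMap (q t)) hs (fun t _ => (h t).hasDerivWithinAt)
    (fun t ht => (norm_jetMap_le _).trans (by linarith [hK t ht])) ht₀ ht

lemma IsJet.eq_zero (h : IsJet q Y) (hq : Continuous q) {t₀ : ℝ} (h0 : Y t₀ = 0) (t : ℝ) :
    Y t = 0 := by
  obtain ⟨K, hK⟩ := (isCompact_uIcc (a := t₀) (b := t)).exists_bound_of_continuousOn
    hq.continuousOn
  have := h.norm_le ordConnected_uIcc hK left_mem_uIcc right_mem_uIcc
  rw [h0, norm_zero, zero_mul] at this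
  exact norm_le_zero_iff.1 this

lemma IsJet.add (hY : IsJet q Y) (hZ : IsJet q Z) : IsJet q (fun t => Y t + Z t) := fun t => by
  rw [map_add]
  exact (hY t).add (hZ t)

lemma IsJet.const_smul (hY : IsJet q Y) (k : ℂ) : IsJet q (fun t => k • Y t) :=
  isJet_iff.2 fun t => ⟨(hY.hasDerivAt_zero t).const_mul k, (hY.hasDerivAt_one t).const_mul k,
    (hY.hasDerivAt_two t).const_mul k,
    ((hY.hasDerivAt_three t).const_mul k).congr_deriv (mul_left_comm _ _ _)⟩

/-- Affine functions solve the equation. -/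
lemma isJet_affine (q : ℝ → ℂ) (a b : ℂ) (t₀ : ℝ) :
    IsJet q (fun t => ![a + b * (t - t₀ : ℝ), b, 0, 0]) := by
  refine isJet_iff.2 fun t => ⟨?_, ?_, ?_, ?_⟩
  · have h : HasDerivAt (fun s : ℝ => ((s - t₀ : ℝ) : ℂ)) ((1 : ℝ) : ℂ) t :=
      ((hasDerivAt_id t).sub_const t₀).ofReal_comp
    simpa using (h.const_mul b).const_add a
  · simpa using hasDerivAt_const t b
  · simpa using hasDerivAt_const t (0 : ℂ)
  · simpa using hasDerivAt_const t (0 : ℂ)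

lemma IsJet.eq_affine (hY : IsJet q Y) (hq : Continuous q) {t₀ : ℝ} (h2 : Y t₀ 2 = 0)
    (h3 : Y t₀ 3 = 0) (t : ℝ) : Y t = ![Y t₀ 0 + Y t₀ 1 * (t - t₀ : ℝ), Y t₀ 1, 0, 0] := by
  have hZ := hY.add ((isJet_affine q (Y t₀ 0) (Y t₀ 1) t₀).const_smul (-1))
  have h0 := hZ.eq_zero hq (t₀ := t₀) (by ext i; fin_cases i <;> simp [h2, h3]) t
  rw [neg_one_smul, ← sub_eq_add_neg, sub_eq_zero] at h0
  exact h0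

/-- Two solutions of nearby equations stay close to each other. -/
lemma IsJet.norm_sub_le {q' : ℝ → ℂ} (hY : IsJet q Y) (hZ : IsJet q' Z) {T K η S : ℝ}
    (hK0 : 0 ≤ K) (hη : 0 ≤ η) (hS : 0 ≤ S)
    (hK : ∀ t ∈ Icc 0 T, ‖q t‖ ≤ K) (hqq : ∀ t ∈ Icc 0 T, ‖q t - q' t‖ ≤ η)
    (hZS : ∀ t ∈ Icc 0 T, ‖Z t‖ ≤ S) {t : ℝ} (ht : t ∈ Icc 0 T) :
    ‖Y t - Z t‖ ≤ (‖Y 0 - Z 0‖ + η * S) * Real.exp ((1 + K) * T) := by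
  have h := norm_le_gronwallBound_of_norm_deriv_right_le (f := fun t => Y t - Z t)
    (f' := fun t => jetMap (q t) (Y t) - jetMap (q' t) (Z t)) (δ := ‖Y 0 - Z 0‖) (K := 1 + K)
    (ε := η * S) (a := 0) (b := T)
    (hY.continuous.sub hZ.continuous).continuousOn
    (fun u _ => ((hY u).sub (hZ u)).hasDerivWithinAt) le_rfl
    (fun u hu => by
      have hu' := Ico_subset_Icc_self hu
      have e : jetMap (q u) (Y u) - jetMap (q' u) (Z u) =
          jetMap (q u) (Y u - Z u) + (jetMap (q u) (Z u) - jetMap (q' u) (Z u)) := by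
        rw [map_sub]; abel
      rw [e]
      refine (norm_add_le _ _).trans (add_le_add ?_ ?_)
      · refine (ContinuousLinearMap.le_opNorm _ _).trans ?_
        gcongr
        exact (norm_jetMap_le _).trans (by linarith [hK u hu'])
      · refine (norm_jetMap_sub_le _ _ _).trans ?_
        gcongr
        · exact hqq u hu'
        · exact hZS u hu') t ht
  refine h.trans ?_
  rw [gronwallBound_of_K_ne_0 (by positivity), sub_zero]
  have hT : Real.exp ((1 + K) * t) ≤ Real.exp ((1 + K) * T) := by
    gcongr
    exact ht.2
  have h1 : η * S / (1 + K) ≤ η * S := div_le_self (by positivity) (by linarith)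
  have h2 : 0 ≤ Real.exp ((1 + K) * t) - 1 := by
    have := Real.one_le_exp (x := (1 + K) * t) (mul_nonneg (by linarith) ht.1)
    linarith
  calc ‖Y 0 - Z 0‖ * Real.exp ((1 + K) * t) + η * S / (1 + K) * (Real.exp ((1 + K) * t) - 1)
      ≤ ‖Y 0 - Z 0‖ * Real.exp ((1 + K) * T) + η * S * (Real.exp ((1 + K) * T)) := by
        gcongr
        linarith
    _ = _ := by ring

/-- Continuous dependence of the solution on the equation, the data and the time. -/
lemma tendsto_isJet {qn : ℕ → ℝ → ℂ} {Yn : ℕ → ℝ → Fin 4 → ℂ} (hn : ∀ n, IsJet (qn n) (Yn n))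
    (hY : IsJet q Y) (hqc : Continuous q)
    (hq : ∀ T η : ℝ, 0 < η → ∀ᶠ n in atTop, ∀ t ∈ Icc 0 T, ‖qn n t - q t‖ ≤ η)
    (h0 : Tendsto (fun n => Yn n 0) atTop (𝓝 (Y 0))) {tn : ℕ → ℝ} {t : ℝ} (htn : ∀ n, 0 ≤ tn n)
    (ht : Tendsto tn atTop (𝓝 t)) : Tendsto (fun n => Yn n (tn n)) atTop (𝓝 (Y t)) := by
  set T := t + 1
  obtain ⟨K, hK⟩ := (isCompact_Icc (a := (0 : ℝ)) (b := T)).exists_bound_of_continuousOn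
    hqc.continuousOn
  obtain ⟨S, hS⟩ := (isCompact_Icc (a := (0 : ℝ)) (b := T)).exists_bound_of_continuousOn
    hY.continuous.continuousOn
  have ht0 : 0 ≤ t := ge_of_tendsto' ht htn
  have hK0 : 0 ≤ K := (norm_nonneg _).trans (hK 0 ⟨le_rfl, by positivity⟩)
  have hS0 : 0 ≤ S := (norm_nonneg _).trans (hS 0 ⟨le_rfl, by positivity⟩)
  have hYt : Tendsto (fun n => Y (tn n)) atTop (𝓝 (Y t)) := (hY.continuous.tendsto t).comp ht
  suffices h : Tendsto (fun n => Yn n (tn n) - Y (tn n)) atTop (𝓝 0) by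
    simpa using h.add hYt
  rw [Metric.tendsto_atTop]
  intro ε hε
  set E := Real.exp ((1 + (K + 1)) * T) with hE
  have hE0 : 0 < E := Real.exp_pos _
  set η := min 1 (ε / (4 * E * (S + 1)))
  have hη : 0 < η := lt_min one_pos (by positivity)
  have hη1 : η * S * E ≤ ε / 4 := by
    have : η ≤ ε / (4 * E * (S + 1)) := min_le_right _ _
    calc η * S * E ≤ ε / (4 * E * (S + 1)) * (S + 1) * E := by gcongr; linarith
      _ = ε / 4 := by field_simp
  have h0' : ∀ᶠ n in atTop, ‖Yn n 0 - Y 0‖ < ε / (4 * E) :=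
    (tendsto_iff_norm_sub_tendsto_zero.1 h0).eventually_lt_const (by positivity)
  have htT : ∀ᶠ n in atTop, tn n < T := ht.eventually_lt_const (by simp [T])
  obtain ⟨N, hN⟩ := eventually_atTop.1 ((hq T η hη).and (h0'.and htT))
  refine ⟨N, fun n hn' => ?_⟩
  obtain ⟨h1, h2, h3⟩ := hN n hn'
  rw [dist_zero_right]
  have := (hn n).norm_sub_le hY (K := K + 1) (by linarith) hη.le hS0 (fun u hu => by
    have h4 := norm_add_le (qn n u - q u) (q u)
    rw [sub_add_cancel] at h4
    linarith [h1 u hu, hK u hu, min_le_left 1 (ε / (4 * E * (S + 1)))]) h1 hS ⟨htn n, h3.le⟩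
  rw [← hE] at this
  have h5 : ‖Yn n 0 - Y 0‖ * E ≤ ε / 4 := by
    calc ‖Yn n 0 - Y 0‖ * E ≤ ε / (4 * E) * E := by gcongr
      _ = ε / 4 := by field_simp
  nlinarith

end Jet

/-! ### Decaying solutions with a linear profile -/

section LinearProfile

variable {A B C : ℝ}

/-- The series `cubicSeries` along the real line `t ↦ d (t - c)`. -/
noncomputable def airyJet (A B C : ℝ) (d c : ℂ) (t : ℝ) : Fin 4 → ℂ :=
  ![cubicSeries A B C (d * (t - c)), d * cubicSeries1 A B C (d * (t - c)),
    d ^ 2 * cubicSeries2 A B C (d * (t - c)),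
    d ^ 3 * (d * (t - c) * cubicSeries1 A B C (d * (t - c)) - cubicSeries A B C (d * (t - c)))]

lemma airyJet_isJet (A B C : ℝ) (d c : ℂ) :
    IsJet (fun t => d ^ 3 * (t - c)) (airyJet A B C d c) := by
  have hz : ∀ t : ℝ, HasDerivAt (fun s : ℝ => d * ((s : ℂ) - c)) d t := fun t => by
    simpa using ((hasDerivAt_id t).ofReal_comp.sub_const c).const_mul d
  have h0 := fun t : ℝ => (cubicSeries_hasDerivAt A B C (d * (t - c))).comp t (hz t)
  have h1 := fun t : ℝ => (cubicSeries1_hasDerivAt A B C (d * (t - c))).comp t (hz t)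
  have h2 := fun t : ℝ => (cubicSeries2_hasDerivAt A B C (d * (t - c))).comp t (hz t)
  refine isJet_iff.2 fun t => ⟨?_, ?_, ?_, ?_⟩
  · refine (h0 t).congr_deriv ?_
    simp [airyJet]; ring
  · refine ((h1 t).const_mul d).congr_deriv ?_
    simp [airyJet]; ring
  · refine ((h2 t).const_mul (d ^ 2)).congr_deriv ?_
    simp [airyJet]; ring
  · refine ((((hz t).mul (h1 t)).sub (h0 t)).const_mul (d ^ 3)).congr_deriv ?_
    simp [airyJet]; ring

/-- In the sector `|arg z| ≤ π / 3` the Airy function and its primitives decay. -/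
lemma IsAiryPrimitive.norm_le_of_sector (h : IsAiryPrimitive A B C) {z : ℂ} (h2 : 2 ≤ ‖z‖)
    (hz : ‖z‖ ≤ 2 * z.re) : ‖cubicSeries A B C z‖ ≤ 3 / √‖z‖ ∧ ‖cubicSeries1 A B C z‖ ≤ 3 / √‖z‖ ∧
      ‖cubicSeries2 A B C z‖ ≤ 2 := by
  obtain ⟨σ, hσ⟩ : ∃ σ : ℂ, σ = z ^ (1 / 2 : ℂ) := ⟨_, rfl⟩
  have hx0 : 0 ≤ σ.re := hσ ▸ re_cpow_half_nonneg z
  have hsq : σ ^ 2 = z := by rw [hσ]; exact cpow_half_sq z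
  have hn : σ.re ^ 2 + σ.im ^ 2 = ‖z‖ := by
    rw [← hsq, norm_pow, ← Complex.normSq_eq_norm_sq, Complex.normSq_apply]; ring
  have hre : σ.re ^ 2 - σ.im ^ 2 = z.re := by
    rw [← hsq, sq σ, Complex.mul_re]; ring
  have hx2 : 3 / 4 * ‖z‖ ≤ σ.re ^ 2 := by linarith
  have hx1 : 1 ≤ σ.re := by nlinarith
  have hxp : 0 < σ.re := by linarith
  have hexp : ‖Complex.exp (-(2 / 3 * σ ^ 3))‖ ≤ 1 := by
    rw [Complex.norm_exp, Real.exp_le_one_iff]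
    have : (σ ^ 3).re = σ.re * (σ.re ^ 2 - 3 * σ.im ^ 2) := by
      rw [pow_succ, hsq, Complex.mul_re, ← hsq, sq, Complex.mul_re, Complex.mul_im]; ring
    have h3 : (-(2 / 3 * σ ^ 3)).re = -(2 / 3 * (σ ^ 3).re) := by
      rw [Complex.neg_re, show (2 / 3 : ℂ) = ((2 / 3 : ℝ) : ℂ) by push_cast; rfl,
        Complex.re_ofReal_mul]
    rw [h3, this]
    have : 0 ≤ σ.re * (σ.re ^ 2 - 3 * σ.im ^ 2) := mul_nonneg hx0 (by linarith)
    linarith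
  have hpi : √(π / σ.re) ≤ 2 := by
    rw [Real.sqrt_le_left (by norm_num)]
    have : π / σ.re ≤ π := div_le_self Real.pi_pos.le hx1
    linarith [Real.pi_le_four]
  have hk : ∀ k : ℕ, ‖Complex.exp (-(2 / 3 * σ ^ 3)) * saddleIntegral (-k) σ‖ ≤
      1 / σ.re ^ k * 2 := fun k => by
    rw [norm_mul]
    calc _ ≤ 1 * ((1 / σ.re ^ k) * √(π / σ.re)) := by
          gcongr
          exact norm_saddleIntegral_neg_le hxp k
      _ ≤ _ := by rw [one_mul]; gcongr
  have hs : 0 < √‖z‖ := Real.sqrt_pos.2 (by linarith)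
  have hinv : 1 / σ.re * 2 ≤ 3 / √‖z‖ := by
    rw [div_mul_eq_mul_div, one_mul, div_le_div_iff₀ hxp hs]
    refine le_of_sq_le_sq ?_ (by positivity)
    rw [mul_pow, mul_pow, Real.sq_sqrt (norm_nonneg z)]
    linarith
  obtain ⟨e0, e1, e2⟩ := h σ hxp
  rw [hsq] at e0 e1 e2
  refine ⟨?_, ?_, ?_⟩
  · rw [e0]
    refine (hk 2).trans (le_trans ?_ hinv)
    gcongr
    exact le_self_pow₀ hx1 (by norm_num)
  · rw [e1, norm_neg]
    simpa using (hk 1).trans (le_trans (by simp) hinv)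
  · rw [e2]
    simpa using hk 0

/-- The number `l exp (i π / 6)`, whose cube is `i l ^ 3`. With it, `airyJet` solves the equation with
coefficient `i l ^ 3 (t - c)` along a ray on which the Airy function decays. -/
noncomputable def airyDir (l : ℝ) : ℂ := l * ((√3 / 2 : ℝ) + (1 / 2 : ℝ) * Complex.I)

lemma airyDir_cube (l : ℝ) : airyDir l ^ 3 = Complex.I * l ^ 3 := by
  have h3 := sqrt_three_sq
  have hI := Complex.I_sq
  unfold airyDir
  push_cast
  linear_combination (l : ℂ) ^ 3 * ((√3 : ℂ) / 8 + 3 / 8 * Complex.I) * h3 +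
    (l : ℂ) ^ 3 * (3 * (√3 : ℂ) / 8 + Complex.I / 8) * hI

lemma norm_airyDir {l : ℝ} (hl : 0 < l) : ‖airyDir l‖ = l := by
  have : ‖((√3 / 2 : ℝ) : ℂ) + (1 / 2 : ℝ) * Complex.I‖ = 1 := by
    rw [Complex.norm_add_mul_I, div_pow, Real.sq_sqrt (by norm_num)]
    norm_num
  rw [airyDir, norm_mul, this, mul_one, Complex.norm_real, Real.norm_of_nonneg hl.le]

lemma airyDir_mul_re (l : ℝ) (w : ℂ) : (airyDir l * w).re = l * (√3 / 2 * w.re - w.im / 2) := by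
  rw [airyDir, mul_assoc, Complex.re_ofReal_mul]
  congr 1
  rw [Complex.mul_re]
  simp
  ring

/-- Along the chosen ray the series is far inside the sector of decay. -/
lemma eventually_airyDir_sector {l : ℝ} (hl : 0 < l) (c : ℂ) (R : ℝ) :
    ∀ᶠ t : ℝ in atTop, R ≤ ‖airyDir l * (t - c)‖ ∧
      ‖airyDir l * (t - c)‖ ≤ 2 * (airyDir l * (t - c)).re := by
  filter_upwards [eventually_ge_atTop (‖c‖ + |R| / l), eventually_ge_atTop (8 * ‖c‖)] with t h1 h2
  rw [norm_mul, norm_airyDir hl, airyDir_mul_re]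
  have hn0 := norm_nonneg c
  have ht : 0 ≤ t := by linarith
  have hc1 := abs_le.1 (Complex.abs_re_le_norm c)
  have hc2 := abs_le.1 (Complex.abs_im_le_norm c)
  have hs : 1.7 ≤ √3 := Real.le_sqrt_of_sq_le (by norm_num)
  have hs2 : √3 ≤ 2 := Real.sqrt_le_left (by norm_num) |>.2 (by norm_num)
  have hlow : t - ‖c‖ ≤ ‖(t : ℂ) - c‖ := by
    have := norm_sub_norm_le (t : ℂ) c
    rwa [Complex.norm_real, Real.norm_of_nonneg ht] at this
  have hup : ‖(t : ℂ) - c‖ ≤ t + ‖c‖ := by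
    have := norm_sub_le (t : ℂ) c
    rwa [Complex.norm_real, Real.norm_of_nonneg ht] at this
  constructor
  · have h3 : |R| / l ≤ ‖(t : ℂ) - c‖ := by linarith
    rw [div_le_iff₀ hl] at h3
    linarith [le_abs_self R]
  · have h3 : ‖(t : ℂ) - c‖ ≤ √3 * (t - c.re) + c.im := by
      nlinarith
    have h4 : 2 * (l * (√3 / 2 * ((t : ℂ) - c).re - ((t : ℂ) - c).im / 2)) =
        l * (√3 * (t - c.re) + c.im) := by
      simp; ring
    rw [h4]
    gcongr

/-- The Airy function and its derivative have no common zero. -/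
lemma IsAiryPrimitive.second_ne_zero (h : IsAiryPrimitive A B C) (z : ℂ)
    (h2 : cubicSeries2 A B C z = 0)
    (h3 : z * cubicSeries1 A B C z - cubicSeries A B C z = 0) : False := by
  have hC : 0 < C := by simpa [cubicSeries2_zero] using (h.sign le_rfl).2.2
  have hJ := airyJet_isJet A B C (-z) 1
  have hz : -z * ((0 : ℝ) - 1) = z := by push_cast; ring
  have ha := hJ.eq_affine (by fun_prop) (t₀ := 0)
    (by simp only [airyJet, hz, h2]; simp) (by simp only [airyJet, hz, h3]; simp) 1
  have h4 := congrFun ha 2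
  simp [airyJet, cubicSeries2_zero] at h4
  rcases h4 with h4 | h4
  · rw [h4, cubicSeries2_zero] at h2
    exact hC.ne' (by exact_mod_cast h2)
  · exact hC.ne' h4

/-- For a linear profile, a decaying solution has no zeros on the half line. -/
theorem decaying_jet_eq_zero {s κ : ℝ} (hs : 0 < s) (hκ : 0 < κ) {c : ℂ}
    (hc : 0 ≤ c.im ∨ c.re ≤ 0) {Y : ℝ → Fin 4 → ℂ}
    (hY : IsJet (fun t => Complex.I * s * (κ * t - c)) Y)
    (hdec : Tendsto (fun t : ℝ => (1 + t) * ‖Y t‖) atTop (𝓝 0)) {t₁ : ℝ} (ht₁ : 0 ≤ t₁)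
    (h1 : Y t₁ 0 = 0) (t : ℝ) : Y t = 0 := by
  obtain ⟨A, B, C, hA⟩ := exists_cubicSeries_eq_saddleIntegral
  replace hA : IsAiryPrimitive A B C := hA
  obtain ⟨l, hl, hl3⟩ : ∃ l : ℝ, 0 < l ∧ l ^ 3 = s * κ :=
    ⟨(s * κ) ^ ((3 : ℕ)⁻¹ : ℝ), by positivity, Real.rpow_inv_natCast_pow (by positivity) (by norm_num)⟩
  set c' : ℂ := c / κ with hc'
  have hκ' : (κ : ℂ) ≠ 0 := by exact_mod_cast hκ.ne'
  set G := airyJet A B C (airyDir l) c'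
  have hqc : Continuous fun t : ℝ => Complex.I * s * (κ * t - c) := by fun_prop
  have hG : IsJet (fun t => Complex.I * s * (κ * t - c)) G := by
    have := airyJet_isJet A B C (airyDir l) c'
    convert this using 2 with t
    rw [airyDir_cube, ← Complex.ofReal_pow, hl3, hc']
    push_cast
    field_simp
  have hd0 : airyDir l ≠ 0 := norm_pos_iff.1 (by rw [norm_airyDir hl]; exact hl)
  -- decay of the Airy solution
  have hnorm : Tendsto (fun t : ℝ => ‖airyDir l * ((t : ℂ) - c')‖) atTop atTop :=
    tendsto_atTop.2 fun R => (eventually_airyDir_sector hl c' R).mono fun t ht => ht.1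
  have hinv : Tendsto (fun t : ℝ => 3 / √‖airyDir l * ((t : ℂ) - c')‖) atTop (𝓝 0) :=
    (Real.tendsto_sqrt_atTop.comp hnorm).const_div_atTop 3
  have hG0 : Tendsto (fun t => G t 0) atTop (𝓝 0) := by
    refine squeeze_zero_norm' ?_ hinv
    filter_upwards [eventually_airyDir_sector hl c' 2] with t ht
    exact (hA.norm_le_of_sector ht.1 ht.2).1
  have hG1 : Tendsto (fun t => G t 1) atTop (𝓝 0) := by
    have h2 : Tendsto (fun t : ℝ => cubicSeries1 A B C (airyDir l * ((t : ℂ) - c'))) atTop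
        (𝓝 0) := by
      refine squeeze_zero_norm' ?_ hinv
      filter_upwards [eventually_airyDir_sector hl c' 2] with t ht
      exact (hA.norm_le_of_sector ht.1 ht.2).2.1
    simpa [G, airyJet] using h2.const_mul (airyDir l)
  have hYn : ∀ i, Tendsto (fun t => Y t i) atTop (𝓝 0) := fun i => by
    refine squeeze_zero_norm' ?_ hdec
    filter_upwards [eventually_ge_atTop 0] with t ht
    have := norm_le_pi_norm (Y t) i
    nlinarith [norm_nonneg (Y t)]
  -- the Wronskian of the two second derivatives
  have hW : ∀ t, Y t 2 * G t 3 - Y t 3 * G t 2 = 0 := by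
    have hder : ∀ t, HasDerivAt (fun t => Y t 2 * G t 3 - Y t 3 * G t 2) 0 t := fun t => by
      have := ((hY.hasDerivAt_two t).mul (hG.hasDerivAt_three t)).sub
        ((hY.hasDerivAt_three t).mul (hG.hasDerivAt_two t))
      refine this.congr_deriv ?_
      ring
    have hconst : ∀ t, Y t 2 * G t 3 - Y t 3 * G t 2 = Y 0 2 * G 0 3 - Y 0 3 * G 0 2 := fun t =>
      is_const_of_deriv_eq_zero (fun t => (hder t).differentiableAt) (fun t => (hder t).deriv) t 0
    have hlim : Tendsto (fun t => Y t 2 * G t 3 - Y t 3 * G t 2) atTop (𝓝 0) := by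
      set R := (2 * l ^ 2 + l ^ 3 * (3 * l * (1 + ‖c'‖) + 3))
      have hR : Tendsto (fun t => R * ((1 + t) * ‖Y t‖)) atTop (𝓝 0) := by
        simpa using hdec.const_mul R
      refine squeeze_zero_norm' ?_ hR
      filter_upwards [eventually_airyDir_sector hl c' 2, eventually_ge_atTop 0] with t ht ht0
      obtain ⟨b0, b1, b2⟩ := hA.norm_le_of_sector ht.1 ht.2
      set z := airyDir l * ((t : ℂ) - c') with hz
      have hsq : 3 / √‖z‖ ≤ 3 := div_le_self (by norm_num) (Real.one_le_sqrt.2 (by linarith [ht.1]))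
      have hzn : ‖z‖ ≤ l * (t + ‖c'‖) := by
        rw [hz, norm_mul, norm_airyDir hl]
        gcongr
        refine (norm_sub_le _ _).trans ?_
        rw [Complex.norm_real, Real.norm_of_nonneg ht0]
      have g2 : ‖G t 2‖ ≤ l ^ 2 * 2 := by
        change ‖airyDir l ^ 2 * cubicSeries2 A B C z‖ ≤ _
        rw [norm_mul, norm_pow, norm_airyDir hl]
        gcongr
      have g3 : ‖G t 3‖ ≤ l ^ 3 * (l * (t + ‖c'‖) * 3 + 3) := by
        change ‖airyDir l ^ 3 * (z * cubicSeries1 A B C z - cubicSeries A B C z)‖ ≤ _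
        rw [norm_mul, norm_pow, norm_airyDir hl]
        gcongr
        refine (norm_sub_le _ _).trans ?_
        rw [norm_mul]
        gcongr
        · linarith
        · linarith
      have y2 := norm_le_pi_norm (Y t) 2
      have y3 := norm_le_pi_norm (Y t) 3
      calc ‖Y t 2 * G t 3 - Y t 3 * G t 2‖ ≤ ‖Y t 2‖ * ‖G t 3‖ + ‖Y t 3‖ * ‖G t 2‖ := by
            rw [← norm_mul, ← norm_mul]; exact norm_sub_le _ _
        _ ≤ ‖Y t‖ * (l ^ 3 * (l * (t + ‖c'‖) * 3 + 3)) + ‖Y t‖ * (l ^ 2 * 2) := by gcongr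
        _ = (l ^ 3 * (l * (t + ‖c'‖) * 3 + 3) + l ^ 2 * 2) * ‖Y t‖ := by ring
        _ ≤ (R * (1 + t)) * ‖Y t‖ := by
          gcongr
          have e1 : 0 ≤ l ^ 2 * t := by positivity
          have e2 : 0 ≤ l ^ 3 * l * (t * ‖c'‖) := by positivity
          have e3 : 0 ≤ l ^ 3 * l := by positivity
          have e4 : 0 ≤ l ^ 3 * t := by positivity
          simp only [R]
          nlinarith
        _ = _ := by ring
    intro t
    have h2 := tendsto_nhds_unique (hlim.congr hconst) tendsto_const_nhds
    rw [hconst t, ← h2]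
  -- hence the two solutions differ by an affine function, which is zero by decay
  obtain ⟨k, hk2, hk3⟩ : ∃ k : ℂ, Y 0 2 = k * G 0 2 ∧ Y 0 3 = k * G 0 3 := by
    have h0 := hW 0
    by_cases g2 : G 0 2 = 0
    · have g3 : G 0 3 ≠ 0 := fun g3 => by
        have e2 : airyDir l ^ 2 * cubicSeries2 A B C (airyDir l * ((0 : ℝ) - c')) = 0 := g2
        have e3 : airyDir l ^ 3 * (airyDir l * ((0 : ℝ) - c') *
          cubicSeries1 A B C (airyDir l * ((0 : ℝ) - c')) -
            cubicSeries A B C (airyDir l * ((0 : ℝ) - c'))) = 0 := g3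
        exact hA.second_ne_zero _ ((mul_eq_zero.1 e2).resolve_left (pow_ne_zero _ hd0))
          ((mul_eq_zero.1 e3).resolve_left (pow_ne_zero _ hd0))
      refine ⟨Y 0 3 / G 0 3, ?_, by field_simp⟩
      rw [g2, mul_zero, sub_zero] at h0
      rw [g2, mul_zero, (mul_eq_zero.1 h0).resolve_right g3]
    · refine ⟨Y 0 2 / G 0 2, by field_simp, ?_⟩
      field_simp
      linear_combination -h0
  have hZ := hY.add (hG.const_smul (-k))
  have haff := hZ.eq_affine hqc (t₀ := 0) (by simp [hk2]) (by simp [hk3])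
  set a := Y 0 0 + (-k) * G 0 0
  set b := Y 0 1 + (-k) * G 0 1
  have hb1 : ∀ t, Y t 1 + (-k) * G t 1 = b := fun t => congrFun (haff t) 1
  have ha1 : ∀ t : ℝ, Y t 0 + (-k) * G t 0 = a + b * (t - 0 : ℝ) := fun t => congrFun (haff t) 0
  have hb : b = 0 := by
    have := (hYn 1).add (hG1.const_mul (-k))
    simp only [hb1, mul_zero, add_zero] at this
    exact tendsto_nhds_unique tendsto_const_nhds this
  have ha : a = 0 := by
    have := (hYn 0).add (hG0.const_mul (-k))
    simp only [ha1, hb, zero_mul, mul_zero, add_zero] at this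
    exact tendsto_nhds_unique tendsto_const_nhds this
  have hYG : ∀ t, Y t = k • G t := fun t => by
    have e : Y t + -k • G t = 0 := by
      rw [haff t]
      ext i
      fin_cases i
      · change a + b * _ = 0
        rw [ha, hb]; simp
      · exact hb
      · rfl
      · rfl
    rw [neg_smul, ← sub_eq_add_neg, sub_eq_zero] at e
    exact e
  -- the zero of `Y` lies in the zero-free sector of the Airy primitive
  have hf : G t₁ 0 ≠ 0 := by
    refine hA.ne_zero ?_
    rw [norm_mul, norm_airyDir hl, airyDir_mul_re]
    set w : ℂ := (t₁ : ℂ) - c'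
    have hcre : c'.re = c.re / κ := Complex.div_ofReal_re _ _
    have hcim : c'.im = c.im / κ := Complex.div_ofReal_im _ _
    have hw : w.im ≤ 0 ∨ 0 ≤ w.re := by
      rcases hc with hc | hc
      · left
        have : 0 ≤ c.im / κ := by positivity
        simp [w, hcim, this]
      · right
        have : c.re / κ ≤ 0 := div_nonpos_of_nonpos_of_nonneg hc hκ.le
        simp only [w, Complex.sub_re, Complex.ofReal_re, hcre]
        linarith
    have hs : √3 ≤ 1.74 := Real.sqrt_le_left (by norm_num) |>.2 (by norm_num)
    have hs0 := Real.sqrt_nonneg 3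
    have hr := abs_le.1 (Complex.abs_re_le_norm w)
    have hi := abs_le.1 (Complex.abs_im_le_norm w)
    have hn := norm_nonneg w
    have key : -(0.87 * ‖w‖) ≤ √3 / 2 * w.re - w.im / 2 := by
      rcases hw with hw | hw
      · nlinarith
      · nlinarith
    calc -(0.87 * (l * ‖w‖)) = l * -(0.87 * ‖w‖) := by ring
      _ ≤ _ := by gcongr
  have hk : k = 0 := by
    have := congrFun (hYG t₁) 0
    rw [h1, Pi.smul_apply, smul_eq_mul] at this
    exact (mul_eq_zero.1 this.symm).resolve_right hf
  rw [hYG t, hk, zero_smul]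

end LinearProfile

end OrrSommerfeld

namespace OrrSommerfeld

open Set Filter Topology MeasureTheory

open scoped Real

/-! ### WKB expansions with a large parameter -/

lemma inner_mul_self (D y : ℂ) : inner ℝ y (D * y) = D.re * ‖y‖ ^ 2 := by
  rw [Complex.inner, ← Complex.normSq_eq_norm_sq, Complex.normSq_apply]
  simp
  ring

/-- A barrier for a pair `(x, y)` of linear equations: where `y` is damped with respect to `x`,
the cone `‖y‖ ≤ Γ ‖x‖` is invariant. The sign `s` is the direction of time. -/
lemma cone_invariant {s u T Γ : ℝ} (hs : s = 1 ∨ s = -1) (hΓ : 0 < Γ) {x y c d w f : ℝ → ℂ}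
    (hx : ∀ τ ∈ Icc 0 T, HasDerivAt x (c (u + s * τ) * x (u + s * τ) +
      w (u + s * τ) * y (u + s * τ)) (u + s * τ))
    (hy : ∀ τ ∈ Icc 0 T, HasDerivAt y (d (u + s * τ) * y (u + s * τ) + f (u + s * τ)) (u + s * τ))
    (hne : ∀ τ ∈ Icc 0 T, x (u + s * τ) = 0 → y (u + s * τ) ≠ 0)
    (hf : ∀ τ ∈ Icc 0 T, ‖y (u + s * τ)‖ = Γ * ‖x (u + s * τ)‖ →
      ‖f (u + s * τ)‖ < (Γ * (s * ((c (u + s * τ)).re - (d (u + s * τ)).re)) -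
        Γ ^ 2 * ‖w (u + s * τ)‖) * ‖x (u + s * τ)‖ ∨ x (u + s * τ) = 0)
    (h0 : ‖y u‖ ≤ Γ * ‖x u‖) {τ : ℝ} (hτ : τ ∈ Icc 0 T) :
    ‖y (u + s * τ)‖ ≤ Γ * ‖x (u + s * τ)‖ := by
  have hlin : ∀ τ : ℝ, HasDerivAt (fun v : ℝ => u + s * v) s τ := fun τ => by
    simpa using ((hasDerivAt_id τ).const_mul s).const_add u
  have hx' : ∀ τ ∈ Icc 0 T, HasDerivAt (fun v => Γ ^ 2 * ‖x (u + s * v)‖ ^ 2)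
      (Γ ^ 2 * (2 * inner ℝ (x (u + s * τ)) (s • (c (u + s * τ) * x (u + s * τ) +
        w (u + s * τ) * y (u + s * τ))))) τ := fun τ hτ =>
    (((hx τ hτ).scomp τ (hlin τ)).norm_sq).const_mul _
  have hy' : ∀ τ ∈ Icc 0 T, HasDerivAt (fun v => ‖y (u + s * v)‖ ^ 2)
      (2 * inner ℝ (y (u + s * τ)) (s • (d (u + s * τ) * y (u + s * τ) + f (u + s * τ)))) τ :=
    fun τ hτ => ((hy τ hτ).scomp τ (hlin τ)).norm_sq
  have key := image_le_of_deriv_right_lt_deriv_boundary' (f := fun v => ‖y (u + s * v)‖ ^ 2)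
    (B := fun v => Γ ^ 2 * ‖x (u + s * v)‖ ^ 2) (a := 0) (b := T)
    (fun v hv => (hy' v hv).continuousAt.continuousWithinAt)
    (fun v hv => (hy' v (Ico_subset_Icc_self hv)).hasDerivWithinAt)
    (by
      simp only [mul_zero, add_zero]
      rw [← mul_pow]
      gcongr)
    (fun v hv => (hx' v hv).continuousAt.continuousWithinAt)
    (fun v hv => (hx' v (Ico_subset_Icc_self hv)).hasDerivWithinAt)
    (fun v hv heq => by
      have hv' := Ico_subset_Icc_self hv
      rw [← mul_pow] at heq
      have heq' : ‖y (u + s * v)‖ = Γ * ‖x (u + s * v)‖ :=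
        (pow_left_inj₀ (norm_nonneg _) (by positivity) (by norm_num)).1 heq
      have hfv := hf v hv' heq'
      have hnev := hne v hv'
      set X := x (u + s * v)
      set Y := y (u + s * v)
      set cc := c (u + s * v)
      set dd := d (u + s * v)
      set ww := w (u + s * v)
      set ff := f (u + s * v)
      have hX : X ≠ 0 := fun h => hnev h (norm_eq_zero.1 (by rw [heq', h, norm_zero, mul_zero]))
      have hXp : 0 < ‖X‖ := norm_pos_iff.2 hX
      rcases hfv with hfv | hfv
      swap
      · exact absurd hfv hX
      rw [real_inner_smul_right, real_inner_smul_right, inner_add_right, inner_add_right,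
        inner_mul_self, inner_mul_self]
      have hss : |s| = 1 := by rcases hs with h | h <;> simp [h]
      have i1 : |s * inner ℝ Y ff| ≤ ‖Y‖ * ‖ff‖ := by
        rw [abs_mul, hss, one_mul]; exact abs_real_inner_le_norm _ _
      have i2 : |s * inner ℝ X (ww * Y)| ≤ ‖X‖ * (‖ww‖ * ‖Y‖) := by
        rw [abs_mul, hss, one_mul, ← norm_mul]; exact abs_real_inner_le_norm _ _
      have i3 := (abs_le.1 i1).2
      have i4 := (abs_le.1 i2).1
      rw [heq'] at i3 i4 ⊢
      have i5 := mul_lt_mul_of_pos_left hfv (mul_pos hΓ hXp)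
      have i6 := mul_le_mul_of_nonneg_left i4 (sq_nonneg Γ)
      nlinarith [i5, i6, i3]) hτ
  have key' : ‖y (u + s * τ)‖ ^ 2 ≤ (Γ * ‖x (u + s * τ)‖) ^ 2 := by rw [mul_pow]; exact key
  exact le_of_sq_le_sq key' (by positivity)

/-- The function `m = q ^ (1/2)` is large and slowly varying on `[M, ∞)`, and its real part controls
its modulus; `p = m' / m` and `p'` is the derivative of `p`. -/
structure WKB (Q M : ℝ) (q m p p' : ℝ → ℂ) : Prop where
  one_le_M : 1 ≤ M
  one_le_Q : 1 ≤ Q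
  hasDerivAt_m : ∀ t, M ≤ t → HasDerivAt m (p t * m t) t
  hasDerivAt_p : ∀ t, M ≤ t → HasDerivAt p (p' t) t
  sq : ∀ t, M ≤ t → m t ^ 2 = q t
  norm_p : ∀ t, M ≤ t → ‖p t‖ ≤ Q / t
  norm_third : ∀ t, M ≤ t → ‖p' t / 2 - p t ^ 2 / 4‖ ≤ Q / t ^ 2
  norm_first : ∀ t, M ≤ t → ‖5 / 2 * (p' t - p t ^ 2)‖ ≤ Q / t ^ 2
  /-- The constant is just below `sin (π / 8)`: the values of `q` lie in the quadrant around `i`. -/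
  re : ∀ t, M ≤ t → 0.38 * ‖m t‖ ≤ (m t).re
  large : ∀ t, M ≤ t → 10000 * Q ≤ t * ‖m t‖
  one_le : ∀ t, M ≤ t → 1 ≤ ‖m t‖

/-- The defects `Y_{k+1} - (s m - γ m' / m) Y_k`, for `(k, γ) = (0, 5/2), (1, 3/2), (2, 1/2)`, of the
WKB expansion with sign `s = ± 1` are small at the point `t`. The bound for each defect is five times
the size `A` of the forcing in its equation: `A = Q` for `k = 2`, and then `A = 2 * 5 Q + Q` and
`A = 2 * 55 Q + Q`, where the defect of the next component adds to the forcing. -/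
def IsWKBAt (Q s : ℝ) (m p : ℝ → ℂ) (Y : ℝ → Fin 4 → ℂ) (t : ℝ) : Prop :=
  t ^ 2 * ‖m t‖ * ‖Y t 3 - (s * m t - 1 / 2 * p t) * Y t 2‖ ≤ 5 * Q * ‖Y t 2‖ ∧
  t ^ 2 * ‖m t‖ * ‖Y t 2 - (s * m t - 3 / 2 * p t) * Y t 1‖ ≤ 55 * Q * ‖Y t 1‖ ∧
  t ^ 2 * ‖m t‖ * ‖Y t 1 - (s * m t - 5 / 2 * p t) * Y t 0‖ ≤ 555 * Q * ‖Y t 0‖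

section WKB

variable {Q M s : ℝ} {q m p p' : ℝ → ℂ} {Y : ℝ → Fin 4 → ℂ}

lemma WKB.pos (h : WKB Q M q m p p') {t : ℝ} (ht : M ≤ t) : 0 < t := by
  linarith [h.one_le_M]

lemma WKB.div_le (h : WKB Q M q m p p') {t : ℝ} (ht : M ≤ t) : Q / t ≤ ‖m t‖ / 10000 := by
  have := h.large t ht
  have ht0 := h.pos ht
  rw [div_le_div_iff₀ ht0 (by norm_num)]
  linarith

/-- One step of the argument: the defect `e` of the equation `x' = (s m - γ p) x + e` stays
controlled by `x`, in the direction of time in which `x` grows. -/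
lemma WKB.defect_le (h : WKB Q M q m p p') {u T A γ : ℝ} (hs : s = 1 ∨ s = -1)
    (hM : ∀ τ ∈ Icc 0 T, M ≤ u + s * τ) (hA : 0 < A) (hAQ : A ≤ 120 * Q) (hγ0 : 0 ≤ γ)
    (hγ : γ ≤ 5 / 2) {x e d g : ℝ → ℂ}
    (hx : ∀ t, M ≤ t → HasDerivAt x ((s * m t - γ * p t) * x t + e t) t)
    (he : ∀ t, M ≤ t → HasDerivAt e (d t * e t + g t) t)
    (hd : ∀ t, M ≤ t → s * (d t).re ≤ ‖p t‖)
    (hg : ∀ τ ∈ Icc 0 T, (u + s * τ) ^ 2 * ‖m (u + s * τ)‖ * ‖e (u + s * τ)‖ =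
      5 * A * ‖x (u + s * τ)‖ → (u + s * τ) ^ 2 * ‖g (u + s * τ)‖ ≤ A * ‖x (u + s * τ)‖)
    (hne : ∀ τ ∈ Icc 0 T, x (u + s * τ) = 0 → e (u + s * τ) ≠ 0)
    (h0 : u ^ 2 * ‖m u‖ * ‖e u‖ ≤ 5 * A * ‖x u‖) {τ : ℝ} (hτ : τ ∈ Icc 0 T) :
    (u + s * τ) ^ 2 * ‖m (u + s * τ)‖ * ‖e (u + s * τ)‖ ≤ 5 * A * ‖x (u + s * τ)‖ := by
  have hmne : ∀ t, M ≤ t → m t ≠ 0 := fun t ht => norm_pos_iff.1 (by linarith [h.one_le t ht])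
  have hnorm : ∀ t : ℝ, ‖(t : ℂ) ^ 2 * m t * e t‖ = t ^ 2 * ‖m t‖ * ‖e t‖ := fun t => by
    rw [norm_mul, norm_mul, norm_pow, Complex.norm_real, Real.norm_eq_abs, sq_abs]
  have key := cone_invariant (Γ := 5 * A) (T := T) (u := u) hs (by positivity) (x := x)
    (y := fun t => (t : ℂ) ^ 2 * m t * e t) (c := fun t => s * m t - γ * p t)
    (w := fun t => 1 / ((t : ℂ) ^ 2 * m t)) (d := fun t => 2 / t + p t + d t)
    (f := fun t => (t : ℂ) ^ 2 * m t * g t)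
    (fun τ hτ => by
      refine (hx _ (hM τ hτ)).congr_deriv ?_
      have h1 := hmne _ (hM τ hτ)
      have h2 : ((u + s * τ : ℝ) : ℂ) ≠ 0 := by exact_mod_cast (h.pos (hM τ hτ)).ne'
      field_simp)
    (fun τ hτ => by
      have h1 := hmne _ (hM τ hτ)
      have h2 : ((u + s * τ : ℝ) : ℂ) ≠ 0 := by exact_mod_cast (h.pos (hM τ hτ)).ne'
      have h3 := (hasDerivAt_id (u + s * τ)).ofReal_comp
      refine (((h3.pow 2).mul (h.hasDerivAt_m _ (hM τ hτ))).mul (he _ (hM τ hτ))).congr_deriv ?_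
      simp only [id, Pi.pow_apply, Pi.mul_apply]
      field_simp
      push_cast
      ring)
    (fun τ hτ hx0 hy0 => by
      have h1 := hmne _ (hM τ hτ)
      have h2 : ((u + s * τ : ℝ) : ℂ) ≠ 0 := by exact_mod_cast (h.pos (hM τ hτ)).ne'
      exact hne τ hτ hx0 ((mul_eq_zero.1 hy0).resolve_left (mul_ne_zero (pow_ne_zero _ h2) h1)))
    (fun τ hτ heq => by
      have ht := hM τ hτ
      have hgt := hg τ hτ (by rw [← hnorm]; exact heq)
      have hdt := hd _ ht
      set t := u + s * τ
      by_cases hX : x t = 0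
      · exact Or.inr hX
      left
      have hXp : 0 < ‖x t‖ := norm_pos_iff.2 hX
      have ht0 := h.pos ht
      have ht1 : 1 ≤ t := h.one_le_M.trans ht
      have hm1 := h.one_le t ht
      have hp := (h.norm_p t ht).trans (h.div_le ht)
      have h2t : 2 / t ≤ 2 * (‖m t‖ / 10000) := by
        have := h.div_le ht
        have hQ : 1 / t ≤ Q / t := by gcongr; exact h.one_le_Q
        have : 2 / t = 2 * (1 / t) := by ring
        linarith
      have h2t0 : 0 < 2 / t := by positivity
      have hss : |s| = 1 := by rcases hs with h | h <;> simp [h]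
      have hsp : |s * (p t).re| ≤ ‖p t‖ := by
        rw [abs_mul, hss, one_mul]; exact Complex.abs_re_le_norm _
      have hsp' := abs_le.1 hsp
      have hs2 : s * s = 1 := by rcases hs with h | h <;> simp [h]
      have hs1 : s ≤ 1 := by rcases hs with h | h <;> simp [h]
      have hc : ((s : ℂ) * m t - γ * p t).re = s * (m t).re - γ * (p t).re := by
        simp
      have hd' : (2 / (t : ℂ) + p t + d t).re = 2 / t + (p t).re + (d t).re := by
        rw [show (2 / (t : ℂ)) = ((2 / t : ℝ) : ℂ) by push_cast; rfl]
        simp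
      have hgap : 0.37 * ‖m t‖ ≤ s * (((s : ℂ) * m t - γ * p t).re - (2 / (t : ℂ) + p t + d t).re) := by
        rw [hc, hd']
        have e1 : s * (s * (m t).re - γ * (p t).re - (2 / t + (p t).re + (d t).re)) =
          (s * s) * (m t).re - γ * (s * (p t).re) - s * (2 / t) - s * (p t).re - s * (d t).re := by
          ring
        rw [e1, hs2]
        have e2 : γ * (s * (p t).re) ≤ 5 / 2 * ‖p t‖ :=
          (mul_le_mul_of_nonneg_left hsp'.2 hγ0).trans
            (mul_le_mul_of_nonneg_right hγ (norm_nonneg _))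
        have e3 : s * (2 / t) ≤ 2 / t := by nlinarith
        linarith [h.re t ht]
      have hw : 5 * A * ‖1 / ((t : ℂ) ^ 2 * m t)‖ ≤ 0.06 := by
        rw [norm_div, norm_one, norm_mul, norm_pow, Complex.norm_real, Real.norm_of_nonneg ht0.le,
          mul_one_div, div_le_iff₀ (by positivity)]
        have hl := h.large t ht
        have : t * ‖m t‖ ≤ t ^ 2 * ‖m t‖ := by gcongr; nlinarith
        nlinarith
      have hfn : ‖(t : ℂ) ^ 2 * m t * g t‖ ≤ A * ‖m t‖ * ‖x t‖ := by
        rw [norm_mul, norm_mul, norm_pow, Complex.norm_real, Real.norm_eq_abs, sq_abs]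
        nlinarith
      refine hfn.trans_lt ?_
      gcongr
      have e4 := mul_le_mul_of_nonneg_left hgap (by positivity : 0 ≤ 5 * A)
      have e5 := mul_le_mul_of_nonneg_left hw (by positivity : 0 ≤ 5 * A)
      nlinarith [mul_pos hA (by linarith : 0 < ‖m t‖), mul_le_mul_of_nonneg_left hm1 hA.le])
    (by rw [hnorm]; exact h0) hτ
  rwa [hnorm] at key

/-- The WKB expansion with sign `s` propagates in the direction of time `s`. -/
theorem WKB.propagate (h : WKB Q M q m p p') (hs : s = 1 ∨ s = -1) (hq : Continuous q)
    (hY : IsJet q Y) {u T : ℝ} (hM : ∀ τ ∈ Icc 0 T, M ≤ u + s * τ)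
    (hu : IsWKBAt Q s m p Y u) (hne : Y u 0 ≠ 0 ∧ Y u 1 ≠ 0 ∧ Y u 2 ≠ 0) {τ : ℝ} (hτ : τ ∈ Icc 0 T) :
    IsWKBAt Q s m p Y (u + s * τ) := by
  have hQ := h.one_le_Q
  have hss : |s| = 1 := by rcases hs with h | h <;> simp [h]
  have hs2 : s * s = 1 := by rcases hs with h | h <;> simp [h]
  have hs2' : (s : ℂ) * s = 1 := by exact_mod_cast hs2
  have hsp : ∀ z : ℂ, s * z.re ≤ ‖z‖ := fun z => by
    have := abs_le.1 (Complex.abs_re_le_norm z)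
    rcases hs with h | h <;> rw [h] <;> linarith
  have hm' : ∀ t, M ≤ t → HasDerivAt (fun t => (s : ℂ) * m t) (s * (p t * m t)) t := fun t ht =>
    (h.hasDerivAt_m t ht).const_mul _
  have hp' : ∀ (γ : ℂ) t, M ≤ t → HasDerivAt (fun t => γ * p t) (γ * p' t) t := fun γ t ht =>
    (h.hasDerivAt_p t ht).const_mul _
  have hmQ : ∀ t, M ≤ t → 10000 * Q ≤ t ^ 2 * ‖m t‖ := fun t ht => by
    have h1 := h.large t ht
    have h2 : 1 ≤ t := h.one_le_M.trans ht
    have : t * ‖m t‖ ≤ t ^ 2 * ‖m t‖ := by gcongr; nlinarith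
    linarith
  -- no common zero of the second and third components
  have hne' : ∀ t, Y t 2 = 0 → Y t 3 ≠ 0 := fun t h2 h3 =>
    hne.2.2 (congrFun (hY.eq_affine hq h2 h3 u) 2)
  have hz : ∀ {t : ℝ} {x e : ℂ} {R : ℝ}, M ≤ t → t ^ 2 * ‖m t‖ * ‖e‖ ≤ R * ‖x‖ → x = 0 → e = 0 := by
    intro t x e R ht hle hx
    rw [hx, norm_zero, mul_zero] at hle
    have := hmQ t ht
    have h3 : ‖e‖ ≤ 0 := by
      by_contra! hc
      nlinarith
    exact norm_le_zero_iff.1 h3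
  have step3 : ∀ τ ∈ Icc 0 T, (u + s * τ) ^ 2 * ‖m (u + s * τ)‖ * ‖Y (u + s * τ) 3 -
      (s * m (u + s * τ) - 1 / 2 * p (u + s * τ)) * Y (u + s * τ) 2‖ ≤
      5 * Q * ‖Y (u + s * τ) 2‖ := by
    intro τ hτ
    refine h.defect_le (A := Q) (γ := 1 / 2) hs hM (by linarith) (by linarith) (by norm_num)
      (by norm_num) (x := fun t => Y t 2)
      (e := fun t => Y t 3 - (s * m t - 1 / 2 * p t) * Y t 2)
      (d := fun t => -(s * m t - 1 / 2 * p t)) (g := fun t => (p' t / 2 - p t ^ 2 / 4) * Y t 2)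
      (fun t _ => ?_) (fun t ht => ?_) (fun t ht => ?_) (fun τ hτ _ => ?_) (fun τ hτ hx he => ?_)
      hu.1 hτ
    · refine (hY.hasDerivAt_two t).congr_deriv ?_
      push_cast
      ring
    · refine ((hY.hasDerivAt_three t).sub (((hm' t ht).sub (hp' (1 / 2) t ht)).mul
        (hY.hasDerivAt_two t))).congr_deriv ?_
      rw [← h.sq t ht]
      simp only [Pi.sub_apply]
      linear_combination (-m t ^ 2 * Y t 2) * hs2'
    · have e1 : s * (-((s : ℂ) * m t - 1 / 2 * p t)).re = -((s * s) * (m t).re) +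
          s * (1 / 2 * p t).re := by
        simp only [Complex.neg_re, Complex.sub_re, Complex.re_ofReal_mul]; ring
      rw [e1, hs2]
      have := hsp (1 / 2 * p t)
      rw [norm_mul] at this
      norm_num at this ⊢
      nlinarith [h.re t ht, norm_nonneg (m t), norm_nonneg (p t)]
    · have ht := hM τ hτ
      set t := u + s * τ
      have h1 := h.norm_third t ht
      have ht0 := h.pos ht
      rw [le_div_iff₀ (by positivity)] at h1
      rw [norm_mul]
      nlinarith [norm_nonneg (Y t 2)]
    · have e : Y (u + s * τ) 3 = 0 := by
        simpa [show Y (u + s * τ) 2 = 0 from hx] using he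
      exact hne' _ hx e
  have hY2 : ∀ τ ∈ Icc 0 T, Y (u + s * τ) 2 ≠ 0 := fun τ hτ h2 => by
    have := hz (hM τ hτ) (step3 τ hτ) h2
    rw [h2, mul_zero, sub_zero] at this
    exact hne' _ h2 this
  -- a component is bounded by the preceding one as long as its defect is small
  have hnext : ∀ {t : ℝ} {x y : ℂ} {γ R : ℝ}, M ≤ t → 0 ≤ γ → γ ≤ 5 / 2 → R ≤ 600 * Q →
      t ^ 2 * ‖m t‖ * ‖y - (s * m t - γ * p t) * x‖ ≤ R * ‖x‖ → ‖y‖ ≤ 2 * (‖m t‖ * ‖x‖) := by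
    intro t x y γ R ht hγ0 hγ hR hle
    have e1 : ‖y‖ ≤ ‖(s * m t - γ * p t) * x‖ + ‖y - (s * m t - γ * p t) * x‖ := by
      have := norm_add_le ((s * m t - γ * p t) * x) (y - (s * m t - γ * p t) * x)
      rwa [add_sub_cancel] at this
    have e2 : ‖(s : ℂ) * m t - γ * p t‖ ≤ 1.1 * ‖m t‖ := by
      refine (norm_sub_le _ _).trans ?_
      rw [norm_mul, norm_mul, Complex.norm_real, Complex.norm_real, Real.norm_eq_abs,
        Real.norm_eq_abs, hss, abs_of_nonneg hγ0]
      have := (h.norm_p t ht).trans (h.div_le ht)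
      nlinarith [norm_nonneg (p t)]
    have e3 : ‖y - (s * m t - γ * p t) * x‖ ≤ 0.06 * ‖x‖ := by
      have h1 := hmQ t ht
      have h2 := norm_nonneg (y - (s * m t - γ * p t) * x)
      have h3 := norm_nonneg x
      have h4 : 10000 * Q * ‖y - (s * m t - γ * p t) * x‖ ≤ 600 * Q * ‖x‖ :=
        (mul_le_mul_of_nonneg_right h1 h2).trans (hle.trans (by gcongr))
      nlinarith
    rw [norm_mul] at e1
    have h1 := h.one_le t ht
    nlinarith [norm_nonneg x, mul_le_mul_of_nonneg_right e2 (norm_nonneg x),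
      mul_le_mul_of_nonneg_right h1 (norm_nonneg x)]
  have step2 : ∀ τ ∈ Icc 0 T, (u + s * τ) ^ 2 * ‖m (u + s * τ)‖ * ‖Y (u + s * τ) 2 -
      (s * m (u + s * τ) - 3 / 2 * p (u + s * τ)) * Y (u + s * τ) 1‖ ≤
      55 * Q * ‖Y (u + s * τ) 1‖ := by
    intro τ hτ
    rw [show 55 * Q = 5 * (11 * Q) by ring]
    refine h.defect_le (A := 11 * Q) (γ := 3 / 2) hs hM (by linarith) (by linarith) (by norm_num)
      (by norm_num) (x := fun t => Y t 1)
      (e := fun t => Y t 2 - (s * m t - 3 / 2 * p t) * Y t 1)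
      (d := p) (g := fun t => (Y t 3 - (s * m t - 1 / 2 * p t) * Y t 2) +
        3 / 5 * (5 / 2 * (p' t - p t ^ 2)) * Y t 1)
      (fun t _ => ?_) (fun t ht => ?_) (fun t ht => hsp _) (fun τ hτ heq => ?_)
      (fun τ hτ hx he => ?_) (by linarith [hu.2.1]) hτ
    · refine (hY.hasDerivAt_one t).congr_deriv ?_
      push_cast
      ring
    · refine ((hY.hasDerivAt_two t).sub (((hm' t ht).sub (hp' (3 / 2) t ht)).mul
        (hY.hasDerivAt_one t))).congr_deriv ?_
      simp only [Pi.sub_apply]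
      ring
    · have ht := hM τ hτ
      have h3 := step3 τ hτ
      set t := u + s * τ
      have h1 := h.norm_first t ht
      have ht0 := h.pos ht
      have hm1 := h.one_le t ht
      rw [le_div_iff₀ (by positivity)] at h1
      have h4 : ‖Y t 2‖ ≤ 2 * (‖m t‖ * ‖Y t 1‖) :=
        hnext (γ := 3 / 2) (R := 5 * (11 * Q)) ht (by norm_num) (by norm_num) (by linarith)
          (le_of_eq (by push_cast; exact heq))
      have h5 : t ^ 2 * ‖Y t 3 - (s * m t - 1 / 2 * p t) * Y t 2‖ ≤ 10 * Q * ‖Y t 1‖ := by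
        have : ‖m t‖ * (t ^ 2 * ‖Y t 3 - (s * m t - 1 / 2 * p t) * Y t 2‖) ≤
            ‖m t‖ * (10 * Q * ‖Y t 1‖) := by nlinarith
        exact le_of_mul_le_mul_left this (by linarith)
      calc t ^ 2 * ‖_‖ ≤ t ^ 2 * (‖Y t 3 - (s * m t - 1 / 2 * p t) * Y t 2‖ +
            3 / 5 * ‖5 / 2 * (p' t - p t ^ 2)‖ * ‖Y t 1‖) := by
            gcongr
            refine (norm_add_le _ _).trans (add_le_add le_rfl (le_of_eq ?_))
            rw [norm_mul, norm_mul]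
            norm_num
        _ ≤ 11 * Q * ‖Y t 1‖ := by nlinarith [norm_nonneg (Y t 1)]
    · have e : Y (u + s * τ) 2 = 0 := by
        simpa [show Y (u + s * τ) 1 = 0 from hx] using he
      exact hY2 τ hτ e
  have hY1 : ∀ τ ∈ Icc 0 T, Y (u + s * τ) 1 ≠ 0 := fun τ hτ h2 => by
    have := hz (hM τ hτ) (step2 τ hτ) h2
    rw [h2, mul_zero, sub_zero] at this
    exact hY2 τ hτ this
  refine ⟨step3 τ hτ, step2 τ hτ, ?_⟩
  rw [show 555 * Q = 5 * (111 * Q) by ring]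
  refine h.defect_le (A := 111 * Q) (γ := 5 / 2) hs hM (by linarith) (by linarith) (by norm_num)
    (by norm_num) (x := fun t => Y t 0)
    (e := fun t => Y t 1 - (s * m t - 5 / 2 * p t) * Y t 0)
    (d := p) (g := fun t => (Y t 2 - (s * m t - 3 / 2 * p t) * Y t 1) +
      5 / 2 * (p' t - p t ^ 2) * Y t 0)
    (fun t _ => ?_) (fun t ht => ?_) (fun t ht => hsp _) (fun τ hτ heq => ?_)
    (fun τ hτ hx he => ?_) (by linarith [hu.2.2]) hτ
  · refine (hY.hasDerivAt_zero t).congr_deriv ?_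
    push_cast
    ring
  · refine ((hY.hasDerivAt_one t).sub (((hm' t ht).sub (hp' (5 / 2) t ht)).mul
      (hY.hasDerivAt_zero t))).congr_deriv ?_
    simp only [Pi.sub_apply]
    ring
  · have ht := hM τ hτ
    have h3 := step2 τ hτ
    set t := u + s * τ
    have h1 := h.norm_first t ht
    have ht0 := h.pos ht
    have hm1 := h.one_le t ht
    rw [le_div_iff₀ (by positivity)] at h1
    have h4 : ‖Y t 1‖ ≤ 2 * (‖m t‖ * ‖Y t 0‖) :=
      hnext (γ := 5 / 2) (R := 5 * (111 * Q)) ht (by norm_num) (by norm_num) (by linarith)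
        (le_of_eq (by push_cast; exact heq))
    have h5 : t ^ 2 * ‖Y t 2 - (s * m t - 3 / 2 * p t) * Y t 1‖ ≤ 110 * Q * ‖Y t 0‖ := by
      have : ‖m t‖ * (t ^ 2 * ‖Y t 2 - (s * m t - 3 / 2 * p t) * Y t 1‖) ≤
          ‖m t‖ * (110 * Q * ‖Y t 0‖) := by nlinarith
      exact le_of_mul_le_mul_left this (by linarith)
    calc t ^ 2 * ‖_‖ ≤ t ^ 2 * (‖Y t 2 - (s * m t - 3 / 2 * p t) * Y t 1‖ +
          ‖5 / 2 * (p' t - p t ^ 2)‖ * ‖Y t 0‖) := by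
          gcongr
          refine (norm_add_le _ _).trans (add_le_add le_rfl (le_of_eq ?_))
          rw [norm_mul]
      _ ≤ 111 * Q * ‖Y t 0‖ := by nlinarith [norm_nonneg (Y t 0)]
  · have e : Y (u + s * τ) 1 = 0 := by
      simpa [show Y (u + s * τ) 0 = 0 from hx] using he
    exact hY1 τ hτ e

end WKB

end OrrSommerfeld

namespace OrrSommerfeld

open Set Filter Topology MeasureTheory

open scoped Real

section WKBConsequences

variable {Q M s : ℝ} {q m p p' : ℝ → ℂ} {Y : ℝ → Fin 4 → ℂ}

lemma WKB.sub_le_of_defect (h : WKB Q M q m p p') {t γ R : ℝ} (ht : M ≤ t) (hγ0 : 0 ≤ γ)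
    (hγ : γ ≤ 5 / 2) (hR : R ≤ 555 * Q) {x y n : ℂ}
    (hle : t ^ 2 * ‖m t‖ * ‖y - (n - γ * p t) * x‖ ≤ R * ‖x‖) :
    ‖y - n * x‖ ≤ 600 * Q / t * ‖x‖ := by
  have ht0 := h.pos ht
  have ht1 : 1 ≤ t := h.one_le_M.trans ht
  have hm := h.one_le t ht
  have hx := norm_nonneg x
  have e1 : t * ‖y - (n - γ * p t) * x‖ ≤ 555 * Q * ‖x‖ := by
    refine le_trans ?_ (hle.trans (mul_le_mul_of_nonneg_right hR hx))
    gcongr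
    calc t = t * 1 * 1 := by ring
      _ ≤ t * t * ‖m t‖ := by gcongr
      _ = _ := by ring
  have e2 : ‖y - n * x‖ ≤ ‖y - (n - γ * p t) * x‖ + γ * ‖p t‖ * ‖x‖ := by
    have := norm_sub_le (y - (n - γ * p t) * x) (γ * p t * x)
    rw [norm_mul, norm_mul, Complex.norm_real, Real.norm_of_nonneg hγ0] at this
    refine le_trans (le_of_eq ?_) this
    congr 1
    ring
  have e3 : t * ‖p t‖ ≤ Q := by
    have := h.norm_p t ht
    rw [le_div_iff₀ ht0] at this
    linarith
  have e4 : t * (γ * ‖p t‖ * ‖x‖) ≤ 5 / 2 * Q * ‖x‖ := by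
    calc t * (γ * ‖p t‖ * ‖x‖) = γ * (t * ‖p t‖) * ‖x‖ := by ring
      _ ≤ 5 / 2 * Q * ‖x‖ := by gcongr
  have hQ := h.one_le_Q
  rw [div_mul_eq_mul_div, le_div_iff₀ ht0]
  nlinarith

/-- The logarithmic derivatives are close to those of `exp (s ∫ m)`. -/
lemma WKB.sub_le (h : WKB Q M q m p p') {t : ℝ} (ht : M ≤ t) (hw : IsWKBAt Q s m p Y t) :
    ‖Y t 1 - s * m t * Y t 0‖ ≤ 600 * Q / t * ‖Y t 0‖ ∧
    ‖Y t 2 - s * m t * Y t 1‖ ≤ 600 * Q / t * ‖Y t 1‖ ∧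
    ‖Y t 3 - s * m t * Y t 2‖ ≤ 600 * Q / t * ‖Y t 2‖ := by
  have hQ := h.one_le_Q
  refine ⟨h.sub_le_of_defect (γ := 5 / 2) ht (by norm_num) le_rfl le_rfl ?_,
    h.sub_le_of_defect (γ := 3 / 2) (R := 55 * Q) ht (by norm_num) (by norm_num) (by linarith) ?_,
    h.sub_le_of_defect (γ := 1 / 2) (R := 5 * Q) ht (by norm_num) (by norm_num) (by linarith) ?_⟩
  · push_cast; exact hw.2.2
  · push_cast; exact hw.2.1
  · push_cast; exact hw.1

lemma WKB.norm_next_le (h : WKB Q M q m p p') (hs : s = 1 ∨ s = -1) {t : ℝ} (ht : M ≤ t)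
    (hw : IsWKBAt Q s m p Y t) : ‖Y t 1‖ ≤ 2 * ‖m t‖ * ‖Y t 0‖ ∧
    ‖Y t 2‖ ≤ 2 * ‖m t‖ * ‖Y t 1‖ ∧ ‖Y t 3‖ ≤ 2 * ‖m t‖ * ‖Y t 2‖ := by
  have hss : |s| = 1 := by rcases hs with h | h <;> simp [h]
  have hd := h.div_le ht
  have key : ∀ x y : ℂ, ‖y - s * m t * x‖ ≤ 600 * Q / t * ‖x‖ → ‖y‖ ≤ 2 * ‖m t‖ * ‖x‖ := by
    intro x y hxy
    have e1 : ‖y‖ ≤ ‖y - s * m t * x‖ + ‖s * m t * x‖ := by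
      have := norm_add_le (y - s * m t * x) (s * m t * x)
      rwa [sub_add_cancel] at this
    rw [norm_mul, norm_mul, Complex.norm_real, Real.norm_eq_abs, hss, one_mul] at e1
    have e2 : 600 * Q / t * ‖x‖ ≤ ‖m t‖ * ‖x‖ := by
      gcongr
      have : 600 * Q / t = 600 * (Q / t) := by ring
      linarith [norm_nonneg (m t)]
    linarith
  obtain ⟨h1, h2, h3⟩ := h.sub_le ht hw
  exact ⟨key _ _ h1, key _ _ h2, key _ _ h3⟩

lemma WKB.eq_zero (h : WKB Q M q m p p') (hs : s = 1 ∨ s = -1) {t : ℝ} (ht : M ≤ t)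
    (hw : IsWKBAt Q s m p Y t) (h0 : Y t 0 = 0) : Y t = 0 := by
  obtain ⟨h1, h2, h3⟩ := h.norm_next_le hs ht hw
  have e1 : Y t 1 = 0 := norm_le_zero_iff.1 (by simpa [h0] using h1)
  have e2 : Y t 2 = 0 := norm_le_zero_iff.1 (by simpa [e1] using h2)
  have e3 : Y t 3 = 0 := norm_le_zero_iff.1 (by simpa [e2] using h3)
  ext i
  fin_cases i
  · exact h0
  · exact e1
  · exact e2
  · exact e3

lemma WKB.norm_le (h : WKB Q M q m p p') (hs : s = 1 ∨ s = -1) {t : ℝ} (ht : M ≤ t)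
    (hw : IsWKBAt Q s m p Y t) : ‖Y t‖ ≤ 8 * ‖m t‖ ^ 3 * ‖Y t 0‖ := by
  obtain ⟨h1, h2, h3⟩ := h.norm_next_le hs ht hw
  have hm := h.one_le t ht
  have hy := norm_nonneg (Y t 0)
  have e2 : ‖Y t 2‖ ≤ 4 * ‖m t‖ ^ 2 * ‖Y t 0‖ := by
    calc _ ≤ 2 * ‖m t‖ * (2 * ‖m t‖ * ‖Y t 0‖) := h2.trans (by gcongr)
      _ = _ := by ring
  have e3 : ‖Y t 3‖ ≤ 8 * ‖m t‖ ^ 3 * ‖Y t 0‖ := by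
    calc _ ≤ 2 * ‖m t‖ * (4 * ‖m t‖ ^ 2 * ‖Y t 0‖) := h3.trans (by gcongr)
      _ = _ := by ring
  rw [pi_norm_le_iff_of_nonneg (by positivity)]
  have hp2 : ‖m t‖ ≤ ‖m t‖ ^ 3 := le_self_pow₀ hm (by norm_num)
  have hp3 : ‖m t‖ ^ 2 ≤ ‖m t‖ ^ 3 := pow_le_pow_right₀ hm (by norm_num)
  intro i
  fin_cases i
  · change ‖Y t 0‖ ≤ _
    have : 1 * ‖Y t 0‖ ≤ 8 * ‖m t‖ ^ 3 * ‖Y t 0‖ := by gcongr; linarith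
    linarith
  · exact h1.trans (by gcongr; linarith)
  · exact e2.trans (by gcongr; linarith)
  · exact e3

/-- Data without defects, up to a small constant. -/
lemma isWKBAt_of_data (h : WKB Q M q m p p') (hs : s = 1 ∨ s = -1) {t : ℝ} (ht : M ≤ t) {a : ℂ}
    (ha : t ^ 2 * ‖m t‖ * (2 * ‖m t‖ * ‖a‖) ≤ 555 * Q * ‖1 + a‖) (h0 : Y t 0 = 1 + a)
    (h1 : Y t 1 = s * m t - 5 / 2 * p t) (h2 : Y t 2 = (s * m t - 3 / 2 * p t) * Y t 1)
    (h3 : Y t 3 = (s * m t - 1 / 2 * p t) * Y t 2) : IsWKBAt Q s m p Y t := by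
  have hQ := h.one_le_Q
  have hss : |s| = 1 := by rcases hs with h | h <;> simp [h]
  refine ⟨?_, ?_, ?_⟩
  · rw [h3, sub_self, norm_zero, mul_zero]; positivity
  · rw [h2, sub_self, norm_zero, mul_zero]; positivity
  · rw [h0]
    refine le_trans ?_ ha
    gcongr
    rw [h1, show (s : ℂ) * m t - 5 / 2 * p t - (s * m t - 5 / 2 * p t) * (1 + a) =
      -((s * m t - 5 / 2 * p t) * a) by ring, norm_neg, norm_mul]
    gcongr
    refine (norm_sub_le _ _).trans ?_
    rw [norm_mul, norm_mul, Complex.norm_real, Real.norm_eq_abs, hss]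
    have := (h.norm_p t ht).trans (h.div_le ht)
    norm_num
    linarith [norm_nonneg (m t)]

lemma WKB.exponent_ne_zero (h : WKB Q M q m p p') (hs : s = 1 ∨ s = -1) {t : ℝ} (ht : M ≤ t)
    {γ : ℝ} (hγ0 : 0 ≤ γ) (hγ : γ ≤ 5 / 2) : (s : ℂ) * m t - γ * p t ≠ 0 := by
  intro h0
  have hss : |s| = 1 := by rcases hs with h | h <;> simp [h]
  have e : ‖(s : ℂ) * m t‖ = ‖(γ : ℂ) * p t‖ := by rw [sub_eq_zero.1 h0]
  rw [norm_mul, norm_mul, Complex.norm_real, Complex.norm_real, Real.norm_eq_abs, hss,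
    Real.norm_of_nonneg hγ0] at e
  have h1 := (h.norm_p t ht).trans (h.div_le ht)
  have h2 := h.one_le t ht
  nlinarith [norm_nonneg (p t)]

/-- The amplitude `φ² m⁵` grows at most like `exp (2 s ∫ m)`. -/
theorem WKB.growth (h : WKB Q M q m p p') (hY : IsJet q Y) {N : ℝ → ℝ}
    {t₁ t₂ : ℝ} (h1 : M ≤ t₁) (h12 : t₁ ≤ t₂) (hNc : ContinuousOn N (Icc t₁ t₂))
    (hN : ∀ t ∈ Ioo t₁ t₂, HasDerivAt N (m t).re t) (hw : ∀ t ∈ Icc t₁ t₂, IsWKBAt Q s m p Y t) :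
    ‖Y t₂ 0‖ ^ 2 * ‖m t₂‖ ^ 5 ≤
      Real.exp (1110 * Q) * Real.exp (2 * (s * (N t₂ - N t₁))) * (‖Y t₁ 0‖ ^ 2 * ‖m t₁‖ ^ 5) := by
  have hQ := h.one_le_Q
  set W : ℝ → ℂ := fun t => Y t 0 ^ 2 * m t ^ 5 with hWdef
  set R := 1110 * Q with hR
  have hWn : ∀ t, ‖W t‖ = ‖Y t 0‖ ^ 2 * ‖m t‖ ^ 5 := fun t => by
    simp [W, norm_pow]
  have hW : ∀ t, M ≤ t → HasDerivAt W (2 * (s * m t) * W t +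
      2 * Y t 0 * (Y t 1 - (s * m t - 5 / 2 * p t) * Y t 0) * m t ^ 5) t := fun t ht => by
    refine (((hY.hasDerivAt_zero t).pow 2).mul ((h.hasDerivAt_m t ht).pow 5)).congr_deriv ?_
    simp only [W, Pi.pow_apply]
    ring
  set Φ : ℝ → ℝ := fun t => ‖W t‖ ^ 2 * Real.exp (-(4 * s) * N t + 2 * R * t⁻¹) with hΦ
  have hanti : AntitoneOn Φ (Icc t₁ t₂) := by
    have hder : ∀ t ∈ Ioo t₁ t₂, HasDerivAt Φ _ t := fun t ht => by
      have hMt : M ≤ t := h1.trans ht.1.le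
      exact ((hW t hMt).norm_sq).mul ((((hN t ht).const_mul (-(4 * s))).add
        ((hasDerivAt_inv (h.pos hMt).ne').const_mul (2 * R))).exp)
    refine antitoneOn_of_deriv_nonpos (convex_Icc _ _) ?_ ?_ ?_
    · refine ContinuousOn.mul ?_ ?_
      · exact (ContinuousOn.pow (ContinuousOn.norm
          (fun t ht => (hW t (h1.trans ht.1)).continuousAt.continuousWithinAt)) 2)
      · refine Real.continuous_exp.comp_continuousOn ((hNc.const_mul _).add
          (ContinuousOn.const_mul (ContinuousOn.inv₀ continuousOn_id fun t ht => ?_) _))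
        exact (h.pos (h1.trans ht.1)).ne'
    · rw [interior_Icc]
      exact fun t ht => (hder t ht).differentiableAt.differentiableWithinAt
    · rw [interior_Icc]
      intro t ht
      have hMt : M ≤ t := h1.trans ht.1.le
      have ht0 := h.pos hMt
      have hm := h.one_le t hMt
      rw [(hder t ht).deriv]
      have he := (hw t (Ioo_subset_Icc_self ht)).2.2
      set E := Real.exp (-(4 * s) * N t + 2 * R * t⁻¹)
      have hE : 0 < E := Real.exp_pos _
      set g := 2 * Y t 0 * (Y t 1 - (s * m t - 5 / 2 * p t) * Y t 0) * m t ^ 5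
      have hg : ‖g‖ ≤ R * (t ^ 2)⁻¹ * ‖W t‖ := by
        rw [hWn, mul_comm R, mul_assoc, ← div_eq_inv_mul, le_div_iff₀ (by positivity)]
        simp only [g, norm_mul, norm_pow, Complex.norm_ofNat]
        have h3 : t ^ 2 * ‖Y t 1 - (s * m t - 5 / 2 * p t) * Y t 0‖ ≤ 555 * Q * ‖Y t 0‖ := by
          refine le_trans ?_ he
          gcongr
          nlinarith [sq_nonneg t]
        calc _ = 2 * ‖Y t 0‖ * ‖m t‖ ^ 5 *
              (t ^ 2 * ‖Y t 1 - (s * m t - 5 / 2 * p t) * Y t 0‖) := by ring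
          _ ≤ 2 * ‖Y t 0‖ * ‖m t‖ ^ 5 * (555 * Q * ‖Y t 0‖) := by gcongr
          _ = _ := by simp only [R]; ring
      have hin : inner ℝ (W t) g ≤ R * (t ^ 2)⁻¹ * ‖W t‖ ^ 2 := by
        refine (real_inner_le_norm _ _).trans ?_
        nlinarith [norm_nonneg (W t)]
      have hre : (2 * ((s : ℂ) * m t)).re = 2 * (s * (m t).re) := by
        simp
      rw [inner_add_right, inner_mul_self, hre]
      have : 2 * (2 * (s * (m t).re) * ‖W t‖ ^ 2 + inner ℝ (W t) g) * E +
          ‖W t‖ ^ 2 * (E * (-(4 * s) * (m t).re + 2 * R * -(t ^ 2)⁻¹)) =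
          2 * E * (inner ℝ (W t) g - R * (t ^ 2)⁻¹ * ‖W t‖ ^ 2) := by ring
      exact (le_of_eq this).trans (mul_nonpos_of_nonneg_of_nonpos (by positivity) (by linarith))
  have hle := hanti ⟨le_rfl, h12⟩ ⟨h12, le_rfl⟩ h12
  simp only [hΦ] at hle
  have ht1 : 0 < t₁ := h.pos h1
  have ht2 : 0 < t₂ := ht1.trans_le h12
  have hinv1 : t₁⁻¹ ≤ 1 := inv_le_one_of_one_le₀ (h.one_le_M.trans h1)
  have hinv2 : 0 ≤ t₂⁻¹ := by positivity
  have hsq : ‖W t₂‖ ^ 2 ≤ (Real.exp R * Real.exp (2 * (s * (N t₂ - N t₁))) * ‖W t₁‖) ^ 2 := by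
    calc ‖W t₂‖ ^ 2 = ‖W t₂‖ ^ 2 * Real.exp (-(4 * s) * N t₂ + 2 * R * t₂⁻¹) *
          Real.exp (-(-(4 * s) * N t₂ + 2 * R * t₂⁻¹)) := by
          rw [mul_assoc, ← Real.exp_add, add_neg_cancel, Real.exp_zero, mul_one]
      _ ≤ ‖W t₁‖ ^ 2 * Real.exp (-(4 * s) * N t₁ + 2 * R * t₁⁻¹) *
          Real.exp (-(-(4 * s) * N t₂ + 2 * R * t₂⁻¹)) := by gcongr
      _ = ‖W t₁‖ ^ 2 * Real.exp ((-(4 * s) * N t₁ + 2 * R * t₁⁻¹) +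
          -(-(4 * s) * N t₂ + 2 * R * t₂⁻¹)) := by rw [mul_assoc, ← Real.exp_add]
      _ ≤ ‖W t₁‖ ^ 2 * Real.exp (2 * (R + 2 * (s * (N t₂ - N t₁)))) := by
          gcongr
          have : 0 ≤ R := by positivity
          nlinarith
      _ = _ := by
          rw [mul_pow, mul_pow, ← Real.exp_nat_mul, ← Real.exp_nat_mul, ← Real.exp_add, mul_comm]
          congr 2
          push_cast
          ring
  have := le_of_sq_le_sq hsq (by positivity)
  rwa [hWn, hWn] at this

end WKBConsequences

end OrrSommerfeld

namespace OrrSommerfeld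

open Set Filter Topology MeasureTheory

open scoped Real

/-! ### Bounds on the shear profile -/

/-- The quantitative properties of the profile `U`, with derivatives `U₁` and `U₂`. -/
structure ProfileBounds (U U₁ U₂ : ℝ → ℝ) (κ L : ℝ) : Prop where
  hasDeriv : ∀ z, 0 ≤ z → HasDerivWithinAt U (U₁ z) (Ici 0) z
  hasDeriv' : ∀ z, 0 ≤ z → HasDerivWithinAt U₁ (U₂ z) (Ici 0) z
  kappa_pos : 0 < κ
  slope_pos : 0 < U₁ 0
  zero : U 0 = 0
  lower : ∀ z, 0 ≤ z → κ * min z 1 ≤ U z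
  upper : ∀ z, 0 ≤ z → U z ≤ L * min z 1
  deriv_le : ∀ z, 0 ≤ z → z * |U₁ z| ≤ L * min z 1
  deriv2_le : ∀ z, 0 ≤ z → z ^ 2 * |U₂ z| ≤ L * min z 1
  deriv2_le' : ∀ z, 0 ≤ z → |U₂ z| ≤ L
  tangent : ∀ z, 0 ≤ z → |U z - U₁ 0 * z| ≤ L * z ^ 2

lemma dz_zero {E : Type*} [NormedAddCommGroup E] [NormedSpace ℝ E] (f : ℝ → E) (z : ℝ) :
    dz 0 f z = f z := by
  simp [dz]

lemma dz_hasDerivWithinAt {E : Type*} [NormedAddCommGroup E] [NormedSpace ℝ E] {f : ℝ → E}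
    (hf : SmoothOnHalfLine f) (k : ℕ) {z : ℝ} (hz : 0 ≤ z) :
    HasDerivWithinAt (dz k f) (dz (k + 1) f z) (Ici 0) z := by
  have hd : DifferentiableOn ℝ (iteratedDerivWithin k f (Ici 0)) (Ici 0) :=
    hf.differentiableOn_iteratedDerivWithin (by exact_mod_cast WithTop.coe_lt_top k)
      (uniqueDiffOn_Ici 0)
  have h := (hd z hz).hasDerivWithinAt
  rwa [← iteratedDerivWithin_succ] at h

lemma mul_exp_neg_le {β z : ℝ} (hβ : 0 < β) : z * Real.exp (-(β * z)) ≤ 1 / β := by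
  rw [Real.exp_neg, ← div_eq_mul_inv, div_le_div_iff₀ (Real.exp_pos _) hβ]
  linarith [Real.add_one_le_exp (β * z)]

lemma sq_mul_exp_neg_le {β z : ℝ} (hβ : 0 < β) (hz : 0 ≤ z) :
    z ^ 2 * Real.exp (-(β * z)) ≤ 4 / β ^ 2 := by
  have h := mul_exp_neg_le (z := z) (half_pos hβ)
  have h0 : 0 ≤ z * Real.exp (-(β / 2 * z)) := by positivity
  calc z ^ 2 * Real.exp (-(β * z)) = (z * Real.exp (-(β / 2 * z))) ^ 2 := by
        rw [mul_pow, ← Real.exp_nat_mul]; congr 2; push_cast; ring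
    _ ≤ (1 / (β / 2)) ^ 2 := by gcongr
    _ = _ := by field_simp; norm_num

lemma IsShearProfile.exists_bounds {U : ℝ → ℝ} {Uplus : ℝ} (hU : IsShearProfile U Uplus) :
    ∃ κ L : ℝ, ProfileBounds U (dz 1 U) (dz 2 U) κ L := by
  have hd0 : ∀ z, 0 ≤ z → HasDerivWithinAt U (dz 1 U z) (Ici 0) z := fun z hz => by
    have := dz_hasDerivWithinAt hU.smooth 0 hz
    rwa [show dz 0 U = U from funext (dz_zero U)] at this
  have hd1 : ∀ z, 0 ≤ z → HasDerivWithinAt (dz 1 U) (dz 2 U z) (Ici 0) z := fun z hz =>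
    dz_hasDerivWithinAt hU.smooth 1 hz
  obtain ⟨C₀, β₀, hβ₀, h0⟩ := hU.expConv
  obtain ⟨C₁, β₁, hβ₁, h1⟩ := hU.expConv_deriv 1 le_rfl
  obtain ⟨C₂, β₂, hβ₂, h2⟩ := hU.expConv_deriv 2 (by norm_num)
  have hexp : ∀ {β z : ℝ}, 0 < β → 0 ≤ z → Real.exp (-(β * z)) ≤ 1 := fun {β z} hβ hz =>
    Real.exp_le_one_iff.2 (by have := mul_nonneg hβ.le hz; linarith)
  have hC₁ : 0 ≤ C₁ := by have := (abs_nonneg _).trans (h1 0 le_rfl); simpa using this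
  have hC₂ : 0 ≤ C₂ := by have := (abs_nonneg _).trans (h2 0 le_rfl); simpa using this
  have hC₀ : 0 ≤ C₀ := by have := (abs_nonneg _).trans (h0 0 le_rfl); simpa using this
  have b1 : ∀ z, 0 ≤ z → |dz 1 U z| ≤ C₁ := fun z hz =>
    (h1 z hz).trans (mul_le_of_le_one_right hC₁ (hexp hβ₁ hz))
  have b2 : ∀ z, 0 ≤ z → |dz 2 U z| ≤ C₂ := fun z hz =>
    (h2 z hz).trans (mul_le_of_le_one_right hC₂ (hexp hβ₂ hz))
  have b0 : ∀ z, 0 ≤ z → U z ≤ Uplus + C₀ := fun z hz => by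
    have := (abs_le.1 ((h0 z hz).trans (mul_le_of_le_one_right hC₀ (hexp hβ₀ hz)))).2
    linarith
  have m1 : ∀ z, 0 ≤ z → |dz 1 U z - dz 1 U 0| ≤ C₂ * z := fun z hz => by
    have := (convex_Ici (0 : ℝ)).norm_image_sub_le_of_norm_hasDerivWithin_le (f := dz 1 U)
      (fun x hx => hd1 x hx) (fun x hx => b2 x hx) (self_mem_Ici) hz
    simpa [abs_of_nonneg hz] using this
  have m0 : ∀ z, 0 ≤ z → |U z| ≤ C₁ * z := fun z hz => by
    have := (convex_Ici (0 : ℝ)).norm_image_sub_le_of_norm_hasDerivWithin_le (f := U)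
      (fun x hx => hd0 x hx) (fun x hx => b1 x hx) (self_mem_Ici) hz
    simpa [abs_of_nonneg hz, hU.zero] using this
  have mt : ∀ z, 0 ≤ z → |U z - dz 1 U 0 * z| ≤ C₂ * z ^ 2 := fun z hz => by
    have := (convex_Icc (0 : ℝ) z).norm_image_sub_le_of_norm_hasDerivWithin_le
      (f := fun x => U x - dz 1 U 0 * x) (f' := fun x => dz 1 U x - dz 1 U 0) (C := C₂ * z)
      (fun x hx => by
        have := ((hd0 x hx.1).mono Icc_subset_Ici_self).sub
          ((hasDerivWithinAt_id x (Icc 0 z)).const_mul (dz 1 U 0))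
        rw [mul_one] at this
        exact this)
      (fun x hx => (m1 x hx.1).trans (by gcongr; exact hx.2))
      (⟨le_rfl, hz⟩ : (0 : ℝ) ∈ Icc 0 z) ⟨hz, le_rfl⟩
    simp only [hU.zero, mul_zero, sub_zero, Real.norm_eq_abs, abs_of_nonneg hz] at this
    linarith [this, sq z]
  set κ₀ := dz 1 U 0
  have hκ₀ : 0 < κ₀ := hU.deriv_zero_pos
  -- lower bound: tangent near `0`, limit at infinity, compactness in between
  obtain ⟨δ, hδ, hδU⟩ : ∃ δ, 0 < δ ∧ ∀ z, 0 ≤ z → z ≤ δ → κ₀ / 2 * z ≤ U z := by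
    refine ⟨κ₀ / (2 * (C₂ + 1)), by positivity, fun z hz hzδ => ?_⟩
    rw [le_div_iff₀ (by positivity)] at hzδ
    have := (abs_le.1 (mt z hz)).1
    nlinarith
  obtain ⟨R, hR⟩ : ∃ R, ∀ z, R ≤ z → Uplus / 2 ≤ U z := by
    have hlim : Tendsto (fun z : ℝ => C₀ * Real.exp (-(β₀ * z))) atTop (𝓝 0) := by
      have : Tendsto (fun z : ℝ => -(β₀ * z)) atTop atBot :=
        tendsto_neg_atTop_atBot.comp (tendsto_id.const_mul_atTop hβ₀)
      simpa using (Real.tendsto_exp_atBot.comp this).const_mul C₀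
    have hev := (hlim.eventually_lt_const (half_pos hU.Uplus_pos)).and (eventually_ge_atTop 0)
    obtain ⟨R, hR⟩ := eventually_atTop.1 hev
    refine ⟨R, fun z hz => ?_⟩
    have h3 := (abs_le.1 ((h0 z (hR z hz).2).trans (hR z hz).1.le)).1
    linarith
  obtain ⟨c, hc, hcU⟩ : ∃ c, 0 < c ∧ ∀ z ∈ Icc δ (max δ R), c ≤ U z := by
    have hcont : ContinuousOn U (Icc δ (max δ R)) := fun z hz =>
      ((hd0 z (hδ.le.trans hz.1)).continuousWithinAt).mono fun y hy => hδ.le.trans hy.1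
    obtain ⟨z₀, hz₀, hmin⟩ := isCompact_Icc.exists_isMinOn ⟨δ, le_rfl, le_max_left _ _⟩ hcont
    exact ⟨U z₀, hU.pos z₀ (hδ.trans_le hz₀.1), fun z hz => hmin hz⟩
  set κ := min (κ₀ / 2) (min c (Uplus / 2))
  have hκ : 0 < κ := lt_min (half_pos hκ₀) (lt_min hc (half_pos hU.Uplus_pos))
  set L := C₁ + C₂ + (Uplus + C₀) + C₁ * (1 / β₁) + C₂ * (4 / β₂ ^ 2)
  have hUp := hU.Uplus_pos
  have p1 : 0 ≤ C₁ * (1 / β₁) := by positivity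
  have p2 : 0 ≤ C₂ * (4 / β₂ ^ 2) := by positivity
  have hL : 0 ≤ L := by positivity
  have hmin : ∀ {z y : ℝ}, 0 ≤ z → y ≤ L * z → y ≤ L → y ≤ L * min z 1 := by
    intro z y _ h3 h4
    rcases le_total z 1 with h | h
    · rwa [min_eq_left h]
    · rwa [min_eq_right h, mul_one]
  refine ⟨κ, L, hd0, hd1, hκ, hκ₀, hU.zero, fun z hz => ?_, fun z hz => ?_, fun z hz => ?_,
    fun z hz => ?_, fun z hz => ?_, fun z hz => ?_⟩
  · rcases le_total z δ with h | h
    · refine le_trans ?_ (hδU z hz h)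
      gcongr
      · exact min_le_left _ _
      · exact min_le_left _ _
    · have h3 : κ * min z 1 ≤ κ := mul_le_of_le_one_right hκ.le (min_le_right _ _)
      rcases le_total z (max δ R) with h' | h'
      · exact h3.trans (((min_le_right _ _).trans (min_le_left _ _)).trans (hcU z ⟨h, h'⟩))
      · exact h3.trans (((min_le_right _ _).trans (min_le_right _ _)).trans
          (hR z ((le_max_right _ _).trans h')))
  · refine hmin hz (((le_abs_self _).trans (m0 z hz)).trans ?_) ((b0 z hz).trans ?_)
    · gcongr; linarith
    · linarith
  · refine hmin hz ?_ ?_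
    · rw [mul_comm]
      gcongr
      linarith [b1 z hz]
    · calc z * |dz 1 U z| ≤ z * (C₁ * Real.exp (-(β₁ * z))) := by gcongr; exact h1 z hz
        _ = C₁ * (z * Real.exp (-(β₁ * z))) := by ring
        _ ≤ C₁ * (1 / β₁) := by gcongr; exact mul_exp_neg_le hβ₁
        _ ≤ L := by linarith
  · have hbig : z ^ 2 * |dz 2 U z| ≤ L := by
      calc z ^ 2 * |dz 2 U z| ≤ z ^ 2 * (C₂ * Real.exp (-(β₂ * z))) := by gcongr; exact h2 z hz
        _ = C₂ * (z ^ 2 * Real.exp (-(β₂ * z))) := by ring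
        _ ≤ C₂ * (4 / β₂ ^ 2) := by gcongr; exact sq_mul_exp_neg_le hβ₂ hz
        _ ≤ L := by linarith
    rcases le_total z 1 with h | h
    · rw [min_eq_left h]
      calc z ^ 2 * |dz 2 U z| ≤ z * C₂ := by
            rw [sq, mul_assoc]
            gcongr
            exact (mul_le_of_le_one_left (abs_nonneg _) h).trans (b2 z hz)
        _ ≤ L * z := by rw [mul_comm]; gcongr; linarith
    · rwa [min_eq_right h, mul_one]
  · linarith [b2 z hz]
  · refine (mt z hz).trans ?_
    gcongr
    linarith

end OrrSommerfeld

namespace OrrSommerfeld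

open Set Filter Topology MeasureTheory

open scoped Real

/-! ### The rescaled problem -/

/-- The rescaled profile `U (h ζ) / h`, extended linearly to `ζ < 0` with slope `σ`; the extension only
serves to have a continuous coefficient on the whole line. -/
noncomputable def scaledU (U : ℝ → ℝ) (σ h ζ : ℝ) : ℝ := U (h * max ζ 0) / h + σ * min ζ 0

/-- The coefficient `i s (U (h ζ) / h - c)` of the rescaled equation `φ'''' = q φ''`. -/
noncomputable def scaledQ (U : ℝ → ℝ) (σ h s : ℝ) (c : ℂ) (ζ : ℝ) : ℂ :=
  Complex.I * s * (scaledU U σ h ζ - c)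

/-- The principal square root of the coefficient `scaledQ`. -/
noncomputable def scaledRoot (U : ℝ → ℝ) (σ h s : ℝ) (c : ℂ) (ζ : ℝ) : ℂ :=
  scaledQ U σ h s c ζ ^ (1 / 2 : ℂ)

/-- The logarithmic derivative of `scaledRoot`. -/
noncomputable def scaledLog (U U₁ : ℝ → ℝ) (h : ℝ) (c : ℂ) (ζ : ℝ) : ℂ :=
  U₁ (h * ζ) / (2 * ((U (h * ζ) / h : ℝ) - c))

/-- The derivative of `scaledLog`. -/
noncomputable def scaledLog' (U U₁ U₂ : ℝ → ℝ) (h : ℝ) (c : ℂ) (ζ : ℝ) : ℂ :=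
  (h * U₂ (h * ζ) : ℝ) / (2 * ((U (h * ζ) / h : ℝ) - c)) - 2 * scaledLog U U₁ h c ζ ^ 2

/-- The range of the rescaled parameters `h = ν ^ (1/4)`, `s = α / h` and `c / h`. -/
structure IsScaled (U : ℝ → ℝ) (σ a b K h s : ℝ) (c : ℂ) : Prop where
  h_pos : 0 < h
  lower : a ≤ s
  upper : s ≤ b
  c_le : ‖c‖ ≤ K
  re_pos : ∀ ζ, 0 ≤ ζ → 0 < (scaledRoot U σ h s c ζ).re

section Scaled

variable {U U₁ U₂ : ℝ → ℝ} {κ L σ a b K h s : ℝ} {c : ℂ}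

lemma scaledU_of_nonneg (U : ℝ → ℝ) (σ h : ℝ) {ζ : ℝ} (hζ : 0 ≤ ζ) :
    scaledU U σ h ζ = U (h * ζ) / h := by
  rw [scaledU, max_eq_left hζ, min_eq_right hζ, mul_zero, add_zero]

lemma scaledRoot_sq (U : ℝ → ℝ) (σ h s : ℝ) (c : ℂ) (ζ : ℝ) :
    scaledRoot U σ h s c ζ ^ 2 = scaledQ U σ h s c ζ := cpow_half_sq _

lemma sq_mem_slitPlane {w : ℂ} (hw : 0 < w.re) : w ^ 2 ∈ Complex.slitPlane := by
  rw [Complex.mem_slitPlane_iff, sq, Complex.mul_re, Complex.mul_im]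
  by_cases h : w.im = 0
  · left; rw [h]; nlinarith
  · right
    have := mul_ne_zero hw.ne' h
    intro h0
    exact this (by linarith)

lemma IsScaled.mem_slitPlane (hs : IsScaled U σ a b K h s c) {ζ : ℝ} (hζ : 0 ≤ ζ) :
    scaledQ U σ h s c ζ ∈ Complex.slitPlane := by
  rw [← scaledRoot_sq]
  exact sq_mem_slitPlane (hs.re_pos ζ hζ)

lemma ProfileBounds.continuous_scaledQ (hB : ProfileBounds U U₁ U₂ κ L) (σ : ℝ) (hh : 0 < h)
    (s : ℝ) (c : ℂ) : Continuous (scaledQ U σ h s c) := by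
  have hU : ContinuousOn U (Ici 0) := fun z hz => (hB.hasDeriv z hz).continuousWithinAt
  have h1 : Continuous fun ζ : ℝ => U (h * max ζ 0) :=
    hU.comp_continuous (by fun_prop) fun ζ => mul_nonneg hh.le (le_max_right _ _)
  have h2 : Continuous (scaledU U σ h) := by
    exact (h1.div_const h).add (by fun_prop)
  unfold scaledQ
  fun_prop

lemma IsScaled.continuousOn_root (hs : IsScaled U σ a b K h s c)
    (hB : ProfileBounds U U₁ U₂ κ L) : ContinuousOn (scaledRoot U σ h s c) (Ici 0) := fun _ hζ =>
  ((hB.continuous_scaledQ σ hs.h_pos s c).continuousAt.cpow continuousAt_const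
    (hs.mem_slitPlane hζ)).continuousWithinAt

/-- If the real part of the root never vanishes, then `c` lies outside the open fourth quadrant: at
a point where `U = Re c` the coefficient would be real and negative. -/
lemma IsScaled.sign (hs : IsScaled U σ a b K h s c) (hB : ProfileBounds U U₁ U₂ κ L) (ha : 0 < a)
    (hK : h * K ≤ κ) : 0 ≤ c.im ∨ c.re ≤ 0 := by
  by_contra! hc
  have hh := hs.h_pos
  have hcont : ContinuousOn U (Icc 0 1) := fun z hz =>
    ((hB.hasDeriv z hz.1).continuousWithinAt).mono Icc_subset_Ici_self
  have hmem : h * c.re ∈ Icc (U 0) (U 1) := by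
    refine ⟨by rw [hB.zero]; exact mul_nonneg hh.le hc.2.le, ?_⟩
    have h1 := hB.lower 1 zero_le_one
    rw [min_self, mul_one] at h1
    have h2 : c.re ≤ K := (Complex.re_le_norm c).trans hs.c_le
    nlinarith
  obtain ⟨z, hz, hUz⟩ := intermediate_value_Icc zero_le_one hcont hmem
  have hζ : 0 ≤ z / h := div_nonneg hz.1 hh.le
  have hq : scaledQ U σ h s c (z / h) = ((s * c.im : ℝ) : ℂ) := by
    rw [scaledQ, scaledU_of_nonneg U σ h hζ, mul_div_cancel₀ _ hh.ne', hUz,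
      mul_div_cancel_left₀ _ hh.ne']
    apply Complex.ext <;> simp
  have hneg : s * c.im < 0 := mul_neg_of_pos_of_neg (ha.trans_le hs.lower) hc.1
  have hsl := hs.mem_slitPlane hζ
  rw [hq, Complex.ofReal_mem_slitPlane] at hsl
  linarith

/-- A square root with positive real part of a number in the quadrant around `i` is in a cone. -/
lemma norm_le_re_of_sq {w : ℂ} (hw : 0 < w.re) (h : |(w ^ 2).re| ≤ (w ^ 2).im) :
    0.38 * ‖w‖ ≤ w.re := by
  have h1 : (w ^ 2).re = w.re ^ 2 - w.im ^ 2 := by rw [sq, Complex.mul_re]; ring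
  have h2 : (w ^ 2).im = 2 * (w.re * w.im) := by rw [sq, Complex.mul_im]; ring
  rw [h1, h2] at h
  have h3 := (abs_le.1 h).1
  have him : 0 ≤ w.im := by
    by_contra! hc
    nlinarith [(abs_nonneg (w.re ^ 2 - w.im ^ 2)).trans h, mul_neg_of_pos_of_neg hw hc]
  refine le_of_sq_le_sq ?_ hw.le
  rw [mul_pow, ← Complex.normSq_eq_norm_sq, Complex.normSq_apply]
  have h4 : w.im ≤ 2.4143 * w.re := by
    by_contra! hc
    nlinarith
  nlinarith

/-- In the range `ζ ≥ M`, `h M ≤ 1`, the rescaled profile dominates the parameter `c`. -/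
lemma ProfileBounds.scaled_bounds (hB : ProfileBounds U U₁ U₂ κ L) (hs : IsScaled U σ a b K h s c)
    {M ζ : ℝ} (hM : 0 < M) (hKM : 2 * K ≤ κ * M) (hhM : h * M ≤ 1) (hζ : M ≤ ζ) :
    ∃ μ : ℝ, μ = min ζ (1 / h) ∧ M ≤ μ ∧ κ * μ ≤ U (h * ζ) / h ∧ U (h * ζ) / h ≤ L * μ ∧
      2 * ‖c‖ ≤ κ * μ ∧ κ * μ / 2 ≤ ‖((U (h * ζ) / h : ℝ) : ℂ) - c‖ ∧
      ‖((U (h * ζ) / h : ℝ) : ℂ) - c‖ ≤ 2 * (L * μ) ∧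
      ζ * |U₁ (h * ζ)| ≤ L * μ ∧ ζ ^ 2 * (h * |U₂ (h * ζ)|) ≤ L * μ := by
  have hh := hs.h_pos
  have hζ0 : 0 < ζ := hM.trans_le hζ
  have hz : 0 ≤ h * ζ := by positivity
  have hmin : min (h * ζ) 1 = h * min ζ (1 / h) := by
    rw [mul_min_of_nonneg _ _ hh.le, mul_one_div_cancel hh.ne']
  have h1 := hB.lower _ hz
  have h2 := hB.upper _ hz
  have h3 := hB.deriv_le _ hz
  have h4 := hB.deriv2_le _ hz
  rw [hmin] at h1 h2 h3 h4
  have hμM : M ≤ min ζ (1 / h) := le_min hζ (by rw [le_div_iff₀ hh]; linarith)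
  have hκ := hB.kappa_pos
  set μ := min ζ (1 / h)
  have e1 : κ * μ ≤ U (h * ζ) / h := by rw [le_div_iff₀ hh]; linarith
  have e2 : U (h * ζ) / h ≤ L * μ := by rw [div_le_iff₀ hh]; linarith
  have e3 : 2 * ‖c‖ ≤ κ * μ := by
    have : κ * M ≤ κ * μ := by gcongr
    linarith [hs.c_le]
  have hμ0 : 0 < κ * μ := mul_pos hκ (hM.trans_le hμM)
  have hn : ‖((U (h * ζ) / h : ℝ) : ℂ)‖ = U (h * ζ) / h := by
    rw [Complex.norm_real, Real.norm_of_nonneg (by linarith)]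
  refine ⟨μ, rfl, hμM, e1, e2, e3, ?_, ?_, ?_, ?_⟩
  · have := norm_sub_norm_le ((U (h * ζ) / h : ℝ) : ℂ) c
    linarith
  · have := norm_sub_le ((U (h * ζ) / h : ℝ) : ℂ) c
    linarith
  · have : h * (ζ * |U₁ (h * ζ)|) ≤ h * (L * μ) := by linarith
    exact le_of_mul_le_mul_left this hh
  · have : h * (ζ ^ 2 * (h * |U₂ (h * ζ)|)) ≤ h * (L * μ) := by linarith
    exact le_of_mul_le_mul_left this hh

lemma ProfileBounds.norm_scaledQ_le (hB : ProfileBounds U U₁ U₂ κ L)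
    (hs : IsScaled U σ a b K h s c) (ha : 0 < a) {ζ : ℝ} (hζ : 0 ≤ ζ) :
    ‖scaledQ U σ h s c ζ‖ ≤ b * (L * ζ + K) := by
  have hh := hs.h_pos
  have hz : 0 ≤ h * ζ := by positivity
  have h1 := hB.lower _ hz
  have h2 := hB.upper _ hz
  have hL : 0 ≤ L := (abs_nonneg _).trans (hB.deriv2_le' 0 le_rfl)
  have h3 : U (h * ζ) / h ≤ L * ζ := by
    rw [div_le_iff₀ hh]
    have : L * min (h * ζ) 1 ≤ L * (h * ζ) := by gcongr; exact min_le_left _ _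
    linarith
  have h4 : 0 ≤ U (h * ζ) / h := by
    refine div_nonneg (le_trans ?_ h1) hh.le
    have := hB.kappa_pos
    positivity
  have hs0 : 0 < s := ha.trans_le hs.lower
  rw [scaledQ, scaledU_of_nonneg U σ h hζ, norm_mul, norm_mul, Complex.norm_I, one_mul,
    Complex.norm_real, Real.norm_of_nonneg hs0.le]
  have h5 : ‖((U (h * ζ) / h : ℝ) : ℂ) - c‖ ≤ L * ζ + K := by
    refine (norm_sub_le _ _).trans ?_
    rw [Complex.norm_real, Real.norm_of_nonneg h4]
    linarith [hs.c_le]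
  exact mul_le_mul hs.upper h5 (norm_nonneg _) (hs0.le.trans hs.upper)

/-- The WKB bounds hold uniformly in the parameters. -/
theorem ProfileBounds.exists_wkb (hB : ProfileBounds U U₁ U₂ κ L) (σ K : ℝ) (ha : 0 < a)
    (hK : 0 < K) : ∃ Q M D : ℝ, 1 ≤ D ∧ 1 ≤ M ∧ 2 * K ≤ κ * M ∧ ∀ (h s : ℝ) (c : ℂ),
      IsScaled U σ a b K h s c → h * M ≤ 1 →
      WKB Q M (scaledQ U σ h s c) (scaledRoot U σ h s c) (scaledLog U U₁ h c)
        (scaledLog' U U₁ U₂ h c) ∧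
      (∀ ζ, M ≤ ζ → ‖scaledRoot U σ h s c ζ‖ ^ 2 ≤ D * ζ ∧
        h * ‖scaledRoot U σ h s c ζ‖ ^ 2 ≤ D) ∧
      (∀ t₁ t₂, M ≤ t₁ → t₁ ≤ t₂ →
        ‖scaledRoot U σ h s c t₁‖ ^ 2 ≤ D * ‖scaledRoot U σ h s c t₂‖ ^ 2) := by
  have hκ := hB.kappa_pos
  have hκL : κ ≤ L := by
    have h1 := hB.lower 1 zero_le_one
    have h2 := hB.upper 1 zero_le_one
    rw [min_self] at h1 h2
    linarith
  have hL : 0 < L := hκ.trans_le hκL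
  set Λ := L / κ with hΛ
  have hΛ1 : 1 ≤ Λ := by rwa [hΛ, le_div_iff₀ hκ, one_mul]
  set Q := 10 * Λ ^ 2 with hQ
  have hΛ2 : Λ ≤ Λ ^ 2 := le_self_pow₀ hΛ1 (by norm_num)
  have hQ1 : 1 ≤ Q := by linarith
  -- the three terms make `V` dominate `c`, give `1 ≤ |m|`, and give `10000 Q ≤ ζ |m|`
  set M := 2 * K / κ + 2 / (a * κ) + 10000 * Q with hMdef
  have hM1 : 1 ≤ M := by
    have : 0 ≤ 2 * K / κ + 2 / (a * κ) := by positivity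
    linarith
  have hM0 : 0 < M := by linarith
  have hKM : 2 * K ≤ κ * M := by
    have : κ * (2 * K / κ) = 2 * K := by field_simp
    have : 0 ≤ κ * (2 / (a * κ) + 10000 * Q) := by positivity
    nlinarith
  have haM : 2 ≤ a * κ * M := by
    have : a * κ * (2 / (a * κ)) = 2 := by field_simp
    have : 0 ≤ a * κ * (2 * K / κ + 10000 * Q) := by positivity
    nlinarith
  have hMQ : 10000 * Q ≤ M := by
    have : 0 ≤ 2 * K / κ + 2 / (a * κ) := by positivity
    linarith
  set D := 1 + 2 * |b| * L + 4 * |b| * L / (a * κ) with hD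
  have hD1 : 1 ≤ D := by
    have : 0 ≤ 2 * |b| * L + 4 * |b| * L / (a * κ) := by positivity
    linarith
  refine ⟨Q, M, D, hD1, hM1, hKM, fun h s c hs hhM => ?_⟩
  have hh := hs.h_pos
  have hs0 : 0 < s := ha.trans_le hs.lower
  have hsb : s ≤ |b| := hs.upper.trans (le_abs_self _)
  have hbd := fun ζ (hζ : M ≤ ζ) => hB.scaled_bounds hs hM0 hKM hhM hζ
  set q := scaledQ U σ h s c
  set m := scaledRoot U σ h s c
  set p := scaledLog U U₁ h c
  set V : ℝ → ℂ := fun ζ => ((U (h * ζ) / h : ℝ) : ℂ) - c with hV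
  have hqV0 : ∀ ζ, 0 < ζ → q ζ = Complex.I * s * V ζ := fun ζ hζ => by
    simp only [q, scaledQ, V]
    rw [scaledU_of_nonneg U σ h hζ.le]
  have hqV : ∀ ζ, M ≤ ζ → q ζ = Complex.I * s * V ζ := fun ζ hζ => hqV0 ζ (hM0.trans_le hζ)
  have hmsq : ∀ ζ, m ζ ^ 2 = q ζ := scaledRoot_sq U σ h s c
  have hmn : ∀ ζ, M ≤ ζ → ‖m ζ‖ ^ 2 = s * ‖V ζ‖ := fun ζ hζ => by
    rw [← norm_pow, hmsq, hqV ζ hζ, norm_mul, norm_mul, Complex.norm_I, one_mul,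
      Complex.norm_real, Real.norm_of_nonneg hs0.le]
  have hV0 : ∀ ζ, M ≤ ζ → V ζ ≠ 0 := fun ζ hζ => by
    obtain ⟨μ, -, h1, -, -, -, h2, -⟩ := hbd ζ hζ
    have : 0 < κ * μ := mul_pos hκ (hM0.trans_le h1)
    exact norm_pos_iff.1 (by linarith)
  have hm1 : ∀ ζ, M ≤ ζ → 1 ≤ ‖m ζ‖ := fun ζ hζ => by
    obtain ⟨μ, -, h1, -, -, -, h2, -⟩ := hbd ζ hζ
    have h3 : 1 ≤ ‖m ζ‖ ^ 2 := by
      rw [hmn ζ hζ]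
      have h4 : a * κ * M ≤ a * κ * μ := by gcongr
      have h5 : a * (κ * μ / 2) ≤ s * ‖V ζ‖ := by
        have : 0 < κ * μ := mul_pos hκ (hM0.trans_le h1)
        exact mul_le_mul hs.lower h2 (by positivity) hs0.le
      linarith
    by_contra! hc
    nlinarith [norm_nonneg (m ζ)]
  -- derivatives
  have hU' : ∀ ζ, M ≤ ζ → HasDerivAt (fun ζ => U (h * ζ) / h) (U₁ (h * ζ)) ζ := fun ζ hζ => by
    have hz : 0 < h * ζ := mul_pos hh (hM0.trans_le hζ)
    have h1 := (hB.hasDeriv _ hz.le).hasDerivAt (Ici_mem_nhds hz)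
    have h2 : HasDerivAt (fun ζ => h * ζ) h ζ := by simpa using (hasDerivAt_id ζ).const_mul h
    refine ((h1.comp ζ h2).div_const h).congr_deriv ?_
    field_simp
  have hV' : ∀ ζ, M ≤ ζ → HasDerivAt V ((U₁ (h * ζ) : ℝ) : ℂ) ζ := fun ζ hζ =>
    (hU' ζ hζ).ofReal_comp.sub_const c
  have hU'' : ∀ ζ, M ≤ ζ → HasDerivAt (fun ζ => U₁ (h * ζ)) (h * U₂ (h * ζ)) ζ := fun ζ hζ => by
    have hz : 0 < h * ζ := mul_pos hh (hM0.trans_le hζ)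
    have h1 := (hB.hasDeriv' _ hz.le).hasDerivAt (Ici_mem_nhds hz)
    have h2 : HasDerivAt (fun ζ => h * ζ) h ζ := by simpa using (hasDerivAt_id ζ).const_mul h
    exact (h1.comp ζ h2).congr_deriv (mul_comm _ _)
  have hp : ∀ ζ, p ζ = U₁ (h * ζ) / (2 * V ζ) := fun ζ => rfl
  have hpn : ∀ ζ, M ≤ ζ → ‖p ζ‖ ≤ Λ / ζ := fun ζ hζ => by
    obtain ⟨μ, -, h1, -, -, -, h2, -, h3, -⟩ := hbd ζ hζ
    have hζ0 : 0 < ζ := hM0.trans_le hζ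
    have h4 : 0 < κ * μ := mul_pos hκ (hM0.trans_le h1)
    rw [hp, norm_div, norm_mul, Complex.norm_real, Complex.norm_two, Real.norm_eq_abs,
      div_le_div_iff₀ (by linarith) hζ0, hΛ]
    calc |U₁ (h * ζ)| * ζ ≤ L * μ := by linarith
      _ = L / κ * (2 * (κ * μ / 2)) := by field_simp
      _ ≤ _ := by gcongr
  have hp'n : ∀ ζ, M ≤ ζ → ‖scaledLog' U U₁ U₂ h c ζ‖ ≤ 3 * Λ ^ 2 / ζ ^ 2 := fun ζ hζ => by
    obtain ⟨μ, -, h1, -, -, -, h2, -, -, h3⟩ := hbd ζ hζ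
    have hζ0 : 0 < ζ := hM0.trans_le hζ
    have h4 : 0 < κ * μ := mul_pos hκ (hM0.trans_le h1)
    have h5 : ‖((h * U₂ (h * ζ) : ℝ) : ℂ) / (2 * V ζ)‖ ≤ Λ / ζ ^ 2 := by
      rw [norm_div, norm_mul, Complex.norm_real, Complex.norm_two, norm_mul, Real.norm_eq_abs,
        Real.norm_eq_abs, abs_of_pos hh, div_le_div_iff₀ (by linarith) (by positivity), hΛ]
      calc h * |U₂ (h * ζ)| * ζ ^ 2 ≤ L * μ := by linarith
        _ = L / κ * (2 * (κ * μ / 2)) := by field_simp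
        _ ≤ _ := by gcongr
    have h6 : ‖2 * p ζ ^ 2‖ ≤ 2 * (Λ / ζ) ^ 2 := by
      rw [norm_mul, norm_pow, Complex.norm_two]
      gcongr
      exact hpn ζ hζ
    calc _ ≤ Λ / ζ ^ 2 + 2 * (Λ / ζ) ^ 2 := (norm_sub_le _ _).trans (add_le_add h5 h6)
      _ = (Λ + 2 * Λ ^ 2) / ζ ^ 2 := by field_simp
      _ ≤ _ := by gcongr; linarith
  have hpsq : ∀ ζ, M ≤ ζ → ‖p ζ ^ 2‖ ≤ Λ ^ 2 / ζ ^ 2 := fun ζ hζ => by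
    rw [norm_pow, ← div_pow]
    gcongr
    exact hpn ζ hζ
  refine ⟨⟨hM1, hQ1, fun ζ hζ => ?_, fun ζ hζ => ?_, fun ζ _ => hmsq ζ, fun ζ hζ => ?_,
    fun ζ hζ => ?_, fun ζ hζ => ?_, fun ζ hζ => ?_, fun ζ hζ => ?_, hm1⟩, fun ζ hζ => ?_,
    fun t₁ t₂ ht₁ ht => ?_⟩
  · have hq' : HasDerivAt (fun ζ => Complex.I * s * V ζ) (Complex.I * s * (U₁ (h * ζ) : ℝ)) ζ :=
      (hV' ζ hζ).const_mul _
    have hq'' : HasDerivAt q (Complex.I * s * (U₁ (h * ζ) : ℝ)) ζ :=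
      hq'.congr_of_eventuallyEq ((eventually_gt_nhds (hM0.trans_le hζ)).mono hqV0)
    have hsl : q ζ ∈ Complex.slitPlane := hs.mem_slitPlane (hM0.le.trans hζ)
    refine ((Complex.hasStrictDerivAt_cpow_const (c := 1 / 2) hsl).hasDerivAt.comp ζ
      hq'').congr_deriv ?_
    have h0 : q ζ ≠ 0 := Complex.slitPlane_ne_zero hsl
    rw [Complex.cpow_sub _ _ h0, Complex.cpow_one]
    change 1 / 2 * (m ζ / q ζ) * _ = _
    have hs0' : (s : ℂ) ≠ 0 := by exact_mod_cast hs0.ne'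
    have h3 := hV0 ζ hζ
    rw [hp, hqV ζ hζ]
    field_simp
  · refine ((hU'' ζ hζ).ofReal_comp.div ((hV' ζ hζ).const_mul 2)
      (mul_ne_zero two_ne_zero (hV0 ζ hζ))).congr_deriv ?_
    have := hV0 ζ hζ
    change _ = ((h * U₂ (h * ζ) : ℝ) : ℂ) / (2 * V ζ) - 2 * p ζ ^ 2
    rw [hp]
    field_simp
  · refine (hpn ζ hζ).trans ?_
    have : 0 < ζ := hM0.trans_le hζ
    gcongr
    linarith
  · have h1 := hp'n ζ hζ
    have h2 := hpsq ζ hζ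
    calc _ ≤ ‖scaledLog' U U₁ U₂ h c ζ / 2‖ + ‖p ζ ^ 2 / 4‖ := norm_sub_le _ _
      _ ≤ 3 * Λ ^ 2 / ζ ^ 2 + Λ ^ 2 / ζ ^ 2 := by
          rw [norm_div, norm_div]
          norm_num
          have := norm_nonneg (scaledLog' U U₁ U₂ h c ζ)
          have := norm_nonneg (p ζ ^ 2)
          rw [norm_pow] at *
          linarith
      _ = 4 * Λ ^ 2 / ζ ^ 2 := by ring
      _ ≤ _ := by gcongr; linarith
  · have h1 := hp'n ζ hζ
    have h2 := hpsq ζ hζ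
    rw [norm_mul]
    calc _ ≤ 5 / 2 * (3 * Λ ^ 2 / ζ ^ 2 + Λ ^ 2 / ζ ^ 2) := by
          have := norm_sub_le (scaledLog' U U₁ U₂ h c ζ) (p ζ ^ 2)
          norm_num at this ⊢
          rw [norm_pow] at *
          linarith
      _ = Q / ζ ^ 2 := by rw [hQ]; ring
  · obtain ⟨μ, -, h1, h2, -, h3, -⟩ := hbd ζ hζ
    refine norm_le_re_of_sq (hs.re_pos ζ (hM0.le.trans hζ)) ?_
    rw [hmsq, hqV ζ hζ]
    have e1 : (Complex.I * s * V ζ).re = s * c.im := by simp [V]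
    have e2 : (Complex.I * s * V ζ).im = s * (U (h * ζ) / h - c.re) := by
      simp [V]
    rw [e1, e2, abs_mul, abs_of_pos hs0]
    gcongr
    linarith [Complex.abs_im_le_norm c, Complex.re_le_norm c]
  · have := hm1 ζ hζ
    nlinarith
  · obtain ⟨μ, hμ, h1, -, -, -, -, h2, -⟩ := hbd ζ hζ
    rw [hmn ζ hζ]
    have hμ0 : 0 < μ := hM0.trans_le h1
    have e1 : s * ‖V ζ‖ ≤ D * μ := by
      calc s * ‖V ζ‖ ≤ |b| * (2 * (L * μ)) := by gcongr
        _ = (2 * |b| * L) * μ := by ring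
        _ ≤ D * μ := by
            gcongr
            have : 0 ≤ 4 * |b| * L / (a * κ) := by positivity
            linarith
    have hD0 : 0 ≤ D := by linarith
    refine ⟨e1.trans (by gcongr; rw [hμ]; exact min_le_left _ _), ?_⟩
    have hμh : μ * h ≤ 1 := by rw [← le_div_iff₀ hh, hμ]; exact min_le_right _ _
    calc h * (s * ‖V ζ‖) ≤ h * (D * μ) := by gcongr
      _ = D * (μ * h) := by ring
      _ ≤ D * 1 := by gcongr
      _ = D := mul_one D
  · obtain ⟨μ₁, hμ₁, h1, -, -, -, -, h2, -⟩ := hbd t₁ ht₁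
    obtain ⟨μ₂, hμ₂, h3, -, -, -, h4, -⟩ := hbd t₂ (ht₁.trans ht)
    rw [hmn t₁ ht₁, hmn t₂ (ht₁.trans ht)]
    have hμ : μ₁ ≤ μ₂ := by
      rw [hμ₁, hμ₂]
      exact min_le_min_right _ ht
    have hμ0 : 0 < μ₁ := hM0.trans_le h1
    calc s * ‖V t₁‖ ≤ |b| * (2 * (L * μ₂)) := by
          gcongr
          exact h2.trans (by gcongr)
      _ = 4 * |b| * L / (a * κ) * (a * (κ * μ₂ / 2)) := by field_simp; ring
      _ ≤ 4 * |b| * L / (a * κ) * (s * ‖V t₂‖) := by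
          have hμ2 : 0 < κ * μ₂ := mul_pos hκ (hM0.trans_le h3)
          exact mul_le_mul_of_nonneg_left (mul_le_mul hs.lower h4 (by positivity) hs0.le)
            (by positivity)
      _ ≤ D * (s * ‖V t₂‖) := by
          gcongr
          have : 0 ≤ 2 * |b| * L := by positivity
          linarith

/-- As `h → 0`, the coefficient converges to the one of the linear profile. -/
lemma ProfileBounds.eventually_scaledQ (hB : ProfileBounds U U₁ U₂ κ L) {hn sn : ℕ → ℝ}
    {cn : ℕ → ℂ} (hpos : ∀ n, 0 < hn n) (hh : Tendsto hn atTop (𝓝 0))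
    (hs : Tendsto sn atTop (𝓝 s)) (hc : Tendsto cn atTop (𝓝 c)) (T η : ℝ) (hη : 0 < η) :
    ∀ᶠ n in atTop, ∀ t ∈ Icc 0 T, ‖scaledQ U (U₁ 0) (hn n) (sn n) (cn n) t -
      Complex.I * s * ((U₁ 0 : ℝ) * t - c)‖ ≤ η := by
  have h1 : Tendsto (fun n => |sn n| * (L * hn n * T ^ 2) + |sn n - s| * (|U₁ 0| * |T|) +
      ‖(sn n : ℂ) * cn n - s * c‖) atTop (𝓝 0) := by
    have e1 : Tendsto (fun n => |sn n| * (L * hn n * T ^ 2)) atTop (𝓝 0) := by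
      simpa using hs.abs.mul ((hh.const_mul L).mul_const (T ^ 2))
    have e2 : Tendsto (fun n => |sn n - s| * (|U₁ 0| * |T|)) atTop (𝓝 0) := by
      simpa using (hs.sub_const s).abs.mul_const (|U₁ 0| * |T|)
    have e3 : Tendsto (fun n => ‖(sn n : ℂ) * cn n - s * c‖) atTop (𝓝 0) := by
      have e4 : Tendsto (fun n => (sn n : ℂ)) atTop (𝓝 (s : ℂ)) :=
        (Complex.continuous_ofReal.tendsto s).comp hs
      simpa using ((e4.mul hc).sub_const ((s : ℂ) * c)).norm
    simpa using (e1.add e2).add e3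
  filter_upwards [h1.eventually_lt_const hη] with n hn' t ht
  refine le_trans ?_ hn'.le
  have hp := hpos n
  have hz : 0 ≤ hn n * t := mul_nonneg hp.le ht.1
  have htan := hB.tangent _ hz
  have hL : 0 ≤ L := (abs_nonneg _).trans (hB.deriv2_le' 0 le_rfl)
  have hT : |t| ≤ |T| := abs_le_abs_of_nonneg ht.1 ht.2
  have e1 : |U (hn n * t) / hn n - U₁ 0 * t| ≤ L * hn n * T ^ 2 := by
    have : U (hn n * t) / hn n - U₁ 0 * t = (U (hn n * t) - U₁ 0 * (hn n * t)) / hn n := by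
      field_simp
    rw [this, abs_div, abs_of_pos hp, div_le_iff₀ hp]
    refine htan.trans ?_
    have : t ^ 2 ≤ T ^ 2 := sq_le_sq.2 hT
    calc L * (hn n * t) ^ 2 = L * hn n * t ^ 2 * hn n := by ring
      _ ≤ _ := by gcongr
  rw [scaledQ, scaledU_of_nonneg U _ _ ht.1]
  have e2 : Complex.I * sn n * ((U (hn n * t) / hn n : ℝ) - cn n) -
      Complex.I * s * ((U₁ 0 : ℝ) * t - c) =
      Complex.I * (sn n * ((U (hn n * t) / hn n - U₁ 0 * t : ℝ) : ℂ) +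
        ((sn n - s : ℝ) : ℂ) * ((U₁ 0 : ℝ) * (t : ℝ)) - (sn n * cn n - s * c)) := by
    push_cast
    ring
  rw [e2, norm_mul, Complex.norm_I, one_mul]
  refine (norm_sub_le _ _).trans (add_le_add ((norm_add_le _ _).trans (add_le_add ?_ ?_)) le_rfl)
  · rw [norm_mul, Complex.norm_real, Complex.norm_real, Real.norm_eq_abs, Real.norm_eq_abs]
    gcongr
  · rw [norm_mul, norm_mul, Complex.norm_real, Complex.norm_real, Complex.norm_real,
      Real.norm_eq_abs, Real.norm_eq_abs, Real.norm_eq_abs]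
    gcongr

end Scaled

end OrrSommerfeld

namespace OrrSommerfeld

open Set Filter Topology MeasureTheory

open scoped Real

/-! ### The decaying solution -/

section Decaying

variable {Q M s : ℝ} {q m p p' : ℝ → ℂ} {Y : ℝ → Fin 4 → ℂ}

lemma IsWKBAt.const_smul {t : ℝ} (h : IsWKBAt Q s m p Y t) (k : ℂ) :
    IsWKBAt Q s m p (fun t => k • Y t) t := by
  have key : ∀ (R : ℝ) (x y n : ℂ), t ^ 2 * ‖m t‖ * ‖y - n * x‖ ≤ R * ‖x‖ →
      t ^ 2 * ‖m t‖ * ‖k * y - n * (k * x)‖ ≤ R * ‖k * x‖ := by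
    intro R x y n hle
    rw [show k * y - n * (k * x) = k * (y - n * x) by ring, norm_mul, norm_mul]
    nlinarith [norm_nonneg k, mul_le_mul_of_nonneg_left hle (norm_nonneg k)]
  exact ⟨key _ _ _ _ h.1, key _ _ _ _ h.2.1, key _ _ _ _ h.2.2⟩

lemma isWKBAt_of_tendsto {Yn : ℕ → ℝ → Fin 4 → ℂ} {t : ℝ}
    (hY : Tendsto (fun n => Yn n t) atTop (𝓝 (Y t)))
    (hn : ∀ᶠ n in atTop, IsWKBAt Q s m p (Yn n) t) : IsWKBAt Q s m p Y t := by
  have hi : ∀ i, Tendsto (fun n => Yn n t i) atTop (𝓝 (Y t i)) := fun i =>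
    ((continuous_apply i).tendsto _).comp hY
  refine ⟨?_, ?_, ?_⟩
  · exact le_of_tendsto_of_tendsto (((hi 3).sub ((hi 2).const_mul _)).norm.const_mul _)
      ((hi 2).norm.const_mul _) (hn.mono fun n h => h.1)
  · exact le_of_tendsto_of_tendsto (((hi 2).sub ((hi 1).const_mul _)).norm.const_mul _)
      ((hi 1).norm.const_mul _) (hn.mono fun n h => h.2.1)
  · exact le_of_tendsto_of_tendsto (((hi 1).sub ((hi 0).const_mul _)).norm.const_mul _)
      ((hi 0).norm.const_mul _) (hn.mono fun n h => h.2.2)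

/-- A solution whose WKB expansion has no defects at `u`, up to the constant `a`. -/
lemma WKB.exists_jet (h : WKB Q M q m p p') (hs : s = 1 ∨ s = -1) (hq : Continuous q) {u : ℝ}
    (hu : M ≤ u) {a : ℂ} (ha : u ^ 2 * ‖m u‖ * (2 * ‖m u‖ * ‖a‖) ≤ 555 * Q * ‖1 + a‖)
    (ha1 : 1 + a ≠ 0) : ∃ Y, IsJet q Y ∧ Y u 0 = 1 + a ∧ Y u 1 = s * m u - 5 / 2 * p u ∧
      Y u 2 = (s * m u - 3 / 2 * p u) * (s * m u - 5 / 2 * p u) ∧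
      Y u 3 = (s * m u - 1 / 2 * p u) * ((s * m u - 3 / 2 * p u) * (s * m u - 5 / 2 * p u)) ∧
      ∀ T : ℝ, (∀ τ ∈ Icc 0 T, M ≤ u + s * τ) → ∀ τ ∈ Icc 0 T,
        IsWKBAt Q s m p Y (u + s * τ) := by
  obtain ⟨Y, hYu, hY⟩ := exists_isJet hq u ![1 + a, s * m u - 5 / 2 * p u,
    (s * m u - 3 / 2 * p u) * (s * m u - 5 / 2 * p u),
    (s * m u - 1 / 2 * p u) * ((s * m u - 3 / 2 * p u) * (s * m u - 5 / 2 * p u))]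
  have h0 : Y u 0 = 1 + a := by rw [hYu]; rfl
  have h1 : Y u 1 = s * m u - 5 / 2 * p u := by rw [hYu]; rfl
  have h2 : Y u 2 = (s * m u - 3 / 2 * p u) * (s * m u - 5 / 2 * p u) := by rw [hYu]; rfl
  have h3 : Y u 3 = (s * m u - 1 / 2 * p u) *
    ((s * m u - 3 / 2 * p u) * (s * m u - 5 / 2 * p u)) := by rw [hYu]; rfl
  have e1 := h.exponent_ne_zero hs hu (γ := 5 / 2) (by norm_num) le_rfl
  have e2 := h.exponent_ne_zero hs hu (γ := 3 / 2) (by norm_num) (by norm_num)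
  push_cast at e1 e2
  refine ⟨Y, hY, h0, h1, h2, h3, fun T hT τ hτ => ?_⟩
  refine h.propagate hs hq hY hT
    (isWKBAt_of_data h hs hu ha h0 h1 (by rw [h2, h1]) (by rw [h3, h2])) ⟨?_, ?_, ?_⟩ hτ
  · rw [h0]; exact ha1
  · rw [h1]; exact e1
  · rw [h2]; exact mul_ne_zero e2 e1

/-- A normalised solution which follows `exp (-∫ m)` up to infinity, obtained as the limit of the
solutions with WKB data at `T → ∞`. -/
theorem WKB.exists_decaying (h : WKB Q M q m p p') (hq : Continuous q) :
    ∃ Y, IsJet q Y ∧ ‖Y 0‖ = 1 ∧ ∀ t, M ≤ t → IsWKBAt Q (-1) m p Y t := by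
  have hs : (-1 : ℝ) = 1 ∨ (-1 : ℝ) = -1 := Or.inr rfl
  have hQ := h.one_le_Q
  have hstep : ∀ n : ℕ, ∃ Z, IsJet q Z ∧ ‖Z 0‖ = 1 ∧
      ∀ t, M ≤ t → t ≤ M + n → IsWKBAt Q (-1) m p Z t := by
    intro n
    have hu : M ≤ M + n := by simp
    obtain ⟨Z, hZ, h0, -, -, -, hw⟩ := h.exists_jet hs hq hu (a := 0)
      (by simp; linarith) (by simp)
    have hZ0 : Z 0 ≠ 0 := fun hc => by
      have := hZ.eq_zero hq hc (M + n)
      rw [this] at h0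
      simp at h0
    have hZn : ‖Z 0‖ ≠ 0 := norm_ne_zero_iff.2 hZ0
    refine ⟨fun t => ((‖Z 0‖⁻¹ : ℝ) : ℂ) • Z t, hZ.const_smul _, ?_, fun t ht1 ht2 =>
      IsWKBAt.const_smul ?_ _⟩
    · change ‖((‖Z 0‖⁻¹ : ℝ) : ℂ) • Z 0‖ = 1
      rw [norm_smul, Complex.norm_real, norm_inv, norm_norm, inv_mul_cancel₀ hZn]
    · have := hw n (fun τ hτ => by linarith [hτ.2]) (M + n - t)
        ⟨by linarith, by linarith⟩
      rwa [show M + n + -1 * (M + n - t) = t by ring] at this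
  choose Z hZ hZ1 hZw using hstep
  obtain ⟨y₀, hy₀, φ, hφ, hlim⟩ := (isCompact_sphere (0 : Fin 4 → ℂ) 1).tendsto_subseq
    (x := fun n => Z n 0) (fun n => by simp [hZ1 n])
  obtain ⟨Y, hY0, hY⟩ := exists_isJet hq 0 y₀
  refine ⟨Y, hY, by rw [hY0]; simpa using hy₀, fun t ht => ?_⟩
  have ht0 : 0 ≤ t := (h.pos ht).le
  have hconv := tendsto_isJet (qn := fun _ => q) (Yn := fun n => Z (φ n)) (fun n => hZ (φ n)) hY hq
    (fun T η hη => Eventually.of_forall fun n u _ => by simpa using hη.le)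
    (by rw [hY0]; exact hlim) (tn := fun _ => t) (fun _ => ht0) tendsto_const_nhds
  refine isWKBAt_of_tendsto hconv ?_
  filter_upwards [eventually_ge_atTop ⌈t - M⌉₊] with n hn
  refine hZw (φ n) t ht ?_
  have h1 : t - M ≤ n := (Nat.le_ceil _).trans (by exact_mod_cast hn)
  have h2 : (n : ℝ) ≤ φ n := by exact_mod_cast hφ.id_le n
  linarith

/-- The integral of the real part of a continuous function on the half line. -/
lemma integral_re_properties (hm : ContinuousOn m (Ici 0)) :
    ContinuousOn (fun t => ∫ y in (0 : ℝ)..t, (m y).re) (Ici 0) ∧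
    (∀ t, 0 < t → HasDerivAt (fun t => ∫ y in (0 : ℝ)..t, (m y).re) (m t).re t) ∧
    ∀ t₁ t₂, 0 ≤ t₁ → t₁ ≤ t₂ → (∫ y in (0 : ℝ)..t₂, (m y).re) - ∫ y in (0 : ℝ)..t₁, (m y).re =
      ∫ y in t₁..t₂, (m y).re := by
  have hre : ContinuousOn (fun y => (m y).re) (Ici 0) :=
    Complex.continuous_re.comp_continuousOn hm
  have hint : ∀ t₁ t₂, 0 ≤ t₁ → 0 ≤ t₂ →
      IntervalIntegrable (fun y => (m y).re) volume t₁ t₂ := fun t₁ t₂ h1 h2 =>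
    (hre.mono fun y hy => (le_min h1 h2).trans hy.1).intervalIntegrable
  have hder : ∀ t, 0 < t → HasDerivAt (fun t => ∫ y in (0 : ℝ)..t, (m y).re) (m t).re t :=
    fun t ht => intervalIntegral.integral_hasDerivAt_right (hint 0 t le_rfl ht.le)
      (ContinuousOn.stronglyMeasurableAtFilter isOpen_Ioi (hre.mono Ioi_subset_Ici_self) t ht)
      (hre.continuousAt (Ici_mem_nhds ht))
  refine ⟨fun t ht => ?_, hder, fun t₁ t₂ h1 h2 => ?_⟩
  · have hc := intervalIntegral.continuousOn_primitive_interval (μ := volume)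
      (f := fun y => (m y).re) (a := 0) (b := t + 1)
      ((hre.mono (by
        rw [uIcc_of_le (by linarith [mem_Ici.1 ht])]
        exact Icc_subset_Ici_self)).integrableOn_compact isCompact_uIcc)
    rw [uIcc_of_le (by linarith [mem_Ici.1 ht])] at hc
    refine (hc t ⟨ht, by linarith⟩).mono_of_mem_nhdsWithin ?_
    rw [← Ici_inter_Iic]
    exact inter_mem_nhdsWithin _ (Iic_mem_nhds (by linarith))
  · exact intervalIntegral.integral_interval_sub_left (hint 0 t₂ le_rfl (h1.trans h2))
      (hint 0 t₁ le_rfl h1)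

/-- Exponential decay of the solutions that follow `exp (-∫ m)`. -/
lemma WKB.decay (h : WKB Q M q m p p') (hm : ContinuousOn m (Ici 0)) (hY : IsJet q Y)
    (hw : ∀ t, M ≤ t → IsWKBAt Q (-1) m p Y t) {t : ℝ} (ht : M ≤ t) :
    ‖Y t 0‖ ^ 2 * ‖m t‖ ^ 5 ≤
      Real.exp (1110 * Q) * Real.exp (-(0.76 * (t - M))) * (‖Y M 0‖ ^ 2 * ‖m M‖ ^ 5) := by
  obtain ⟨h1, h2, h3⟩ := integral_re_properties hm
  have hM0 := h.pos le_rfl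
  have hg := h.growth (s := -1) hY le_rfl ht
    (h1.mono fun y hy => hM0.le.trans hy.1) (fun y hy => h2 y (hM0.trans hy.1))
    (fun y hy => hw y hy.1)
  rw [h3 M t hM0.le ht] at hg
  refine hg.trans ?_
  have hint : 0.38 * (t - M) ≤ ∫ y in M..t, (m y).re := by
    have := intervalIntegral.integral_mono_on ht (f := fun _ => (0.38 : ℝ))
      (g := fun y => (m y).re) (μ := volume) intervalIntegrable_const
      (((Complex.continuous_re.comp_continuousOn hm).mono
        fun y hy => hM0.le.trans (by rw [uIcc_of_le ht] at hy; exact hy.1)).intervalIntegrable)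
      (fun y hy => by
        have e1 := h.re y hy.1
        have e2 := h.one_le y hy.1
        linarith)
    simpa [mul_comm] using this
  gcongr
  linarith

end Decaying

section DecayingScaled

variable {U U₁ U₂ : ℝ → ℝ} {κ L a b K Q M D : ℝ}

lemma ProfileBounds.norm_jet_le (hB : ProfileBounds U U₁ U₂ κ L) (ha : 0 < a) {σ h s : ℝ} {c : ℂ}
    (hs : IsScaled U σ a b K h s c) {Y : ℝ → Fin 4 → ℂ} (hY : IsJet (scaledQ U σ h s c) Y)
    {t₀ t : ℝ} (ht₀ : t₀ ∈ Icc 0 M) (ht : t ∈ Icc 0 M) :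
    ‖Y t‖ ≤ ‖Y t₀‖ * Real.exp ((1 + b * (L * M + K)) * M) := by
  have hL : 0 ≤ L := (abs_nonneg _).trans (hB.deriv2_le' 0 le_rfl)
  have hb : 0 ≤ b := ha.le.trans (hs.lower.trans hs.upper)
  have hK : 0 ≤ K := (norm_nonneg c).trans hs.c_le
  have hM : 0 ≤ M := ht.1.trans ht.2
  refine (hY.norm_le (ordConnected_Icc (a := (0 : ℝ)) (b := M)) (K := b * (L * M + K))
    (fun u hu => ?_) ht₀ ht).trans ?_
  · refine (hB.norm_scaledQ_le hs ha hu.1).trans ?_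
    have := hu.2
    gcongr
  · gcongr
    rw [abs_le]
    constructor <;> linarith [ht.1, ht.2, ht₀.1, ht₀.2]

lemma tendsto_of_sq_le_pow_mul_exp {f : ℝ → ℝ} {C k : ℝ} (hk : 0 < k) (hf : ∀ t, 0 ≤ f t)
    (h : ∀ᶠ t in atTop, f t ^ 2 ≤ C * t ^ 3 * Real.exp (-(k * t))) :
    Tendsto (fun t => (1 + t) * f t) atTop (𝓝 0) := by
  have h1 : Tendsto (fun t : ℝ => 4 * C * (t ^ (5 : ℝ) * Real.exp (-k * t))) atTop (𝓝 0) := by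
    simpa using (tendsto_rpow_mul_exp_neg_mul_atTop_nhds_zero 5 k hk).const_mul (4 * C)
  have h2 : Tendsto (fun t => ((1 + t) * f t) ^ 2) atTop (𝓝 0) := by
    refine squeeze_zero' (Eventually.of_forall fun t => sq_nonneg _) ?_ h1
    filter_upwards [h, eventually_ge_atTop 1] with t ht ht1
    have e : t ^ (5 : ℝ) = t ^ 5 := by exact_mod_cast Real.rpow_natCast t 5
    rw [e, mul_pow]
    calc (1 + t) ^ 2 * f t ^ 2 ≤ (2 * t) ^ 2 * (C * t ^ 3 * Real.exp (-(k * t))) := by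
          gcongr
          linarith
      _ = _ := by rw [neg_mul]; ring
  have h3 := (Real.continuous_sqrt.tendsto 0).comp h2
  rw [Real.sqrt_zero] at h3
  refine h3.congr' ?_
  filter_upwards [eventually_ge_atTop 0] with t ht
  exact Real.sqrt_sq (mul_nonneg (by linarith) (hf t))

/-- The decaying solution is bounded away from zero on `[0, M]`, uniformly in the parameters: by
compactness a failure would produce a decaying solution with a zero for the linear profile. -/
theorem ProfileBounds.exists_lower_bound (hB : ProfileBounds U U₁ U₂ κ L) (ha : 0 < a)
    (hKM : 2 * K ≤ κ * M) (hM : 1 ≤ M)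
    (hwkb : ∀ (h s : ℝ) (c : ℂ), IsScaled U (U₁ 0) a b K h s c → h * M ≤ 1 →
      WKB Q M (scaledQ U (U₁ 0) h s c) (scaledRoot U (U₁ 0) h s c) (scaledLog U U₁ h c)
        (scaledLog' U U₁ U₂ h c))
    (hD : ∀ (h s : ℝ) (c : ℂ), IsScaled U (U₁ 0) a b K h s c → h * M ≤ 1 → ∀ ζ, M ≤ ζ →
      ‖scaledRoot U (U₁ 0) h s c ζ‖ ^ 2 ≤ D * ζ) :
    ∃ h₀ d : ℝ, 0 < h₀ ∧ 0 < d ∧ h₀ * M ≤ 1 ∧ ∀ (h s : ℝ) (c : ℂ),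
      IsScaled U (U₁ 0) a b K h s c → h ≤ h₀ → ∀ Y, IsJet (scaledQ U (U₁ 0) h s c) Y →
      ‖Y 0‖ = 1 → (∀ t, M ≤ t → IsWKBAt Q (-1) (scaledRoot U (U₁ 0) h s c)
        (scaledLog U U₁ h c) Y t) → ∀ t ∈ Icc 0 M, d ≤ ‖Y t 0‖ := by
  have hM0 : 0 < M := by linarith
  have hκ := hB.kappa_pos
  by_contra! hcon
  have hseq : ∀ n : ℕ, ∃ (h s : ℝ) (c : ℂ) (Y : ℝ → Fin 4 → ℂ) (t : ℝ),
      IsScaled U (U₁ 0) a b K h s c ∧ h ≤ 1 / (M * (n + 1)) ∧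
      IsJet (scaledQ U (U₁ 0) h s c) Y ∧ ‖Y 0‖ = 1 ∧
      (∀ t, M ≤ t → IsWKBAt Q (-1) (scaledRoot U (U₁ 0) h s c) (scaledLog U U₁ h c) Y t) ∧
      t ∈ Icc 0 M ∧ ‖Y t 0‖ < 1 / ((n : ℝ) + 1) := by
    intro n
    obtain ⟨h, s, c, hs, hle, Y, hY, hY0, hw, t, ht, hlt⟩ :=
      hcon (1 / (M * (n + 1))) (1 / ((n : ℝ) + 1)) (by positivity) (by positivity)
        (by
          rw [div_mul_eq_mul_div, one_mul, div_le_one (by positivity)]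
          nlinarith [(Nat.cast_nonneg n : (0 : ℝ) ≤ n)])
    exact ⟨h, s, c, Y, t, hs, hle, hY, hY0, hw, ht, hlt⟩
  choose h s c Y t hs hle hY hY0 hw ht hlt using hseq
  have hhM : ∀ n, h n * M ≤ 1 := fun n => by
    have := mul_le_mul_of_nonneg_right (hle n) hM0.le
    refine this.trans ?_
    rw [div_mul_eq_mul_div, one_mul, div_le_one (by positivity)]
    nlinarith [(Nat.cast_nonneg n : (0 : ℝ) ≤ n)]
  have hh : Tendsto h atTop (𝓝 0) := by
    refine squeeze_zero (fun n => (hs n).h_pos.le) (fun n => (hle n).trans ?_)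
      tendsto_one_div_add_atTop_nhds_zero_nat
    gcongr
    nlinarith [(Nat.cast_nonneg n : (0 : ℝ) ≤ n)]
  have hK0 : 0 ≤ K := (norm_nonneg _).trans (hs 0).c_le
  have hsign : ∀ n, 0 ≤ (c n).im ∨ (c n).re ≤ 0 := fun n =>
    (hs n).sign hB ha (by nlinarith [hhM n, (hs n).h_pos])
  -- a convergent subsequence of the parameters, of the data and of the zeros
  obtain ⟨⟨s', c', y', t'⟩, hmem, φ, hφ, hlim⟩ :=
    (((isCompact_Icc (a := a) (b := b)).prod ((isCompact_closedBall (0 : ℂ) K).prod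
      ((isCompact_sphere (0 : Fin 4 → ℂ) 1).prod (isCompact_Icc (a := (0 : ℝ)) (b := M)))))).tendsto_subseq
      (x := fun n => (s n, c n, Y n 0, t n)) (fun n => by
        refine ⟨⟨(hs n).lower, (hs n).upper⟩, ?_, ?_, ht n⟩
        · simpa using (hs n).c_le
        · simpa using hY0 n)
  rw [Prod.tendsto_iff] at hlim
  obtain ⟨hls, hlim⟩ := hlim
  rw [Prod.tendsto_iff] at hlim
  obtain ⟨hlc, hlim⟩ := hlim
  rw [Prod.tendsto_iff] at hlim
  obtain ⟨hly, hlt'⟩ := hlim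
  obtain ⟨hms, -, hmy, hmt⟩ := hmem
  simp only [Function.comp_def] at hls hlc hly hlt'
  have hs' : 0 < s' := ha.trans_le hms.1
  have hsign' : 0 ≤ c'.im ∨ c'.re ≤ 0 := by
    have hcl : IsClosed {z : ℂ | 0 ≤ z.im ∨ z.re ≤ 0} :=
      (isClosed_le continuous_const Complex.continuous_im).union
        (isClosed_le Complex.continuous_re continuous_const)
    exact hcl.mem_of_tendsto hlc (Eventually.of_forall fun n => hsign (φ n))
  have hqc : Continuous fun t : ℝ => Complex.I * s' * ((U₁ 0 : ℝ) * t - c') := by fun_prop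
  obtain ⟨Z, hZ0, hZ⟩ := exists_isJet hqc 0 y'
  have hconv : ∀ {u : ℕ → ℝ} {u' : ℝ}, (∀ n, 0 ≤ u n) → Tendsto u atTop (𝓝 u') →
      Tendsto (fun n => Y (φ n) (u n)) atTop (𝓝 (Z u')) := fun {u u'} hu hu' =>
    tendsto_isJet (fun n => hY (φ n)) hZ hqc
      (fun T η hη => hB.eventually_scaledQ (fun n => (hs (φ n)).h_pos)
        (hh.comp hφ.tendsto_atTop) hls hlc T η hη) (by rw [hZ0]; exact hly) hu hu'
  have hzero : Z t' 0 = 0 := by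
    have h1 := ((continuous_apply (0 : Fin 4)).tendsto _).comp
      (hconv (fun n => (ht (φ n)).1) hlt')
    have h2 : Tendsto (fun n => Y (φ n) (t (φ n)) 0) atTop (𝓝 0) :=
      squeeze_zero_norm (fun n => (hlt (φ n)).le)
        (tendsto_one_div_add_atTop_nhds_zero_nat.comp hφ.tendsto_atTop)
    exact tendsto_nhds_unique h1 h2
  -- the uniform decay passes to the limit
  set E := Real.exp ((1 + b * (L * M + K)) * M) with hE
  set C := 64 * D ^ 3 * (Real.exp (1110 * Q) * Real.exp (0.76 * M) * (E ^ 2 * (1 + D * M) ^ 3))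
    with hC
  have hdecn : ∀ n u, M ≤ u → ‖Y n u‖ ^ 2 ≤ C * u ^ 3 * Real.exp (-(0.76 * u)) := by
    intro n u hu
    have W := hwkb _ _ _ (hs n) (hhM n)
    have hu0 : 0 < u := hM0.trans_le hu
    have h1 := W.decay ((hs n).continuousOn_root hB) (hY n) (hw n) hu
    have h2 := W.norm_le (Or.inr rfl) hu (hw n u hu)
    have h3 := hD _ _ _ (hs n) (hhM n) u hu
    have h4 := hD _ _ _ (hs n) (hhM n) M le_rfl
    have h5 := W.one_le u hu
    have h6 := W.one_le M le_rfl
    have h7 := hB.norm_jet_le (M := M) ha (hs n) (hY n) (t₀ := 0) (t := M) ⟨le_rfl, hM0.le⟩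
      ⟨hM0.le, le_rfl⟩
    rw [hY0 n, one_mul] at h7
    have h8 : ‖Y n M 0‖ ≤ E := (norm_le_pi_norm _ 0).trans h7
    set m := scaledRoot U (U₁ 0) (h n) (s n) (c n)
    have h9 : ‖m M‖ ^ 5 ≤ (1 + D * M) ^ 3 := by
      calc ‖m M‖ ^ 5 ≤ ‖m M‖ ^ 6 := pow_le_pow_right₀ h6 (by norm_num)
        _ = (‖m M‖ ^ 2) ^ 3 := by ring
        _ ≤ _ := by gcongr; linarith
    have h10 : ‖m u‖ ^ 6 ≤ D ^ 3 * u ^ 3 := by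
      calc ‖m u‖ ^ 6 = (‖m u‖ ^ 2) ^ 3 := by ring
        _ ≤ (D * u) ^ 3 := by gcongr
        _ = _ := by ring
    have h11 : ‖Y n u 0‖ ^ 2 ≤ Real.exp (1110 * Q) * Real.exp (-(0.76 * (u - M))) *
        (E ^ 2 * (1 + D * M) ^ 3) := by
      calc ‖Y n u 0‖ ^ 2 ≤ ‖Y n u 0‖ ^ 2 * ‖m u‖ ^ 5 :=
            le_mul_of_one_le_right (sq_nonneg _) (one_le_pow₀ h5)
        _ ≤ _ := h1.trans (by gcongr)
    calc ‖Y n u‖ ^ 2 ≤ (8 * ‖m u‖ ^ 3 * ‖Y n u 0‖) ^ 2 := by gcongr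
      _ = 64 * ‖m u‖ ^ 6 * ‖Y n u 0‖ ^ 2 := by ring
      _ ≤ 64 * (D ^ 3 * u ^ 3) * (Real.exp (1110 * Q) * Real.exp (-(0.76 * (u - M))) *
          (E ^ 2 * (1 + D * M) ^ 3)) := by
          have : 0 ≤ D ^ 3 * u ^ 3 := (by positivity : 0 ≤ ‖m u‖ ^ 6).trans h10
          gcongr
      _ = _ := by
          rw [show -(0.76 * (u - M)) = 0.76 * M + -(0.76 * u) by ring, Real.exp_add, hC]
          ring
  have hdec : ∀ u, M ≤ u → ‖Z u‖ ^ 2 ≤ C * u ^ 3 * Real.exp (-(0.76 * u)) := fun u hu =>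
    le_of_tendsto ((hconv (u := fun _ => u) (fun _ => hM0.le.trans hu) tendsto_const_nhds).norm.pow 2)
      (Eventually.of_forall fun n => hdecn (φ n) u hu)
  have hfin := decaying_jet_eq_zero hs' hB.slope_pos hsign' hZ
    (tendsto_of_sq_le_pow_mul_exp (by norm_num) (fun _ => norm_nonneg _)
      ((eventually_ge_atTop M).mono hdec)) hmt.1 hzero 0
  rw [hZ0] at hfin
  have hy1 : ‖y'‖ = 1 := by simpa using hmy
  rw [hfin, norm_zero] at hy1
  exact zero_ne_one hy1

end DecayingScaled

end OrrSommerfeld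

namespace OrrSommerfeld

open Set Filter Topology MeasureTheory

open scoped Real

/-! ### The growing solution, and the common properties of the two solutions -/

/-- A curve of bounded length cannot come close to all the points of a disc: some small translation
moves it away from the origin, by a distance that does not depend on the curve. -/
lemma exists_translation_away {B M r : ℝ} (hB : 0 < B) (hM : 0 < M) (hr : 0 < r) :
    ∃ d : ℝ, 0 < d ∧ ∀ γ : ℝ → ℂ, (∀ x ∈ Icc 0 M, ∀ y ∈ Icc 0 M, ‖γ x - γ y‖ ≤ B * |x - y|) →
      ∃ z : ℂ, ‖z‖ ≤ r ∧ ∀ t ∈ Icc 0 M, d ≤ ‖γ t + z‖ := by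
  obtain ⟨n, hn⟩ := exists_nat_gt (max 1 (8 * (B * M) ^ 2 / r ^ 2))
  have hn1 : (1 : ℝ) < n := (le_max_left _ _).trans_lt hn
  have hn2 : 8 * (B * M) ^ 2 < n * r ^ 2 := by
    have := (le_max_right _ _).trans_lt hn
    rwa [div_lt_iff₀ (by positivity)] at this
  have hn0 : (0 : ℝ) < n := by linarith
  set d := B * M / n with hd
  have hd0 : 0 < d := by positivity
  refine ⟨d, hd0, fun γ hγ => ?_⟩
  by_contra! hcon
  have hcover : Metric.closedBall (0 : ℂ) r ⊆
      ⋃ i ∈ Finset.range (n + 1), Metric.ball (-γ (i * M / n)) (2 * d) := by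
    intro z hz
    obtain ⟨t, ht, hlt⟩ := hcon z (by simpa using hz)
    -- the grid point next to `t`
    set i := ⌊t * n / M⌋₊
    have h0 : 0 ≤ t * n / M := div_nonneg (mul_nonneg ht.1 hn0.le) hM.le
    have h1 : (i : ℝ) ≤ t * n / M := Nat.floor_le h0
    have h2 : t * n / M < i + 1 := Nat.lt_floor_add_one _
    have h3 : t * n / M ≤ n := by
      rw [div_le_iff₀ hM]
      nlinarith [ht.2]
    have hi : i ≤ n := by exact_mod_cast h1.trans h3
    have hi' : (i : ℝ) ≤ n := by exact_mod_cast hi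
    rw [le_div_iff₀ hM] at h1
    rw [div_lt_iff₀ hM] at h2
    have hmem : (i : ℝ) * M / n ∈ Icc 0 M := by
      refine ⟨by positivity, ?_⟩
      rw [div_le_iff₀ hn0]
      nlinarith
    simp only [mem_iUnion, Finset.mem_range, Metric.mem_ball]
    refine ⟨i, by omega, ?_⟩
    rw [dist_eq_norm, sub_neg_eq_add]
    have h4 : |i * M / n - t| ≤ M / n := by
      rw [abs_le]
      constructor
      · rw [neg_le_sub_iff_le_add, ← add_div, le_div_iff₀ hn0]
        nlinarith
      · have : i * M / n ≤ t := by rw [div_le_iff₀ hn0]; exact h1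
        have : 0 ≤ M / n := by positivity
        linarith
    have h5 : ‖γ (i * M / n) - γ t‖ ≤ d := by
      refine (hγ _ hmem t ht).trans ?_
      exact (mul_le_mul_of_nonneg_left h4 hB.le).trans_eq (mul_div_assoc _ _ _).symm
    have h6 := norm_add_le (γ (i * M / n) - γ t) (γ t + z)
    rw [show γ (i * M / n) - γ t + (γ t + z) = z + γ (i * M / n) by ring] at h6
    linarith
  have hvol : volume (Metric.closedBall (0 : ℂ) r) ≤
      ∑ i ∈ Finset.range (n + 1), volume (Metric.ball (-γ (i * M / n)) (2 * d)) :=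
    (measure_mono hcover).trans (measure_biUnion_finset_le _ _)
  simp only [Complex.volume_closedBall, Complex.volume_ball, Finset.sum_const, Finset.card_range,
    nsmul_eq_mul] at hvol
  rw [← mul_assoc, ENNReal.mul_le_mul_iff_left (ENNReal.coe_ne_zero.2 NNReal.pi_ne_zero) (by simp),
    ← ENNReal.ofReal_pow hr.le, ← ENNReal.ofReal_pow (by positivity), ← ENNReal.ofReal_natCast,
    ← ENNReal.ofReal_mul (by positivity), ENNReal.ofReal_le_ofReal_iff (by positivity)] at hvol
  have hd2 : d ^ 2 * n ^ 2 = (B * M) ^ 2 := by rw [hd]; field_simp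
  push_cast at hvol
  have h7 : r ^ 2 * n ^ 2 ≤ (n + 1) * 4 * (B * M) ^ 2 := by
    rw [← hd2]
    nlinarith [sq_nonneg (n : ℝ)]
  have h8 : (n + 1) * 4 * (B * M) ^ 2 ≤ n * (8 * (B * M) ^ 2) := by
    nlinarith [sq_nonneg (B * M)]
  have h9 : n * (8 * (B * M) ^ 2) < n * (n * r ^ 2) := by gcongr
  linarith

/-- A solution of the rescaled equation that follows `exp (s ∫ m)` on `[M, ∞)` and stays away from
zero on `[0, M]`, with constants `d` and `G`. -/
structure IsMode (Q M d G s : ℝ) (q m p : ℝ → ℂ) (Y : ℝ → Fin 4 → ℂ) : Prop where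
  isJet : IsJet q Y
  isWKBAt : ∀ t, M ≤ t → IsWKBAt Q s m p Y t
  le_norm : ∀ t ∈ Icc 0 M, d ≤ ‖Y t 0‖
  norm_le : ∀ t ∈ Icc 0 M, ‖Y t‖ ≤ G

section Modes

variable {U U₁ U₂ : ℝ → ℝ} {κ L a b K Q M D : ℝ}

/-- The growing solution: WKB data at `M`, up to a small constant which is used to avoid zeros. -/
lemma ProfileBounds.exists_growing (hB : ProfileBounds U U₁ U₂ κ L) (ha : 0 < a)
    (hM : 1 ≤ M) (hD1 : 1 ≤ D) : ∃ d G : ℝ, 0 < d ∧ ∀ (h s : ℝ) (c : ℂ),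
      IsScaled U (U₁ 0) a b K h s c →
      WKB Q M (scaledQ U (U₁ 0) h s c) (scaledRoot U (U₁ 0) h s c) (scaledLog U U₁ h c)
        (scaledLog' U U₁ U₂ h c) →
      ‖scaledRoot U (U₁ 0) h s c M‖ ^ 2 ≤ D * M →
      ∃ Y, IsMode Q M d G 1 (scaledQ U (U₁ 0) h s c) (scaledRoot U (U₁ 0) h s c)
        (scaledLog U U₁ h c) Y := by
  have hM0 : 0 < M := by linarith
  have hL : 0 ≤ L := (abs_nonneg _).trans (hB.deriv2_le' 0 le_rfl)
  set E := Real.exp ((1 + b * (L * M + K)) * M) with hE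
  have hE0 : 0 < E := Real.exp_pos _
  set G := 8 * (D * M) ^ 2 * 2 * E
  have hG : 0 < G := by positivity
  set r := 1 / (2 + 2 * D * M ^ 3) with hr
  have hr0 : 0 < r := by positivity
  have hr2 : r ≤ 1 / 2 := by
    rw [hr]
    gcongr
    have : 0 ≤ 2 * D * M ^ 3 := by positivity
    linarith
  obtain ⟨d, hd, hcurve⟩ := exists_translation_away hG hM0 hr0
  refine ⟨d, G, hd, fun h s c hs W hm => ?_⟩
  have hs1 : (1 : ℝ) = 1 ∨ (1 : ℝ) = -1 := Or.inl rfl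
  have hqc := hB.continuous_scaledQ (U₁ 0) hs.h_pos s c
  set q := scaledQ U (U₁ 0) h s c
  set m := scaledRoot U (U₁ 0) h s c
  have hbound : ∀ z : ℂ, ‖z‖ ≤ 1 / 2 → 1 / 2 ≤ ‖1 + z‖ ∧ ‖1 + z‖ ≤ 2 := fun z hz => by
    have h1 := norm_sub_norm_le (1 : ℂ) (-z)
    have h2 := norm_add_le (1 : ℂ) z
    rw [norm_one] at h1 h2
    rw [norm_neg, sub_neg_eq_add] at h1
    constructor <;> linarith
  have hex : ∀ z : ℂ, ‖z‖ ≤ r → _ := fun z hz => W.exists_jet hs1 hqc le_rfl (a := z)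
    (by
      obtain ⟨h1, h2⟩ := hbound z (hz.trans hr2)
      have h3 : 2 * D * M ^ 3 * r ≤ 1 := by
        rw [hr, mul_one_div, div_le_one (by positivity)]
        linarith
      have hQ := W.one_le_Q
      calc M ^ 2 * ‖m M‖ * (2 * ‖m M‖ * ‖z‖) = M ^ 2 * 2 * ‖m M‖ ^ 2 * ‖z‖ := by ring
        _ ≤ M ^ 2 * 2 * (D * M) * r := by gcongr
        _ = 2 * D * M ^ 3 * r := by ring
        _ ≤ 555 * 1 * (1 / 2) := by linarith
        _ ≤ _ := by gcongr)
    (by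
      obtain ⟨h1, -⟩ := hbound z (hz.trans hr2)
      exact norm_pos_iff.1 (by linarith))
  have hbd : ∀ z : ℂ, ‖z‖ ≤ r → ∀ Y, IsJet q Y → Y M 0 = 1 + z →
      IsWKBAt Q 1 m (scaledLog U U₁ h c) Y M → ∀ t ∈ Icc 0 M, ‖Y t‖ ≤ G := by
    intro z hz Y hY h0 hw t ht
    refine (hB.norm_jet_le ha hs hY (t₀ := M) ⟨hM0.le, le_rfl⟩ ht).trans ?_
    rw [← hE]
    have h1 := W.norm_le hs1 le_rfl hw
    have h2 := (hbound z (hz.trans hr2)).2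
    have h3 : ‖m M‖ ^ 3 ≤ (D * M) ^ 2 := by
      calc ‖m M‖ ^ 3 ≤ ‖m M‖ ^ 4 := pow_le_pow_right₀ (W.one_le M le_rfl) (by norm_num)
        _ = (‖m M‖ ^ 2) ^ 2 := by ring
        _ ≤ _ := by gcongr
    rw [h0] at h1
    have h4 : ‖Y M‖ ≤ 8 * (D * M) ^ 2 * 2 := h1.trans (by gcongr)
    simp only [G]
    gcongr
  have hw0 : ∀ Y : ℝ → Fin 4 → ℂ, (∀ T : ℝ, (∀ τ ∈ Icc 0 T, M ≤ M + 1 * τ) → ∀ τ ∈ Icc 0 T,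
      IsWKBAt Q 1 m (scaledLog U U₁ h c) Y (M + 1 * τ)) → ∀ t, M ≤ t →
      IsWKBAt Q 1 m (scaledLog U U₁ h c) Y t := fun Y hY t ht => by
    have := hY (t - M) (fun τ hτ => by linarith [hτ.1]) (t - M) ⟨by linarith, le_rfl⟩
    rwa [one_mul, add_sub_cancel] at this
  obtain ⟨Φ, hΦ, hΦ0, hΦ1, hΦ2, hΦ3, hΦw⟩ := hex 0 (by simpa using hr0.le)
  have hΦG := hbd 0 (by simpa using hr0.le) Φ hΦ hΦ0 (hw0 Φ hΦw M le_rfl)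
  obtain ⟨z, hz, hzd⟩ := hcurve (fun t => Φ t 0) (fun x hx y hy => by
    have := (convex_Icc (0 : ℝ) M).norm_image_sub_le_of_norm_hasDerivWithin_le (f := fun t => Φ t 0)
      (f' := fun t => Φ t 1) (C := G) (fun t _ => (hΦ.hasDerivAt_zero t).hasDerivWithinAt)
      (fun t ht => (norm_le_pi_norm _ 1).trans (hΦG t ht)) hy hx
    simpa using this)
  obtain ⟨Y, hY, hY0, hY1, hY2, hY3, hYw⟩ := hex z hz
  refine ⟨Y, hY, hw0 Y hYw, fun t ht => ?_, hbd z hz Y hY hY0 (hw0 Y hYw M le_rfl)⟩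
  have haff := (hY.add (hΦ.const_smul (-1))).eq_affine hqc (t₀ := M)
    (by simp [hY2, hΦ2]) (by simp [hY3, hΦ3]) t
  have h0 := congrFun haff 0
  simp [hY0, hΦ0, hY1, hΦ1] at h0
  have : Y t 0 = Φ t 0 + z := by linear_combination h0
  rw [this]
  exact hzd t ht

/-- Both solutions exist, with constants that do not depend on the parameters. -/
theorem ProfileBounds.exists_modes (hB : ProfileBounds U U₁ U₂ κ L) (ha : 0 < a)
    (hK : 0 < K) : ∃ Q M D d G h₀ : ℝ, 1 ≤ D ∧ 0 < d ∧ 0 < h₀ ∧ 1 ≤ M ∧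
      ∀ (h s : ℝ) (c : ℂ), IsScaled U (U₁ 0) a b K h s c → h ≤ h₀ →
      WKB Q M (scaledQ U (U₁ 0) h s c) (scaledRoot U (U₁ 0) h s c) (scaledLog U U₁ h c)
        (scaledLog' U U₁ U₂ h c) ∧
      (∀ ζ, M ≤ ζ → h * ‖scaledRoot U (U₁ 0) h s c ζ‖ ^ 2 ≤ D) ∧
      (∀ t₁ t₂, M ≤ t₁ → t₁ ≤ t₂ →
        ‖scaledRoot U (U₁ 0) h s c t₁‖ ^ 2 ≤ D * ‖scaledRoot U (U₁ 0) h s c t₂‖ ^ 2) ∧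
      (∃ Y, IsMode Q M d G 1 (scaledQ U (U₁ 0) h s c) (scaledRoot U (U₁ 0) h s c)
        (scaledLog U U₁ h c) Y) ∧
      ∃ Y, IsMode Q M d G (-1) (scaledQ U (U₁ 0) h s c) (scaledRoot U (U₁ 0) h s c)
        (scaledLog U U₁ h c) Y := by
  obtain ⟨Q, M, D, hD1, hM, hKM, hwkb⟩ := hB.exists_wkb (b := b) (U₁ 0) K ha hK
  have hM0 : 0 < M := by linarith
  obtain ⟨d₁, G₁, hd₁, hgrow⟩ := hB.exists_growing (Q := Q) (b := b) (K := K) ha hM hD1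
  obtain ⟨h₀, d₂, hh₀, hd₂, hh₀M, hlow⟩ := hB.exists_lower_bound (Q := Q) (D := D) (b := b) ha hKM hM
    (fun h s c hs hh => (hwkb h s c hs hh).1)
    (fun h s c hs hh ζ hζ => ((hwkb h s c hs hh).2.1 ζ hζ).1)
  set E := Real.exp ((1 + b * (L * M + K)) * M) with hE
  refine ⟨Q, M, D, min d₁ d₂, max G₁ E, h₀, hD1, lt_min hd₁ hd₂, hh₀, hM, fun h s c hs hh => ?_⟩
  have hhM : h * M ≤ 1 := (mul_le_mul_of_nonneg_right hh hM0.le).trans hh₀M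
  obtain ⟨W, hm, hmm⟩ := hwkb h s c hs hhM
  refine ⟨W, fun ζ hζ => (hm ζ hζ).2, hmm, ?_, ?_⟩
  · obtain ⟨Y, hY⟩ := hgrow h s c hs W (hm M le_rfl).1
    exact ⟨Y, hY.isJet, hY.isWKBAt, fun t ht => (min_le_left _ _).trans (hY.le_norm t ht),
      fun t ht => (hY.norm_le t ht).trans (le_max_left _ _)⟩
  · obtain ⟨Y, hY, hY0, hw⟩ := W.exists_decaying (hB.continuous_scaledQ (U₁ 0) hs.h_pos s c)
    refine ⟨Y, hY, hw, fun t ht => (min_le_right _ _).trans (hlow h s c hs hh Y hY hY0 hw t ht),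
      fun t ht => ?_⟩
    have := hB.norm_jet_le ha hs hY (M := M) (t₀ := 0) ⟨le_rfl, hM0.le⟩ ht
    rw [hY0, one_mul] at this
    exact this.trans (le_max_right _ _)

end Modes

end OrrSommerfeld

namespace OrrSommerfeld

open Set Filter Topology MeasureTheory

open scoped Real

section ModeProperties

variable {Q M d G D R h s : ℝ} {q m p p' : ℝ → ℂ} {Y : ℝ → Fin 4 → ℂ}

lemma IsMode.ne_zero (hY : IsMode Q M d G s q m p Y) (W : WKB Q M q m p p')
    (hs : s = 1 ∨ s = -1) (hq : Continuous q) (hd : 0 < d) {t : ℝ} (ht : 0 ≤ t) : Y t 0 ≠ 0 := by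
  have hM0 := W.pos le_rfl
  rcases le_total t M with h | h
  · exact norm_pos_iff.1 (hd.trans_le (hY.le_norm t ⟨ht, h⟩))
  · intro h0
    have h1 := hY.isJet.eq_zero hq (W.eq_zero hs h (hY.isWKBAt t h) h0) 0
    have h2 := hY.le_norm 0 ⟨le_rfl, hM0.le⟩
    rw [h1, Pi.zero_apply, norm_zero] at h2
    linarith

lemma IsMode.second_le (hY : IsMode Q M d G s q m p Y) (W : WKB Q M q m p p')
    (hs : s = 1 ∨ s = -1) (hd : 0 < d) (hD : 1 ≤ D) (hh : 0 < h) (hh1 : h ≤ 1)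
    (hm : ∀ t, M ≤ t → h * ‖m t‖ ^ 2 ≤ D) {t : ℝ} (ht : 0 ≤ t) :
    h * ‖Y t 2‖ ≤ (G / d + 4 * D) * ‖Y t 0‖ := by
  have hM0 := W.pos le_rfl
  have hG : 0 ≤ G := (norm_nonneg _).trans (hY.norm_le 0 ⟨le_rfl, hM0.le⟩)
  rcases le_total t M with h1 | h1
  · have h2 := hY.le_norm t ⟨ht, h1⟩
    have h3 := (norm_le_pi_norm (Y t) 2).trans (hY.norm_le t ⟨ht, h1⟩)
    calc h * ‖Y t 2‖ ≤ 1 * G := by gcongr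
      _ = G / d * d := by field_simp
      _ ≤ (G / d + 4 * D) * ‖Y t 0‖ := by
          gcongr
          linarith
  · obtain ⟨e1, e2, -⟩ := W.norm_next_le hs h1 (hY.isWKBAt t h1)
    have e3 : ‖Y t 2‖ ≤ 2 * ‖m t‖ * (2 * ‖m t‖ * ‖Y t 0‖) := e2.trans (by gcongr)
    calc h * ‖Y t 2‖ ≤ h * (2 * ‖m t‖ * (2 * ‖m t‖ * ‖Y t 0‖)) := by gcongr
      _ = 4 * (h * ‖m t‖ ^ 2) * ‖Y t 0‖ := by ring
      _ ≤ 4 * D * ‖Y t 0‖ := by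
          gcongr
          exact hm t h1
      _ ≤ _ := by
          gcongr
          have : 0 ≤ G / d := by positivity
          linarith

/-- Growth from `t₁` to `t₂`, by the WKB amplitude on `[M, ∞)` and by compactness on `[0, M]`. -/
lemma IsMode.ratio_le (hY : IsMode Q M d G s q m p Y) (W : WKB Q M q m p p')
    (hs : s = 1 ∨ s = -1) (hd : 0 < d) (hD : 1 ≤ D) (hmc : ContinuousOn m (Ici 0))
    (hR : ∀ t ∈ Icc 0 M, ‖m t‖ ≤ R)
    (hm : ∀ t₁ t₂, M ≤ t₁ → t₁ ≤ t₂ → ‖m t₁‖ ^ 2 ≤ D * ‖m t₂‖ ^ 2) {t₁ t₂ : ℝ} (h0 : 0 ≤ t₁)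
    (h12 : t₁ ≤ t₂) :
    ‖Y t₂ 0‖ ≤ (Real.exp (1110 * Q) * D ^ 5) * (G / d * Real.exp (R * M)) *
      Real.exp (s * ∫ y in t₁..t₂, (m y).re) * ‖Y t₁ 0‖ := by
  have hQ := W.one_le_Q
  have hM0 := W.pos le_rfl
  have hss : |s| = 1 := by rcases hs with h | h <;> simp [h]
  obtain ⟨i1, i2, i3⟩ := integral_re_properties hmc
  have hR0 : 0 ≤ R := (norm_nonneg _).trans (hR 0 ⟨le_rfl, hM0.le⟩)
  have hdG : d ≤ G := (hY.le_norm 0 ⟨le_rfl, hM0.le⟩).trans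
    ((norm_le_pi_norm _ 0).trans (hY.norm_le 0 ⟨le_rfl, hM0.le⟩))
  have hGd : 1 ≤ G / d := by rwa [le_div_iff₀ hd, one_mul]
  set C₁ := Real.exp (1110 * Q) * D ^ 5
  set C₂ := G / d * Real.exp (R * M)
  have hC₁ : 1 ≤ C₁ := one_le_mul_of_one_le_of_one_le (Real.one_le_exp (by linarith))
    (one_le_pow₀ hD)
  have hC₂ : 1 ≤ C₂ := one_le_mul_of_one_le_of_one_le hGd (Real.one_le_exp (by positivity))
  have near : ∀ t₁ t₂, 0 ≤ t₁ → t₁ ≤ t₂ → t₂ ≤ M →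
      ‖Y t₂ 0‖ ≤ C₂ * Real.exp (s * ∫ y in t₁..t₂, (m y).re) * ‖Y t₁ 0‖ := by
    intro t₁ t₂ h0 h12 h2
    have e1 : |s * ∫ y in t₁..t₂, (m y).re| ≤ R * M := by
      rw [abs_mul, hss, one_mul]
      have := intervalIntegral.norm_integral_le_of_norm_le_const (a := t₁) (b := t₂) (C := R)
        (f := fun y => (m y).re) (fun y hy => by
          rw [uIoc_of_le h12] at hy
          exact (Complex.abs_re_le_norm _).trans (hR y ⟨h0.trans hy.1.le, hy.2.trans h2⟩))
      rw [Real.norm_eq_abs] at this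
      refine this.trans ?_
      gcongr
      rw [abs_of_nonneg (by linarith)]
      linarith
    have e2 := (norm_le_pi_norm _ 0).trans (hY.norm_le t₂ ⟨h0.trans h12, h2⟩)
    have e3 := hY.le_norm t₁ ⟨h0, h12.trans h2⟩
    have e4 : 1 ≤ Real.exp (R * M) * Real.exp (s * ∫ y in t₁..t₂, (m y).re) := by
      rw [← Real.exp_add]
      exact Real.one_le_exp (by linarith [(abs_le.1 e1).1])
    calc ‖Y t₂ 0‖ ≤ G := e2
      _ = G / d * 1 * d := by field_simp
      _ ≤ G / d * (Real.exp (R * M) * Real.exp (s * ∫ y in t₁..t₂, (m y).re)) * ‖Y t₁ 0‖ := by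
          gcongr
      _ = _ := by simp only [C₂]; ring
  have far : ∀ t₁ t₂, M ≤ t₁ → t₁ ≤ t₂ →
      ‖Y t₂ 0‖ ≤ C₁ * Real.exp (s * ∫ y in t₁..t₂, (m y).re) * ‖Y t₁ 0‖ := by
    intro t₁ t₂ h1 h12
    have h2 := h1.trans h12
    have hg := W.growth hY.isJet h1 h12
      (i1.mono fun y hy => (hM0.le.trans h1).trans hy.1)
      (fun y hy => i2 y ((hM0.trans_le h1).trans hy.1)) (fun y hy => hY.isWKBAt y (h1.trans hy.1))
    rw [i3 t₁ t₂ (hM0.le.trans h1) h12] at hg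
    set I := ∫ y in t₁..t₂, (m y).re
    have e1 : ‖m t₁‖ ^ 5 ≤ D ^ 5 * ‖m t₂‖ ^ 5 := by
      rw [← mul_pow]
      have e2 : ‖m t₁‖ ≤ D * ‖m t₂‖ := by
        refine le_of_sq_le_sq ((hm t₁ t₂ h1 h12).trans ?_) (by positivity)
        rw [mul_pow]
        gcongr
        exact le_self_pow₀ hD (by norm_num)
      gcongr
    have hm2 : 0 < ‖m t₂‖ ^ 5 := by
      have := W.one_le t₂ h2
      positivity
    have e3 : ‖Y t₂ 0‖ ^ 2 * ‖m t₂‖ ^ 5 ≤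
        (C₁ * Real.exp (2 * (s * I)) * ‖Y t₁ 0‖ ^ 2) * ‖m t₂‖ ^ 5 := by
      calc _ ≤ _ := hg
        _ ≤ Real.exp (1110 * Q) * Real.exp (2 * (s * I)) *
            (‖Y t₁ 0‖ ^ 2 * (D ^ 5 * ‖m t₂‖ ^ 5)) := by gcongr
        _ = _ := by simp only [C₁]; ring
    have e4 := le_of_mul_le_mul_right e3 hm2
    refine le_of_sq_le_sq (e4.trans ?_) (by positivity)
    rw [mul_pow, mul_pow, ← Real.exp_nat_mul]
    push_cast
    gcongr
    exact le_self_pow₀ hC₁ (by norm_num)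
  rcases le_total t₂ M with h2 | h2
  · refine (near t₁ t₂ h0 h12 h2).trans ?_
    gcongr
    exact le_mul_of_one_le_left (by linarith) hC₁
  · rcases le_total M t₁ with h1 | h1
    · refine (far t₁ t₂ h1 h12).trans ?_
      gcongr
      exact le_mul_of_one_le_right (by linarith) hC₂
    · have e1 := near t₁ M h0 h1 le_rfl
      have e2 := far M t₂ le_rfl h2
      have e3 : ∫ y in t₁..t₂, (m y).re = (∫ y in t₁..M, (m y).re) + ∫ y in M..t₂, (m y).re := by
        rw [← i3 t₁ t₂ h0 h12, ← i3 t₁ M h0 h1, ← i3 M t₂ hM0.le h2]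
        ring
      calc ‖Y t₂ 0‖ ≤ C₁ * Real.exp (s * ∫ y in M..t₂, (m y).re) *
            (C₂ * Real.exp (s * ∫ y in t₁..M, (m y).re) * ‖Y t₁ 0‖) := e2.trans (by gcongr)
        _ = _ := by rw [e3, mul_add, Real.exp_add]; ring

/-- If each component is close to `w` times the preceding one, then the quotients by the powers of
`w` are close to `1`. -/
lemma norm_div_sub_one_le {y : Fin 4 → ℂ} {w : ℂ} {η : ℝ} (hη0 : 0 ≤ η) (hη : η ≤ 1)
    (hw : 1 ≤ ‖w‖) (hy : y 0 ≠ 0) (h1 : ‖y 1 - w * y 0‖ ≤ η * ‖y 0‖)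
    (h2 : ‖y 2 - w * y 1‖ ≤ η * ‖y 1‖) (h3 : ‖y 3 - w * y 2‖ ≤ η * ‖y 2‖) :
    ‖y 1 / y 0 / w - 1‖ ≤ 7 * η ∧ ‖y 2 / y 0 / w ^ 2 - 1‖ ≤ 7 * η ∧
      ‖y 3 / y 0 / w ^ 3 - 1‖ ≤ 7 * η := by
  have hw0 : w ≠ 0 := norm_pos_iff.1 (by linarith)
  have step : ∀ (u v : ℂ) (k : ℕ), ‖v - w * u‖ ≤ η * ‖u‖ →
      ‖v / y 0 / w ^ (k + 1) - u / y 0 / w ^ k‖ ≤ η * ‖u / y 0 / w ^ k‖ := by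
    intro u v k huv
    have e : v / y 0 / w ^ (k + 1) - u / y 0 / w ^ k = (v - w * u) / (y 0 * w ^ k * w) := by
      field_simp
      ring
    rw [e, norm_div, norm_div, norm_div, norm_mul, norm_mul, div_div, ← mul_div_assoc,
      norm_pow]
    have hy' : 0 < ‖y 0‖ := norm_pos_iff.2 hy
    have hw' : 0 < ‖w‖ := by linarith
    refine div_le_div₀ (by positivity) huv (by positivity) ?_
    exact le_mul_of_one_le_right (by positivity) hw
  have s1 := step _ _ 0 h1
  have s2 := step _ _ 1 h2
  have s3 := step _ _ 2 h3
  simp only [pow_zero, div_one, zero_add, pow_one, Nat.reduceAdd] at s1 s2 s3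
  rw [div_self hy, norm_one, mul_one] at s1
  set A := y 1 / y 0 / w
  set B := y 2 / y 0 / w ^ 2
  set C := y 3 / y 0 / w ^ 3
  have tri : ∀ x : ℂ, ‖x‖ ≤ 1 + ‖x - 1‖ := fun x => by
    have := norm_add_le (1 : ℂ) (x - 1)
    rwa [add_sub_cancel, norm_one] at this
  have a2 : ‖B - 1‖ ≤ ‖B - A‖ + ‖A - 1‖ := norm_sub_le_norm_sub_add_norm_sub _ _ _
  have a3 : ‖C - 1‖ ≤ ‖C - B‖ + ‖B - 1‖ := norm_sub_le_norm_sub_add_norm_sub _ _ _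
  have t1 := tri A
  have b1 : η * ‖A‖ ≤ η * 2 := by gcongr; linarith
  have b2 : ‖B - 1‖ ≤ 3 * η := by linarith
  have t2 := tri B
  have b3 : η * ‖B‖ ≤ η * 4 := by gcongr; linarith
  exact ⟨by linarith, by linarith, by linarith⟩

end ModeProperties

/-- The two solutions of the rescaled problem: `s = 1` is the growing one and `s = -1` the decaying
one. The constants do not depend on the parameters. -/
theorem ProfileBounds.exists_solutions {U U₁ U₂ : ℝ → ℝ} {κ L a b K : ℝ}
    (hB : ProfileBounds U U₁ U₂ κ L) (ha : 0 < a) (hK : 0 < K) :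
    ∃ M C P h₀ : ℝ, 0 < M ∧ 0 ≤ C ∧ 0 < h₀ ∧ h₀ ≤ 1 ∧ ∀ (h r : ℝ) (c : ℂ),
      IsScaled U (U₁ 0) a b K h r c → h ≤ h₀ → ∀ s : ℝ, s = 1 ∨ s = -1 →
      ∃ Y, IsJet (scaledQ U (U₁ 0) h r c) Y ∧ (∀ t, 0 ≤ t → Y t 0 ≠ 0) ∧
        (∀ t, 0 ≤ t → h * ‖Y t 2‖ ≤ C * ‖Y t 0‖) ∧
        (∀ t₁ t₂, 0 ≤ t₁ → t₁ ≤ t₂ → ‖Y t₂ 0‖ ≤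
          C * Real.exp (s * ∫ y in t₁..t₂, (scaledRoot U (U₁ 0) h r c y).re) * ‖Y t₁ 0‖) ∧
        ∀ t η : ℝ, M ≤ t → P / t ≤ η → η ≤ 1 →
          ‖Y t 1 / Y t 0 / (s * scaledRoot U (U₁ 0) h r c t) - 1‖ ≤ 7 * η ∧
          ‖Y t 2 / Y t 0 / (s * scaledRoot U (U₁ 0) h r c t) ^ 2 - 1‖ ≤ 7 * η ∧
          ‖Y t 3 / Y t 0 / (s * scaledRoot U (U₁ 0) h r c t) ^ 3 - 1‖ ≤ 7 * η := by
  obtain ⟨Q, M, D, d, G, h₀, hD, hd, hh₀, hM, hmodes⟩ := hB.exists_modes (b := b) ha hK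
  have hM0 : 0 < M := by linarith
  set R := 1 + b * (L * M + K)
  set C₀ := (Real.exp (1110 * Q) * D ^ 5) * (G / d * Real.exp (R * M))
  refine ⟨M, |C₀| + |G / d + 4 * D|, 600 * Q, min h₀ 1, hM0, by positivity,
    lt_min hh₀ one_pos, min_le_right _ _, fun h r c hr hh s hs => ?_⟩
  have hh1 : h ≤ 1 := hh.trans (min_le_right _ _)
  obtain ⟨W, hm1, hm2, hplus, hminus⟩ := hmodes h r c hr (hh.trans (min_le_left _ _))
  obtain ⟨Y, hY⟩ : ∃ Y, IsMode Q M d G s (scaledQ U (U₁ 0) h r c) (scaledRoot U (U₁ 0) h r c)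
      (scaledLog U U₁ h c) Y := by
    rcases hs with rfl | rfl
    · exact hplus
    · exact hminus
  have hss : |s| = 1 := by rcases hs with h | h <;> simp [h]
  have hqc := hB.continuous_scaledQ (U₁ 0) hr.h_pos r c
  have hne := fun t (ht : 0 ≤ t) => hY.ne_zero W hs hqc hd ht
  refine ⟨Y, hY.isJet, hne, fun t ht => ?_, fun t₁ t₂ h0 h12 => ?_, fun t η ht hPη hη => ?_⟩
  · refine (hY.second_le W hs hd hD hr.h_pos hh1 hm1 ht).trans ?_
    refine mul_le_mul_of_nonneg_right ?_ (norm_nonneg _)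
    linarith [le_abs_self (G / d + 4 * D), abs_nonneg C₀]
  · refine (hY.ratio_le W hs hd hD (hr.continuousOn_root hB) (R := R) (fun t ht => ?_) hm2 h0
      h12).trans ?_
    · have h1 : ‖scaledRoot U (U₁ 0) h r c t‖ ^ 2 ≤ b * (L * M + K) := by
        rw [← norm_pow, scaledRoot_sq]
        refine (hB.norm_scaledQ_le hr ha ht.1).trans ?_
        have hb : 0 ≤ b := ha.le.trans (hr.lower.trans hr.upper)
        have hL : 0 ≤ L := (abs_nonneg _).trans (hB.deriv2_le' 0 le_rfl)
        have := ht.2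
        gcongr
      simp only [R]
      nlinarith [sq_nonneg (‖scaledRoot U (U₁ 0) h r c t‖ - 1)]
    · gcongr
      linarith [le_abs_self C₀, abs_nonneg (G / d + 4 * D)]
  · have ht0 : 0 < t := hM0.trans_le ht
    have hQ := W.one_le_Q
    obtain ⟨e1, e2, e3⟩ := W.sub_le ht (hY.isWKBAt t ht)
    refine norm_div_sub_one_le ((by positivity : 0 ≤ 600 * Q / t).trans hPη) hη ?_
      (hne t ht0.le) (e1.trans (by gcongr)) (e2.trans (by gcongr)) (e3.trans (by gcongr))
    rw [norm_mul, Complex.norm_real, Real.norm_eq_abs, hss, one_mul]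
    exact W.one_le t ht

end OrrSommerfeld

namespace OrrSommerfeld

open Set Filter Topology MeasureTheory

open scoped Real

/-! ### Back to the original variables -/

section Unscale

lemma dz_succ_eq {f g g' : ℝ → ℂ} {k : ℕ} (h : ∀ z, 0 ≤ z → dz k f z = g z)
    (hg : ∀ z, 0 ≤ z → HasDerivWithinAt g (g' z) (Ici 0) z) {z : ℝ} (hz : 0 ≤ z) :
    dz (k + 1) f z = g' z := by
  have h1 : HasDerivWithinAt (iteratedDerivWithin k f (Ici 0)) (g' z) (Ici 0) z :=
    (hg z hz).congr (fun y hy => h y hy) (h z hz)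
  rw [dz, iteratedDerivWithin_succ]
  exact h1.derivWithin (uniqueDiffOn_Ici 0 z hz)

variable {U : ℝ → ℝ} {Uplus a b K ν α σ h s κ L : ℝ} {c : ℂ} {q : ℝ → ℂ} {Y : ℝ → Fin 4 → ℂ}

lemma IsJet.unscale_deriv (hY : IsJet q Y) (hh : 0 < h) (z : ℝ) :
    HasDerivAt (fun z => Y (z / h) 0) (Y (z / h) 1 / h) z ∧
    HasDerivAt (fun z => Y (z / h) 1 / h) (Y (z / h) 2 / h ^ 2) z ∧
    HasDerivAt (fun z => Y (z / h) 2 / h ^ 2) (Y (z / h) 3 / h ^ 3) z ∧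
    HasDerivAt (fun z => Y (z / h) 3 / h ^ 3) (q (z / h) * Y (z / h) 2 / h ^ 4) z := by
  have hh' : (h : ℂ) ≠ 0 := by exact_mod_cast hh.ne'
  have hlin : HasDerivAt (fun z : ℝ => z / h) (1 / h) z := (hasDerivAt_id z).div_const h
  refine ⟨?_, ?_, ?_, ?_⟩
  · refine ((hY.hasDerivAt_zero (z / h)).scomp z hlin).congr_deriv ?_
    rw [Complex.real_smul]; push_cast; field_simp
  · refine (((hY.hasDerivAt_one (z / h)).scomp z hlin).div_const _).congr_deriv ?_
    rw [Complex.real_smul]; push_cast; field_simp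
  · refine (((hY.hasDerivAt_two (z / h)).scomp z hlin).div_const _).congr_deriv ?_
    rw [Complex.real_smul]; push_cast; field_simp
  · refine (((hY.hasDerivAt_three (z / h)).scomp z hlin).div_const _).congr_deriv ?_
    rw [Complex.real_smul]; push_cast; field_simp

lemma IsJet.dz_unscale (hY : IsJet q Y) (hh : 0 < h) {z : ℝ} (hz : 0 ≤ z) :
    dz 1 (fun z => Y (z / h) 0) z = Y (z / h) 1 / h ∧
    dz 2 (fun z => Y (z / h) 0) z = Y (z / h) 2 / h ^ 2 ∧
    dz 3 (fun z => Y (z / h) 0) z = Y (z / h) 3 / h ^ 3 := by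
  have hd := hY.unscale_deriv hh
  have h1 : ∀ z, 0 ≤ z → dz 1 (fun z => Y (z / h) 0) z = Y (z / h) 1 / h := fun z hz =>
    dz_succ_eq (k := 0) (fun z _ => dz_zero _ z) (fun z _ => (hd z).1.hasDerivWithinAt) hz
  have h2 : ∀ z, 0 ≤ z → dz 2 (fun z => Y (z / h) 0) z = Y (z / h) 2 / h ^ 2 := fun z hz =>
    dz_succ_eq h1 (fun z _ => (hd z).2.1.hasDerivWithinAt) hz
  exact ⟨h1 z hz, h2 z hz, dz_succ_eq h2 (fun z _ => (hd z).2.2.1.hasDerivWithinAt) hz⟩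

/-- A linear combination `φ'' - β φ` of an unscaled jet is differentiated twice. -/
lemma IsJet.dz_two_unscale (hY : IsJet q Y) (hh : 0 < h) (β : ℂ) {ψ : ℝ → ℂ}
    (hψ : ∀ z, 0 ≤ z → ψ z = Y (z / h) 2 / h ^ 2 - β * Y (z / h) 0) {z : ℝ} (hz : 0 ≤ z) :
    dz 2 ψ z = q (z / h) * Y (z / h) 2 / h ^ 4 - β * (Y (z / h) 2 / h ^ 2) := by
  have hd := hY.unscale_deriv hh
  have h1 : ∀ z, 0 ≤ z → dz 1 ψ z = Y (z / h) 3 / h ^ 3 - β * (Y (z / h) 1 / h) := fun z hz =>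
    dz_succ_eq (k := 0) (fun z hz => (dz_zero ψ z).trans (hψ z hz))
      (fun z _ => ((hd z).2.2.1.sub ((hd z).1.const_mul β)).hasDerivWithinAt) hz
  exact dz_succ_eq h1
    (fun z _ => ((hd z).2.2.2.sub ((hd z).2.1.const_mul β)).hasDerivWithinAt) hz

/-- Jets are as smooth as the coefficient allows. -/
lemma IsJet.smooth_unscale (hY : IsJet q Y) (hh : 0 < h)
    (hq : SmoothOnHalfLine fun z => q (z / h)) : SmoothOnHalfLine fun z => Y (z / h) 0 := by
  have hd := hY.unscale_deriv hh
  have hsucc : ∀ {f g : ℝ → ℂ} {n : ℕ}, (∀ z, HasDerivAt f (g z) z) → ContDiffOn ℝ n g (Ici 0) →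
      ContDiffOn ℝ (n + 1 : ℕ) f (Ici 0) := by
    intro f g n hf hg
    push_cast
    rw [contDiffOn_succ_iff_derivWithin (uniqueDiffOn_Ici 0)]
    refine ⟨fun z _ => (hf z).differentiableAt.differentiableWithinAt, by simp, ?_⟩
    exact hg.congr fun z hz => (hf z).hasDerivWithinAt.derivWithin (uniqueDiffOn_Ici 0 z hz)
  have key : ∀ n : ℕ, ContDiffOn ℝ n (fun z => Y (z / h) 0) (Ici 0) ∧
      ContDiffOn ℝ n (fun z => Y (z / h) 1 / h) (Ici 0) ∧
      ContDiffOn ℝ n (fun z => Y (z / h) 2 / h ^ 2) (Ici 0) ∧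
      ContDiffOn ℝ n (fun z => Y (z / h) 3 / h ^ 3) (Ici 0) := by
    intro n
    induction n with
    | zero =>
      simp only [CharP.cast_eq_zero, contDiffOn_zero]
      exact ⟨fun z _ => (hd z).1.continuousAt.continuousWithinAt,
        fun z _ => (hd z).2.1.continuousAt.continuousWithinAt,
        fun z _ => (hd z).2.2.1.continuousAt.continuousWithinAt,
        fun z _ => (hd z).2.2.2.continuousAt.continuousWithinAt⟩
    | succ n ih =>
      obtain ⟨-, i1, i2, i3⟩ := ih
      refine ⟨hsucc (fun z => (hd z).1) i1, hsucc (fun z => (hd z).2.1) i2,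
        hsucc (fun z => (hd z).2.2.1) i3, hsucc (fun z => (hd z).2.2.2) ?_⟩
      have hqn : ContDiffOn ℝ n (fun z => q (z / h)) (Ici 0) :=
        hq.of_le (by exact_mod_cast le_top)
      refine ((hqn.mul i2).div_const ((h : ℂ) ^ 2)).congr fun z _ => ?_
      field_simp
  exact contDiffOn_infty.2 fun n => (key n).1

/-- The passage from `(ν, α, c)` to the rescaled parameters. -/
lemma Admissible.scaling (hA : Admissible U a b K ν α c) (ha : 0 < a) (σ : ℝ)
    (hhν : h = ν ^ (1 / 4 : ℝ)) : 0 < h ∧ h ^ 4 = ν ∧ 0 < α ∧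
      (∀ z, 0 ≤ z → scaledQ U σ h (α / h) (c / h) (z / h) * eps ν α = h ^ 2 * (U z - c)) ∧
      (∀ z, 0 ≤ z → scaledRoot U σ h (α / h) (c / h) (z / h) = h * muf U ν α c z) ∧
      IsScaled U σ a b K h (α / h) (c / h) := by
  have hν := hA.nu_pos
  have hh : 0 < h := hhν ▸ Real.rpow_pos_of_pos hν _
  have hh4 : h ^ 4 = ν := by
    rw [hhν, ← Real.rpow_natCast, ← Real.rpow_mul hν.le]
    norm_num
  have h1 := hA.alpha_lower
  have h2 := hA.alpha_upper
  have h3 := hA.c_bound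
  rw [← hhν] at h1 h2 h3
  have hα : 0 < α := (mul_pos ha hh).trans_le h1
  have hh' : (h : ℂ) ≠ 0 := by exact_mod_cast hh.ne'
  have hα' : (α : ℂ) ≠ 0 := by exact_mod_cast hα.ne'
  have hq : ∀ z, 0 ≤ z → scaledQ U σ h (α / h) (c / h) (z / h) * eps ν α = h ^ 2 * (U z - c) := by
    intro z hz
    have hI := Complex.I_ne_zero
    rw [scaledQ, scaledU_of_nonneg U σ h (by positivity), mul_div_cancel₀ _ hh.ne', eps, ← hh4]
    push_cast
    field_simp
  have hε : eps ν α ≠ 0 := by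
    rw [eps]
    exact div_ne_zero (by exact_mod_cast hν.ne') (mul_ne_zero Complex.I_ne_zero hα')
  have hroot : ∀ z, 0 ≤ z → scaledRoot U σ h (α / h) (c / h) (z / h) = h * muf U ν α c z := by
    intro z hz
    have e1 : scaledRoot U σ h (α / h) (c / h) (z / h) ^ 2 = (h * muf U ν α c z) ^ 2 := by
      rw [scaledRoot_sq, mul_pow, muf, cpow_half_sq, ← mul_div_assoc, ← hq z hz,
        mul_div_cancel_right₀ _ hε]
    have e2 : 0 ≤ (scaledRoot U σ h (α / h) (c / h) (z / h)).re := re_cpow_half_nonneg _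
    have e3 : 0 < ((h : ℂ) * muf U ν α c z).re := by
      rw [Complex.re_ofReal_mul]
      exact mul_pos hh (hA.re_muf_pos z hz)
    rcases sq_eq_sq_iff_eq_or_eq_neg.1 e1 with e | e
    · exact e
    · rw [e, Complex.neg_re] at e2
      linarith
  refine ⟨hh, hh4, hα, hq, hroot, hh, ?_, ?_, ?_, fun ζ hζ => ?_⟩
  · rwa [le_div_iff₀ hh]
  · rwa [div_le_iff₀ hh]
  · rwa [norm_div, Complex.norm_real, Real.norm_of_nonneg hh.le, div_le_iff₀ hh]
  · have hz : 0 ≤ h * ζ := by positivity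
    have := hroot (h * ζ) hz
    rw [mul_div_cancel_left₀ _ hh.ne'] at this
    rw [this, Complex.re_ofReal_mul]
    exact mul_pos hh (hA.re_muf_pos _ hz)

/-- What is to be proved for one of the two functions, with sign `e = ± 1`: smoothness, absence of
zeros, the modified Airy equation, the Orr-Sommerfeld bound, the growth bound and, with `P` and `M`,
the equivalents of the derivatives. -/
def IsApprox (U : ℝ → ℝ) (C P M e ν α : ℝ) (c : ℂ) (φ : ℝ → ℂ) : Prop :=
  SmoothOnHalfLine φ ∧ (∀ z, 0 ≤ z → φ z ≠ 0) ∧ (∀ z, 0 ≤ z → opA U ν α c (dz 2 φ) z = 0) ∧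
  (∀ z, 0 ≤ z → ‖orr U ν α c φ z‖ ≤ C * ‖φ z‖) ∧
  (∀ x₁ x₂, 0 ≤ x₁ → x₁ < x₂ →
    ‖φ x₂ / φ x₁‖ ≤ C * Real.exp (e * ∫ y in x₁..x₂, (muf U ν α c y).re)) ∧
  ∀ z η : ℝ, 0 ≤ z → M * ν ^ (1 / 4 : ℝ) ≤ z → P * ν ^ (1 / 4 : ℝ) ≤ η * z → η ≤ 1 →
    ∀ k : ℕ, 1 ≤ k → k ≤ 3 → ‖dz k φ z / φ z / (e * muf U ν α c z) ^ k - 1‖ ≤ 7 * η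

lemma IsShearProfile.exists_approx (hU : IsShearProfile U Uplus) (ha : 0 < a) (hK : 0 < K) :
    ∃ ν₀ C P M : ℝ, 0 < ν₀ ∧ 0 < M ∧ ∀ ν α c, ν < ν₀ → Admissible U a b K ν α c →
      ∀ e : ℝ, e = 1 ∨ e = -1 → ∃ φ, IsApprox U C P M e ν α c φ := by
  obtain ⟨κ, L, hB⟩ := hU.exists_bounds
  obtain ⟨M, C₀, P, h₀, hM, hC₀, hh₀, hh₀1, hsol⟩ := hB.exists_solutions (b := b) ha hK
  have hL : 0 ≤ L := (abs_nonneg _).trans (hB.deriv2_le' 0 le_rfl)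
  refine ⟨h₀ ^ 4, C₀ + (2 * |b| * C₀ + |b| ^ 3 + (L + K) * |b| ^ 2 + L), P, M, by positivity, hM,
    fun ν α c hν hA e he => ?_⟩
  obtain ⟨h, hh⟩ : ∃ h : ℝ, h = ν ^ (1 / 4 : ℝ) := ⟨_, rfl⟩
  obtain ⟨hpos, h4, hα, hq, hroot, hS⟩ := hA.scaling ha (dz 1 U 0) hh
  have hle : h ≤ h₀ := by
    rw [← h4] at hν
    exact (lt_of_pow_lt_pow_left₀ 4 hh₀.le hν).le
  have hh1 : h ≤ 1 := hle.trans hh₀1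
  obtain ⟨Y, hY, hne, h2, hgr, hratio⟩ := hsol h (α / h) (c / h) hS hle e he
  have hh' : (h : ℂ) ≠ 0 := by exact_mod_cast hpos.ne'
  have hα' : (α : ℂ) ≠ 0 := by exact_mod_cast hα.ne'
  have hdz := fun z (hz : 0 ≤ z) => hY.dz_unscale hpos hz
  have hz0 : ∀ {z : ℝ}, 0 ≤ z → 0 ≤ z / h := fun hz => div_nonneg hz hpos.le
  set φ : ℝ → ℂ := fun z => Y (z / h) 0
  set q := scaledQ U (dz 1 U 0) h (α / h) (c / h)
  have hbα : α ≤ h * |b| := by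
    have := hA.alpha_upper
    rw [← hh] at this
    nlinarith [le_abs_self b]
  refine ⟨φ, ?_, fun z hz => hne _ (hz0 hz), fun z hz => ?_, fun z hz => ?_,
    fun x₁ x₂ hx₁ hx => ?_, fun z η hz hMz hPz hη k hk1 hk3 => ?_⟩
  · refine hY.smooth_unscale hpos ?_
    have hUc : ContDiffOn ℝ (⊤ : ℕ∞) (fun z => ((U z : ℝ) : ℂ)) (Ici 0) :=
      Complex.ofRealCLM.contDiff.comp_contDiffOn hU.smooth
    refine ((contDiffOn_const (c := Complex.I * ((α / h : ℝ) : ℂ))).mul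
      ((hUc.div_const (h : ℂ)).sub (contDiffOn_const (c := c / h)))).congr fun z hz => ?_
    simp only [q, scaledQ]
    rw [scaledU_of_nonneg _ _ _ (hz0 hz), mul_div_cancel₀ _ hpos.ne']
    push_cast
    rfl
  · have e1 : dz 2 (dz 2 φ) z = q (z / h) * Y (z / h) 2 / h ^ 4 := by
      have := hY.dz_two_unscale hpos 0 (ψ := dz 2 φ)
        (fun z hz => by rw [(hdz z hz).2.1]; ring) hz
      rw [this]; ring
    rw [opA, e1, (hdz z hz).2.1]
    field_simp
    linear_combination (-(Y (z / h) 2)) * hq z hz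
  · have e1 : dz 2 (lap α φ) z =
        q (z / h) * Y (z / h) 2 / h ^ 4 - (α : ℂ) ^ 2 * (Y (z / h) 2 / h ^ 2) :=
      hY.dz_two_unscale hpos ((α : ℂ) ^ 2) (fun z hz => by rw [lap, (hdz z hz).2.1]) hz
    have e2 : lap α φ z = Y (z / h) 2 / h ^ 2 - (α : ℂ) ^ 2 * φ z := by rw [lap, (hdz z hz).2.1]
    have e3 : orr U ν α c φ z = 2 * eps ν α * (α : ℂ) ^ 2 * (Y (z / h) 2 / h ^ 2) -
        eps ν α * (α : ℂ) ^ 4 * φ z - (U z - c) * (α : ℂ) ^ 2 * φ z - (dz 2 U z : ℝ) * φ z := by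
      rw [orr, show lap α (lap α φ) z = dz 2 (lap α φ) z - (α : ℂ) ^ 2 * lap α φ z from rfl, e1, e2]
      field_simp
      linear_combination (-(Y (z / h) 2)) * hq z hz
    have hε : ‖eps ν α‖ = h ^ 4 / α := by
      rw [eps, norm_div, norm_mul, Complex.norm_I, one_mul, Complex.norm_real, Complex.norm_real,
        Real.norm_of_nonneg hA.nu_pos.le, Real.norm_of_nonneg hα.le, h4]
    have hαn : ‖(α : ℂ)‖ = α := by rw [Complex.norm_real, Real.norm_of_nonneg hα.le]
    have hhn : ‖(h : ℂ)‖ = h := by rw [Complex.norm_real, Real.norm_of_nonneg hpos.le]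
    have h2z : h * ‖Y (z / h) 2‖ ≤ C₀ * ‖φ z‖ := h2 _ (hz0 hz)
    have hφ := norm_nonneg (φ z)
    have hαb : α ≤ |b| := hbα.trans (mul_le_of_le_one_left (abs_nonneg b) hh1)
    have n1 : ‖2 * eps ν α * (α : ℂ) ^ 2 * (Y (z / h) 2 / h ^ 2)‖ ≤ 2 * |b| * C₀ * ‖φ z‖ := by
      rw [norm_mul, norm_mul, norm_mul, norm_div, norm_pow, norm_pow, hε, hαn, hhn,
        Complex.norm_two]
      calc 2 * (h ^ 4 / α) * α ^ 2 * (‖Y (z / h) 2‖ / h ^ 2) = 2 * α * h * (h * ‖Y (z / h) 2‖) := by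
            field_simp
        _ ≤ 2 * |b| * 1 * (C₀ * ‖φ z‖) := by gcongr
        _ = _ := by ring
    have n2 : ‖eps ν α * (α : ℂ) ^ 4 * φ z‖ ≤ |b| ^ 3 * ‖φ z‖ := by
      rw [norm_mul, norm_mul, norm_pow, hε, hαn]
      calc h ^ 4 / α * α ^ 4 * ‖φ z‖ = h ^ 4 * α ^ 3 * ‖φ z‖ := by field_simp
        _ ≤ 1 * |b| ^ 3 * ‖φ z‖ := by
            gcongr
            exact pow_le_one₀ hpos.le hh1
        _ = _ := by ring
    have n3 : ‖((U z : ℂ) - c) * (α : ℂ) ^ 2 * φ z‖ ≤ (L + K) * |b| ^ 2 * ‖φ z‖ := by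
      rw [norm_mul, norm_mul, norm_pow, hαn]
      have hUz : ‖(U z : ℂ) - c‖ ≤ L + K := by
        refine (norm_sub_le _ _).trans (add_le_add ?_ ?_)
        · have u1 := hB.lower z hz
          have u2 := hB.upper z hz
          have u3 : 0 ≤ U z := (mul_nonneg hB.kappa_pos.le (le_min hz zero_le_one)).trans u1
          rw [Complex.norm_real, Real.norm_of_nonneg u3]
          exact u2.trans (mul_le_of_le_one_right hL (min_le_right _ _))
        · refine hA.c_bound.trans ?_
          rw [← hh]
          exact mul_le_of_le_one_right hK.le hh1
      gcongr
    have n4 : ‖((dz 2 U z : ℝ) : ℂ) * φ z‖ ≤ L * ‖φ z‖ := by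
      rw [norm_mul, Complex.norm_real]
      gcongr
      exact hB.deriv2_le' z hz
    rw [e3]
    refine (norm_sub_le _ _).trans ((add_le_add ((norm_sub_le _ _).trans (add_le_add
      ((norm_sub_le _ _).trans (add_le_add n1 n2)) n3)) n4).trans ?_)
    have : 0 ≤ C₀ * ‖φ z‖ := by positivity
    linarith
  · have hint : ∫ y in x₁..x₂, (muf U ν α c y).re =
        ∫ y in (x₁ / h)..(x₂ / h), (scaledRoot U (dz 1 U 0) h (α / h) (c / h) y).re := by
      have e1 := intervalIntegral.integral_comp_div (a := x₁) (b := x₂)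
        (fun y => (scaledRoot U (dz 1 U 0) h (α / h) (c / h) y).re) hpos.ne'
      have e2 : ∫ y in x₁..x₂, (scaledRoot U (dz 1 U 0) h (α / h) (c / h) (y / h)).re =
          ∫ y in x₁..x₂, h * (muf U ν α c y).re :=
        intervalIntegral.integral_congr fun y hy => by
          rw [uIcc_of_le hx.le] at hy
          rw [hroot y (hx₁.trans hy.1), Complex.re_ofReal_mul]
      rw [e2, intervalIntegral.integral_const_mul, smul_eq_mul] at e1
      exact mul_left_cancel₀ hpos.ne' e1
    have h1 := hgr (x₁ / h) (x₂ / h) (hz0 hx₁) (by gcongr)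
    have h0 : 0 < ‖φ x₁‖ := norm_pos_iff.2 (hne _ (hz0 hx₁))
    rw [← hint] at h1
    rw [norm_div, div_le_iff₀ h0]
    refine h1.trans ?_
    change _ * ‖φ x₁‖ ≤ _
    gcongr
    have : 0 ≤ 2 * |b| * C₀ + |b| ^ 3 + (L + K) * |b| ^ 2 + L := by positivity
    linarith
  · rw [← hh] at hMz hPz
    have hzp : 0 < z := (mul_pos hM hpos).trans_le hMz
    have ht : M ≤ z / h := by rwa [le_div_iff₀ hpos]
    have hP : P / (z / h) ≤ η := by
      rw [div_div_eq_mul_div, div_le_iff₀ hzp]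
      exact hPz
    obtain ⟨r1, r2, r3⟩ := hratio (z / h) η ht hP hη
    obtain ⟨d1, d2, d3⟩ := hdz z hz
    rw [hroot z hz] at r1 r2 r3
    have conv : ∀ (y : ℂ) (k : ℕ), y / Y (z / h) 0 / (e * (h * muf U ν α c z)) ^ k =
        y / h ^ k / φ z / (e * muf U ν α c z) ^ k := fun y k => by
      rw [show (e : ℂ) * (h * muf U ν α c z) = h * (e * muf U ν α c z) by ring, mul_pow]
      simp only [div_div, φ]
      congr 1
      ring
    have conv1 := conv (Y (z / h) 1) 1
    rw [pow_one, pow_one, pow_one] at conv1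
    rw [conv1] at r1
    rw [conv] at r2 r3
    interval_cases k
    · rw [d1, pow_one]; exact r1
    · rw [d2]; exact r2
    · rw [d3]; exact r3

end Unscale

end OrrSommerfeld

theorem proposition2p1 (U : ℝ → ℝ) (Uplus : ℝ) (hU : OrrSommerfeld.IsShearProfile U Uplus)
    (a b K : ℝ) (ha : 0 < a) (hb : 0 < b) (hK : 0 < K) :
    ∃ ν₀ : ℝ, 0 < ν₀ ∧ ∃ C : ℝ, ∃ φp φm : ℝ → ℝ → ℂ → ℝ → ℂ,
      -- the functions are smooth, without zeros, and nearly solve the Orr-Sommerfeld equation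
      (∀ (ν α : ℝ) (c : ℂ), ν < ν₀ → OrrSommerfeld.Admissible U a b K ν α c →
        OrrSommerfeld.SmoothOnHalfLine (φp ν α c) ∧
        OrrSommerfeld.SmoothOnHalfLine (φm ν α c) ∧
        (∀ z : ℝ, 0 ≤ z → φp ν α c z ≠ 0 ∧ φm ν α c z ≠ 0) ∧
        (∀ z : ℝ, 0 ≤ z →
          ‖OrrSommerfeld.orr U ν α c (φp ν α c) z‖ ≤ C * ‖φp ν α c z‖ ∧
          ‖OrrSommerfeld.orr U ν α c (φm ν α c) z‖ ≤ C * ‖φm ν α c z‖) ∧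
        -- growth of the first function, decay of the second one
        (∀ x₁ x₂ : ℝ, 0 ≤ x₁ → x₁ < x₂ →
          ‖φp ν α c x₂ / φp ν α c x₁‖ ≤
            C * Real.exp (∫ y in x₁..x₂, (OrrSommerfeld.muf U ν α c y).re) ∧
          ‖φm ν α c x₂ / φm ν α c x₁‖ ≤
            C * Real.exp (-∫ y in x₁..x₂, (OrrSommerfeld.muf U ν α c y).re))) ∧
      -- they solve the modified Airy equation up to any power of ν
      (∀ N : ℕ, ∃ CN : ℝ, ∀ (ν α : ℝ) (c : ℂ), ν < ν₀ →
        OrrSommerfeld.Admissible U a b K ν α c → ∀ z : ℝ, 0 ≤ z →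
          ‖OrrSommerfeld.opA U ν α c (OrrSommerfeld.dz 2 (φp ν α c)) z‖ ≤
            CN * ν ^ N * ‖φp ν α c z‖ ∧
          ‖OrrSommerfeld.opA U ν α c (OrrSommerfeld.dz 2 (φm ν α c)) z‖ ≤
            CN * ν ^ N * ‖φm ν α c z‖) ∧
      -- equivalents of the logarithmic derivatives for z ≫ ν^{1/4}, as ν → 0
      (∀ δ : ℝ, 0 < δ → ∃ M ν₁ : ℝ, 0 < ν₁ ∧ ∀ (ν α : ℝ) (c : ℂ), ν < ν₀ → ν < ν₁ →
        OrrSommerfeld.Admissible U a b K ν α c →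
        ∀ z : ℝ, 0 ≤ z → M * ν ^ (1 / 4 : ℝ) ≤ z → ∀ k : ℕ, 1 ≤ k → k ≤ 3 →
          ‖OrrSommerfeld.dz k (φp ν α c) z / φp ν α c z
            / OrrSommerfeld.muf U ν α c z ^ k - 1‖ ≤ δ ∧
          ‖OrrSommerfeld.dz k (φm ν α c) z / φm ν α c z
            / ((-1) ^ k * OrrSommerfeld.muf U ν α c z ^ k) - 1‖ ≤ δ) := by
  obtain ⟨ν₀, C, P, M, hν₀, hM, hex⟩ := hU.exists_approx (b := b) ha hK
  have hchoice : ∀ e : ℝ, e = 1 ∨ e = -1 → ∃ φ : ℝ → ℝ → ℂ → ℝ → ℂ, ∀ ν α c, ν < ν₀ →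
      OrrSommerfeld.Admissible U a b K ν α c →
      OrrSommerfeld.IsApprox U C P M e ν α c (φ ν α c) := by
    intro e he
    have h : ∀ ν α c, ∃ φ : ℝ → ℂ, ν < ν₀ → OrrSommerfeld.Admissible U a b K ν α c →
        OrrSommerfeld.IsApprox U C P M e ν α c φ := fun ν α c => by
      by_cases h : ν < ν₀ ∧ OrrSommerfeld.Admissible U a b K ν α c
      · obtain ⟨φ, hφ⟩ := hex ν α c h.1 h.2 e he
        exact ⟨φ, fun _ _ => hφ⟩
      · exact ⟨0, fun h1 h2 => absurd ⟨h1, h2⟩ h⟩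
    choose φ hφ using h
    exact ⟨φ, hφ⟩
  obtain ⟨φp, hp⟩ := hchoice 1 (Or.inl rfl)
  obtain ⟨φm, hm⟩ := hchoice (-1) (Or.inr rfl)
  refine ⟨ν₀, hν₀, C, φp, φm, fun ν α c hν hA => ?_, fun N => ⟨0, fun ν α c hν hA z hz => ?_⟩,
    fun δ hδ => ?_⟩
  · obtain ⟨p1, p2, -, p4, p5, -⟩ := hp ν α c hν hA
    obtain ⟨m1, m2, -, m4, m5, -⟩ := hm ν α c hν hA
    refine ⟨p1, m1, fun z hz => ⟨p2 z hz, m2 z hz⟩, fun z hz => ⟨p4 z hz, m4 z hz⟩,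
      fun x₁ x₂ h0 h12 => ⟨?_, ?_⟩⟩
    · simpa using p5 x₁ x₂ h0 h12
    · simpa using m5 x₁ x₂ h0 h12
  · rw [(hp ν α c hν hA).2.2.1 z hz, (hm ν α c hν hA).2.2.1 z hz]
    simp
  · have hη : 0 < min (δ / 7) 1 := lt_min (by positivity) one_pos
    refine ⟨max M (P / min (δ / 7) 1), 1, one_pos, fun ν α c hν _ hA z hz hMz k hk1 hk3 => ?_⟩
    have h0 : 0 ≤ ν ^ (1 / 4 : ℝ) := Real.rpow_nonneg hA.nu_pos.le _
    have h1 : M * ν ^ (1 / 4 : ℝ) ≤ z :=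
      (mul_le_mul_of_nonneg_right (le_max_left _ _) h0).trans hMz
    have h2 : P * ν ^ (1 / 4 : ℝ) ≤ min (δ / 7) 1 * z := by
      have := (mul_le_mul_of_nonneg_right (le_max_right M (P / min (δ / 7) 1)) h0).trans hMz
      rw [div_mul_eq_mul_div, div_le_iff₀ hη] at this
      linarith
    have h3 : 7 * min (δ / 7) 1 ≤ δ := by
      have := min_le_left (δ / 7) 1
      linarith
    constructor
    · have := (hp ν α c hν hA).2.2.2.2.2 z _ hz h1 h2 (min_le_right _ _) k hk1 hk3
      rw [Complex.ofReal_one, one_mul] at this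
      exact this.trans h3
    · have := (hm ν α c hν hA).2.2.2.2.2 z _ hz h1 h2 (min_le_right _ _) k hk1 hk3
      rw [Complex.ofReal_neg, Complex.ofReal_one, mul_pow] at this
      exact this.trans h3
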